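/- Let $X$ be a compact smooth 6-manifold with an almost Hermitian structure $(g,J)$, fundamental form $\omega(\cdot,\cdot)=g(J\cdot,\cdot)$ and orientation $\omega^3/3!$. Let $(J,\omega,\Omega)$ be a compatible $SU(3)$-structure: $\Omega=\Omega_1+i\Omega_2$ is a smooth form of type $(3,0)$, with $\Omega_1$ real, $\Omega_2=J\Omega_1=\Omega_1(J\cdot,J\cdot,J\cdot)$, $\omega\wedge\Omega_1=0$ and $\omega^3=\tfrac32\,\Omega_1\wedge\Omega_2$. Assume it is half-flat, i.e. $d\omega^2=0$ and $d\Omega_1=0$. Let $G$ be a compact Lie group with simple Lie algebra $\mathfrak g$, $P\to X$ a smooth principal $G$-bundle with adjoint bundle $\mathfrak g_P$, $A$ a smooth connection on $P$ and $u\in\Omega^{0,3}(X,\mathfrak g_P\otimes\mathbb C)$ smooth, such that $(A,u)$ is a DT-instanton: $$F_A^{0,2}=\bar\partial_A^*u:=-{*}\,\partial_A{*}u,\qquad \Lambda F_A=*[u\wedge\bar u],$$ where $\Lambda F_A=*(F_A\wedge\tfrac{\omega^2}{2})$ and $*$ is the $\mathbb C$-linear extension of the Hodge star. Assume that $A$ is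 irreducible, i.e. its holonomy group at every point of $P$ is all of $G$. Then $u$ can be written in exactly one way as $u=\tfrac i4(\Phi_1+i\Phi_2)\bar\Omega$ with smooth sections $\Phi_1,\Phi_2$ of $\mathfrak g_P$, and these satisfy $\Phi_1=0$ and $$I\,d_A\Phi_2=-*(F_A\wedge\Omega_1),\qquad F_A\wedge\frac{\omega^2}{2}=0,$$ where $(I\alpha)(v)=\alpha(Jv)$ for 1-forms $\alpha$; moreover $d_A\Phi_2=-*(F_A\wedge\Omega_2)$, which is the first of these two equations rewritten. -/

import Mathlib

open scoped Manifold ContDiff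

set_option linter.unusedSectionVars false

namespace DTInstanton

noncomputable section

/-! ### Exterior algebra on one finite-dimensional real vector space -/

section Pointwise

variable {V W W₁ W₂ W₃ Y : Type*}
  [AddCommGroup V] [Module ℝ V] [TopologicalSpace V] [IsTopologicalAddGroup V]
  [ContinuousSMul ℝ V] [T2Space V] [FiniteDimensional ℝ V]
  [NormedAddCommGroup W] [NormedSpace ℝ W]
  [NormedAddCommGroup W₁] [NormedSpace ℝ W₁] [NormedAddCommGroup W₂] [NormedSpace ℝ W₂]
  [NormedAddCommGroup W₃] [NormedSpace ℝ W₃] [NormedAddCommGroup Y] [NormedSpace ℝ Y]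
  {k l m n : ℕ}

theorem multilinear_continuous (f : MultilinearMap ℝ (fun _ : Fin k => V) W) :
    Continuous f := by
  classical
  let b := Module.finBasis ℝ V
  have h : ∀ v : Fin k → V,
      f v = ∑ r : Fin k → Fin (Module.finrank ℝ V), (∏ i, b.coord (r i) (v i)) • f (fun i => b (r i)) := by
    intro v
    have hv : v = fun i => ∑ j, b.coord j (v i) • b j := by
      funext i
      exact (b.sum_repr (v i)).symm
    conv_lhs => rw [hv]
    rw [f.map_sum]
    exact Finset.sum_congr rfl fun r _ => f.map_smul_univ _ _
  rw [show (f : (Fin k → V) → W) = _ from funext h]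
  refine continuous_finsetSum _ fun r _ => Continuous.smul ?_ continuous_const
  refine continuous_finsetProd _ fun i _ => ?_
  exact (LinearMap.continuous_of_finiteDimensional (b.coord (r i))).comp (continuous_apply i)

/-- In finite dimensions every alternating map is continuous. -/
def toCont (f : V [⋀^Fin k]→ₗ[ℝ] W) : V [⋀^Fin k]→L[ℝ] W :=
  { f with cont := multilinear_continuous f.toMultilinearMap }

/-- The wedge product of a `W₁`-valued and a `W₂`-valued form with respect to a bilinear map
`W₁ × W₂ → W₃` (signed sum over all shuffles). -/
def wedge (B : W₁ →ₗ[ℝ] W₂ →ₗ[ℝ] W₃) (α : V [⋀^Fin k]→L[ℝ] W₁) (β : V [⋀^Fin l]→L[ℝ] W₂) :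
    V [⋀^Fin (k + l)]→L[ℝ] W₃ :=
  toCont (((TensorProduct.lift B).compAlternatingMap
    (α.toAlternatingMap.domCoprod β.toAlternatingMap)).domDomCongr finSumFinEquiv)

/-- Wedge product of real-valued forms. -/
abbrev wedgeR (α : V [⋀^Fin k]→L[ℝ] ℝ) (β : V [⋀^Fin l]→L[ℝ] ℝ) : V [⋀^Fin (k + l)]→L[ℝ] ℝ :=
  wedge (LinearMap.mul ℝ ℝ) α β

/-- Wedge product of a vector-valued form with a real-valued form. -/
abbrev wedgeS (α : V [⋀^Fin k]→L[ℝ] W) (β : V [⋀^Fin l]→L[ℝ] ℝ) : V [⋀^Fin (k + l)]→L[ℝ] W :=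
  wedge (LinearMap.lsmul ℝ W).flip α β

theorem append_update (w : Fin k → V) (v : Fin m → V) (i : Fin m) (z : V) :
    Fin.append w (Function.update v i z)
      = Function.update (Fin.append w v) (Fin.natAdd k i) z := by
  funext j
  refine Fin.addCases (fun a => ?_) (fun a => ?_) j
  · rw [Fin.append_left, Function.update_of_ne, Fin.append_left]
    simp only [ne_eq, Fin.ext_iff, Fin.val_castAdd, Fin.val_natAdd]
    omega
  · rw [Fin.append_right]
    by_cases hai : a = i
    · subst hai; simp
    · rw [Function.update_of_ne hai, Function.update_of_ne, Fin.append_right]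
      simpa [Fin.ext_iff] using hai

/-- The form `β(w₁, …, w_k, ·, …, ·)`. -/
def interior (w : Fin k → V) (β : V [⋀^Fin (k + m)]→L[ℝ] ℝ) : V [⋀^Fin m]→L[ℝ] ℝ :=
  toCont
    { toFun := fun v => β (Fin.append w v)
      map_update_add' := by
        intro inst v i x y
        obtain rfl : inst = instDecidableEqFin m := Subsingleton.elim _ _
        rw [append_update, append_update, append_update]
        exact β.map_update_add _ _ _ _
      map_update_smul' := by
        intro inst v i c x
        obtain rfl : inst = instDecidableEqFin m := Subsingleton.elim _ _
        rw [append_update, append_update]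
        exact β.map_update_smul _ _ _ _
      map_eq_zero_of_eq' := by
        intro v i j hv hij
        refine β.map_eq_zero_of_eq (i := Fin.natAdd k i) (j := Fin.natAdd k j) _ ?_ ?_
        · rw [Fin.append_right, Fin.append_right, hv]
        · simpa [Fin.ext_iff] using hij }

/-- The frame dual to `b` with respect to the inner product `g`: `g (dualFrame g b i) (b j) = δᵢⱼ`. -/
def dualFrame (g : V →L[ℝ] V →L[ℝ] ℝ) (b : Module.Basis (Fin n) ℝ V) (i : Fin n) : V :=
  ∑ j, (Matrix.of fun i j => g (b i) (b j))⁻¹ i j • b j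

/-- The Hodge star `*α = (1/k!) ∑ α(b_{i₁}, …, b_{i_k}) vol(b^{i₁}, …, b^{i_k}, ·, …, ·)` of the
inner product `g` and the volume form `vol`, where `b` is any basis and `(bⁱ)` its `g`-dual basis.
It is characterised by `α ∧ *β = ⟨α, β⟩ vol`, and does not depend on `b`. -/
def hodge (g : V →L[ℝ] V →L[ℝ] ℝ) (b : Module.Basis (Fin n) ℝ V)
    (vol : V [⋀^Fin (k + m)]→L[ℝ] ℝ) (α : V [⋀^Fin k]→L[ℝ] W) : V [⋀^Fin m]→L[ℝ] W :=
  ((k.factorial : ℝ)⁻¹) • ∑ i : Fin k → Fin n,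
    ((1 : ℝ →L[ℝ] ℝ).smulRight (α fun a => b (i a))).compContinuousAlternatingMap
      (interior (fun a => dualFrame g b (i a)) vol)

/-! The complexification of a real vector space `Y` is `Y × Y`, the pair `(a, b)` standing
for `a + i b`. -/

/-- Multiplication by a complex number on the complexification `Y × Y`. -/
def cmul (z : ℂ) : Y × Y →L[ℝ] Y × Y :=
  (z.re • ContinuousLinearMap.fst ℝ Y Y - z.im • ContinuousLinearMap.snd ℝ Y Y).prod
    (z.re • ContinuousLinearMap.snd ℝ Y Y + z.im • ContinuousLinearMap.fst ℝ Y Y)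

/-- Complex conjugation on the complexification `Y × Y`. -/
def conjC : Y × Y →L[ℝ] Y × Y :=
  (ContinuousLinearMap.fst ℝ Y Y).prod (-ContinuousLinearMap.snd ℝ Y Y)

/-- The complex bilinear extension of a real bilinear map. -/
def complexify (B : Y →ₗ[ℝ] Y →ₗ[ℝ] Y) : Y × Y →ₗ[ℝ] Y × Y →ₗ[ℝ] Y × Y :=
  LinearMap.mk₂ ℝ (fun a b => (B a.1 b.1 - B a.2 b.2, B a.1 b.2 + B a.2 b.1))
    (by intro a a' b; ext <;> simp <;> abel)
    (by intro c a b; ext <;> simp [smul_sub, smul_add])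
    (by intro a b b'; ext <;> simp <;> abel)
    (by intro c a b; ext <;> simp [smul_sub, smul_add])

/-- The multilinear map underlying `pqPart`. -/
def pqMultilinear (J : V →L[ℝ] V) (p q : ℕ) (α : V [⋀^Fin (p + q)]→L[ℝ] (Y × Y)) :
    MultilinearMap ℝ (fun _ : Fin (p + q) => V) (Y × Y) :=
  ∑ S ∈ Finset.powersetCard p Finset.univ, ∑ T : Finset (Fin (p + q)),
    (cmul ((1 / 2) ^ (p + q) * (-Complex.I) ^ (T ∩ S).card * Complex.I ^ (T \ S).card) :
        (Y × Y) →L[ℝ] (Y × Y)).toLinearMap.compMultilinearMap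
      (α.toAlternatingMap.toMultilinearMap.compLinearMap fun i =>
        if i ∈ T then J.toLinearMap else LinearMap.id)

theorem pqMultilinear_apply (J : V →L[ℝ] V) (p q : ℕ) (α : V [⋀^Fin (p + q)]→L[ℝ] (Y × Y))
    (v : Fin (p + q) → V) :
    pqMultilinear J p q α v =
      ∑ S ∈ Finset.powersetCard p Finset.univ, ∑ T : Finset (Fin (p + q)),
        cmul ((1 / 2) ^ (p + q) * (-Complex.I) ^ (T ∩ S).card * Complex.I ^ (T \ S).card)
          (α fun i => if i ∈ T then J (v i) else v i) := by
  simp only [pqMultilinear, sum_apply]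
  refine Finset.sum_congr rfl fun S _ => Finset.sum_congr rfl fun T _ => ?_
  simp only [LinearMap.compMultilinearMap_apply, MultilinearMap.compLinearMap_apply]
  change cmul _ (α _) = _
  congr 2
  funext i
  split_ifs <;> rfl

theorem pqMultilinear_alternating (J : V →L[ℝ] V) (p q : ℕ)
    (α : V [⋀^Fin (p + q)]→L[ℝ] (Y × Y)) (v : Fin (p + q) → V) (i j : Fin (p + q))
    (hv : v i = v j) (hij : i ≠ j) : pqMultilinear J p q α v = 0 := by
  have hvσ : ∀ a, v (Equiv.swap i j a) = v a := by
    intro a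
    by_cases h1 : a = i
    · subst h1; simp [hv]
    by_cases h2 : a = j
    · subst h2; simp [hv]
    rw [Equiv.swap_apply_of_ne_of_ne h1 h2]
  have key : pqMultilinear J p q α v = -pqMultilinear J p q α v := by
    conv_lhs => rw [pqMultilinear_apply]
    rw [pqMultilinear_apply, ← Finset.sum_neg_distrib]
    let σ := (Equiv.swap i j).toEmbedding
    have hσ : ∀ S : Finset (Fin (p + q)), (S.map σ).map σ = S := by
      intro S
      ext a
      simp [σ, Finset.mem_map_equiv]
    refine Finset.sum_nbij' (fun S => S.map σ) (fun S => S.map σ) ?_ ?_ ?_ ?_ ?_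
    · intro S hS; simpa [Finset.mem_powersetCard] using hS
    · intro S hS; simpa [Finset.mem_powersetCard] using hS
    · intro S _; exact hσ S
    · intro S _; exact hσ S
    intro S _
    rw [← Finset.sum_neg_distrib]
    refine Finset.sum_nbij' (fun T => T.map σ) (fun T => T.map σ) ?_ ?_ ?_ ?_ ?_
    · intro T _; exact Finset.mem_univ _
    · intro T _; exact Finset.mem_univ _
    · intro T _; exact hσ T
    · intro T _; exact hσ T
    intro T _
    have h1 : (T.map σ ∩ S.map σ).card = (T ∩ S).card := by
      rw [← Finset.map_inter, Finset.card_map]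
    have h2 : (T.map σ \ S.map σ).card = (T \ S).card := by
      rw [← Finset.map_sdiff, Finset.card_map]
    have h3 : (fun a => if a ∈ T.map σ then J (v a) else v a)
        = (fun a => if a ∈ T then J (v a) else v a) ∘ Equiv.swap i j := by
      funext a
      simp [σ, Finset.mem_map_equiv, hvσ]
    have h4 : (α fun a => if a ∈ T.map σ then J (v a) else v a)
        = -(α fun a => if a ∈ T then J (v a) else v a) := by
      rw [h3]
      exact α.toAlternatingMap.map_swap _ hij
    rw [h1, h2, h4, map_neg, neg_neg]
  have h2 : (2 : ℝ) • pqMultilinear J p q α v = 0 := by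
    rw [two_smul]
    nth_rewrite 1 [key]
    exact neg_add_cancel _
  exact (smul_eq_zero.mp h2).resolve_left two_ne_zero

/-- The component of type `(p, q)` of a complex-valued form `α`, with respect to the complex
structure `J`:
`α^{p,q}(v₁, …, v_k) = ∑_{|S| = p} α(w₁, …, w_k)`, where `wᵢ = (vᵢ - i J vᵢ) / 2` if `i ∈ S` and
`wᵢ = (vᵢ + i J vᵢ) / 2` otherwise, and `α` is extended complex-multilinearly. In
`pqMultilinear` the products are expanded, `T` being the set of slots with the term in `J`. -/
def pqPart (J : V →L[ℝ] V) (p q : ℕ) (α : V [⋀^Fin (p + q)]→L[ℝ] (Y × Y)) :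
    V [⋀^Fin (p + q)]→L[ℝ] (Y × Y) :=
  toCont { pqMultilinear J p q α with
    map_eq_zero_of_eq' := pqMultilinear_alternating J p q α }

end Pointwise

/-! ### Differential forms on manifolds -/

section Forms

variable {E : Type*} [NormedAddCommGroup E] [NormedSpace ℝ E]
  {M : Type*} [TopologicalSpace M] [ChartedSpace E M]
  {W : Type*} [NormedAddCommGroup W] [NormedSpace ℝ W] {k : ℕ}

instance [FiniteDimensional ℝ E] (x : M) : FiniteDimensional ℝ (TangentSpace 𝓘(ℝ, E) x) :=
  inferInstanceAs (FiniteDimensional ℝ E)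

instance (x : M) : T2Space (TangentSpace 𝓘(ℝ, E) x) :=
  inferInstanceAs (T2Space E)

variable (E M W k) in
/-- (Not necessarily smooth) `W`-valued differential `k`-forms on the manifold `M`. -/
abbrev DiffForm : Type _ := (x : M) → TangentSpace 𝓘(ℝ, E) x [⋀^Fin k]→L[ℝ] W

/-- A form in the chart around `x₀`: its pullback under the inverse of the chart. -/
def coordRep (α : DiffForm E M W k) (x₀ : M) (y : E) : E [⋀^Fin k]→L[ℝ] W :=
  (α ((extChartAt 𝓘(ℝ, E) x₀).symm y)).compContinuousLinearMap
    (mfderiv 𝓘(ℝ, E) 𝓘(ℝ, E) (extChartAt 𝓘(ℝ, E) x₀).symm y)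

/-- Smoothness of a form: it is smooth in charts. -/
def IsSmoothForm (α : DiffForm E M W k) : Prop :=
  ∀ x₀ : M, ContDiffOn ℝ ∞ (coordRep α x₀) (extChartAt 𝓘(ℝ, E) x₀).target

/-- The exterior derivative of a form, computed at `x` in the chart around `x`. -/
def extDer (α : DiffForm E M W k) : DiffForm E M W (k + 1) := fun x =>
  (extDeriv (coordRep α x) (extChartAt 𝓘(ℝ, E) x x)).compContinuousLinearMap
    (mfderiv 𝓘(ℝ, E) 𝓘(ℝ, E) (extChartAt 𝓘(ℝ, E) x) x)

/-- A field of linear functionals as a `1`-form. -/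
def oneForm (θ : (x : M) → TangentSpace 𝓘(ℝ, E) x →L[ℝ] W) : DiffForm E M W 1 := fun x =>
  ContinuousAlternatingMap.ofSubsingleton ℝ (TangentSpace 𝓘(ℝ, E) x) W (0 : Fin 1) (θ x)

end Forms

/-- Euclidean space `ℝⁿ`, the model of all `n`-dimensional manifolds below. -/
abbrev Euc (n : ℕ) : Type := EuclideanSpace ℝ (Fin n)

/-! ### Almost Hermitian and `SU(3)`-structures in dimension six -/

section SU3

variable (X : Type*) [TopologicalSpace X] [ChartedSpace (Euc 6) X] [IsManifold (𝓡 6) ∞ X]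

/-- An almost Hermitian structure `(g, J)` on a `6`-manifold. -/
structure AlmostHermitian where
  /-- the Riemannian metric -/
  g : Bundle.ContMDiffRiemannianMetric (𝓡 6) ∞ (Euc 6) (fun x : X => TangentSpace (𝓡 6) x)
  /-- the almost complex structure -/
  J : (x : X) → TangentSpace (𝓡 6) x →L[ℝ] TangentSpace (𝓡 6) x
  J_smooth : ContMDiff (𝓡 6) ((𝓡 6).prod 𝓘(ℝ, Euc 6 →L[ℝ] Euc 6)) ∞
    (fun x => Bundle.TotalSpace.mk' (Euc 6 →L[ℝ] Euc 6)
      (E := fun x : X => TangentSpace (𝓡 6) x →L[ℝ] TangentSpace (𝓡 6) x) x (J x))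
  J_sq : ∀ x v, J x (J x v) = -v
  compat : ∀ x v w, g.inner x (J x v) (J x w) = g.inner x v w

variable {X}

namespace AlmostHermitian

variable (S : AlmostHermitian X)

theorem inner_J_self (x : X) (v : TangentSpace (𝓡 6) x) : S.g.inner x (S.J x v) v = 0 := by
  have h := S.compat x (S.J x v) v
  rw [S.J_sq, map_neg, neg_apply, S.g.symm x v (S.J x v)] at h
  linarith

/-- The fundamental form `ω(v, w) = g(J v, w)`. -/
def omega : DiffForm (Euc 6) X ℝ 2 := fun x =>
  toCont
    { toFun := fun v => S.g.inner x (S.J x (v 0)) (v 1)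
      map_update_add' := by
        intro inst v i a b
        obtain rfl : inst = instDecidableEqFin 2 := Subsingleton.elim _ _
        fin_cases i <;> simp
      map_update_smul' := by
        intro inst v i c a
        obtain rfl : inst = instDecidableEqFin 2 := Subsingleton.elim _ _
        fin_cases i <;> simp
      map_eq_zero_of_eq' := by
        intro v i j hv hij
        have h01 : v 0 = v 1 := by
          fin_cases i <;> fin_cases j <;> first | exact absurd rfl hij | exact hv | exact hv.symm
        rw [h01]
        exact S.inner_J_self x (v 1) }

/-- The form `ω²`. -/
def omegaSq : DiffForm (Euc 6) X ℝ 4 := fun x => wedgeR (S.omega x) (S.omega x)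

/-- The form `ω³`. -/
def omegaCube : DiffForm (Euc 6) X ℝ 6 := fun x => wedgeR (S.omegaSq x) (S.omega x)

/-- The volume form `ω³ / 3!` of the metric and the orientation given by `J`. -/
def vol : DiffForm (Euc 6) X ℝ 6 := fun x => (1 / 6 : ℝ) • S.omegaCube x

/-- The Hodge star `Λ^k → Λ^m`, `k + m = 6`, at the point `x`, on forms with values in `W`
(for a complexification it is the complex linear extension of the real Hodge star). -/
def star {W : Type*} [NormedAddCommGroup W] [NormedSpace ℝ W] (x : X) (k m : ℕ) (h : k + m = 6)
    (α : TangentSpace (𝓡 6) x [⋀^Fin k]→L[ℝ] W) : TangentSpace (𝓡 6) x [⋀^Fin m]→L[ℝ] W :=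
  hodge (S.g.inner x)
    ((EuclideanSpace.basisFun (Fin 6) ℝ).toBasis :
      Module.Basis (Fin 6) ℝ (TangentSpace (𝓡 6) x))
    (toCont ((S.vol x).toAlternatingMap.domDomCongr (finCongr h.symm))) α

end AlmostHermitian

variable (X) in
/-- An `SU(3)`-structure `(g, J, Ω₁)`: a smooth real `3`-form `Ω₁` such that, with
`Ω₂ = J Ω₁ = Ω₁(J·, J·, J·)`, the complex form `Ω = Ω₁ + i Ω₂` is of type `(3, 0)`, and
`ω ∧ Ω₁ = 0`, `ω³ = (3/2) Ω₁ ∧ Ω₂`. -/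
structure SU3Structure extends AlmostHermitian X where
  /-- the real part of the complex volume form -/
  Ω₁ : DiffForm (Euc 6) X ℝ 3
  smooth : IsSmoothForm Ω₁
  /-- the real part of `Ω(v₁, …, J vᵢ, …, v₃) = i Ω(v₁, v₂, v₃)`; the imaginary part is
  a consequence -/
  type_three_zero : ∀ x (v : Fin 3 → TangentSpace (𝓡 6) x) (i : Fin 3),
    Ω₁ x (Function.update v i (J x (v i))) = -(Ω₁ x).compContinuousLinearMap (J x) v
  omega_wedge : ∀ x, wedgeR (toAlmostHermitian.omega x) (Ω₁ x) = 0
  normalized : ∀ x, toAlmostHermitian.omegaCube x =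
    (3 / 2 : ℝ) • wedgeR (Ω₁ x) ((Ω₁ x).compContinuousLinearMap (J x))

namespace SU3Structure

variable (S : SU3Structure X)

/-- The imaginary part `Ω₂ = J Ω₁` of the complex volume form. -/
def Ω₂ : DiffForm (Euc 6) X ℝ 3 := fun x => (S.Ω₁ x).compContinuousLinearMap (S.J x)

/-- The complex volume form `Ω = Ω₁ + i Ω₂`. -/
def Ω (x : X) (v : Fin 3 → TangentSpace (𝓡 6) x) : ℂ := ⟨S.Ω₁ x v, S.Ω₂ x v⟩

/-- Half-flat: `dω² = 0` and `dΩ₁ = 0`. -/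
def IsHalfFlat : Prop :=
  (∀ x, extDer S.omegaSq x = 0) ∧ ∀ x, extDer S.Ω₁ x = 0

end SU3Structure

end SU3

/-! ### Lie groups, principal bundles, connections -/

section LieGroups

instance : ENat.LEInfty (minSmoothness ℝ 3) :=
  ⟨by rw [minSmoothness_of_isRCLikeNormedField]; exact ENat.LEInfty.out⟩

variable {n : ℕ} {G : Type*} [TopologicalSpace G] [ChartedSpace (Euc n) G] [Group G]

/-- The adjoint representation of `G` on its Lie algebra `T₁G`, whose underlying vector space is
`ℝⁿ`: `Ad g` is the derivative at `1` of the conjugation by `g`. -/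
def Ad (g : G) : Euc n →L[ℝ] Euc n :=
  mfderiv (𝓡 n) (𝓡 n) (fun h : G => g * h * g⁻¹) 1

variable (n G) in
/-- The bracket of the Lie algebra `T₁G` as a bilinear map. -/
def lieBr [LieGroup (𝓡 n) ∞ G] : Euc n →ₗ[ℝ] Euc n →ₗ[ℝ] Euc n :=
  (LinearMap.mk₂ ℝ (fun a b => ⁅a, b⁆) add_lie smul_lie lie_add (fun c a b => lie_smul c a b) :
    GroupLieAlgebra (𝓡 n) G →ₗ[ℝ] GroupLieAlgebra (𝓡 n) G →ₗ[ℝ] GroupLieAlgebra (𝓡 n) G)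

end LieGroups

section Bundles

variable (n m : ℕ) (X G P : Type*)
  [TopologicalSpace X] [ChartedSpace (Euc 6) X]
  [TopologicalSpace G] [ChartedSpace (Euc n) G] [Group G]
  [TopologicalSpace P] [ChartedSpace (Euc m) P]

/-- A smooth principal `G`-bundle `P → X`. -/
structure PrincipalBundle where
  /-- the projection -/
  π : P → X
  /-- the right action of `G` on `P` -/
  act : P → G → P
  act_one : ∀ p, act p 1 = p
  act_mul : ∀ p g h, act p (g * h) = act (act p g) h
  π_act : ∀ p g, π (act p g) = π p
  act_smooth : ContMDiff ((𝓡 m).prod (𝓡 n)) (𝓡 m) ∞ (fun q : P × G => act q.1 q.2)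
  /-- equivariant local trivialisations -/
  locally_trivial : ∀ x : X, ∃ U : Set X, IsOpen U ∧ x ∈ U ∧
    ∃ e : OpenPartialHomeomorph P (X × G),
      e.source = π ⁻¹' U ∧ e.target = U ×ˢ Set.univ ∧
      ContMDiffOn (𝓡 m) ((𝓡 6).prod (𝓡 n)) ∞ e e.source ∧
      ContMDiffOn ((𝓡 6).prod (𝓡 n)) (𝓡 m) ∞ e.symm e.target ∧
      (∀ p ∈ e.source, (e p).1 = π p) ∧
      ∀ p ∈ e.source, ∀ g, e (act p g) = ((e p).1, (e p).2 * g)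

variable {n m X G P}

namespace PrincipalBundle

variable (B : PrincipalBundle n m X G P)

/-- The derivative of the projection. -/
def dπ (p : P) : TangentSpace (𝓡 m) p →L[ℝ] TangentSpace (𝓡 6) (B.π p) :=
  mfderiv (𝓡 m) (𝓡 6) B.π p

/-- The derivative of the right translation by `g`. -/
def dR (g : G) (p : P) : TangentSpace (𝓡 m) p →L[ℝ] TangentSpace (𝓡 m) (B.act p g) :=
  mfderiv (𝓡 m) (𝓡 m) (fun q => B.act q g) p

/-- A connection on a principal bundle, given by its connection `1`-form with values in the Lie
algebra of `G`. -/
structure Connection where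
  /-- the connection form -/
  θ : (p : P) → TangentSpace (𝓡 m) p →L[ℝ] Euc n
  smooth : IsSmoothForm (oneForm θ)
  equivariant : ∀ g p v, θ (B.act p g) (B.dR g p v) = Ad g⁻¹ (θ p v)
  /-- `θ` sends the fundamental vector field of `ξ` to `ξ` -/
  fundamental : ∀ (p : P) (ξ : GroupLieAlgebra (𝓡 n) G),
    θ (B.act p 1) (mfderiv (𝓡 n) (𝓡 m) (fun g : G => B.act p g) 1 ξ) = ξ

/-- A (not necessarily smooth or equivariant) family of `W`-valued `k`-forms on the spaces
`T_{π(p)}X`. A `k`-form on `X` with values in the bundle associated to a representation of `G` on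
`W` is such a family: its value at `p` is the value at `π(p)`, read in the frame `p`. -/
abbrev FormFamily (W : Type*) [NormedAddCommGroup W] [NormedSpace ℝ W] (k : ℕ) : Type _ :=
  (p : P) → TangentSpace (𝓡 6) (B.π p) [⋀^Fin k]→L[ℝ] W

section

variable {B} {W : Type*} [NormedAddCommGroup W] [NormedSpace ℝ W] {k : ℕ}

/-- The horizontal form on `P` that corresponds to a family of forms. -/
def FormFamily.toTotal (η : B.FormFamily W k) : DiffForm (Euc m) P W k := fun p =>
  (η p).compContinuousLinearMap (B.dπ p)

/-- Equivariance `R_g^* η = ρ(g⁻¹) η` of a family of forms, for the representation `ρ`. -/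
def FormFamily.IsEquivariant (η : B.FormFamily W k) (ρ : G → W →L[ℝ] W) : Prop :=
  ∀ g p (v : Fin k → TangentSpace (𝓡 m) p),
    η.toTotal (B.act p g) (fun i => B.dR g p (v i)) = ρ g⁻¹ (η.toTotal p v)

namespace Connection

variable (A : B.Connection)

/-- The horizontal lift `T_{π(p)}X → T_pP`: the vector `v` is sent to the `w` with `dπ(w) = v` and
`θ(w) = 0`. -/
def lift (p : P) : TangentSpace (𝓡 6) (B.π p) →L[ℝ] TangentSpace (𝓡 m) p :=
  ((B.dπ p).prod (A.θ p)).inverse ∘L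
    ContinuousLinearMap.inl ℝ (TangentSpace (𝓡 6) (B.π p)) (Euc n)

/-- The curvature `F_A`, the horizontal part of `dθ`. -/
def curvature : B.FormFamily (Euc n) 2 := fun p =>
  (extDer (oneForm A.θ) p).compContinuousLinearMap (A.lift p)

/-- The covariant exterior derivative `d_A` of forms with values in an associated bundle. -/
def d (η : B.FormFamily W k) : B.FormFamily W (k + 1) := fun p =>
  (extDer η.toTotal p).compContinuousLinearMap (A.lift p)

/-- The covariant derivative `d_A Φ` of a section of an associated bundle. -/
def d₀ (Φ : P → W) (p : P) : TangentSpace (𝓡 6) (B.π p) →L[ℝ] W :=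
  (mfderiv (𝓡 m) 𝓘(ℝ, W) Φ p : TangentSpace (𝓡 m) p →L[ℝ] W) ∘L A.lift p

/-- `q` can be reached from `p` along a horizontal path of class `C¹`. -/
def HorizontallyJoined (p q : P) : Prop :=
  ∃ γ : ℝ → P, ContMDiff 𝓘(ℝ, ℝ) (𝓡 m) 1 γ ∧ γ 0 = p ∧ γ 1 = q ∧
    ∀ t ∈ Set.Icc (0 : ℝ) 1, A.θ (γ t) (mfderiv 𝓘(ℝ, ℝ) (𝓡 m) γ t (1 : ℝ)) = 0

/-- The holonomy group at `p`: all `g` such that `p` and `p g` can be joined by a piecewise `C¹`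
horizontal path. -/
def holonomy (p : P) : Set G :=
  {g | Relation.ReflTransGen A.HorizontallyJoined p (B.act p g)}

/-- The connection is irreducible: it does not reduce to a proper subgroup of `G`, that is, its
holonomy group at each point is all of `G`. -/
def IsIrreducible : Prop := ∀ p, A.holonomy p = Set.univ

end Connection

end

/-- Smooth sections of the adjoint bundle, as equivariant functions on `P`. -/
structure AdSection where
  /-- the equivariant function -/
  val : P → Euc n
  smooth : ContMDiff (𝓡 m) 𝓘(ℝ, Euc n) ∞ val
  equivariant : ∀ g p, val (B.act p g) = Ad g⁻¹ (val p)

variable [IsManifold (𝓡 6) ∞ X]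

/-- Higgs fields: smooth forms of type `(0, 3)` with values in the complexified adjoint bundle. -/
structure HiggsField (S : AlmostHermitian X) where
  /-- the equivariant family of forms -/
  val : B.FormFamily (Euc n × Euc n) 3
  smooth : IsSmoothForm val.toTotal
  equivariant : val.IsEquivariant fun g => (Ad g).prodMap (Ad g)
  type_zero_three : ∀ p, pqPart (S.J (B.π p)) 0 3 (val p) = val p

variable {B}

/-- The DT-instanton equations `F_A^{0,2} = -* ∂_A (* u)` and `Λ F_A = *[u ∧ ū]`, where
`∂_A` of a form of type `(0, 3)` is the component of type `(1, 3)` of `d_A`, and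
`Λ F_A = *(F_A ∧ ω² / 2)`. -/
def IsDTInstanton [LieGroup (𝓡 n) ∞ G] (S : AlmostHermitian X) (A : B.Connection)
    (u : B.HiggsField S) : Prop :=
  (∀ p, pqPart (S.J (B.π p)) 0 2
        ((ContinuousLinearMap.inl ℝ (Euc n) (Euc n)).compContinuousAlternatingMap
          (A.curvature p)) =
      -S.star (B.π p) 4 2 rfl
        (pqPart (S.J (B.π p)) 1 3
          (A.d (fun q => S.star (B.π q) 3 3 rfl (u.val q)) p))) ∧
  ∀ p, (ContinuousLinearMap.inl ℝ (Euc n) (Euc n)).compContinuousAlternatingMap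
        (S.star (B.π p) 6 0 rfl (wedgeS (A.curvature p) ((1 / 2 : ℝ) • S.omegaSq (B.π p)))) =
      S.star (B.π p) 6 0 rfl
        (wedge (complexify (lieBr n G)) (u.val p)
          (conjC.compContinuousAlternatingMap (u.val p)))

/-- The relation `u = (i/4) (Φ₁ + i Φ₂) Ω̄`. -/
def HasComponents (S : SU3Structure X) (u : B.HiggsField S.toAlmostHermitian)
    (Φ₁ Φ₂ : B.AdSection) : Prop :=
  ∀ p v, u.val p v =
    cmul (Complex.I / 4 * (starRingEnd ℂ) (S.Ω (B.π p) v)) (Φ₁.val p, Φ₂.val p)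

end PrincipalBundle

end Bundles

end

end DTInstanton

open scoped Manifold ContDiff

set_option linter.unusedSectionVars false
set_option maxRecDepth 8000

namespace DTInstanton

noncomputable section

/-! ### Linear algebra of `SU(3)`-structures -/

section Pointwise

variable {V W W₁ W₂ W₃ Y : Type*}
  [AddCommGroup V] [Module ℝ V] [TopologicalSpace V] [IsTopologicalAddGroup V]
  [ContinuousSMul ℝ V] [T2Space V] [FiniteDimensional ℝ V]
  [NormedAddCommGroup W] [NormedSpace ℝ W]
  [NormedAddCommGroup W₁] [NormedSpace ℝ W₁] [NormedAddCommGroup W₂] [NormedSpace ℝ W₂]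
  [NormedAddCommGroup W₃] [NormedSpace ℝ W₃] [NormedAddCommGroup Y] [NormedSpace ℝ Y]
  {k l m n : ℕ}

/-! The argument is a Bochner argument for `Φ₁`. Write u = (i/4)(Φ₁ + iΦ₂)Ω̄. Since *Ω₁ = Ω₂ and *Ω₂
= -Ω₁, one has *Ω̄ = iΩ̄ and *u = -(1/4)(Φ₁ + iΦ₂)Ω̄. Because Ω is of type (3,0) and dΩ₁ = 0, the
form dΩ₂ is of type (2,2) and contributes nothing to the (1,3)-part of d_A(*u) (`extDeriv_im_symm`).
The first instanton equation therefore is a pointwise linear relation between F^{0,2} and the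
covariant derivatives of Φ₁ and Φ₂. In a unitary frame with Ω = 1 on it, this relation consists of
six real equations (`FrameRelations`), which amount to F ∧ Ω₁ = *d_AΦ₁ + d_AΦ₂ ∧ ω²/2
(`wedge_re_eq`). The second equation becomes F ∧ ω²/2 = [Φ₁, Φ₂] vol (`wedge_conj`,
`wedge_omegaSq`).

Apply d_A to the first of these. The Bianchi identity and dΩ₁ = 0 kill the left side; dω² = 0 and
d_A²Φ₂ = [F, Φ₂] leave d_A * d_AΦ₁ = -[[Φ₁, Φ₂], Φ₂] vol (`sum_fderiv_gradDensity`). Pairing with Φ₁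
in an Ad-invariant inner product, for which ad is skew, gives Δ|Φ₁|² = 2(|d_AΦ₁|² + |[Φ₁, Φ₂]|²) ≥
0, where Δ is the divergence of the gradient (`ellipticOp_normSq`).

Instead of integrating over X, the proof uses Hopf's strong maximum principle in charts
(`eventually_eq_of_ellipticOp_nonneg`). On the compact space X it makes |Φ₁|² locally constant, so
Δ|Φ₁|² = 0 and d_AΦ₁ = 0 (`d₀_eq_zero`). A parallel section is constant along horizontal paths; full
holonomy makes its values Ad-invariant, hence central, and a simple Lie algebra has no centre
(`eq_zero_of_parallel`). The frame relations with d_AΦ₁ = 0 give the two formulas for d_AΦ₂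
(`hodge_wedge_re`, `hodge_wedge_im`), and Φ₁ = 0 gives F ∧ ω²/2 = 0.

Sections and forms with values in the adjoint bundle are equivariant objects on P. Covariant
derivatives are computed in local sections of P that are horizontal at one point
(`exists_horizontal`), where they become ordinary derivatives. -/

/-- The wedge product as a sum over any system of representatives of the shuffles. -/
theorem wedge_eq_sum_reps {N : ℕ} (B : W₁ →ₗ[ℝ] W₂ →ₗ[ℝ] W₃) (α : V [⋀^Fin k]→L[ℝ] W₁)
    (β : V [⋀^Fin l]→L[ℝ] W₂) (R : Fin N → Equiv.Perm (Fin (k + l)))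
    (hN : N * (k.factorial * l.factorial) = (k + l).factorial)
    (hR : ∀ i j, (∀ a : Fin k, ∃ b : Fin k, R i (Fin.castAdd l a) = R j (Fin.castAdd l b)) → i = j)
    (v : Fin (k + l) → V) :
    wedge B α β v = ∑ i, (Equiv.Perm.sign (R i) : ℤ) •
      B (α fun a => v (R i (Fin.castAdd l a))) (β fun b => v (R i (Fin.natAdd k b))) := by
  classical
  let e : Fin k ⊕ Fin l ≃ Fin (k + l) := finSumFinEquiv
  let ρ : Fin N → Equiv.Perm (Fin k ⊕ Fin l) := fun i => e.permCongr.symm (R i)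
  have hρ : ∀ i x, e (ρ i x) = R i (e x) := by intro i x; simp [ρ, Equiv.permCongr_def]
  let q : Fin N → Equiv.Perm.ModSumCongr (Fin k) (Fin l) := fun i => Quotient.mk'' (ρ i)
  -- By `hR` distinct representatives send the first k slots to distinct sets, so they lie in
  -- distinct left cosets of S_k × S_l. By `hN` and Lagrange's theorem there are as many of them as
  -- cosets.
  have hq : Function.Bijective q := by
    rw [Fintype.bijective_iff_injective_and_card]
    refine ⟨fun i j hij => hR i j fun a => ?_, ?_⟩
    · have h := QuotientGroup.leftRel_apply.mp (Quotient.exact' hij)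
      obtain ⟨⟨sl, sr⟩, h⟩ := h
      replace h : ρ i * Equiv.Perm.sumCongrHom _ _ (sl, sr) = ρ j := by rw [h]; simp
      refine ⟨sl⁻¹ a, ?_⟩
      have h2 : e (ρ j (Sum.inl (sl⁻¹ a))) = e (ρ i (Sum.inl a)) := by
        rw [← h]; simp
      rw [hρ, hρ] at h2
      simpa [e] using h2.symm
    · have hc := Subgroup.card_eq_card_quotient_mul_card_subgroup
        (Equiv.Perm.sumCongrHom (Fin k) (Fin l)).range
      have h1 : Nat.card (Equiv.Perm.sumCongrHom (Fin k) (Fin l)).range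
          = k.factorial * l.factorial := by
        rw [← Nat.card_congr (MonoidHom.ofInjective
          (Equiv.Perm.sumCongrHom_injective (α := Fin k) (β := Fin l))).toEquiv]
        simp [Fintype.card_perm]
      have h2 : Nat.card (Equiv.Perm (Fin k ⊕ Fin l)) = (k + l).factorial := by
        simp [Fintype.card_perm]
      rw [h1, h2, ← hN] at hc
      have := Nat.eq_of_mul_eq_mul_right (by positivity) hc
      rw [Fintype.card_fin, this, Nat.card_eq_fintype_card]
  have hsum : wedge B α β v = ∑ σ : Equiv.Perm.ModSumCongr (Fin k) (Fin l),
      TensorProduct.lift B (AlternatingMap.domCoprod.summand α.toAlternatingMap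
        β.toAlternatingMap σ (fun i => v (e i))) := by
    rw [← map_sum, ← sum_apply]; rfl
  rw [hsum, ← (Equiv.ofBijective q hq).sum_comp]
  refine Finset.sum_congr rfl fun i _ => ?_
  have h3 : Equiv.Perm.sign (ρ i) = Equiv.Perm.sign (R i) := by simp [ρ]
  rw [Equiv.ofBijective_apply]
  change TensorProduct.lift B (AlternatingMap.domCoprod.summand _ _ (Quotient.mk'' (ρ i)) _) = _
  rw [AlternatingMap.domCoprod.summand_mk'', smul_apply, h3, Units.smul_def, map_zsmul]
  congr 1
  change B (α fun a => v (e (ρ i (Sum.inl a)))) (β fun b => v (e (ρ i (Sum.inr b)))) = _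
  simp only [hρ]
  rfl

/-- A permutation given by its values and those of its inverse. -/
abbrev permOf (f g : Fin n → Fin n) (h : ∀ i, g (f i) = i := by decide)
    (h' : ∀ i, f (g i) = i := by decide) : Equiv.Perm (Fin n) := ⟨f, g, h, h'⟩


/-- Representatives of the `(1, 4)`-shuffles. -/
def shuffleOneFour : Fin 5 → Equiv.Perm (Fin (1 + 4)) :=
  ![permOf ![0, 1, 2, 3, 4] ![0, 1, 2, 3, 4],
    permOf ![1, 0, 2, 3, 4] ![1, 0, 2, 3, 4],
    permOf ![2, 0, 1, 3, 4] ![1, 2, 0, 3, 4],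
    permOf ![3, 0, 1, 2, 4] ![1, 2, 3, 0, 4],
    permOf ![4, 0, 1, 2, 3] ![1, 2, 3, 4, 0]]

/-- This expansion and its analogues in the other bidegrees carry all later computations: identities
between forms are checked on the vectors of a frame. That a table lists one representative of each
shuffle is decidable. -/
theorem wedgeOneFour_apply (B : W₁ →ₗ[ℝ] W₂ →ₗ[ℝ] W₃) (α : V [⋀^Fin 1]→L[ℝ] W₁)
    (β : V [⋀^Fin 4]→L[ℝ] W₂) (a b c d e : V) :
    wedge B α β ![a, b, c, d, e] =
      B (α ![a]) (β ![b, c, d, e])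
      - B (α ![b]) (β ![a, c, d, e])
      + B (α ![c]) (β ![a, b, d, e])
      - B (α ![d]) (β ![a, b, c, e])
      + B (α ![e]) (β ![a, b, c, d]) := by
  rw [wedge_eq_sum_reps B α β shuffleOneFour (by decide) (by decide)]
  have hs : (fun i => (Equiv.Perm.sign (shuffleOneFour i) : ℤ)) =
      ![1, -1, 1, -1, 1] := by decide
  have hα : ∀ i, (fun j => ![a, b, c, d, e] (shuffleOneFour i (Fin.castAdd 4 j))) =
      ![![a], ![b], ![c], ![d], ![e]] i := by
    intro i; fin_cases i <;> (ext j; fin_cases j; rfl)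
  have hβ : ∀ i, (fun j => ![a, b, c, d, e] (shuffleOneFour i (Fin.natAdd 1 j))) =
      ![![b, c, d, e], ![a, c, d, e], ![a, b, d, e], ![a, b, c, e], ![a, b, c, d]] i := by
    intro i; fin_cases i <;> (ext j; fin_cases j <;> rfl)
  simp only [hα, hβ, congrFun hs, Fin.sum_univ_succ, Fin.sum_univ_zero, Matrix.cons_val_zero,
    Matrix.cons_val_succ, one_smul, neg_smul, add_zero]
  abel

/-- Representatives of the `(2, 2)`-shuffles. -/
def shuffleTwoTwo : Fin 6 → Equiv.Perm (Fin (2 + 2)) :=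
  ![permOf ![0, 1, 2, 3] ![0, 1, 2, 3],
    permOf ![0, 2, 1, 3] ![0, 2, 1, 3],
    permOf ![0, 3, 1, 2] ![0, 2, 3, 1],
    permOf ![1, 2, 0, 3] ![2, 0, 1, 3],
    permOf ![1, 3, 0, 2] ![2, 0, 3, 1],
    permOf ![2, 3, 0, 1] ![2, 3, 0, 1]]

theorem wedgeTwoTwo_apply (B : W₁ →ₗ[ℝ] W₂ →ₗ[ℝ] W₃) (α : V [⋀^Fin 2]→L[ℝ] W₁)
    (β : V [⋀^Fin 2]→L[ℝ] W₂) (a b c d : V) :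
    wedge B α β ![a, b, c, d] =
      B (α ![a, b]) (β ![c, d])
      - B (α ![a, c]) (β ![b, d])
      + B (α ![a, d]) (β ![b, c])
      + B (α ![b, c]) (β ![a, d])
      - B (α ![b, d]) (β ![a, c])
      + B (α ![c, d]) (β ![a, b]) := by
  rw [wedge_eq_sum_reps B α β shuffleTwoTwo (by decide) (by decide)]
  have hs : (fun i => (Equiv.Perm.sign (shuffleTwoTwo i) : ℤ)) =
      ![1, -1, 1, 1, -1, 1] := by decide
  have hα : ∀ i, (fun j => ![a, b, c, d] (shuffleTwoTwo i (Fin.castAdd 2 j))) =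
      ![![a, b], ![a, c], ![a, d], ![b, c], ![b, d], ![c, d]] i := by
    intro i; fin_cases i <;> (ext j; fin_cases j <;> rfl)
  have hβ : ∀ i, (fun j => ![a, b, c, d] (shuffleTwoTwo i (Fin.natAdd 2 j))) =
      ![![c, d], ![b, d], ![b, c], ![a, d], ![a, c], ![a, b]] i := by
    intro i; fin_cases i <;> (ext j; fin_cases j <;> rfl)
  simp only [hα, hβ, congrFun hs, Fin.sum_univ_succ, Fin.sum_univ_zero, Matrix.cons_val_zero,
    Matrix.cons_val_succ, one_smul, neg_smul, add_zero]
  abel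

/-- Representatives of the `(2, 3)`-shuffles. -/
def shuffleTwoThree : Fin 10 → Equiv.Perm (Fin (2 + 3)) :=
  ![permOf ![0, 1, 2, 3, 4] ![0, 1, 2, 3, 4],
    permOf ![0, 2, 1, 3, 4] ![0, 2, 1, 3, 4],
    permOf ![0, 3, 1, 2, 4] ![0, 2, 3, 1, 4],
    permOf ![0, 4, 1, 2, 3] ![0, 2, 3, 4, 1],
    permOf ![1, 2, 0, 3, 4] ![2, 0, 1, 3, 4],
    permOf ![1, 3, 0, 2, 4] ![2, 0, 3, 1, 4],
    permOf ![1, 4, 0, 2, 3] ![2, 0, 3, 4, 1],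
    permOf ![2, 3, 0, 1, 4] ![2, 3, 0, 1, 4],
    permOf ![2, 4, 0, 1, 3] ![2, 3, 0, 4, 1],
    permOf ![3, 4, 0, 1, 2] ![2, 3, 4, 0, 1]]

theorem wedgeTwoThree_apply (B : W₁ →ₗ[ℝ] W₂ →ₗ[ℝ] W₃) (α : V [⋀^Fin 2]→L[ℝ] W₁)
    (β : V [⋀^Fin 3]→L[ℝ] W₂) (a b c d e : V) :
    wedge B α β ![a, b, c, d, e] =
      B (α ![a, b]) (β ![c, d, e])
      - B (α ![a, c]) (β ![b, d, e])
      + B (α ![a, d]) (β ![b, c, e])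
      - B (α ![a, e]) (β ![b, c, d])
      + B (α ![b, c]) (β ![a, d, e])
      - B (α ![b, d]) (β ![a, c, e])
      + B (α ![b, e]) (β ![a, c, d])
      + B (α ![c, d]) (β ![a, b, e])
      - B (α ![c, e]) (β ![a, b, d])
      + B (α ![d, e]) (β ![a, b, c]) := by
  rw [wedge_eq_sum_reps B α β shuffleTwoThree (by decide) (by decide)]
  have hs : (fun i => (Equiv.Perm.sign (shuffleTwoThree i) : ℤ)) =
      ![1, -1, 1, -1, 1, -1, 1, 1, -1, 1] := by decide
  have hα : ∀ i, (fun j => ![a, b, c, d, e] (shuffleTwoThree i (Fin.castAdd 3 j))) =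
      ![![a, b], ![a, c], ![a, d], ![a, e], ![b, c], ![b, d], ![b, e], ![c, d], ![c, e],
        ![d, e]] i := by
    intro i; fin_cases i <;> (ext j; fin_cases j <;> rfl)
  have hβ : ∀ i, (fun j => ![a, b, c, d, e] (shuffleTwoThree i (Fin.natAdd 2 j))) =
      ![![c, d, e], ![b, d, e], ![b, c, e], ![b, c, d], ![a, d, e], ![a, c, e], ![a, c, d],
        ![a, b, e], ![a, b, d], ![a, b, c]] i := by
    intro i; fin_cases i <;> (ext j; fin_cases j <;> rfl)
  simp only [hα, hβ, congrFun hs, Fin.sum_univ_succ, Fin.sum_univ_zero, Matrix.cons_val_zero,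
    Matrix.cons_val_succ, one_smul, neg_smul, add_zero]
  abel

/-- Representatives of the `(2, 4)`-shuffles. -/
def shuffleTwoFour : Fin 15 → Equiv.Perm (Fin (2 + 4)) :=
  ![permOf ![0, 1, 2, 3, 4, 5] ![0, 1, 2, 3, 4, 5],
    permOf ![0, 2, 1, 3, 4, 5] ![0, 2, 1, 3, 4, 5],
    permOf ![0, 3, 1, 2, 4, 5] ![0, 2, 3, 1, 4, 5],
    permOf ![0, 4, 1, 2, 3, 5] ![0, 2, 3, 4, 1, 5],
    permOf ![0, 5, 1, 2, 3, 4] ![0, 2, 3, 4, 5, 1],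
    permOf ![1, 2, 0, 3, 4, 5] ![2, 0, 1, 3, 4, 5],
    permOf ![1, 3, 0, 2, 4, 5] ![2, 0, 3, 1, 4, 5],
    permOf ![1, 4, 0, 2, 3, 5] ![2, 0, 3, 4, 1, 5],
    permOf ![1, 5, 0, 2, 3, 4] ![2, 0, 3, 4, 5, 1],
    permOf ![2, 3, 0, 1, 4, 5] ![2, 3, 0, 1, 4, 5],
    permOf ![2, 4, 0, 1, 3, 5] ![2, 3, 0, 4, 1, 5],
    permOf ![2, 5, 0, 1, 3, 4] ![2, 3, 0, 4, 5, 1],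
    permOf ![3, 4, 0, 1, 2, 5] ![2, 3, 4, 0, 1, 5],
    permOf ![3, 5, 0, 1, 2, 4] ![2, 3, 4, 0, 5, 1],
    permOf ![4, 5, 0, 1, 2, 3] ![2, 3, 4, 5, 0, 1]]

theorem wedgeTwoFour_apply (B : W₁ →ₗ[ℝ] W₂ →ₗ[ℝ] W₃) (α : V [⋀^Fin 2]→L[ℝ] W₁)
    (β : V [⋀^Fin 4]→L[ℝ] W₂) (a b c d e f : V) :
    wedge B α β ![a, b, c, d, e, f] =
      B (α ![a, b]) (β ![c, d, e, f])
      - B (α ![a, c]) (β ![b, d, e, f])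
      + B (α ![a, d]) (β ![b, c, e, f])
      - B (α ![a, e]) (β ![b, c, d, f])
      + B (α ![a, f]) (β ![b, c, d, e])
      + B (α ![b, c]) (β ![a, d, e, f])
      - B (α ![b, d]) (β ![a, c, e, f])
      + B (α ![b, e]) (β ![a, c, d, f])
      - B (α ![b, f]) (β ![a, c, d, e])
      + B (α ![c, d]) (β ![a, b, e, f])
      - B (α ![c, e]) (β ![a, b, d, f])
      + B (α ![c, f]) (β ![a, b, d, e])
      + B (α ![d, e]) (β ![a, b, c, f])
      - B (α ![d, f]) (β ![a, b, c, e])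
      + B (α ![e, f]) (β ![a, b, c, d]) := by
  rw [wedge_eq_sum_reps B α β shuffleTwoFour (by decide) (by decide)]
  have hs : (fun i => (Equiv.Perm.sign (shuffleTwoFour i) : ℤ)) =
      ![1, -1, 1, -1, 1, 1, -1, 1, -1, 1, -1, 1, 1, -1, 1] := by decide
  have hα : ∀ i, (fun j => ![a, b, c, d, e, f] (shuffleTwoFour i (Fin.castAdd 4 j))) =
      ![![a, b], ![a, c], ![a, d], ![a, e], ![a, f], ![b, c], ![b, d], ![b, e], ![b, f], ![c, d],
        ![c, e], ![c, f], ![d, e], ![d, f], ![e, f]] i := by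
    intro i; fin_cases i <;> (ext j; fin_cases j <;> rfl)
  have hβ : ∀ i, (fun j => ![a, b, c, d, e, f] (shuffleTwoFour i (Fin.natAdd 2 j))) =
      ![![c, d, e, f], ![b, d, e, f], ![b, c, e, f], ![b, c, d, f], ![b, c, d, e], ![a, d, e, f],
        ![a, c, e, f], ![a, c, d, f], ![a, c, d, e], ![a, b, e, f], ![a, b, d, f], ![a, b, d, e],
        ![a, b, c, f], ![a, b, c, e], ![a, b, c, d]] i := by
    intro i; fin_cases i <;> (ext j; fin_cases j <;> rfl)
  simp only [hα, hβ, congrFun hs, Fin.sum_univ_succ, Fin.sum_univ_zero, Matrix.cons_val_zero,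
    Matrix.cons_val_succ, one_smul, neg_smul, add_zero]
  abel

/-- Representatives of the `(4, 2)`-shuffles. -/
def shuffleFourTwo : Fin 15 → Equiv.Perm (Fin (4 + 2)) :=
  ![permOf ![0, 1, 2, 3, 4, 5] ![0, 1, 2, 3, 4, 5],
    permOf ![0, 1, 2, 4, 3, 5] ![0, 1, 2, 4, 3, 5],
    permOf ![0, 1, 2, 5, 3, 4] ![0, 1, 2, 4, 5, 3],
    permOf ![0, 1, 3, 4, 2, 5] ![0, 1, 4, 2, 3, 5],
    permOf ![0, 1, 3, 5, 2, 4] ![0, 1, 4, 2, 5, 3],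
    permOf ![0, 1, 4, 5, 2, 3] ![0, 1, 4, 5, 2, 3],
    permOf ![0, 2, 3, 4, 1, 5] ![0, 4, 1, 2, 3, 5],
    permOf ![0, 2, 3, 5, 1, 4] ![0, 4, 1, 2, 5, 3],
    permOf ![0, 2, 4, 5, 1, 3] ![0, 4, 1, 5, 2, 3],
    permOf ![0, 3, 4, 5, 1, 2] ![0, 4, 5, 1, 2, 3],
    permOf ![1, 2, 3, 4, 0, 5] ![4, 0, 1, 2, 3, 5],
    permOf ![1, 2, 3, 5, 0, 4] ![4, 0, 1, 2, 5, 3],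
    permOf ![1, 2, 4, 5, 0, 3] ![4, 0, 1, 5, 2, 3],
    permOf ![1, 3, 4, 5, 0, 2] ![4, 0, 5, 1, 2, 3],
    permOf ![2, 3, 4, 5, 0, 1] ![4, 5, 0, 1, 2, 3]]

theorem wedgeFourTwo_apply (B : W₁ →ₗ[ℝ] W₂ →ₗ[ℝ] W₃) (α : V [⋀^Fin 4]→L[ℝ] W₁)
    (β : V [⋀^Fin 2]→L[ℝ] W₂) (a b c d e f : V) :
    wedge B α β ![a, b, c, d, e, f] =
      B (α ![a, b, c, d]) (β ![e, f])
      - B (α ![a, b, c, e]) (β ![d, f])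
      + B (α ![a, b, c, f]) (β ![d, e])
      + B (α ![a, b, d, e]) (β ![c, f])
      - B (α ![a, b, d, f]) (β ![c, e])
      + B (α ![a, b, e, f]) (β ![c, d])
      - B (α ![a, c, d, e]) (β ![b, f])
      + B (α ![a, c, d, f]) (β ![b, e])
      - B (α ![a, c, e, f]) (β ![b, d])
      + B (α ![a, d, e, f]) (β ![b, c])
      + B (α ![b, c, d, e]) (β ![a, f])
      - B (α ![b, c, d, f]) (β ![a, e])
      + B (α ![b, c, e, f]) (β ![a, d])
      - B (α ![b, d, e, f]) (β ![a, c])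
      + B (α ![c, d, e, f]) (β ![a, b]) := by
  rw [wedge_eq_sum_reps B α β shuffleFourTwo (by decide) (by decide)]
  have hs : (fun i => (Equiv.Perm.sign (shuffleFourTwo i) : ℤ)) =
      ![1, -1, 1, 1, -1, 1, -1, 1, -1, 1, 1, -1, 1, -1, 1] := by decide
  have hα : ∀ i, (fun j => ![a, b, c, d, e, f] (shuffleFourTwo i (Fin.castAdd 2 j))) =
      ![![a, b, c, d], ![a, b, c, e], ![a, b, c, f], ![a, b, d, e], ![a, b, d, f], ![a, b, e, f],
        ![a, c, d, e], ![a, c, d, f], ![a, c, e, f], ![a, d, e, f], ![b, c, d, e], ![b, c, d, f],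
        ![b, c, e, f], ![b, d, e, f], ![c, d, e, f]] i := by
    intro i; fin_cases i <;> (ext j; fin_cases j <;> rfl)
  have hβ : ∀ i, (fun j => ![a, b, c, d, e, f] (shuffleFourTwo i (Fin.natAdd 4 j))) =
      ![![e, f], ![d, f], ![d, e], ![c, f], ![c, e], ![c, d], ![b, f], ![b, e], ![b, d], ![b, c],
        ![a, f], ![a, e], ![a, d], ![a, c], ![a, b]] i := by
    intro i; fin_cases i <;> (ext j; fin_cases j <;> rfl)
  simp only [hα, hβ, congrFun hs, Fin.sum_univ_succ, Fin.sum_univ_zero, Matrix.cons_val_zero,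
    Matrix.cons_val_succ, one_smul, neg_smul, add_zero]
  abel

/-- Representatives of the `(3, 3)`-shuffles. -/
def shuffleThreeThree : Fin 20 → Equiv.Perm (Fin (3 + 3)) :=
  ![permOf ![0, 1, 2, 3, 4, 5] ![0, 1, 2, 3, 4, 5],
    permOf ![0, 1, 3, 2, 4, 5] ![0, 1, 3, 2, 4, 5],
    permOf ![0, 1, 4, 2, 3, 5] ![0, 1, 3, 4, 2, 5],
    permOf ![0, 1, 5, 2, 3, 4] ![0, 1, 3, 4, 5, 2],
    permOf ![0, 2, 3, 1, 4, 5] ![0, 3, 1, 2, 4, 5],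
    permOf ![0, 2, 4, 1, 3, 5] ![0, 3, 1, 4, 2, 5],
    permOf ![0, 2, 5, 1, 3, 4] ![0, 3, 1, 4, 5, 2],
    permOf ![0, 3, 4, 1, 2, 5] ![0, 3, 4, 1, 2, 5],
    permOf ![0, 3, 5, 1, 2, 4] ![0, 3, 4, 1, 5, 2],
    permOf ![0, 4, 5, 1, 2, 3] ![0, 3, 4, 5, 1, 2],
    permOf ![1, 2, 3, 0, 4, 5] ![3, 0, 1, 2, 4, 5],
    permOf ![1, 2, 4, 0, 3, 5] ![3, 0, 1, 4, 2, 5],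
    permOf ![1, 2, 5, 0, 3, 4] ![3, 0, 1, 4, 5, 2],
    permOf ![1, 3, 4, 0, 2, 5] ![3, 0, 4, 1, 2, 5],
    permOf ![1, 3, 5, 0, 2, 4] ![3, 0, 4, 1, 5, 2],
    permOf ![1, 4, 5, 0, 2, 3] ![3, 0, 4, 5, 1, 2],
    permOf ![2, 3, 4, 0, 1, 5] ![3, 4, 0, 1, 2, 5],
    permOf ![2, 3, 5, 0, 1, 4] ![3, 4, 0, 1, 5, 2],
    permOf ![2, 4, 5, 0, 1, 3] ![3, 4, 0, 5, 1, 2],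
    permOf ![3, 4, 5, 0, 1, 2] ![3, 4, 5, 0, 1, 2]]

theorem wedgeThreeThree_apply (B : W₁ →ₗ[ℝ] W₂ →ₗ[ℝ] W₃) (α : V [⋀^Fin 3]→L[ℝ] W₁)
    (β : V [⋀^Fin 3]→L[ℝ] W₂) (a b c d e f : V) :
    wedge B α β ![a, b, c, d, e, f] =
      B (α ![a, b, c]) (β ![d, e, f])
      - B (α ![a, b, d]) (β ![c, e, f])
      + B (α ![a, b, e]) (β ![c, d, f])
      - B (α ![a, b, f]) (β ![c, d, e])
      + B (α ![a, c, d]) (β ![b, e, f])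
      - B (α ![a, c, e]) (β ![b, d, f])
      + B (α ![a, c, f]) (β ![b, d, e])
      + B (α ![a, d, e]) (β ![b, c, f])
      - B (α ![a, d, f]) (β ![b, c, e])
      + B (α ![a, e, f]) (β ![b, c, d])
      - B (α ![b, c, d]) (β ![a, e, f])
      + B (α ![b, c, e]) (β ![a, d, f])
      - B (α ![b, c, f]) (β ![a, d, e])
      - B (α ![b, d, e]) (β ![a, c, f])
      + B (α ![b, d, f]) (β ![a, c, e])
      - B (α ![b, e, f]) (β ![a, c, d])
      + B (α ![c, d, e]) (β ![a, b, f])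
      - B (α ![c, d, f]) (β ![a, b, e])
      + B (α ![c, e, f]) (β ![a, b, d])
      - B (α ![d, e, f]) (β ![a, b, c]) := by
  rw [wedge_eq_sum_reps B α β shuffleThreeThree (by decide) (by decide)]
  have hs : (fun i => (Equiv.Perm.sign (shuffleThreeThree i) : ℤ)) =
      ![1, -1, 1, -1, 1, -1, 1, 1, -1, 1, -1, 1, -1, -1, 1, -1, 1, -1, 1, -1] := by decide
  have hα : ∀ i, (fun j => ![a, b, c, d, e, f] (shuffleThreeThree i (Fin.castAdd 3 j))) =
      ![![a, b, c], ![a, b, d], ![a, b, e], ![a, b, f], ![a, c, d], ![a, c, e], ![a, c, f],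
        ![a, d, e], ![a, d, f], ![a, e, f], ![b, c, d], ![b, c, e], ![b, c, f], ![b, d, e], ![b, d, f],
        ![b, e, f], ![c, d, e], ![c, d, f], ![c, e, f], ![d, e, f]] i := by
    intro i; fin_cases i <;> (ext j; fin_cases j <;> rfl)
  have hβ : ∀ i, (fun j => ![a, b, c, d, e, f] (shuffleThreeThree i (Fin.natAdd 3 j))) =
      ![![d, e, f], ![c, e, f], ![c, d, f], ![c, d, e], ![b, e, f], ![b, d, f], ![b, d, e],
        ![b, c, f], ![b, c, e], ![b, c, d], ![a, e, f], ![a, d, f], ![a, d, e], ![a, c, f], ![a, c, e],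
        ![a, c, d], ![a, b, f], ![a, b, e], ![a, b, d], ![a, b, c]] i := by
    intro i; fin_cases i <;> (ext j; fin_cases j <;> rfl)
  simp only [hα, hβ, congrFun hs, Fin.sum_univ_succ, Fin.sum_univ_zero, Matrix.cons_val_zero,
    Matrix.cons_val_succ, one_smul, neg_smul, add_zero]
  abel

/-! ### The Hodge star in an orthonormal basis -/

theorem hodge_apply (g : V →L[ℝ] V →L[ℝ] ℝ) (b : Module.Basis (Fin n) ℝ V)
    (vol : V [⋀^Fin (k + m)]→L[ℝ] ℝ) (α : V [⋀^Fin k]→L[ℝ] W) (v : Fin m → V) :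
    hodge g b vol α v = (k.factorial : ℝ)⁻¹ • ∑ i : Fin k → Fin n,
      vol (Fin.append (fun a => dualFrame g b (i a)) v) • α fun a => b (i a) := by
  rw [hodge, ContinuousAlternatingMap.smul_apply, ContinuousAlternatingMap.sum_apply]
  rfl

/-- `o` is orthonormal for `g`. -/
def OrthonormalFor (g : V →L[ℝ] V →L[ℝ] ℝ) (o : Module.Basis (Fin n) ℝ V) : Prop :=
  ∀ i j, g (o i) (o j) = if i = j then 1 else 0

theorem OrthonormalFor.repr_eq {g : V →L[ℝ] V →L[ℝ] ℝ} {o : Module.Basis (Fin n) ℝ V}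
    (ho : OrthonormalFor g o) (v : V) (j : Fin n) : o.repr v j = g v (o j) := by
  conv_rhs => rw [← o.sum_repr v]
  rw [map_sum, sum_apply]
  simp [ho _ _]

theorem OrthonormalFor.dualFrame_eq {g : V →L[ℝ] V →L[ℝ] ℝ} {o : Module.Basis (Fin n) ℝ V}
    (ho : OrthonormalFor g o) (i : Fin n) : dualFrame g o i = o i := by
  have h : (Matrix.of fun i j => g (o i) (o j)) = 1 := by
    ext i j; simp [ho _ _, Matrix.one_apply]
  simp [dualFrame, h, Matrix.one_apply]

open scoped Matrix in
/-- The Gram matrix of a basis, in terms of an orthonormal basis. -/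
theorem OrthonormalFor.gram_eq {g : V →L[ℝ] V →L[ℝ] ℝ} {o : Module.Basis (Fin n) ℝ V}
    (ho : OrthonormalFor g o) (b : Module.Basis (Fin n) ℝ V) :
    (Matrix.of fun i j => g (b i) (b j)) = (o.toMatrix b)ᵀ * o.toMatrix b := by
  ext i j
  have h : b j = ∑ l, o.repr (b j) l • o l := (o.sum_repr _).symm
  rw [Matrix.of_apply]
  conv_lhs => rw [h]
  simp [Matrix.mul_apply, Module.Basis.toMatrix_apply, ho.repr_eq, mul_comm]

-- With P the matrix of `b` in the orthonormal basis, the Gram matrix is PᵀP, and the assertion is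
-- P((PᵀP)⁻¹)ᵀPᵀ = 1. This completeness relation makes the Hodge star independent of the basis.
open scoped Matrix in
theorem OrthonormalFor.dualFrame_coeff {g : V →L[ℝ] V →L[ℝ] ℝ} {o : Module.Basis (Fin n) ℝ V}
    (ho : OrthonormalFor g o) (b : Module.Basis (Fin n) ℝ V) (j : Fin n) :
    ∑ i, g (dualFrame g b i) (o j) • b i = o j := by
  classical
  let P := o.toMatrix b
  have hP : IsUnit P.det := by
    have := o.invertibleToMatrix b
    exact (Matrix.isUnit_iff_isUnit_det P).mp (isUnit_of_invertible P)
  have hPt : IsUnit Pᵀ.det := by rwa [Matrix.det_transpose]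
  have hc : ∀ i, g (dualFrame g b i) (o j) = (P * ((Pᵀ * P)⁻¹)ᵀ) j i := by
    intro i
    rw [dualFrame, ho.gram_eq b]
    simp [Matrix.mul_apply, P, Module.Basis.toMatrix_apply, ho.repr_eq, mul_comm]
  have hid : P * ((Pᵀ * P)⁻¹)ᵀ * Pᵀ = 1 := by
    rw [Matrix.transpose_nonsing_inv, Matrix.transpose_mul, Matrix.transpose_transpose,
      Matrix.mul_inv_rev, ← Matrix.mul_assoc, Matrix.mul_nonsing_inv _ hP, Matrix.one_mul,
      Matrix.nonsing_inv_mul _ hPt]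
  refine o.repr.injective ?_
  ext l
  have h2 := congrFun (congrFun hid j) l
  rw [Matrix.mul_apply] at h2
  simp only [hc, map_sum, map_smul, Finsupp.coe_finsetSum, Finset.sum_apply, Finsupp.smul_apply,
    smul_eq_mul, Module.Basis.repr_self]
  rw [Finsupp.single_apply]
  rw [Matrix.one_apply] at h2
  exact h2

theorem append_update_left (w : Fin k → V) (v : Fin m → V) (i : Fin k) (z : V) :
    Fin.append (Function.update w i z) v
      = Function.update (Fin.append w v) (Fin.castAdd m i) z := by
  funext j
  refine Fin.addCases (fun a => ?_) (fun a => ?_) j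
  · rw [Fin.append_left]
    by_cases hai : a = i
    · subst hai; simp
    · rw [Function.update_of_ne hai, Function.update_of_ne, Fin.append_left]
      simpa [Fin.ext_iff] using hai
  · rw [Fin.append_right, Function.update_of_ne, Fin.append_right]
    simp only [ne_eq, Fin.ext_iff, Fin.val_castAdd, Fin.val_natAdd]
    omega

/-- Expanding the dual vectors in `o` by multilinearity moves the coefficients to the arguments of
`α`, where `dualFrame_coeff` recombines them into the vectors of `o`. The definition of `star` uses
the standard basis of the model space; this lemma replaces it by an adapted frame. -/
theorem hodge_eq_of_orthonormal {g : V →L[ℝ] V →L[ℝ] ℝ} {o : Module.Basis (Fin n) ℝ V}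
    (ho : OrthonormalFor g o) (b : Module.Basis (Fin n) ℝ V)
    (vol : V [⋀^Fin (k + m)]→L[ℝ] ℝ) (α : V [⋀^Fin k]→L[ℝ] W) :
    hodge g b vol α = hodge g o vol α := by
  ext v
  rw [hodge_apply, hodge_apply]
  congr 1
  -- The volume form as a multilinear form of its first k arguments, the others being fixed.
  let h : V [⋀^Fin k]→ₗ[ℝ] ℝ :=
    { toFun := fun w => vol (Fin.append w v)
      map_update_add' := by
        intro inst w i x y
        obtain rfl : inst = instDecidableEqFin k := Subsingleton.elim _ _
        have hu : ∀ z, Fin.append (Function.update w i z) v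
            = Function.update (Fin.append w v) (Fin.castAdd m i) z := by
          intro z
          rw [append_update_left]
        simp only [hu]
        exact vol.map_update_add _ _ _ _
      map_update_smul' := by
        intro inst w i c x
        obtain rfl : inst = instDecidableEqFin k := Subsingleton.elim _ _
        have hu : ∀ z, Fin.append (Function.update w i z) v
            = Function.update (Fin.append w v) (Fin.castAdd m i) z := by
          intro z
          rw [append_update_left]
        simp only [hu]
        exact vol.map_update_smul _ _ _ _
      map_eq_zero_of_eq' := by
        intro w i j hw hij
        refine vol.map_eq_zero_of_eq (i := Fin.castAdd m i) (j := Fin.castAdd m j) _ ?_ ?_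
        · rw [Fin.append_left, Fin.append_left, hw]
        · simpa [Fin.ext_iff] using hij }
  have hexp : ∀ i : Fin k → Fin n, vol (Fin.append (fun a => dualFrame g b (i a)) v)
      = ∑ j : Fin k → Fin n, (∏ a, g (dualFrame g b (i a)) (o (j a))) • h fun a => o (j a) := by
    intro i
    have h1 : (fun a => dualFrame g b (i a))
        = fun a => ∑ j, g (dualFrame g b (i a)) (o j) • o j := by
      funext a
      conv_lhs => rw [← o.sum_repr (dualFrame g b (i a))]
      exact Finset.sum_congr rfl fun j _ => by rw [ho.repr_eq]
    change h (fun a => dualFrame g b (i a)) = _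
    conv_lhs => rw [h1]
    change h.toMultilinearMap _ = _
    rw [MultilinearMap.map_sum]
    exact Finset.sum_congr rfl fun r _ => h.toMultilinearMap.map_smul_univ _ _
  simp only [hexp, Finset.sum_smul, ho.dualFrame_eq]
  rw [Finset.sum_comm]
  refine Finset.sum_congr rfl fun j _ => ?_
  have h2 : (fun a => o (j a)) = fun a => ∑ i, g (dualFrame g b i) (o (j a)) • b i := by
    funext a
    rw [ho.dualFrame_coeff b]
  have h3 : α (fun a => o (j a)) = ∑ i : Fin k → Fin n,
      (∏ a, g (dualFrame g b (i a)) (o (j a))) • α fun a => b (i a) := by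
    rw [h2]
    change α.toMultilinearMap _ = _
    rw [MultilinearMap.map_sum]
    exact Finset.sum_congr rfl fun r _ => α.toMultilinearMap.map_smul_univ _ _
  change _ = h (fun a => o (j a)) • _
  rw [h3, Finset.smul_sum]
  refine Finset.sum_congr rfl fun i _ => ?_
  rw [smul_smul, smul_eq_mul, mul_comm]

/-- The Hodge star on an orthonormal basis. -/
theorem hodge_orthonormal_apply {g : V →L[ℝ] V →L[ℝ] ℝ} {o : Module.Basis (Fin (k + m)) ℝ V}
    (ho : OrthonormalFor g o) (vol : V [⋀^Fin (k + m)]→L[ℝ] ℝ) (hvol : vol o = 1)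
    (α : V [⋀^Fin k]→L[ℝ] W) (τ : Equiv.Perm (Fin (k + m))) :
    hodge g o vol α (fun a => o (τ (Fin.natAdd k a))) =
      (Equiv.Perm.sign τ : ℤ) • α fun a => o (τ (Fin.castAdd m a)) := by
  classical
  rw [hodge_apply]
  simp only [ho.dualFrame_eq]
  -- Only the k! index tuples that permute the first k values of τ contribute: any other tuple
  -- either repeats an index or meets the remaining values of τ, and the volume form vanishes on it.
  -- The sign of ρ occurs twice in each surviving term, so these terms are all equal and cancel the
  -- factor 1/k!.
  let c : Equiv.Perm (Fin k) → Fin k → Fin (k + m) := fun ρ a => τ (Fin.castAdd m (ρ a))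
  have hc : Function.Injective c := by
    intro ρ ρ' h
    ext a
    have := congrFun h a
    simpa [c, Fin.ext_iff] using this
  have happ : ∀ i : Fin k → Fin (k + m),
      Fin.append (fun a => o (i a)) (fun a => o (τ (Fin.natAdd k a)))
        = o ∘ Fin.append i (fun a => τ (Fin.natAdd k a)) := by
    intro i
    funext j
    refine Fin.addCases (fun a => ?_) (fun a => ?_) j <;> simp
  have hzero : ∀ i : Fin k → Fin (k + m), i ∉ Finset.univ.image c →
      vol (Fin.append (fun a => o (i a)) (fun a => o (τ (Fin.natAdd k a)))) = 0 := by
    intro i hi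
    by_contra hne
    have hinj : Function.Injective (Fin.append i (fun a => τ (Fin.natAdd k a))) := by
      intro x y hxy
      by_contra hxy'
      refine hne (vol.map_eq_zero_of_eq _ ?_ hxy')
      rw [happ, Function.comp_apply, Function.comp_apply, hxy]
    refine hi (Finset.mem_image.mpr ?_)
    have hex : ∀ a, ∃ b : Fin k, τ (Fin.castAdd m b) = i a := by
      intro a
      obtain ⟨x, hx⟩ := τ.surjective (i a)
      induction x using Fin.addCases with
      | left b => exact ⟨b, hx⟩
      | right b =>
        have h1 : Fin.append i (fun a => τ (Fin.natAdd k a)) (Fin.castAdd m a)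
            = Fin.append i (fun a => τ (Fin.natAdd k a)) (Fin.natAdd k b) := by
          rw [Fin.append_left, Fin.append_right, hx]
        have := hinj h1
        simp only [Fin.ext_iff, Fin.val_castAdd, Fin.val_natAdd] at this
        omega
    choose ρ hρ using hex
    have hρi : Function.Injective ρ := by
      intro a b hab
      have h1 : i a = i b := by rw [← hρ, ← hρ, hab]
      have h2 : Fin.append i (fun a => τ (Fin.natAdd k a)) (Fin.castAdd m a)
          = Fin.append i (fun a => τ (Fin.natAdd k a)) (Fin.castAdd m b) := by
        rw [Fin.append_left, Fin.append_left, h1]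
      simpa using hinj h2
    exact ⟨Equiv.ofBijective ρ (Finite.injective_iff_bijective.mp hρi), Finset.mem_univ _,
      funext hρ⟩
  rw [← Finset.sum_subset (Finset.subset_univ (Finset.univ.image c))
    (fun i _ hi => by rw [hzero i hi, zero_smul]), Finset.sum_image hc.injOn]
  have hterm : ∀ ρ : Equiv.Perm (Fin k),
      vol (Fin.append (fun a => o (c ρ a)) (fun a => o (τ (Fin.natAdd k a)))) •
        α (fun a => o (c ρ a)) =
      (Equiv.Perm.sign τ : ℤ) • α fun a => o (τ (Fin.castAdd m a)) := by
    intro ρ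
    let σ : Equiv.Perm (Fin (k + m)) :=
      finSumFinEquiv.permCongr (Equiv.Perm.sumCongr ρ (Equiv.refl _))
    have hσ : Fin.append (c ρ) (fun a => τ (Fin.natAdd k a)) = ⇑(τ * σ) := by
      funext j
      refine Fin.addCases (fun a => ?_) (fun a => ?_) j <;> simp [c, σ, Equiv.permCongr_def]
    have hs : Equiv.Perm.sign σ = Equiv.Perm.sign ρ := by
      simp [σ]
    have h1 : vol (o ∘ ⇑(τ * σ)) = (Equiv.Perm.sign (τ * σ)) • vol o :=
      vol.toAlternatingMap.map_perm _ _
    have h2 : α (fun a => o (c ρ a)) =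
        (Equiv.Perm.sign ρ) • α fun a => o (τ (Fin.castAdd m a)) :=
      α.toAlternatingMap.map_perm (fun a => o (τ (Fin.castAdd m a))) ρ
    rw [happ, hσ, h1, hvol, h2, map_mul, hs]
    rcases Int.units_eq_one_or (Equiv.Perm.sign ρ) with h | h <;>
      rcases Int.units_eq_one_or (Equiv.Perm.sign τ) with h' | h' <;> simp [h, h']
  rw [Finset.sum_congr rfl fun ρ _ => hterm ρ, Finset.sum_const, Finset.card_univ,
    Fintype.card_perm, Fintype.card_fin, ← Nat.cast_smul_eq_nsmul ℝ, smul_smul,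
    inv_mul_cancel₀ (by positivity), one_smul]

/-- Two alternating `n`-forms on a space of dimension `n + 1` are equal if they agree on the
`n`-tuples that arise from a basis by omitting one vector. -/
theorem alternating_ext_succAbove (o : Module.Basis (Fin (n + 1)) ℝ V)
    {α β : V [⋀^Fin n]→L[ℝ] W}
    (h : ∀ i : Fin (n + 1), α (fun a => o (i.succAbove a)) = β fun a => o (i.succAbove a)) :
    α = β := by
  have key : α.toAlternatingMap = β.toAlternatingMap := by
    refine Module.Basis.ext_alternating o fun v hv => ?_
    -- An injective tuple of n out of n + 1 indices misses exactly one, hence is a permutation of a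
    -- face.
    have hns : ¬ Function.Surjective v := by
      intro hs
      have := Fintype.card_le_of_surjective v hs
      simp at this
    obtain ⟨i, hi⟩ := not_forall.mp hns
    have hex : ∀ a, ∃ b, i.succAbove b = v a := fun a =>
      Fin.exists_succAbove_eq fun h' => hi ⟨a, h'⟩
    choose ρ hρ using hex
    have hρi : Function.Injective ρ := by
      intro a b hab
      exact hv (by rw [← hρ, ← hρ, hab])
    let σ := Equiv.ofBijective ρ (Finite.injective_iff_bijective.mp hρi)
    have hv' : (fun a => o (v a)) = (fun a => o (i.succAbove a)) ∘ σ := by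
      funext a; simp [σ, hρ]
    rw [hv', AlternatingMap.map_perm, AlternatingMap.map_perm]
    congr 1
    exact h i
  ext v
  exact congrArg (fun f : V [⋀^Fin n]→ₗ[ℝ] W => f v) key

theorem map_update_neg_apply (α : V [⋀^Fin k]→L[ℝ] W) (v : Fin k → V) (i : Fin k) (x : V) :
    α (Function.update v i (-x)) = -α (Function.update v i x) :=
  α.toAlternatingMap.map_update_neg v i x

/-! ### Components of type (0,2), (1,3) and (0,3) -/

theorem pqPart_apply (J : V →L[ℝ] V) (p q : ℕ) (α : V [⋀^Fin (p + q)]→L[ℝ] (Y × Y))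
    (v : Fin (p + q) → V) :
    pqPart J p q α v =
      ∑ S ∈ Finset.powersetCard p Finset.univ, ∑ T : Finset (Fin (p + q)),
        cmul ((1 / 2) ^ (p + q) * (-Complex.I) ^ (T ∩ S).card * Complex.I ^ (T \ S).card)
          (α fun i => if i ∈ T then J (v i) else v i) :=
  pqMultilinear_apply J p q α v

theorem sum_finset_fin_two {M : Type*} [AddCommMonoid M] (f : Finset (Fin 2) → M) :
    ∑ T, f T = f ∅ + f {0} + f {1} + f {0, 1} := by
  rw [show (Finset.univ : Finset (Finset (Fin 2))) = {∅, {0}, {1}, {0, 1}} by decide]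
  rw [Finset.sum_insert (by decide), Finset.sum_insert (by decide), Finset.sum_insert (by decide),
    Finset.sum_singleton]
  abel

theorem pqPart_zero_two_apply (J : V →L[ℝ] V) (α : V [⋀^Fin (0 + 2)]→L[ℝ] (Y × Y)) (a b : V) :
    pqPart J 0 2 α ![a, b] = (1 / 4 : ℝ) • (α ![a, b] + cmul Complex.I (α ![J a, b]) +
      cmul Complex.I (α ![a, J b]) - α ![J a, J b]) := by
  have h : ∀ (T : Finset (Fin 2)), (fun i => if i ∈ T then J (![a, b] i) else ![a, b] i) =
      ![if 0 ∈ T then J a else a, if 1 ∈ T then J b else b] := by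
    intro T; ext i; fin_cases i <;> rfl
  rw [pqPart_apply, Finset.powersetCard_zero, Finset.sum_singleton, sum_finset_fin_two]
  simp only [h]
  ext <;> simp [cmul, pow_succ] <;> module

theorem cmul_apply (z : ℂ) (y : Y × Y) :
    cmul z y = (z.re • y.1 - z.im • y.2, z.re • y.2 + z.im • y.1) := rfl

theorem cmul_add_left (z w : ℂ) (y : Y × Y) : cmul (z + w) y = cmul z y + cmul w y := by
  simp only [cmul_apply, Complex.add_re, Complex.add_im, Prod.mk_add_mk, Prod.mk.injEq]
  constructor <;> module

theorem cmul_sum_left {ι : Type*} (s : Finset ι) (z : ι → ℂ) (y : Y × Y) :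
    cmul (∑ i ∈ s, z i) y = ∑ i ∈ s, cmul (z i) y := by
  classical
  induction s using Finset.induction_on with
  | empty => ext <;> simp [cmul_apply]
  | insert a s ha ih => rw [Finset.sum_insert ha, Finset.sum_insert ha, cmul_add_left, ih]

theorem sum_finset_fin_four {M : Type*} [AddCommMonoid M] (f : Finset (Fin 4) → M) :
    ∑ T, f T = f ∅ + f {0} + f {1} + f {2} + f {3} + f {0, 1} + f {0, 2} + f {0, 3} +
      f {1, 2} + f {1, 3} + f {2, 3} + f {0, 1, 2} + f {0, 1, 3} + f {0, 2, 3} + f {1, 2, 3} +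
      f {0, 1, 2, 3} := by
  rw [show (Finset.univ : Finset (Finset (Fin 4))) =
    {∅, {0}, {1}, {2}, {3}, {0, 1}, {0, 2}, {0, 3}, {1, 2}, {1, 3}, {2, 3}, {0, 1, 2}, {0, 1, 3},
      {0, 2, 3}, {1, 2, 3}, {0, 1, 2, 3}} by decide]
  iterate 15 rw [Finset.sum_insert (by decide)]
  rw [Finset.sum_singleton]
  abel

/-- For S = {i} the factor is I^|T| if i is not in T. If i lies in T, one factor I becomes -I and
the sign changes. So 4 - |T| of the four terms have a plus sign and |T| of them a minus sign. -/
theorem one_three_coeff (T : Finset (Fin 4)) :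
    ∑ S ∈ Finset.powersetCard 1 (Finset.univ : Finset (Fin 4)),
      ((1 / 2 : ℂ) ^ 4 * (-Complex.I) ^ (T ∩ S).card * Complex.I ^ (T \ S).card) =
    (1 / 16) * (4 - 2 * T.card) * Complex.I ^ T.card := by
  rw [Finset.powersetCard_one, Finset.sum_map]
  have h : ∀ i : Fin 4, ((1 / 2 : ℂ) ^ 4 * (-Complex.I) ^ (T ∩ {i}).card *
      Complex.I ^ (T \ {i}).card) =
      (1 / 16) * Complex.I ^ T.card * (1 - 2 * if i ∈ T then 1 else 0) := by
    intro i
    by_cases hi : i ∈ T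
    · obtain ⟨n, hn⟩ : ∃ n, T.card = n + 1 :=
        Nat.exists_eq_succ_of_ne_zero (Finset.card_ne_zero_of_mem hi)
      rw [Finset.inter_singleton_of_mem hi, Finset.card_singleton,
        Finset.card_sdiff_of_subset (Finset.singleton_subset_iff.mpr hi), Finset.card_singleton, hn]
      simp only [hi, if_true, Nat.add_sub_cancel, pow_succ]
      ring
    · rw [Finset.inter_singleton_of_notMem hi, Finset.sdiff_singleton_eq_erase,
        Finset.erase_eq_of_notMem hi]
      simp only [hi, if_false, Finset.card_empty, pow_zero]
      ring
  simp only [Function.Embedding.coeFn_mk, h]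
  rw [← Finset.mul_sum, Finset.sum_sub_distrib, ← Finset.mul_sum, Finset.sum_ite_mem]
  simp
  ring

/-- Quadruples ending in (c, Jc) suffice, because the complement of (o 0, o 2) in an adapted frame
is (J(o 0), J(o 2), o 4, J(o 4)). Applying J to exactly one of the last two slots produces a
repeated vector, and applying it to both changes nothing, so only four terms remain. -/
theorem pqPart_one_three_apply (J : V →L[ℝ] V) (hJ : ∀ v, J (J v) = -v)
    (α : V [⋀^Fin (1 + 3)]→L[ℝ] (Y × Y)) (a b c : V) :
    pqPart J 1 3 α ![a, b, c, J c] = (1 / 4 : ℝ) • (α ![a, b, c, J c] +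
      cmul Complex.I (α ![J a, b, c, J c]) + cmul Complex.I (α ![a, J b, c, J c]) -
      α ![J a, J b, c, J c]) := by
  have h : ∀ (T : Finset (Fin 4)), (fun i => if i ∈ T then J (![a, b, c, J c] i)
      else ![a, b, c, J c] i) = ![if 0 ∈ T then J a else a, if 1 ∈ T then J b else b,
        if 2 ∈ T then J c else c, if 3 ∈ T then -c else J c] := by
    intro T
    ext i
    fin_cases i
    · rfl
    · rfl
    · rfl
    · change (if 3 ∈ T then J (J c) else J c) = _
      rw [hJ]
      rfl
  have hneg : ∀ x y z w : V, α ![x, y, z, -w] = -α ![x, y, z, w] := by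
    intro x y z w
    have e : ∀ t, ![x, y, z, t] = Function.update ![x, y, z, w] 3 t := by
      intro t; ext i; fin_cases i <;> rfl
    rw [e, map_update_neg_apply, ← e]
  have hzero : ∀ x y z : V, α ![x, y, z, z] = 0 := fun x y z =>
    α.map_eq_zero_of_eq _ (i := 2) (j := 3) rfl (by decide)
  have hswap : ∀ x y z w : V, α ![x, y, z, w] = -α ![x, y, w, z] := by
    intro x y z w
    have := α.toAlternatingMap.map_swap ![x, y, w, z] (i := 2) (j := 3) (by decide)
    refine Eq.trans ?_ this
    change α _ = α _
    congr 1
    ext i; fin_cases i <;> rfl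
  rw [pqPart_apply, Finset.sum_comm]
  simp only [← cmul_sum_left]
  refine (Finset.sum_congr rfl fun T _ => by rw [one_three_coeff T, h T]).trans ?_
  rw [sum_finset_fin_four]
  simp [hneg, hzero, hswap _ _ (J c) c]
  ext <;> simp [cmul] <;> module

theorem sum_finset_fin_three {M : Type*} [AddCommMonoid M] (f : Finset (Fin 3) → M) :
    ∑ T, f T = f ∅ + f {0} + f {1} + f {2} + f {0, 1} + f {0, 2} + f {1, 2} + f {0, 1, 2} := by
  rw [show (Finset.univ : Finset (Finset (Fin 3))) =
    {∅, {0}, {1}, {2}, {0, 1}, {0, 2}, {1, 2}, {0, 1, 2}} by decide]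
  iterate 7 rw [Finset.sum_insert (by decide)]
  rw [Finset.sum_singleton]
  abel

theorem pqPart_zero_three_apply (J : V →L[ℝ] V) (α : V [⋀^Fin (0 + 3)]→L[ℝ] (Y × Y))
    (a b c : V) :
    pqPart J 0 3 α ![a, b, c] = (1 / 8 : ℝ) • (α ![a, b, c] + cmul Complex.I (α ![J a, b, c]) +
      cmul Complex.I (α ![a, J b, c]) + cmul Complex.I (α ![a, b, J c]) - α ![J a, J b, c]
      - α ![J a, b, J c] - α ![a, J b, J c] - cmul Complex.I (α ![J a, J b, J c])) := by
  have h : ∀ (T : Finset (Fin 3)), (fun i => if i ∈ T then J (![a, b, c] i) else ![a, b, c] i) =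
      ![if 0 ∈ T then J a else a, if 1 ∈ T then J b else b, if 2 ∈ T then J c else c] := by
    intro T; ext i; fin_cases i <;> rfl
  rw [pqPart_apply, Finset.powersetCard_zero, Finset.sum_singleton, sum_finset_fin_three]
  simp only [h]
  ext <;> simp [cmul, pow_succ] <;> module

theorem map_vec3_neg (α : V [⋀^Fin 3]→L[ℝ] W) (a b c : V) :
    α ![-a, b, c] = -α ![a, b, c] ∧ α ![a, -b, c] = -α ![a, b, c] ∧
      α ![a, b, -c] = -α ![a, b, c] := by
  have e0 : ∀ t, ![t, b, c] = Function.update ![a, b, c] 0 t := by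
    intro t; ext i; fin_cases i <;> rfl
  have e1 : ∀ t, ![a, t, c] = Function.update ![a, b, c] 1 t := by
    intro t; ext i; fin_cases i <;> rfl
  have e2 : ∀ t, ![a, b, t] = Function.update ![a, b, c] 2 t := by
    intro t; ext i; fin_cases i <;> rfl
  refine ⟨?_, ?_, ?_⟩
  · rw [e0, map_update_neg_apply, ← e0]
  · rw [e1, map_update_neg_apply, ← e1]
  · rw [e2, map_update_neg_apply, ← e2]

theorem map_vec3_swap (α : V [⋀^Fin 3]→L[ℝ] W) (a b c : V) :
    α ![b, a, c] = -α ![a, b, c] ∧ α ![a, c, b] = -α ![a, b, c] ∧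
      α ![c, b, a] = -α ![a, b, c] := by
  refine ⟨?_, ?_, ?_⟩
  · refine Eq.trans ?_ (α.toAlternatingMap.map_swap ![a, b, c] (i := 0) (j := 1) (by decide))
    change α _ = α _
    congr 1
    ext i; fin_cases i <;> rfl
  · refine Eq.trans ?_ (α.toAlternatingMap.map_swap ![a, b, c] (i := 1) (j := 2) (by decide))
    change α _ = α _
    congr 1
    ext i; fin_cases i <;> rfl
  · refine Eq.trans ?_ (α.toAlternatingMap.map_swap ![a, b, c] (i := 0) (j := 2) (by decide))
    change α _ = α _
    congr 1
    ext i; fin_cases i <;> rfl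

theorem map_vec3_eq_zero (α : V [⋀^Fin 3]→L[ℝ] W) (a b : V) :
    α ![a, a, b] = 0 ∧ α ![a, b, a] = 0 ∧ α ![b, a, a] = 0 :=
  ⟨α.map_eq_zero_of_eq _ (i := 0) (j := 1) rfl (by decide),
    α.map_eq_zero_of_eq _ (i := 0) (j := 2) rfl (by decide),
    α.map_eq_zero_of_eq _ (i := 1) (j := 2) rfl (by decide)⟩

/-- A form of type `(0, 3)` is conjugate linear. -/
theorem map_J_of_pqPart_zero_three (J : V →L[ℝ] V) (hJ : ∀ v, J (J v) = -v)
    {α : V [⋀^Fin (0 + 3)]→L[ℝ] (Y × Y)} (hα : pqPart J 0 3 α = α) (a b c : V) :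
    α ![J a, b, c] = cmul (-Complex.I) (α ![a, b, c]) := by
  conv_lhs => rw [← hα]
  conv_rhs => rw [← hα]
  rw [pqPart_zero_three_apply, pqPart_zero_three_apply]
  have hneg : ∀ x y z : V, α ![-x, y, z] = -α ![x, y, z] := fun x y z => (map_vec3_neg α x y z).1
  simp only [hJ, hneg]
  ext <;> simp [cmul] <;> module

/-- Two alternating `3`-forms on a space of dimension six are equal if they agree on the triples
of a basis that are complementary to the triples of `shuffleThreeThree`. -/
theorem alternating_three_ext (o : Module.Basis (Fin 6) ℝ V) {α β : V [⋀^Fin 3]→L[ℝ] W}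
    (h : ∀ i : Fin 20, α (fun a => o (shuffleThreeThree i (Fin.natAdd 3 a))) =
      β fun a => o (shuffleThreeThree i (Fin.natAdd 3 a))) :
    α = β := by
  have key : α.toAlternatingMap = β.toAlternatingMap := by
    refine Module.Basis.ext_alternating o fun v hv => ?_
    -- After sorting, the triple is strictly increasing, and every such triple occurs in the table
    -- of shuffles.
    let σ := Tuple.sort v
    have hm : StrictMono (v ∘ σ) :=
      (Tuple.monotone_sort v).strictMono_of_injective (hv.comp σ.injective)
    have hdec : ∀ a b c : Fin 6, a < b → b < c → ∃ i : Fin 20,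
        shuffleThreeThree i (Fin.natAdd 3 0) = a ∧ shuffleThreeThree i (Fin.natAdd 3 1) = b ∧
        shuffleThreeThree i (Fin.natAdd 3 2) = c := by decide
    obtain ⟨i, h0, h1, h2⟩ := hdec _ _ _ (hm (show (0 : Fin 3) < 1 by decide))
      (hm (show (1 : Fin 3) < 2 by decide))
    have hi : (fun a => o (shuffleThreeThree i (Fin.natAdd 3 a))) = (fun a => o (v a)) ∘ σ := by
      funext a
      fin_cases a
      · exact congrArg o h0
      · exact congrArg o h1
      · exact congrArg o h2
    have h3 := h i
    rw [hi] at h3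
    have h4 : Equiv.Perm.sign σ • α.toAlternatingMap (fun a => o (v a)) =
        Equiv.Perm.sign σ • β.toAlternatingMap (fun a => o (v a)) := by
      rw [← AlternatingMap.map_perm, ← AlternatingMap.map_perm]
      exact h3
    exact smul_left_cancel _ h4
  ext v
  exact congrArg (fun f : V [⋀^Fin 3]→ₗ[ℝ] W => f v) key

/-- The pointwise data of an `SU(3)`-structure. -/
structure SU3Point (g : V →L[ℝ] V →L[ℝ] ℝ) (J : V →L[ℝ] V) (σ : V [⋀^Fin 2]→L[ℝ] ℝ)
    (Ω₁ Ω₂ : V [⋀^Fin 3]→L[ℝ] ℝ) : Prop where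
  finrank : Module.finrank ℝ V = 6
  symm : ∀ v w, g v w = g w v
  pos : ∀ v, v ≠ 0 → 0 < g v v
  J_sq : ∀ v, J (J v) = -v
  compat : ∀ v w, g (J v) (J w) = g v w
  omega_apply : ∀ v w, σ ![v, w] = g (J v) w
  re_J : ∀ a b c, Ω₁ ![J a, b, c] = -Ω₂ ![a, b, c]
  im_J : ∀ a b c, Ω₂ ![J a, b, c] = Ω₁ ![a, b, c]
  normalized : wedgeR (wedgeR σ σ) σ = (3 / 2 : ℝ) • wedgeR Ω₁ Ω₂

/-- An orthonormal basis adapted to an `SU(3)`-structure. -/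
structure IsSU3Frame (g : V →L[ℝ] V →L[ℝ] ℝ) (J : V →L[ℝ] V) (Ω₁ Ω₂ : V [⋀^Fin 3]→L[ℝ] ℝ)
    (o : Module.Basis (Fin 6) ℝ V) : Prop where
  orthonormal : OrthonormalFor g o
  one : o 1 = J (o 0)
  three : o 3 = J (o 2)
  five : o 5 = J (o 4)
  re : Ω₁ ![o 0, o 2, o 4] = 1
  im : Ω₂ ![o 0, o 2, o 4] = 0

/-! ### Existence of adapted frames -/

namespace SU3Point

variable {g : V →L[ℝ] V →L[ℝ] ℝ} {J : V →L[ℝ] V} {σ : V [⋀^Fin 2]→L[ℝ] ℝ}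
  {Ω₁ Ω₂ : V [⋀^Fin 3]→L[ℝ] ℝ}

theorem re_J₁ (h : SU3Point g J σ Ω₁ Ω₂) (a b c : V) : Ω₁ ![a, J b, c] = -Ω₂ ![a, b, c] := by
  rw [(map_vec3_swap Ω₁ (J b) a c).1, h.re_J, (map_vec3_swap Ω₂ a b c).1, neg_neg]

theorem re_J₂ (h : SU3Point g J σ Ω₁ Ω₂) (a b c : V) : Ω₁ ![a, b, J c] = -Ω₂ ![a, b, c] := by
  rw [(map_vec3_swap Ω₁ (J c) b a).2.2, h.re_J, (map_vec3_swap Ω₂ a b c).2.2, neg_neg]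

theorem im_J₁ (h : SU3Point g J σ Ω₁ Ω₂) (a b c : V) : Ω₂ ![a, J b, c] = Ω₁ ![a, b, c] := by
  rw [(map_vec3_swap Ω₂ (J b) a c).1, h.im_J, (map_vec3_swap Ω₁ a b c).1, neg_neg]

theorem im_J₂ (h : SU3Point g J σ Ω₁ Ω₂) (a b c : V) : Ω₂ ![a, b, J c] = Ω₁ ![a, b, c] := by
  rw [(map_vec3_swap Ω₂ (J c) b a).2.2, h.im_J, (map_vec3_swap Ω₁ a b c).2.2, neg_neg]

theorem inner_J_self (h : SU3Point g J σ Ω₁ Ω₂) (v : V) : g (J v) v = 0 := by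
  have h1 := h.compat (J v) v
  rw [h.J_sq, map_neg, neg_apply, h.symm v (J v)] at h1
  linarith

theorem inner_J_right (h : SU3Point g J σ Ω₁ Ω₂) (v w : V) : g v (J w) = -g (J v) w := by
  have h1 := h.compat v (J w)
  rw [h.J_sq, map_neg] at h1
  linarith

/-- Fewer than six linear conditions on a space of dimension six have a nonzero common solution,
which is then normalised. This is the induction step of the Hermitian Gram–Schmidt process in
`exists_unitary`. -/
theorem exists_unit_perp (h : SU3Point g J σ Ω₁ Ω₂) {m : ℕ} (s : Fin m → V) (hm : m < 6) :
    ∃ v, g v v = 1 ∧ ∀ i, g (s i) v = 0 := by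
  let f : V →ₗ[ℝ] (Fin m → ℝ) := LinearMap.pi fun i => (g (s i)).toLinearMap
  have hk : f.ker ≠ ⊥ := LinearMap.ker_ne_bot_of_finrank_lt (by simpa [h.finrank] using hm)
  obtain ⟨w, hw, hw0⟩ := (Submodule.ne_bot_iff _).mp hk
  have hp := h.pos w hw0
  refine ⟨(Real.sqrt (g w w))⁻¹ • w, ?_, fun i => ?_⟩
  · simp only [map_smul, smul_apply, smul_eq_mul]
    have := Real.mul_self_sqrt hp.le
    have h0 : Real.sqrt (g w w) ≠ 0 := (Real.sqrt_pos.mpr hp).ne'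
    field_simp
    nlinarith
  · have : g (s i) w = 0 := congrFun (LinearMap.mem_ker.mp hw) i
    simp [this]

/-- Three vectors that are orthonormal for the Hermitian inner product. -/
structure IsUnitary (g : V →L[ℝ] V →L[ℝ] ℝ) (J : V →L[ℝ] V) (a b c : V) : Prop where
  aa : g a a = 1
  bb : g b b = 1
  cc : g c c = 1
  ab : g a b = 0
  Jab : g (J a) b = 0
  ac : g a c = 0
  Jac : g (J a) c = 0
  bc : g b c = 0
  Jbc : g (J b) c = 0

theorem exists_unitary (h : SU3Point g J σ Ω₁ Ω₂) : ∃ a b c, IsUnitary g J a b c := by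
  obtain ⟨a, ha, -⟩ := h.exists_unit_perp ![] (by norm_num)
  obtain ⟨b, hb, hb'⟩ := h.exists_unit_perp ![a, J a] (by norm_num)
  obtain ⟨c, hc, hc'⟩ := h.exists_unit_perp ![a, J a, b, J b] (by norm_num)
  exact ⟨a, b, c, ha, hb, hc, hb' 0, hb' 1, hc' 0, hc' 1, hc' 2, hc' 3⟩

theorem IsUnitary.exists_basis (h : SU3Point g J σ Ω₁ Ω₂) {a b c : V}
    (hu : IsUnitary g J a b c) : ∃ o : Module.Basis (Fin 6) ℝ V,
      (∀ i, o i = ![a, J a, b, J b, c, J c] i) ∧ OrthonormalFor g o := by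
  have ho : ∀ i j : Fin 6, g (![a, J a, b, J b, c, J c] i) (![a, J a, b, J b, c, J c] j) =
      if i = j then 1 else 0 := by
    have hs := h.symm
    intro i j
    fin_cases i <;> fin_cases j <;>
      simp [h.compat, hu.aa, hu.bb, hu.cc, hu.ab, hu.Jab, hu.ac, hu.Jac, hu.bc, hu.Jbc,
        h.inner_J_right, h.inner_J_self, hs b a, hs c a, hs c b,
         hs (J b) a, hs (J c) a, hs (J c) b]
  have hli : LinearIndependent ℝ ![a, J a, b, J b, c, J c] := by
    rw [Fintype.linearIndependent_iff]
    intro r hr j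
    have h1 := congrArg (fun v => g v (![a, J a, b, J b, c, J c] j)) hr
    simp only [map_sum, map_smul, sum_apply, smul_apply, ho, map_zero, zero_apply] at h1
    simpa using h1
  refine ⟨basisOfLinearIndependentOfCardEqFinrank hli (by simp [h.finrank]), fun i => by simp, ?_⟩
  intro i j
  simpa using ho i j

/-- In a unitary basis ω = e⁰¹ + e²³ + e⁴⁵, and the cube of this sum is 6e⁰¹²³⁴⁵. So every unitary
basis has volume one for ω³/3!. -/
theorem omegaCube_apply (h : SU3Point g J σ Ω₁ Ω₂) {o : Module.Basis (Fin 6) ℝ V}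
    (ho : OrthonormalFor g o) (h1 : o 1 = J (o 0)) (h3 : o 3 = J (o 2)) (h5 : o 5 = J (o 4)) :
    wedgeR (wedgeR σ σ) σ ![o 0, o 1, o 2, o 3, o 4, o 5] = 6 := by
  have e1 : J (o 1) = -o 0 := by rw [h1, h.J_sq]
  have e3 : J (o 3) = -o 2 := by rw [h3, h.J_sq]
  rw [wedgeR, wedgeFourTwo_apply]
  simp only [wedgeR, wedgeTwoTwo_apply, h.omega_apply, ← h1, ← h3, ← h5, e1, e3, map_neg,
    neg_apply, ho _ _, LinearMap.mul_apply']
  simp [Fin.ext_iff]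
  norm_num

-- On a unitary basis built from (a, b, c) one finds Ω₁ ∧ Ω₂ = 4|Ω(a, b, c)|², so the normalisation
-- says 6 = (3/2)·4·|Ω(a, b, c)|². Hence Ω(a, b, c) is a phase, and a rotation of the third vector
-- removes it.
set_option maxRecDepth 4000 in
theorem exists_frame (h : SU3Point g J σ Ω₁ Ω₂) : ∃ o, IsSU3Frame g J Ω₁ Ω₂ o := by
  obtain ⟨a, b, c, hu⟩ := h.exists_unitary
  have hn : (Ω₁ ![a, b, c]) ^ 2 + (Ω₂ ![a, b, c]) ^ 2 = 1 := by
    obtain ⟨o, hoa, ho⟩ := hu.exists_basis h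
    have h0 : o 0 = a := hoa 0
    have h2 : o 2 = b := hoa 2
    have h4 : o 4 = c := hoa 4
    have h1 : o 1 = J a := hoa 1
    have h3 : o 3 = J b := hoa 3
    have h5 : o 5 = J c := hoa 5
    have hc := h.omegaCube_apply ho (by rw [h0, h1]) (by rw [h2, h3]) (by rw [h4, h5])
    rw [h.normalized, ContinuousAlternatingMap.smul_apply, wedgeR, wedgeThreeThree_apply,
      h0, h1, h2, h3, h4, h5] at hc
    simp only [h.re_J, h.re_J₁, h.re_J₂, h.im_J, h.im_J₁, h.im_J₂, map_vec3_eq_zero,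
      LinearMap.mul_apply', smul_eq_mul] at hc
    linarith
  set x := Ω₁ ![a, b, c] with hx
  set y := Ω₂ ![a, b, c] with hy
  -- With J as multiplication by i, the new vector is (x - iy)c, where x + iy = Ω(a, b, c). Complex
  -- linearity gives Ω the value |x + iy|² = 1 on it.
  have hu' : IsUnitary g J a b (x • c - y • J c) :=
    { aa := hu.aa
      bb := hu.bb
      cc := by
        simp only [map_sub, map_smul, sub_apply, smul_apply, smul_eq_mul, h.compat, hu.cc,
          h.inner_J_right, h.inner_J_self]
        linarith
      ab := hu.ab
      Jab := hu.Jab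
      ac := by simp [h.inner_J_right, hu.ac, hu.Jac]
      Jac := by simp [h.compat, hu.ac, hu.Jac]
      bc := by simp [h.inner_J_right, hu.bc, hu.Jbc]
      Jbc := by simp [h.compat, hu.bc, hu.Jbc] }
  obtain ⟨o, hoa, ho⟩ := hu'.exists_basis h
  have h0 : o 0 = a := hoa 0
  have h2 : o 2 = b := hoa 2
  have h4 : o 4 = x • c - y • J c := hoa 4
  have h1 : o 1 = J a := hoa 1
  have h3 : o 3 = J b := hoa 3
  have h5 : o 5 = J (x • c - y • J c) := hoa 5
  have hlin : ∀ Θ : V [⋀^Fin 3]→L[ℝ] ℝ, Θ ![a, b, x • c - y • J c] =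
      x * Θ ![a, b, c] - y * Θ ![a, b, J c] := by
    intro Θ
    have e : ∀ t, ![a, b, t] = Function.update ![a, b, c] 2 t := by
      intro t; ext i; fin_cases i <;> rfl
    rw [e, Θ.map_update_sub, Θ.map_update_smul, Θ.map_update_smul, ← e, ← e]
    simp
  refine ⟨o, ho, by rw [h0, h1], by rw [h2, h3], by rw [h4, h5], ?_, ?_⟩
  · rw [h0, h2, h4, hlin, h.re_J₂, ← hx, ← hy]; linarith
  · rw [h0, h2, h4, hlin, h.im_J₂, ← hx, ← hy]; ring

end SU3Point

/-- The form `v ↦ Θ(v) a`. -/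
def smulForm (Θ : V [⋀^Fin k]→L[ℝ] ℝ) (a : W) : V [⋀^Fin k]→L[ℝ] W :=
  ((1 : ℝ →L[ℝ] ℝ).smulRight a).compContinuousAlternatingMap Θ

theorem smulForm_apply (Θ : V [⋀^Fin k]→L[ℝ] ℝ) (a : W) (v : Fin k → V) :
    smulForm Θ a v = Θ v • a := rfl

/-- A linear functional as a `1`-form. -/
def ofFunctional (α : V →L[ℝ] W) : V [⋀^Fin 1]→L[ℝ] W :=
  ContinuousAlternatingMap.ofSubsingleton ℝ V W (0 : Fin 1) α

theorem ofFunctional_apply (α : V →L[ℝ] W) (v : Fin 1 → V) : ofFunctional α v = α (v 0) := rfl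

/-- Alternating forms of top degree are equal if they agree on a basis. -/
theorem alternating_top_ext (o : Module.Basis (Fin n) ℝ V) {α β : V [⋀^Fin n]→L[ℝ] W}
    (h : α o = β o) : α = β := by
  have key : α.toAlternatingMap = β.toAlternatingMap := by
    refine Module.Basis.ext_alternating o fun v hv => ?_
    let ρ := Equiv.ofBijective v (Finite.injective_iff_bijective.mp hv)
    have hv' : (fun a => o (v a)) = (fun a => o a) ∘ ρ := rfl
    rw [hv', AlternatingMap.map_perm, AlternatingMap.map_perm]
    congr 1
  ext v
  exact congrArg (fun f : V [⋀^Fin n]→ₗ[ℝ] W => f v) key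

/-! ### The complex volume form in an adapted frame -/

namespace IsSU3Frame

variable {g : V →L[ℝ] V →L[ℝ] ℝ} {J : V →L[ℝ] V} {σ : V [⋀^Fin 2]→L[ℝ] ℝ}
  {Ω₁ Ω₂ : V [⋀^Fin 3]→L[ℝ] ℝ} {o : Module.Basis (Fin 6) ℝ V}

theorem coe_eq (o : Module.Basis (Fin 6) ℝ V) : ⇑o = ![o 0, o 1, o 2, o 3, o 4, o 5] := by
  ext i; fin_cases i <;> rfl

theorem vol_apply (ho : IsSU3Frame g J Ω₁ Ω₂ o) (h : SU3Point g J σ Ω₁ Ω₂) :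
    ((1 / 6 : ℝ) • wedgeR (wedgeR σ σ) σ) o = 1 := by
  rw [coe_eq o, ContinuousAlternatingMap.smul_apply,
    h.omegaCube_apply ho.orthonormal ho.one ho.three ho.five]
  norm_num

/-- Cyclic rotation of an adapted basis. -/
theorem rotate (ho : IsSU3Frame g J Ω₁ Ω₂ o) : ∃ o' : Module.Basis (Fin 6) ℝ V,
    IsSU3Frame g J Ω₁ Ω₂ o' ∧ ∀ i, o' i = ![o 2, o 3, o 4, o 5, o 0, o 1] i := by
  let e : Equiv.Perm (Fin 6) := permOf ![4, 5, 0, 1, 2, 3] ![2, 3, 4, 5, 0, 1]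
  have hi : ∀ i, (o.reindex e) i = ![o 2, o 3, o 4, o 5, o 0, o 1] i := by
    intro i
    rw [Module.Basis.reindex_apply]
    fin_cases i <;> rfl
  refine ⟨o.reindex e, ⟨?_, ?_, ?_, ?_, ?_, ?_⟩, hi⟩
  · intro i j
    rw [Module.Basis.reindex_apply, Module.Basis.reindex_apply, ho.orthonormal]
    simp
  · rw [hi, hi]; exact ho.three
  · rw [hi, hi]; exact ho.five
  · rw [hi, hi]; exact ho.one
  · rw [hi, hi, hi]
    change Ω₁ ![o 2, o 4, o 0] = 1
    rw [(map_vec3_swap Ω₁ (o 2) (o 0) (o 4)).2.1, (map_vec3_swap Ω₁ (o 0) (o 2) (o 4)).1, neg_neg,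
      ho.re]
  · rw [hi, hi, hi]
    change Ω₂ ![o 2, o 4, o 0] = 0
    rw [(map_vec3_swap Ω₂ (o 2) (o 0) (o 4)).2.1, (map_vec3_swap Ω₂ (o 0) (o 2) (o 4)).1, neg_neg,
      ho.im]

variable {vol : V [⋀^Fin 6]→L[ℝ] ℝ}

/-- The Hodge star exchanges the real and imaginary parts of the complex volume form. -/
theorem hodge_three (ho : IsSU3Frame g J Ω₁ Ω₂ o) (h : SU3Point g J σ Ω₁ Ω₂) (hvol : vol o = 1)
    (u : V [⋀^Fin 3]→L[ℝ] W) (a b : W) (hu : ∀ v, u v = Ω₁ v • a + Ω₂ v • b) :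
    hodge (k := 3) (m := 3) g o vol u = smulForm Ω₂ a - smulForm Ω₁ b := by
  refine alternating_three_ext o fun i => ?_
  rw [hodge_orthonormal_apply (k := 3) (m := 3) ho.orthonormal vol hvol u (shuffleThreeThree i)]
  have hs : ∀ i, (Equiv.Perm.sign (shuffleThreeThree i) : ℤ) =
      ![1, -1, 1, -1, 1, -1, 1, 1, -1, 1, -1, 1, -1, -1, 1, -1, 1, -1, 1, -1] i := by decide
  have v3 : ∀ f : Fin 3 → V, f = ![f 0, f 1, f 2] := by
    intro f; ext i; fin_cases i <;> rfl
  rw [hs, ContinuousAlternatingMap.sub_apply, smulForm_apply, smulForm_apply, hu, v3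
    (fun a => o (shuffleThreeThree i (Fin.castAdd 3 a))),
    v3 (fun a => o (shuffleThreeThree i (Fin.natAdd 3 a)))]
  -- A triple of frame vectors either contains some v together with Jv, and then Ω vanishes on it,
  -- or reduces to (o 0, o 2, o 4) by moving J out of each slot.
  fin_cases i <;>
    simp [shuffleThreeThree, ho.one, ho.three, ho.five, h.re_J, h.re_J₁, h.re_J₂, h.im_J, h.im_J₁,
      h.im_J₂, map_vec3_eq_zero, ho.re, ho.im]

/-- A form of type `(0, 3)` is a multiple of the conjugate of the complex volume form. -/
theorem eq_of_zero_three (ho : IsSU3Frame g J Ω₁ Ω₂ o) (h : SU3Point g J σ Ω₁ Ω₂)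
    (u : V [⋀^Fin 3]→L[ℝ] (Y × Y)) (hu : pqPart J 0 3 u = u) (v : Fin 3 → V) :
    u v = cmul ⟨Ω₁ v, -Ω₂ v⟩ (u ![o 0, o 2, o 4]) := by
  set w := u ![o 0, o 2, o 4] with hw
  have key : u = smulForm Ω₁ w + smulForm Ω₂ (cmul (-Complex.I) w) := by
    refine alternating_three_ext o fun i => ?_
    have v3 : ∀ f : Fin 3 → V, f = ![f 0, f 1, f 2] := by
      intro f; ext i; fin_cases i <;> rfl
    have u0 := map_J_of_pqPart_zero_three J h.J_sq hu
    have u1 : ∀ a b c, u ![a, J b, c] = cmul (-Complex.I) (u ![a, b, c]) := by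
      intro a b c
      rw [(map_vec3_swap u (J b) a c).1, u0, (map_vec3_swap u a b c).1, map_neg, neg_neg]
    have u2 : ∀ a b c, u ![a, b, J c] = cmul (-Complex.I) (u ![a, b, c]) := by
      intro a b c
      rw [(map_vec3_swap u (J c) b a).2.2, u0, (map_vec3_swap u a b c).2.2, map_neg, neg_neg]
    rw [ContinuousAlternatingMap.add_apply, smulForm_apply, smulForm_apply,
      v3 (fun a => o (shuffleThreeThree i (Fin.natAdd 3 a)))]
    fin_cases i <;>
      simp [shuffleThreeThree, ho.one, ho.three, ho.five, h.re_J, h.re_J₁, h.re_J₂, h.im_J,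
        h.im_J₁, h.im_J₂, map_vec3_eq_zero, ho.re, ho.im, u0, u1, u2, ← hw, cmul_apply,
        show (-w.1, -w.2) = -w from rfl]
  rw [key, ContinuousAlternatingMap.add_apply, smulForm_apply, smulForm_apply]
  ext <;> simp [cmul_apply]

end IsSU3Frame

/-! ### The equation for F^{0,2} in an adapted frame -/

theorem map_vec2_swap (α : V [⋀^Fin 2]→L[ℝ] W) (a b : V) : α ![b, a] = -α ![a, b] := by
  refine Eq.trans ?_ (α.toAlternatingMap.map_swap ![a, b] (i := 0) (j := 1) (by decide))
  change α _ = α _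
  congr 1
  ext i; fin_cases i <;> rfl

theorem hodge_orthonormal_eval {g : V →L[ℝ] V →L[ℝ] ℝ} {o : Module.Basis (Fin n) ℝ V}
    (hn : k + m = n) (ho : OrthonormalFor g o) (vol : V [⋀^Fin (k + m)]→L[ℝ] ℝ)
    (hvol : vol (fun a => o (Fin.cast hn a)) = 1)
    (α : V [⋀^Fin k]→L[ℝ] W) (τ : Equiv.Perm (Fin n)) {s : ℤ}
    (hs : (Equiv.Perm.sign τ : ℤ) = s) {v : Fin m → V} {w : Fin k → V}
    (hv : ∀ a, v a = o (τ (Fin.cast hn (Fin.natAdd k a))))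
    (hw : ∀ a, w a = o (τ (Fin.cast hn (Fin.castAdd m a)))) :
    hodge g o vol α v = s • α w := by
  subst hn
  rw [funext hv, funext hw]
  exact (hodge_orthonormal_apply ho vol hvol α τ).trans (by rw [hs]; rfl)

/-- The real and imaginary parts of `(α₁ + i α₂)(x) Ω̄(y, z, w)`. -/
def conjTerm (Ω₁ Ω₂ : V [⋀^Fin 3]→L[ℝ] ℝ) (α₁ α₂ : V →L[ℝ] W) (x y z w : V) : W × W :=
  (Ω₁ ![y, z, w] • α₁ x + Ω₂ ![y, z, w] • α₂ x, Ω₁ ![y, z, w] • α₂ x - Ω₂ ![y, z, w] • α₁ x)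

/-- The relations between `F^{0,2}` and `∂_A Φ` in an adapted frame. -/
structure FrameRelations (o : Fin 6 → V) (F : V [⋀^Fin 2]→L[ℝ] W) (α₁ α₂ : V →L[ℝ] W) : Prop where
  re₀₂ : F ![o 0, o 2] - F ![o 1, o 3] = α₂ (o 4) - α₁ (o 5)
  im₀₂ : F ![o 1, o 2] + F ![o 0, o 3] = -α₁ (o 4) - α₂ (o 5)
  re₂₄ : F ![o 2, o 4] - F ![o 3, o 5] = α₂ (o 0) - α₁ (o 1)
  im₂₄ : F ![o 3, o 4] + F ![o 2, o 5] = -α₁ (o 0) - α₂ (o 1)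
  re₀₄ : F ![o 1, o 5] - F ![o 0, o 4] = α₂ (o 2) - α₁ (o 3)
  im₀₄ : F ![o 0, o 5] + F ![o 1, o 4] = α₁ (o 2) + α₂ (o 3)

namespace IsSU3Frame

variable {g : V →L[ℝ] V →L[ℝ] ℝ} {J : V →L[ℝ] V} {σ : V [⋀^Fin 2]→L[ℝ] ℝ}
  {Ω₁ Ω₂ : V [⋀^Fin 3]→L[ℝ] ℝ} {o : Module.Basis (Fin 6) ℝ V} {vol : V [⋀^Fin 6]→L[ℝ] ℝ}

/-- The form `β` stands for d_A(*u) = -(1/4)(d_AΦ ∧ Ω̄ - iΦδ) with δ = dΩ₂, and the equation is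
evaluated on (o 0, o 2). The two symmetries of δ say precisely that its terms cancel in
`pqPart_one_three_apply`, so the torsion dΩ₂ drops out and only derivatives of Φ₁ and Φ₂ remain. -/
theorem relation_aux (ho : IsSU3Frame g J Ω₁ Ω₂ o) (h : SU3Point g J σ Ω₁ Ω₂) (hvol : vol o = 1)
    (F : V [⋀^Fin 2]→L[ℝ] W) (α₁ α₂ : V →L[ℝ] W) (φ₁ φ₂ : W) (δ : V [⋀^Fin 4]→L[ℝ] ℝ)
    (hδ₁ : ∀ a b c, δ ![a, b, c, J c] = δ ![J a, J b, c, J c])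
    (hδ₂ : ∀ a b c, δ ![J a, b, c, J c] = -δ ![a, J b, c, J c])
    (β : V [⋀^Fin 4]→L[ℝ] (W × W))
    (hβ : ∀ a b c d, β ![a, b, c, d] = -(1 / 4 : ℝ) •
      (conjTerm Ω₁ Ω₂ α₁ α₂ a b c d - conjTerm Ω₁ Ω₂ α₁ α₂ b a c d + conjTerm Ω₁ Ω₂ α₁ α₂ c a b d
        - conjTerm Ω₁ Ω₂ α₁ α₂ d a b c + (δ ![a, b, c, d] • φ₂, -δ ![a, b, c, d] • φ₁)))
    (hF : pqPart J 0 2 ((ContinuousLinearMap.inl ℝ W W).compContinuousAlternatingMap F) =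
      -hodge (k := 4) (m := 2) g o vol (pqPart J 1 3 β)) :
    F ![o 0, o 2] - F ![o 1, o 3] = α₂ (o 4) - α₁ (o 5) ∧
      F ![o 1, o 2] + F ![o 0, o 3] = -α₁ (o 4) - α₂ (o 5) := by
  have hB := pqPart_one_three_apply J h.J_sq β (J (o 0)) (J (o 2)) (o 4)
  obtain ⟨B, hBdef⟩ : ∃ B : V [⋀^Fin 4]→L[ℝ] (W × W), B = pqPart J 1 3 β := ⟨_, rfl⟩
  rw [← hBdef] at hF hB
  -- The arguments of the 4-form come first and those of its Hodge dual last: τ lists the complement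
  -- 1, 3, 4, 5 before 0, 2.
  let τ : Equiv.Perm (Fin 6) := permOf ![1, 3, 4, 5, 0, 2] ![4, 0, 5, 1, 2, 3]
  have hv : ∀ a : Fin 2, ![o 0, o 2] a = o (τ (Fin.cast rfl (Fin.natAdd 4 a))) := by
    intro a; fin_cases a <;> rfl
  have hw : ∀ a : Fin 4, ![J (o 0), J (o 2), o 4, J (o 4)] a =
      o (τ (Fin.cast rfl (Fin.castAdd 2 a))) := by
    intro a; fin_cases a
    · exact ho.one.symm
    · exact ho.three.symm
    · rfl
    · exact ho.five.symm
  have hs : (Equiv.Perm.sign τ : ℤ) = -1 := by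
    have h0 : (Equiv.Perm.sign (permOf (n := 6) ![1, 3, 4, 5, 0, 2] ![4, 0, 5, 1, 2, 3]) : ℤ) =
        -1 := by
      decide
    exact h0
  obtain ⟨X, hX⟩ : ∃ X : V [⋀^Fin 2]→L[ℝ] (W × W), X = hodge (k := 4) (m := 2) g o vol B := ⟨_, rfl⟩
  rw [← hX] at hF
  have h2 : X ![o 0, o 2] = (-1 : ℤ) • B ![J (o 0), J (o 2), o 4, J (o 4)] := by
    rw [hX]
    exact hodge_orthonormal_eval (k := 4) (m := 2) (n := 6) rfl ho.orthonormal vol hvol B τ hs hv hw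
  have h1 : pqPart J 0 2 ((ContinuousLinearMap.inl ℝ W W).compContinuousAlternatingMap F)
      ![o 0, o 2] = -(X ![o 0, o 2]) := by
    rw [hF]; rfl
  rw [h2] at h1
  rw [pqPart_zero_two_apply] at h1
  rw [hB] at h1
  have hδ₁' := hδ₁ (o 0) (o 2) (o 4)
  have hδ₂' := hδ₂ (o 0) (o 2) (o 4)
  have hJ2 : ∀ a b c d, δ ![-a, b, c, d] = -δ ![a, b, c, d] := by
    intro a b c d
    have e0 : ∀ t, ![t, b, c, d] = Function.update ![a, b, c, d] 0 t := by
      intro t; ext i; fin_cases i <;> rfl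
    rw [e0, map_update_neg_apply, ← e0]
  have hJ3 : ∀ a b c d, δ ![a, -b, c, d] = -δ ![a, b, c, d] := by
    intro a b c d
    have e0 : ∀ t, ![a, t, c, d] = Function.update ![a, b, c, d] 1 t := by
      intro t; ext i; fin_cases i <;> rfl
    rw [e0, map_update_neg_apply, ← e0]
  have hin : ∀ v, ((ContinuousLinearMap.inl ℝ W W).compContinuousAlternatingMap F) v = (F v, 0) :=
    fun v => rfl
  have n0 := fun Θ : V [⋀^Fin 3]→L[ℝ] ℝ => fun a b c => (map_vec3_neg Θ a b c).1
  have n1 := fun Θ : V [⋀^Fin 3]→L[ℝ] ℝ => fun a b c => (map_vec3_neg Θ a b c).2.1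
  simp only [hβ, conjTerm, h.re_J, h.re_J₁, h.re_J₂, h.im_J, h.im_J₁, h.im_J₂, map_vec3_eq_zero,
    h.J_sq, ho.re, ho.im, hin, hδ₁', hδ₂', hJ2, hJ3, n0, n1, map_neg] at h1
  rw [Prod.ext_iff] at h1
  obtain ⟨h3, h4⟩ := h1
  simp [cmul_apply] at h3 h4
  rw [← ho.one, ← ho.three, ← ho.five] at h3 h4
  constructor
  · linear_combination (norm := module) h3
  · linear_combination (norm := module) (4 : ℝ) • h4

/-- A cyclic rotation of an adapted frame is adapted, and the Hodge star does not depend on the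
frame. So the pair of relations of `relation_aux`, applied to the three rotations, yields all six.
-/
theorem relations (ho : IsSU3Frame g J Ω₁ Ω₂ o) (h : SU3Point g J σ Ω₁ Ω₂)
    (hvol : vol = (1 / 6 : ℝ) • wedgeR (wedgeR σ σ) σ)
    (F : V [⋀^Fin 2]→L[ℝ] W) (α₁ α₂ : V →L[ℝ] W) (φ₁ φ₂ : W) (δ : V [⋀^Fin 4]→L[ℝ] ℝ)
    (hδ₁ : ∀ a b c, δ ![a, b, c, J c] = δ ![J a, J b, c, J c])
    (hδ₂ : ∀ a b c, δ ![J a, b, c, J c] = -δ ![a, J b, c, J c])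
    (β : V [⋀^Fin 4]→L[ℝ] (W × W))
    (hβ : ∀ a b c d, β ![a, b, c, d] = -(1 / 4 : ℝ) •
      (conjTerm Ω₁ Ω₂ α₁ α₂ a b c d - conjTerm Ω₁ Ω₂ α₁ α₂ b a c d + conjTerm Ω₁ Ω₂ α₁ α₂ c a b d
        - conjTerm Ω₁ Ω₂ α₁ α₂ d a b c + (δ ![a, b, c, d] • φ₂, -δ ![a, b, c, d] • φ₁)))
    (hF : pqPart J 0 2 ((ContinuousLinearMap.inl ℝ W W).compContinuousAlternatingMap F) =
      -hodge (k := 4) (m := 2) g o vol (pqPart J 1 3 β)) :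
    FrameRelations o F α₁ α₂ := by
  obtain ⟨o', ho', hi'⟩ := ho.rotate
  obtain ⟨o'', ho'', hi''⟩ := ho'.rotate
  have hv : ∀ b, IsSU3Frame g J Ω₁ Ω₂ b → vol b = 1 := fun b hb => hvol ▸ hb.vol_apply h
  have e' := hodge_eq_of_orthonormal (k := 4) (m := 2) ho'.orthonormal o vol (pqPart J 1 3 β)
  have e'' := hodge_eq_of_orthonormal (k := 4) (m := 2) ho''.orthonormal o vol (pqPart J 1 3 β)
  obtain ⟨r1, r2⟩ := ho.relation_aux h (hv o ho) F α₁ α₂ φ₁ φ₂ δ hδ₁ hδ₂ β hβ hF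
  obtain ⟨s1, s2⟩ := ho'.relation_aux h (hv o' ho') F α₁ α₂ φ₁ φ₂ δ hδ₁ hδ₂ β hβ (e' ▸ hF)
  obtain ⟨t1, t2⟩ := ho''.relation_aux h (hv o'' ho'') F α₁ α₂ φ₁ φ₂ δ hδ₁ hδ₂ β hβ (e'' ▸ hF)
  simp only [hi'', hi'] at t1 t2
  simp only [hi'] at s1 s2
  replace s1 : F ![o 2, o 4] - F ![o 3, o 5] = α₂ (o 0) - α₁ (o 1) := s1
  replace s2 : F ![o 3, o 4] + F ![o 2, o 5] = -α₁ (o 0) - α₂ (o 1) := s2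
  replace t1 : F ![o 4, o 0] - F ![o 5, o 1] = α₂ (o 2) - α₁ (o 3) := t1
  replace t2 : F ![o 5, o 0] + F ![o 4, o 1] = -α₁ (o 2) - α₂ (o 3) := t2
  -- The last rotation produces the pairs (4, 0), (5, 1), (5, 0) and (4, 1) in reversed order; this
  -- explains the signs of `re₀₄` and `im₀₄`.
  rw [map_vec2_swap F (o 0), map_vec2_swap F (o 1)] at t1 t2
  refine ⟨r1, r2, s1, s2, ?_, ?_⟩
  · linear_combination (norm := module) t1
  · linear_combination (norm := module) -t2

end IsSU3Frame

/-- Moving the index i to the last place crosses 5 - i others and has sign (-1)^(i+1); moving it to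
the first place, as in `exists_perm_one_five`, crosses i others. -/
theorem exists_perm_five_one (i : Fin 6) : ∃ τ : Equiv.Perm (Fin 6),
    (Equiv.Perm.sign τ : ℤ) = (-1) ^ (i.val + 1) ∧ τ 5 = i ∧
      ∀ a : Fin 5, τ (Fin.castSucc a) = i.succAbove a := by
  refine ⟨(![permOf ![1, 2, 3, 4, 5, 0] ![5, 0, 1, 2, 3, 4],
      permOf ![0, 2, 3, 4, 5, 1] ![0, 5, 1, 2, 3, 4],
      permOf ![0, 1, 3, 4, 5, 2] ![0, 1, 5, 2, 3, 4], permOf ![0, 1, 2, 4, 5, 3] ![0, 1, 2, 5, 3, 4],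
      permOf ![0, 1, 2, 3, 5, 4] ![0, 1, 2, 3, 5, 4], permOf ![0, 1, 2, 3, 4, 5] ![0, 1, 2, 3, 4, 5]] : Fin 6 → Equiv.Perm (Fin 6)) i, ?_⟩
  revert i
  decide

theorem exists_perm_one_five (i : Fin 6) : ∃ τ : Equiv.Perm (Fin 6),
    (Equiv.Perm.sign τ : ℤ) = (-1) ^ i.val ∧ τ 0 = i ∧
      ∀ a : Fin 5, τ (Fin.succ a) = i.succAbove a := by
  refine ⟨(![permOf ![0, 1, 2, 3, 4, 5] ![0, 1, 2, 3, 4, 5],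
      permOf ![1, 0, 2, 3, 4, 5] ![1, 0, 2, 3, 4, 5],
      permOf ![2, 0, 1, 3, 4, 5] ![1, 2, 0, 3, 4, 5], permOf ![3, 0, 1, 2, 4, 5] ![1, 2, 3, 0, 4, 5],
      permOf ![4, 0, 1, 2, 3, 5] ![1, 2, 3, 4, 0, 5], permOf ![5, 0, 1, 2, 3, 4] ![1, 2, 3, 4, 5, 0]] : Fin 6 → Equiv.Perm (Fin 6)) i, ?_⟩
  revert i
  decide

theorem hodge_five_one {g : V →L[ℝ] V →L[ℝ] ℝ} {o : Module.Basis (Fin 6) ℝ V}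
    (ho : OrthonormalFor g o) {vol : V [⋀^Fin 6]→L[ℝ] ℝ} (hvol : vol o = 1)
    (κ : V [⋀^Fin 5]→L[ℝ] W) (i : Fin 6) :
    hodge (k := 5) (m := 1) g o vol κ (fun _ => o i) =
      ((-1) ^ (i.val + 1) : ℤ) • κ fun a => o (i.succAbove a) := by
  obtain ⟨τ, hs, h5, hτ⟩ := exists_perm_five_one i
  refine hodge_orthonormal_eval (k := 5) (m := 1) (n := 6) rfl ho vol hvol κ τ hs ?_ ?_
  · intro a
    rw [Subsingleton.elim a 0]
    exact congrArg o h5.symm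
  · intro a
    exact congrArg o (hτ a).symm

theorem hodge_one_five {g : V →L[ℝ] V →L[ℝ] ℝ} {o : Module.Basis (Fin 6) ℝ V}
    (ho : OrthonormalFor g o) {vol : V [⋀^Fin 6]→L[ℝ] ℝ} (hvol : vol o = 1)
    (α : V →L[ℝ] W) (i : Fin 6) :
    hodge (k := 1) (m := 5) g o vol (ofFunctional α) (fun a => o (i.succAbove a)) =
      ((-1) ^ i.val : ℤ) • α (o i) := by
  obtain ⟨τ, hs, h0, hτ⟩ := exists_perm_one_five i
  have e : ofFunctional α (fun _ => o i) = α (o i) := rfl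
  rw [← e]
  refine hodge_orthonormal_eval (k := 1) (m := 5) (n := 6) rfl ho vol hvol (ofFunctional α) τ hs
    ?_ ?_
  · intro a
    have : Fin.natAdd 1 a = Fin.succ a := Fin.ext (Nat.add_comm _ _)
    exact congrArg o ((hτ a).symm.trans (congrArg τ this.symm))
  · intro a
    rw [Subsingleton.elim a 0]
    exact congrArg o h0.symm

theorem one_form_ext (o : Module.Basis (Fin n) ℝ V) {α β : V [⋀^Fin 1]→L[ℝ] W}
    (h : ∀ i, α (fun _ => o i) = β fun _ => o i) : α = β := by
  have key : α.toAlternatingMap = β.toAlternatingMap := by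
    refine Module.Basis.ext_alternating o fun v _ => ?_
    have : (fun a => o (v a)) = fun _ => o (v 0) := by
      funext a; rw [Subsingleton.elim a 0]
    rw [this]
    exact h (v 0)
  ext v
  exact congrArg (fun f : V [⋀^Fin 1]→ₗ[ℝ] W => f v) key

theorem vec_succAbove (f : Fin 6 → V) (i : Fin 6) : (fun a => f (i.succAbove a)) =
    (![![f 1, f 2, f 3, f 4, f 5], ![f 0, f 2, f 3, f 4, f 5], ![f 0, f 1, f 3, f 4, f 5],
      ![f 0, f 1, f 2, f 4, f 5], ![f 0, f 1, f 2, f 3, f 5],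
      ![f 0, f 1, f 2, f 3, f 4]] : Fin 6 → Fin 5 → V) i := by
  fin_cases i <;> (ext a; fin_cases a <;> rfl)

/-! ### Wedge products with Ω₁, Ω₂ and ω², and their Hodge duals -/

namespace IsSU3Frame

variable {g : V →L[ℝ] V →L[ℝ] ℝ} {J : V →L[ℝ] V} {σ : V [⋀^Fin 2]→L[ℝ] ℝ}
  {Ω₁ Ω₂ : V [⋀^Fin 3]→L[ℝ] ℝ} {o : Module.Basis (Fin 6) ℝ V} {vol : V [⋀^Fin 6]→L[ℝ] ℝ}

/-- The restriction of `F ∧ Ω₁` to the coordinate hyperplanes. -/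
theorem wedge_re_apply (ho : IsSU3Frame g J Ω₁ Ω₂ o) (h : SU3Point g J σ Ω₁ Ω₂)
    {F : V [⋀^Fin 2]→L[ℝ] W} {α₁ α₂ : V →L[ℝ] W} (hr : FrameRelations o F α₁ α₂) (i : Fin 6) :
    wedgeS F Ω₁ (fun a => o (i.succAbove a)) =
      ((-1) ^ i.val : ℤ) • (α₁ (o i) + α₂ (J (o i))) := by
  have e1 : J (o 1) = -o 0 := by rw [ho.one, h.J_sq]
  have e3 : J (o 3) = -o 2 := by rw [ho.three, h.J_sq]
  have e5 : J (o 5) = -o 4 := by rw [ho.five, h.J_sq]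
  obtain ⟨r1, r2, r3, r4, r5, r6⟩ := hr
  rw [vec_succAbove o i]
  -- On each face Ω₁ has exactly two nonzero components. The two remaining curvature terms form, up
  -- to sign, the left side of one of the six frame relations.
  fin_cases i <;> dsimp <;> rw [wedgeTwoThree_apply]
  all_goals
    simp only [ho.one, ho.three, ho.five, h.re_J, h.re_J₁, h.re_J₂, h.im_J₁, h.im_J₂,
      map_vec3_eq_zero, ho.re, ho.im, LinearMap.flip_apply, LinearMap.lsmul_apply]
    simp only [← ho.one, ← ho.three, ← ho.five, e1, e3, e5, map_neg]
  · linear_combination (norm := module) -r4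
  · linear_combination (norm := module) r3
  · linear_combination (norm := module) r6
  · linear_combination (norm := module) r5
  · linear_combination (norm := module) -r2
  · linear_combination (norm := module) r1

/-- The restriction of `F ∧ Ω₂` to the coordinate hyperplanes. -/
theorem wedge_im_apply (ho : IsSU3Frame g J Ω₁ Ω₂ o) (h : SU3Point g J σ Ω₁ Ω₂)
    {F : V [⋀^Fin 2]→L[ℝ] W} {α₁ α₂ : V →L[ℝ] W} (hr : FrameRelations o F α₁ α₂) (i : Fin 6) :
    wedgeS F Ω₂ (fun a => o (i.succAbove a)) =
      ((-1) ^ i.val : ℤ) • (α₂ (o i) - α₁ (J (o i))) := by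
  have e1 : J (o 1) = -o 0 := by rw [ho.one, h.J_sq]
  have e3 : J (o 3) = -o 2 := by rw [ho.three, h.J_sq]
  have e5 : J (o 5) = -o 4 := by rw [ho.five, h.J_sq]
  obtain ⟨r1, r2, r3, r4, r5, r6⟩ := hr
  rw [vec_succAbove o i]
  fin_cases i <;> dsimp <;> rw [wedgeTwoThree_apply]
  all_goals
    simp only [ho.one, ho.three, ho.five, h.re_J₁, h.re_J₂, h.im_J, h.im_J₁, h.im_J₂,
      map_vec3_eq_zero, ho.re, ho.im, LinearMap.flip_apply, LinearMap.lsmul_apply]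
    simp only [← ho.one, ← ho.three, ← ho.five, e1, e3, e5, map_neg]
  · linear_combination (norm := module) r3
  · linear_combination (norm := module) r4
  · linear_combination (norm := module) r5
  · linear_combination (norm := module) -r6
  · linear_combination (norm := module) r1
  · linear_combination (norm := module) r2

/-- By `hodge_one_five` the hypothesis means κ = *α, and ** = -1 on 1-forms in dimension six: the
signs (-1)^i and (-1)^(i+1) multiply to -1. -/
theorem hodge_five_eq (ho : IsSU3Frame g J Ω₁ Ω₂ o) (hvol : vol o = 1)
    {κ : V [⋀^Fin 5]→L[ℝ] W} {α : V →L[ℝ] W}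
    (hκ : ∀ i : Fin 6, κ (fun a => o (i.succAbove a)) = ((-1) ^ i.val : ℤ) • α (o i)) :
    hodge (k := 5) (m := 1) g o vol κ = ofFunctional (-α) := by
  refine one_form_ext o fun i => ?_
  rw [show ofFunctional (-α) (fun _ => o i) = -α (o i) from rfl]
  refine (hodge_five_one ho.orthonormal hvol κ i).trans ?_
  rw [hκ, smul_smul, ← pow_add, show i.val + 1 + i.val = 2 * i.val + 1 by ring, pow_succ, pow_mul]
  simp

/-- The Hodge dual of `F ∧ Ω₁`. -/
theorem hodge_wedge_re (ho : IsSU3Frame g J Ω₁ Ω₂ o) (h : SU3Point g J σ Ω₁ Ω₂)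
    (hvol : vol o = 1) {F : V [⋀^Fin 2]→L[ℝ] W} {α₁ α₂ : V →L[ℝ] W}
    (hr : FrameRelations o F α₁ α₂) :
    hodge (k := 5) (m := 1) g o vol (wedgeS F Ω₁) = ofFunctional (-(α₁ + α₂ ∘L J)) := by
  have key := ho.wedge_re_apply h hr
  obtain ⟨κ, hκ⟩ : ∃ κ : V [⋀^Fin 5]→L[ℝ] W, κ = wedgeS F Ω₁ := ⟨_, rfl⟩
  rw [← hκ] at key ⊢
  exact ho.hodge_five_eq hvol key

/-- The Hodge dual of `F ∧ Ω₂`. -/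
theorem hodge_wedge_im (ho : IsSU3Frame g J Ω₁ Ω₂ o) (h : SU3Point g J σ Ω₁ Ω₂)
    (hvol : vol o = 1) {F : V [⋀^Fin 2]→L[ℝ] W} {α₁ α₂ : V →L[ℝ] W}
    (hr : FrameRelations o F α₁ α₂) :
    hodge (k := 5) (m := 1) g o vol (wedgeS F Ω₂) = ofFunctional (-(α₂ - α₁ ∘L J)) := by
  have key := ho.wedge_im_apply h hr
  obtain ⟨κ, hκ⟩ : ∃ κ : V [⋀^Fin 5]→L[ℝ] W, κ = wedgeS F Ω₂ := ⟨_, rfl⟩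
  rw [← hκ] at key ⊢
  exact ho.hodge_five_eq hvol key

theorem omega_frame (ho : IsSU3Frame g J Ω₁ Ω₂ o) (h : SU3Point g J σ Ω₁ Ω₂) (i j : Fin 6) :
    σ ![o i, o j] = ![![0, 1, 0, 0, 0, 0], ![-1, 0, 0, 0, 0, 0], ![0, 0, 0, 1, 0, 0],
      ![0, 0, -1, 0, 0, 0], ![0, 0, 0, 0, 0, 1], ![0, 0, 0, 0, -1, (0 : ℝ)]] i j := by
  have e1 : J (o 1) = -o 0 := by rw [ho.one, h.J_sq]
  have e3 : J (o 3) = -o 2 := by rw [ho.three, h.J_sq]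
  have e5 : J (o 5) = -o 4 := by rw [ho.five, h.J_sq]
  have hJ : J (o i) = ![o 1, -o 0, o 3, -o 2, o 5, -o 4] i := by
    fin_cases i
    exacts [ho.one.symm, e1, ho.three.symm, e3, ho.five.symm, e5]
  rw [h.omega_apply, hJ]
  fin_cases i <;> fin_cases j <;> simp [ho.orthonormal _ _]

/-- Here ω²/2 = e⁰¹²³ + e⁰¹⁴⁵ + e²³⁴⁵, so on the face without o i only the term with α on the
partner vector ±J(o i) survives. Compared with `hodge_one_five` this says α ∧ ω²/2 = *(α ∘ J). -/
theorem omegaSq_apply (ho : IsSU3Frame g J Ω₁ Ω₂ o) (h : SU3Point g J σ Ω₁ Ω₂) (α : V →L[ℝ] W)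
    (i : Fin 6) : wedgeS (ofFunctional α) ((1 / 2 : ℝ) • wedgeR σ σ) (fun a => o (i.succAbove a)) =
      ((-1) ^ i.val : ℤ) • α (J (o i)) := by
  have e1 : J (o 1) = -o 0 := by rw [ho.one, h.J_sq]
  have e3 : J (o 3) = -o 2 := by rw [ho.three, h.J_sq]
  have e5 : J (o 5) = -o 4 := by rw [ho.five, h.J_sq]
  have key : ∀ a b c d, ((1 / 2 : ℝ) • wedgeR σ σ) ![a, b, c, d] = (1 / 2 : ℝ) *
      wedgeR σ σ ![a, b, c, d] := fun a b c d => rfl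
  rw [vec_succAbove o i]
  fin_cases i <;> dsimp <;> rw [wedgeOneFour_apply]
  all_goals
    simp only [key, wedgeTwoTwo_apply, ho.omega_frame h, LinearMap.flip_apply,
      LinearMap.lsmul_apply, ofFunctional_apply, e1, e3, e5, ← ho.one, ← ho.three, ← ho.five]
    simp
    norm_num

/-- `F ∧ Ω₁ = *α₁ + α₂ ∧ ω² / 2`. -/
theorem wedge_re_eq (ho : IsSU3Frame g J Ω₁ Ω₂ o) (h : SU3Point g J σ Ω₁ Ω₂)
    (hvol : vol o = 1) {F : V [⋀^Fin 2]→L[ℝ] W} {α₁ α₂ : V →L[ℝ] W}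
    (hr : FrameRelations o F α₁ α₂) :
    wedgeS F Ω₁ = hodge (k := 1) (m := 5) g o vol (ofFunctional α₁) +
      wedgeS (ofFunctional α₂) ((1 / 2 : ℝ) • wedgeR σ σ) := by
  have k1 := ho.wedge_re_apply h hr
  have k2 := hodge_one_five ho.orthonormal hvol α₁
  have k3 := ho.omegaSq_apply h α₂
  obtain ⟨κ₁, h1⟩ : ∃ κ : V [⋀^Fin 5]→L[ℝ] W, κ = wedgeS F Ω₁ := ⟨_, rfl⟩
  obtain ⟨κ₂, h2⟩ : ∃ κ : V [⋀^Fin 5]→L[ℝ] W,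
    κ = hodge (k := 1) (m := 5) g o vol (ofFunctional α₁) := ⟨_, rfl⟩
  obtain ⟨κ₃, h3⟩ : ∃ κ : V [⋀^Fin 5]→L[ℝ] W,
    κ = wedgeS (ofFunctional α₂) ((1 / 2 : ℝ) • wedgeR σ σ) := ⟨_, rfl⟩
  rw [← h1] at k1 ⊢
  rw [← h2] at k2 ⊢
  rw [← h3] at k3 ⊢
  refine alternating_ext_succAbove o fun i => ?_
  rw [ContinuousAlternatingMap.add_apply, k1, k2, k3, smul_add]

/-- The first component of `u ∧ ū`. -/
theorem wedge_conj (ho : IsSU3Frame g J Ω₁ Ω₂ o) (h : SU3Point g J σ Ω₁ Ω₂)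
    (hvol : vol o = 1) (B : W →ₗ[ℝ] W →ₗ[ℝ] W) (hB : ∀ a b, B a b = -B b a)
    (φ₁ φ₂ : W) (u : V [⋀^Fin 3]→L[ℝ] (W × W))
    (hu : ∀ v, u v = (1 / 4 : ℝ) • (Ω₁ v • (-φ₂, φ₁) + Ω₂ v • (φ₁, φ₂))) (v : Fin 6 → V) :
    (wedge (complexify B) u (conjC.compContinuousAlternatingMap u) v).1 = vol v • B φ₁ φ₂ := by
  have hc : ∀ v, conjC.compContinuousAlternatingMap u v = ((u v).1, -(u v).2) := fun _ => rfl
  have hb : ∀ x y : W × W, (complexify B x y) = (B x.1 y.1 - B x.2 y.2, B x.1 y.2 + B x.2 y.1) :=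
    fun _ _ => rfl
  have hz : ∀ a, B a a = 0 := by
    intro a
    have h0 : (2 : ℝ) • B a a = 0 := by
      rw [two_smul]; nth_rewrite 1 [hB a a]; exact neg_add_cancel _
    exact (smul_eq_zero.mp h0).resolve_left two_ne_zero
  obtain ⟨X, hX⟩ : ∃ X : V [⋀^Fin 6]→L[ℝ] (W × W),
    X = wedge (complexify B) u (conjC.compContinuousAlternatingMap u) := ⟨_, rfl⟩
  have e := wedgeThreeThree_apply (complexify B) u (conjC.compContinuousAlternatingMap u) (o 0)
    (o 1) (o 2) (o 3) (o 4) (o 5)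
  rw [← hX] at e ⊢
  clear hX
  simp only [hc, hb, hu, ho.one, ho.three, ho.five, h.re_J, h.re_J₁, h.re_J₂, h.im_J, h.im_J₁,
    h.im_J₂, map_vec3_eq_zero, ho.re, ho.im] at e
  simp only [← ho.one, ← ho.three, ← ho.five] at e
  -- With Φ = φ₁ + iφ₂ the product is (1/16)B(Φ, Φ̄) Ω̄ ∧ Ω = (1/4)B(φ₁, φ₂) Ω₁ ∧ Ω₂, and Ω₁ ∧ Ω₂
  -- equals 4 on the frame.
  have e' : (X o).1 = B φ₁ φ₂ := by
    rw [coe_eq o]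
    refine (congrArg Prod.fst e).trans ?_
    simp [hz, hB φ₂ φ₁]
    module
  have key : (ContinuousLinearMap.fst ℝ W W).compContinuousAlternatingMap X
      = smulForm vol (B φ₁ φ₂) := by
    refine alternating_top_ext o ?_
    rw [smulForm_apply, hvol, one_smul]
    exact e'
  exact congrArg (fun f : V [⋀^Fin 6]→L[ℝ] W => f v) key

end IsSU3Frame

/-- The Hodge star of a form of top degree. -/
theorem hodge_top {g : V →L[ℝ] V →L[ℝ] ℝ} {o : Module.Basis (Fin 6) ℝ V}
    (ho : OrthonormalFor g o) {vol : V [⋀^Fin 6]→L[ℝ] ℝ} (hvol : vol o = 1)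
    (κ : V [⋀^Fin 6]→L[ℝ] W) (v : Fin 0 → V) :
    hodge (k := 6) (m := 0) g o vol κ v = κ o := by
  rw [Subsingleton.elim v fun a => o (Fin.natAdd 6 a)]
  refine (hodge_orthonormal_eval (k := 6) (m := 0) (n := 6) rfl ho vol hvol κ 1 (s := 1)
    (w := o) ?_ ?_ ?_).trans (one_smul _ _)
  · simp
  · intro a; exact a.elim0
  · intro a; rfl

end Pointwise

/-! ### The strong maximum principle -/

section MaximumPrinciple

open Filter Topology

/-- Were the second derivative positive, the critical point would also be a local minimum. The
function would then be locally constant and its second derivative zero. -/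
theorem deriv_deriv_nonpos_of_isLocalMax {g : ℝ → ℝ} {t : ℝ} (hg : ContinuousAt g t)
    (h : IsLocalMax g t) : deriv (deriv g) t ≤ 0 := by
  by_contra! hpos
  have hmin := isLocalMin_of_deriv_deriv_pos hpos h.deriv_eq_zero hg
  have hc : g =ᶠ[𝓝 t] fun _ => g t := by
    filter_upwards [h, hmin] with s h1 h2 using le_antisymm h1 h2
  have h1 : deriv g =ᶠ[𝓝 t] fun _ => 0 := by
    refine hc.deriv.trans ?_
    simp
  rw [h1.deriv_eq] at hpos
  simp at hpos

variable {E : Type*} [NormedAddCommGroup E] [InnerProductSpace ℝ E]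

/-- Restrict to the line through z in direction d, along which the Hessian becomes a second
derivative of one variable. -/
theorem hessian_nonpos_of_isLocalMax {F : E → ℝ} {z : E} (hF : ContDiffAt ℝ 2 F z)
    (h : IsLocalMax F z) (d : E) : fderiv ℝ (fderiv ℝ F) z d d ≤ 0 := by
  let γ : ℝ → E := fun t => z + t • d
  have hγ : ∀ t, HasDerivAt γ d t := fun t => by
    have := ((hasDerivAt_id t).smul_const d).const_add z
    rwa [one_smul] at this
  have hγ0 : γ 0 = z := by simp [γ]
  have hcont : ContinuousAt γ 0 := (hγ 0).continuousAt
  have hev : ∀ᶠ y in 𝓝 z, DifferentiableAt ℝ F y :=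
    (hF.eventually (by simp)).mono fun y hy => hy.differentiableAt (by simp)
  have h1 : deriv (F ∘ γ) =ᶠ[𝓝 0] fun t => fderiv ℝ F (γ t) d := by
    have hev' : ∀ᶠ t in 𝓝 (0 : ℝ), DifferentiableAt ℝ F (γ t) := by
      have : Tendsto γ (𝓝 0) (𝓝 z) := by simpa [hγ0] using hcont.tendsto
      exact this.eventually hev
    filter_upwards [hev'] with t ht
    exact (ht.hasFDerivAt.comp_hasDerivAt t (hγ t)).deriv
  have hd : DifferentiableAt ℝ (fderiv ℝ F) z :=
    (hF.fderiv_right (m := 1) (by norm_num)).differentiableAt (by simp)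
  have h2 : deriv (deriv (F ∘ γ)) 0 = fderiv ℝ (fderiv ℝ F) z d d := by
    rw [h1.deriv_eq]
    have h3 : HasDerivAt (fun t => fderiv ℝ F (γ t)) (fderiv ℝ (fderiv ℝ F) z d) 0 := by
      have := hd.hasFDerivAt
      rw [← hγ0] at this
      have := this.comp_hasDerivAt 0 (hγ 0)
      rwa [hγ0] at this
    have h4 := ((ContinuousLinearMap.apply ℝ ℝ d).hasFDerivAt.comp_hasDerivAt 0 h3)
    exact h4.deriv
  rw [← h2]
  refine deriv_deriv_nonpos_of_isLocalMax ?_ ?_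
  · exact ContinuousAt.comp (by rw [hγ0]; exact hF.continuousAt) hcont
  · exact IsLocalMax.comp_continuous (by rw [hγ0]; exact h) hcont

/-- The Gaussian `exp (-λ |y - c|²)`. -/
def gaussianBump (r : ℝ) (c : E) (y : E) : ℝ := Real.exp (-r * ‖y - c‖ ^ 2)

theorem gaussianBump_contDiff (r : ℝ) (c : E) : ContDiff ℝ ∞ (gaussianBump r c) :=
  ((contDiff_const.mul ((contDiff_id.sub contDiff_const).norm_sq ℝ))).exp

theorem fderiv_gaussianBump (r : ℝ) (c y d : E) :
    fderiv ℝ (gaussianBump r c) y d = -2 * r * inner ℝ (y - c) d * gaussianBump r c y := by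
  have h : HasFDerivAt (fun y : E => ‖y - c‖ ^ 2) (2 • innerSL ℝ (y - c)) y := by
    simpa using ((hasFDerivAt_id y).sub_const c).norm_sq
  have := ((h.const_mul (-r)).exp).fderiv
  unfold gaussianBump
  rw [this]
  simp only [smul_apply, innerSL_apply_apply, smul_eq_mul, nsmul_eq_mul]
  push_cast
  ring

theorem fderiv_fderiv_gaussianBump (r : ℝ) (c y d e : E) :
    fderiv ℝ (fderiv ℝ (gaussianBump r c)) y d e =
      (4 * r ^ 2 * inner ℝ (y - c) d * inner ℝ (y - c) e - 2 * r * inner ℝ d e) *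
        gaussianBump r c y := by
  have hd : DifferentiableAt ℝ (fderiv ℝ (gaussianBump r c)) y :=
    ((gaussianBump_contDiff r c).fderiv_right (m := 1) (by norm_cast)).differentiable (by simp) y
  have h1 : fderiv ℝ (fderiv ℝ (gaussianBump r c)) y d e =
      fderiv ℝ (fun y => fderiv ℝ (gaussianBump r c) y e) y d := by
    rw [fderiv_clm_apply hd (differentiableAt_const _)]
    simp
  rw [h1]
  simp only [fderiv_gaussianBump]
  have hb : HasFDerivAt (gaussianBump r c) (fderiv ℝ (gaussianBump r c) y) y :=
    ((gaussianBump_contDiff r c).differentiable (by simp) y).hasFDerivAt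
  have hi : HasFDerivAt (fun y : E => inner ℝ (y - c) e) (innerSL ℝ e) y := by
    have : HasFDerivAt (fun y : E => inner ℝ e (y - c)) (innerSL ℝ e) y :=
      (innerSL ℝ e).hasFDerivAt.comp y ((hasFDerivAt_id y).sub_const c)
    simpa [real_inner_comm] using this
  rw [((hi.const_mul (-2 * r)).fun_mul hb).fderiv]
  simp [fderiv_gaussianBump, real_inner_comm]
  ring

variable {ι : Type*} [Fintype ι]

/-- Diagonalisation of the contraction of a bilinear form with CᵀC. Ellipticity is used only through
it: for Hessians at a maximum, and for the positivity of gradient terms. -/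
theorem sum_transpose_mul (C : Matrix ι ι ℝ) {W : Type*} [AddCommGroup W] [Module ℝ W]
    (Q : W →ₗ[ℝ] W →ₗ[ℝ] ℝ) (w : ι → W) :
    ∑ i, ∑ k, (C.transpose * C) i k * Q (w i) (w k) =
      ∑ a, Q (∑ i, C a i • w i) (∑ i, C a i • w i) := by
  simp only [Matrix.mul_apply, Matrix.transpose_apply, map_sum, map_smul,
      LinearMap.sum_apply, LinearMap.smul_apply, smul_eq_mul, Finset.sum_mul, Finset.mul_sum]
  calc _ = ∑ i, ∑ a, ∑ k, C a i * C a k * Q (w i) (w k) :=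
          Finset.sum_congr rfl fun i _ => Finset.sum_comm
      _ = ∑ a, ∑ i, ∑ k, C a i * C a k * Q (w i) (w k) := Finset.sum_comm
      _ = _ := by
          refine Finset.sum_congr rfl fun a _ => ?_
          rw [Finset.sum_comm]
          refine Finset.sum_congr rfl fun i _ => Finset.sum_congr rfl fun k _ => ?_
          ring

/-- Positive definite matrices, in factored form. -/
def IsPosFactored [DecidableEq ι] (A : Matrix ι ι ℝ) : Prop :=
  ∃ C : Matrix ι ι ℝ, IsUnit C.det ∧ A = C.transpose * C

theorem IsPosFactored.sum_nonneg [DecidableEq ι] {A : Matrix ι ι ℝ} (hA : IsPosFactored A)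
    {W : Type*} [AddCommGroup W] [Module ℝ W] (Q : W →ₗ[ℝ] W →ₗ[ℝ] ℝ) (hQ : ∀ w, 0 ≤ Q w w)
    (w : ι → W) : 0 ≤ ∑ i, ∑ k, A i k * Q (w i) (w k) := by
  obtain ⟨C, -, rfl⟩ := hA
  rw [sum_transpose_mul C Q w]
  exact Finset.sum_nonneg fun a _ => hQ _

theorem IsPosFactored.eq_zero_of_sum_eq_zero [DecidableEq ι] {A : Matrix ι ι ℝ}
    (hA : IsPosFactored A) {W : Type*} [AddCommGroup W] [Module ℝ W] (Q : W →ₗ[ℝ] W →ₗ[ℝ] ℝ)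
    (hQ : ∀ w, w ≠ 0 → 0 < Q w w) (w : ι → W) (h0 : ∑ i, ∑ k, A i k * Q (w i) (w k) = 0)
    (i : ι) : w i = 0 := by
  have hQ' : ∀ w, 0 ≤ Q w w := fun w => by
    by_cases hw : w = 0
    · simp [hw]
    · exact (hQ w hw).le
  obtain ⟨C, hC, rfl⟩ := hA
  rw [sum_transpose_mul C Q w, Finset.sum_eq_zero_iff_of_nonneg fun a _ => hQ' _] at h0
  have h1 : ∀ a, ∑ i, C a i • w i = 0 := fun a => by
    by_contra hne
    exact (hQ _ hne).ne' (h0 a (Finset.mem_univ a))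
  -- Since C is invertible, the vanishing of all transformed vectors forces the original ones to
  -- vanish.
  have h2 : ∑ a, C⁻¹ i a • ∑ j, C a j • w j = w i := by
    simp only [Finset.smul_sum, smul_smul]
    rw [Finset.sum_comm]
    simp only [← Finset.sum_smul, ← Matrix.mul_apply, Matrix.nonsing_inv_mul C hC,
      Matrix.one_apply, ite_smul, one_smul, zero_smul, Finset.sum_ite_eq, Finset.mem_univ, if_true]
  rw [← h2]
  simp [h1]

/-- A second order linear differential operator. -/
def ellipticOp (e : ι → E) (A : E → Matrix ι ι ℝ) (b : E → ι → ℝ) (f : E → ℝ) (y : E) : ℝ :=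
  ∑ i, ∑ k, A y i k * fderiv ℝ (fderiv ℝ f) y (e i) (e k) + ∑ i, b y i * fderiv ℝ f y (e i)

theorem ellipticOp_nonpos_of_isLocalMax (e : ι → E) (A : E → Matrix ι ι ℝ) (b : E → ι → ℝ)
    {F : E → ℝ} {z : E} [DecidableEq ι] (hA : IsPosFactored (A z)) (hF : ContDiffAt ℝ 2 F z)
    (h : IsLocalMax F z) :
    ellipticOp e A b F z ≤ 0 := by
  obtain ⟨C, -, hC⟩ := hA
  have h1 : ∑ i, ∑ k, A z i k * fderiv ℝ (fderiv ℝ F) z (e i) (e k) =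
      ∑ a, fderiv ℝ (fderiv ℝ F) z (∑ i, C a i • e i) (∑ i, C a i • e i) := by
    rw [hC]
    exact sum_transpose_mul C (ContinuousLinearMap.toLinearMap₁₂ (fderiv ℝ (fderiv ℝ F) z)) e
  have h2 : ∑ i, b z i * fderiv ℝ F z (e i) = 0 := by
    simp [h.fderiv_eq_zero]
  rw [ellipticOp, h1, h2, add_zero]
  exact Finset.sum_nonpos fun a _ => hessian_nonpos_of_isLocalMax hF h _

/-- The factored form shows why the Gaussian is a barrier: the term with 2r times the quadratic form
in y - c dominates the bracket that does not involve r once r is large, provided y stays away from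
c. -/
theorem ellipticOp_gaussianBump (e : ι → E) (A : E → Matrix ι ι ℝ) (b : E → ι → ℝ) (r : ℝ)
    (c y : E) : ellipticOp e A b (gaussianBump r c) y =
      2 * r * (2 * r * ∑ i, ∑ k, A y i k * (inner ℝ (y - c) (e i) * inner ℝ (y - c) (e k)) -
        (∑ i, ∑ k, A y i k * inner ℝ (e i) (e k) + ∑ i, b y i * inner ℝ (y - c) (e i))) *
          gaussianBump r c y := by
  simp only [ellipticOp, fderiv_gaussianBump, fderiv_fderiv_gaussianBump]
  have h1 : ∀ i k, A y i k * ((4 * r ^ 2 * inner ℝ (y - c) (e i) * inner ℝ (y - c) (e k) -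
      2 * r * inner ℝ (e i) (e k)) * gaussianBump r c y) =
      (4 * r ^ 2 * gaussianBump r c y) *
        (A y i k * (inner ℝ (y - c) (e i) * inner ℝ (y - c) (e k))) -
      (2 * r * gaussianBump r c y) * (A y i k * inner ℝ (e i) (e k)) := fun i k => by ring
  have h2 : ∀ i, b y i * (-2 * r * inner ℝ (y - c) (e i) * gaussianBump r c y) =
      -(2 * r * gaussianBump r c y) * (b y i * inner ℝ (y - c) (e i)) := fun i => by ring
  simp only [h1, h2, Finset.sum_sub_distrib, ← Finset.mul_sum]
  ring

theorem ellipticOp_add_smul (e : ι → E) (A : E → Matrix ι ι ℝ) (b : E → ι → ℝ) {f h : E → ℝ}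
    {y : E} (hf : ContDiffAt ℝ 2 f y) (hh : ContDiffAt ℝ 2 h y) (ε : ℝ) :
    ellipticOp e A b (fun z => f z + ε * h z) y = ellipticOp e A b f y +
      ε * ellipticOp e A b h y := by
  have d1 : ∀ {f : E → ℝ}, ContDiffAt ℝ 2 f y → ∀ᶠ z in 𝓝 y, DifferentiableAt ℝ f z := fun hf =>
    (hf.eventually (by simp)).mono fun y hy => hy.differentiableAt (by simp)
  have d2 : ∀ {f : E → ℝ}, ContDiffAt ℝ 2 f y → DifferentiableAt ℝ (fderiv ℝ f) y := fun hf =>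
    (hf.fderiv_right (m := 1) (by norm_num)).differentiableAt (by simp)
  have h1 : fderiv ℝ (fun z => f z + ε * h z) =ᶠ[𝓝 y] fun z => fderiv ℝ f z + ε • fderiv ℝ h z := by
    filter_upwards [d1 hf, d1 hh] with z hz hz'
    rw [fderiv_fun_add hz (hz'.const_mul ε), fderiv_const_mul hz']
  have h2 : fderiv ℝ (fderiv ℝ (fun z => f z + ε * h z)) y =
      fderiv ℝ (fderiv ℝ f) y + ε • fderiv ℝ (fderiv ℝ h) y := by
    rw [h1.fderiv_eq]
    exact ((d2 hf).hasFDerivAt.add ((d2 hh).hasFDerivAt.const_smul ε)).fderiv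
  simp only [ellipticOp, h2, h1.self_of_nhds, add_apply, smul_apply, smul_eq_mul, mul_add,
    Finset.sum_add_distrib, Finset.mul_sum]
  have e1 : ∀ i k, A y i k * (ε * fderiv ℝ (fderiv ℝ h) y (e i) (e k)) =
    ε * (A y i k * fderiv ℝ (fderiv ℝ h) y (e i) (e k)) := fun i k => by ring
  have e2 : ∀ i, b y i * (ε * fderiv ℝ h y (e i)) = ε * (b y i * fderiv ℝ h y (e i)) :=
    fun i => by ring
  simp only [e1, e2]
  ring

/-- The strong maximum principle of Hopf. -/
theorem eventually_eq_of_ellipticOp_nonneg [FiniteDimensional ℝ E] [DecidableEq ι]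
    (e : Module.Basis ι ℝ E) {A : E → Matrix ι ι ℝ} {b : E → ι → ℝ} {f : E → ℝ} {U : Set E}
    (hU : IsOpen U) (hf : ContDiffOn ℝ 2 f U) (hA : ∀ i k, ContinuousOn (fun y => A y i k) U)
    (hb : ∀ i, ContinuousOn (fun y => b y i) U) (hpos : ∀ y ∈ U, IsPosFactored (A y))
    (hL : ∀ y ∈ U, 0 ≤ ellipticOp e A b f y) {y₀ : E} (hy₀ : y₀ ∈ U)
    (hM : ∀ y ∈ U, f y ≤ f y₀) : ∀ᶠ y in 𝓝 y₀, f y = f y₀ := by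
  obtain ⟨R, hR, hRU⟩ := Metric.nhds_basis_closedBall.mem_iff.mp (hU.mem_nhds hy₀)
  -- With y₁ within R/2 of y₀, every point no farther from y₁ than y₀ is still in the closed ball of
  -- radius R.
  filter_upwards [Metric.ball_mem_nhds y₀ (half_pos hR)] with y₁ hy₁
  by_contra hne
  rw [Metric.mem_ball] at hy₁
  -- a point where `f` is maximal, nearest to `y₁`
  let K := Metric.closedBall y₀ R ∩ f ⁻¹' {f y₀}
  have hfR : ContinuousOn f (Metric.closedBall y₀ R) := hf.continuousOn.mono hRU
  have hK : IsCompact K := (isCompact_closedBall y₀ R).of_isClosed_subset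
    (hfR.preimage_isClosed_of_isClosed Metric.isClosed_closedBall isClosed_singleton)
    Set.inter_subset_left
  have hy₀K : y₀ ∈ K := ⟨Metric.mem_closedBall_self hR.le, rfl⟩
  obtain ⟨z, hzK, hz⟩ := hK.exists_isMinOn ⟨y₀, hy₀K⟩
    (continuous_const.dist continuous_id : Continuous fun y => dist y₁ y).continuousOn
  have hzr : dist y₁ z ≤ dist y₁ y₀ := hz hy₀K
  have hr : 0 < dist y₁ z := dist_pos.mpr fun h => hne (h ▸ hzK.2)
  have hlt : ∀ y, dist y₁ y < dist y₁ z → f y < f y₀ := by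
    intro y hy
    have hyR : y ∈ Metric.closedBall y₀ R := by
      rw [Metric.mem_closedBall]
      linarith [dist_triangle_left y y₀ y₁]
    refine lt_of_le_of_ne (hM y (hRU hyR)) fun h => ?_
    exact absurd (hz (show y ∈ K from ⟨hyR, h⟩)) (not_le.mpr hy)
  have hzU : z ∈ U := hRU hzK.1
  have hfz : f z = f y₀ := hzK.2
  -- a ball touching at `z` only
  set c := midpoint ℝ y₁ z with hc
  set r := dist c z with hrdef
  have hr2 : r = dist y₁ z / 2 := by
    rw [hrdef, hc, dist_midpoint_right]; norm_num; ring
  have hc1 : dist y₁ c = r := by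
    rw [hr2, hc, dist_left_midpoint]; norm_num; ring
  have hr0 : 0 < r := by linarith
  -- The ball about the midpoint lies in the ball about y₁ through z. Its points at full distance
  -- from y₁ attain equality in the triangle inequality, so c is also the midpoint of y₁ and y;
  -- strict convexity then gives y = z.
  have hball : ∀ y, dist c y ≤ r → y ≠ z → f y < f y₀ := by
    intro y hy hyz
    refine hlt y (lt_of_le_of_ne ?_ fun heq => hyz ?_)
    · linarith [dist_triangle y₁ c y]
    · have h1 : dist c y = r := by linarith [dist_triangle y₁ c y]
      have h2 : c = midpoint ℝ y₁ y := by
        refine eq_midpoint_of_dist_eq_half ?_ ?_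
        · rw [hc1, heq]; linarith
        · rw [h1, heq]; linarith
      rw [hc] at h2
      have h3 := (midpoint_eq_midpoint_iff_vsub_eq_vsub ℝ).mp h2
      rw [vsub_self, vsub_eq_sub] at h3
      exact sub_eq_zero.mp h3.symm
  obtain ⟨s', hs', hsU'⟩ := Metric.nhds_basis_closedBall.mem_iff.mp (hU.mem_nhds hzU)
  -- The bound s < r keeps the centre c out of the ball about z, so the quadratic form in y - c has
  -- a positive minimum on it.
  set s := min s' (r / 2) with hs
  have hs0 : 0 < s := lt_min hs' (by linarith)
  have hsr : s < r := lt_of_le_of_lt (min_le_right _ _) (by linarith)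
  have hsU : Metric.closedBall z s ⊆ U :=
    (Metric.closedBall_subset_closedBall (min_le_left _ _)).trans hsU'
  have hcomp := isCompact_closedBall z s
  have hne' : (Metric.closedBall z s).Nonempty := ⟨z, Metric.mem_closedBall_self hs0.le⟩
  have hyc : ∀ y ∈ Metric.closedBall z s, y - c ≠ 0 := by
    intro y hy h0
    rw [sub_eq_zero] at h0
    rw [Metric.mem_closedBall, h0] at hy
    linarith
  -- the constants
  have cont_inner : ∀ i, Continuous fun y : E => inner ℝ (y - c) (e i) := fun i => by fun_prop
  obtain ⟨μ, hμ0, hμ⟩ : ∃ μ > 0, ∀ y ∈ Metric.closedBall z s, μ ≤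
      ∑ i, ∑ k, A y i k * (inner ℝ (y - c) (e i) * inner ℝ (y - c) (e k)) := by
    have hcont : ContinuousOn (fun y => ∑ i, ∑ k, A y i k *
        (inner ℝ (y - c) (e i) * inner ℝ (y - c) (e k))) (Metric.closedBall z s) :=
      continuousOn_finsetSum _ fun i _ => continuousOn_finsetSum _ fun k _ =>
        ((hA i k).mono hsU).mul ((cont_inner i).mul (cont_inner k)).continuousOn
    obtain ⟨y, hy, hmin⟩ := hcomp.exists_isMinOn hne' hcont
    refine ⟨_, ?_, fun w hw => hmin hw⟩
    have hp := hpos y (hsU hy)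
    have hQ : ∀ w : ℝ, 0 ≤ LinearMap.mul ℝ ℝ w w := fun w => mul_self_nonneg w
    refine lt_of_le_of_ne (hp.sum_nonneg (LinearMap.mul ℝ ℝ) hQ _) fun h0 => hyc y hy ?_
    refine InnerProductSpace.ext_inner_right_basis (𝕜 := ℝ) e fun i => ?_
    rw [inner_zero_left]
    exact hp.eq_zero_of_sum_eq_zero (LinearMap.mul ℝ ℝ) (fun w hw => mul_self_pos.mpr hw)
      (fun i => inner ℝ (y - c) (e i)) h0.symm i
  obtain ⟨D, hD⟩ : ∃ D, ∀ y ∈ Metric.closedBall z s,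
      ∑ i, ∑ k, A y i k * inner ℝ (e i) (e k) + ∑ i, b y i * inner ℝ (y - c) (e i) ≤ D := by
    have hcont : ContinuousOn (fun y => ∑ i, ∑ k, A y i k * inner ℝ (e i) (e k) +
        ∑ i, b y i * inner ℝ (y - c) (e i)) (Metric.closedBall z s) :=
      (continuousOn_finsetSum _ fun i _ => continuousOn_finsetSum _ fun k _ =>
        ((hA i k).mono hsU).mul continuousOn_const).add
      (continuousOn_finsetSum _ fun i _ => ((hb i).mono hsU).mul (cont_inner i).continuousOn)
    obtain ⟨y, hy, hmax⟩ := hcomp.exists_isMaxOn hne' hcont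
    exact ⟨_, fun w hw => hmax hw⟩
  -- The Gaussian exponent is taken so large that the second order term, bounded below by μ, beats
  -- the bound D of all the others.
  obtain ⟨q, hq0, hq⟩ : ∃ q : ℝ, 0 < q ∧ D < 2 * q * μ := by
    refine ⟨(|D| + 1) / (2 * μ), by positivity, ?_⟩
    have : 2 * ((|D| + 1) / (2 * μ)) * μ = |D| + 1 := by field_simp
    linarith [le_abs_self D]
  set h := gaussianBump q c with hh
  have hcd : ∀ y, ContDiffAt ℝ 2 h y := fun y =>
    ((gaussianBump_contDiff q c).of_le (by norm_cast)).contDiffAt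
  have hLh : ∀ y ∈ Metric.closedBall z s, 0 < ellipticOp e A b h y := by
    intro y hy
    rw [ellipticOp_gaussianBump]
    have h1 := hμ y hy
    have h2 := hD y hy
    have h3 : 2 * q * μ ≤ 2 * q *
        ∑ i, ∑ k, A y i k * (inner ℝ (y - c) (e i) * inner ℝ (y - c) (e k)) :=
      mul_le_mul_of_nonneg_left h1 (by positivity)
    have h4 : 0 < gaussianBump q c y := Real.exp_pos _
    refine mul_pos (mul_pos (by positivity) ?_) h4
    linarith
  -- the perturbed function has an interior maximum
  have hcf : ContinuousOn f (Metric.closedBall z s) := hf.continuousOn.mono hsU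
  have hch : Continuous h := (gaussianBump_contDiff q c).continuous
  have hhz : ∀ y, r < dist c y → h y < h z := by
    intro y hy
    refine Real.exp_lt_exp.mpr ?_
    have h1 : ‖z - c‖ = r := by rw [← dist_eq_norm, dist_comm]
    have h2 : r < ‖y - c‖ := by rwa [← dist_eq_norm, dist_comm]
    rw [h1]
    have : r ^ 2 < ‖y - c‖ ^ 2 := by gcongr
    nlinarith
  -- On the part of the sphere inside the touching ball, compactness gives a gap between f and its
  -- maximum, and this gap serves as ε because the bump is at most 1. On the rest f is at most its
  -- maximum, while the bump is smaller than at z.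
  obtain ⟨ε, hε, hεs⟩ : ∃ ε > 0, ∀ y ∈ Metric.sphere z s, f y + ε * h y ≤ f z + ε * h z := by
    by_cases hS : (Metric.sphere z s ∩ Metric.closedBall c r).Nonempty
    · have hSc : IsCompact (Metric.sphere z s ∩ Metric.closedBall c r) :=
        (isCompact_sphere z s).inter_right Metric.isClosed_closedBall
      obtain ⟨y, hy, hmax⟩ := hSc.exists_isMaxOn hS
        (hcf.mono fun w hw => Metric.sphere_subset_closedBall hw.1)
      have hyz : y ≠ z := fun h0 => by
        have := hy.1; rw [h0, Metric.mem_sphere, dist_self] at this; linarith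
      have hy1 := hball y (by rw [dist_comm]; exact hy.2) hyz
      refine ⟨f y₀ - f y, by linarith, fun w hw => ?_⟩
      by_cases hwr : dist c w ≤ r
      · have h1 : f w ≤ f y := hmax ⟨hw, by rw [Metric.mem_closedBall, dist_comm]; exact hwr⟩
        have h2 : h w ≤ 1 := Real.exp_le_one_iff.mpr (by
          have : 0 ≤ q * ‖w - c‖ ^ 2 := by positivity
          linarith)
        have h3 : 0 < h z := Real.exp_pos _
        have h4 : (f y₀ - f y) * h w ≤ (f y₀ - f y) * 1 :=
          mul_le_mul_of_nonneg_left h2 (by linarith)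
        have h5 : 0 ≤ (f y₀ - f y) * h z := mul_nonneg (by linarith) h3.le
        linarith
      · have h1 := hhz w (not_le.mp hwr)
        have h2 := hM w (hsU (Metric.sphere_subset_closedBall hw))
        have h4 : (f y₀ - f y) * h w ≤ (f y₀ - f y) * h z :=
          mul_le_mul_of_nonneg_left h1.le (by linarith)
        linarith
    · refine ⟨1, one_pos, fun w hw => ?_⟩
      have hwr : ¬ dist c w ≤ r := fun h0 => hS ⟨w, hw, by
        rw [Metric.mem_closedBall, dist_comm]; exact h0⟩
      have h1 := hhz w (not_le.mp hwr)
      have h2 := hM w (hsU (Metric.sphere_subset_closedBall hw))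
      linarith
  obtain ⟨w, hw, hwmax⟩ := hcomp.exists_isMaxOn hne'
    (hcf.add (continuousOn_const.mul hch.continuousOn) : ContinuousOn (fun y => f y + ε * h y) _)
  obtain ⟨w, hw, hwmax⟩ : ∃ w ∈ Metric.ball z s,
      ∀ y ∈ Metric.closedBall z s, f y + ε * h y ≤ f w + ε * h w := by
    -- A maximum point on the sphere can be replaced by the centre z, so an interior one always
    -- exists.
    by_cases hws : w ∈ Metric.sphere z s
    · exact ⟨z, Metric.mem_ball_self hs0, fun y hy => (hwmax hy).trans (hεs w hws)⟩
    · refine ⟨w, ?_, fun y hy => hwmax hy⟩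
      exact lt_of_le_of_ne hw hws
  have hwc := Metric.ball_subset_closedBall hw
  have hloc : IsLocalMax (fun y => f y + ε * h y) w := by
    filter_upwards [Metric.isOpen_ball.mem_nhds hw] with y hy
    exact hwmax y (Metric.ball_subset_closedBall hy)
  have hfw : ContDiffAt ℝ 2 f w := hf.contDiffAt (hU.mem_nhds (hsU hwc))
  have h1 := ellipticOp_nonpos_of_isLocalMax e A b (hpos w (hsU hwc))
    (hfw.add (contDiffAt_const.mul (hcd w))) hloc
  -- At the interior maximum the operator is nonpositive on f + εh, although it is nonnegative on f
  -- and positive on h.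
  rw [ellipticOp_add_smul e A b hfw (hcd w) ε] at h1
  have h2 := hL w (hsU hwc)
  have h3 := mul_pos hε (hLh w hwc)
  linarith

end MaximumPrinciple

/-! ### Derivatives of maps between manifolds with their values in the model spaces -/

section ManifoldCalculus

open Filter Topology

variable {E E' E'' : Type*} [NormedAddCommGroup E] [NormedSpace ℝ E]
  [NormedAddCommGroup E'] [NormedSpace ℝ E'] [NormedAddCommGroup E''] [NormedSpace ℝ E'']
  {M M' M'' : Type*} [TopologicalSpace M] [ChartedSpace E M] [TopologicalSpace M']
  [ChartedSpace E' M'] [TopologicalSpace M''] [ChartedSpace E'' M'']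

/-- The derivative of a map of manifolds, as a map of the model vector spaces. -/
def mD (E E' : Type*) [NormedAddCommGroup E] [NormedSpace ℝ E] [NormedAddCommGroup E']
    [NormedSpace ℝ E'] {M M' : Type*} [TopologicalSpace M] [ChartedSpace E M] [TopologicalSpace M']
    [ChartedSpace E' M'] (f : M → M') (x : M) : E →L[ℝ] E' := mfderiv 𝓘(ℝ, E) 𝓘(ℝ, E') f x

theorem mD_comp {g : M' → M''} {f : M → M'} {x : M}
    (hg : MDifferentiableAt 𝓘(ℝ, E') 𝓘(ℝ, E'') g (f x))
    (hf : MDifferentiableAt 𝓘(ℝ, E) 𝓘(ℝ, E') f x) :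
    mD E E'' (fun y => g (f y)) x = (mD E' E'' g (f x)).comp (mD E E' f x) :=
  mfderiv_comp x hg hf

theorem mD_comp_of_eq {g : M' → M''} {f : M → M'} {x : M} {y : M'} (hy : f x = y)
    (hg : MDifferentiableAt 𝓘(ℝ, E') 𝓘(ℝ, E'') g y)
    (hf : MDifferentiableAt 𝓘(ℝ, E) 𝓘(ℝ, E') f x) :
    mD E E'' (fun y => g (f y)) x = (mD E' E'' g y).comp (mD E E' f x) := by
  subst hy
  exact mD_comp hg hf

theorem mD_eq_fderiv (f : E → E') (x : E) : mD E E' f x = fderiv ℝ f x := mfderiv_eq_fderiv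

theorem mD_congr {f g : M → M'} {x : M} (h : f =ᶠ[𝓝 x] g) : mD E E' f x = mD E E' g x :=
  h.mfderiv_eq

theorem mD_id (x : M) : mD E E (fun y : M => y) x = ContinuousLinearMap.id ℝ E :=
  mfderiv_id

theorem mD_const (c : M') (x : M) : mD E E' (fun _ : M => c) x = 0 :=
  mfderiv_const

section Charts

variable [IsManifold 𝓘(ℝ, E) ∞ M]

theorem mdiff_chart {x₀ x : M} (hx : x ∈ (extChartAt 𝓘(ℝ, E) x₀).source) :
    MDifferentiableAt 𝓘(ℝ, E) 𝓘(ℝ, E) (extChartAt 𝓘(ℝ, E) x₀) x :=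
  mdifferentiableAt_extChartAt (by rwa [extChartAt_source] at hx)

theorem chart_target_mem {x₀ : M} {y : E} (hy : y ∈ (extChartAt 𝓘(ℝ, E) x₀).target) :
    (extChartAt 𝓘(ℝ, E) x₀).target ∈ 𝓝 y :=
  (isOpen_extChartAt_target x₀).mem_nhds hy

theorem contMDiffAt_chart_symm {x₀ : M} {y : E} (hy : y ∈ (extChartAt 𝓘(ℝ, E) x₀).target) :
    ContMDiffAt 𝓘(ℝ, E) 𝓘(ℝ, E) ∞ (extChartAt 𝓘(ℝ, E) x₀).symm y :=
  (contMDiffOn_extChartAt_symm x₀).contMDiffAt (chart_target_mem hy)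

theorem mdiff_chart_symm {x₀ : M} {y : E} (hy : y ∈ (extChartAt 𝓘(ℝ, E) x₀).target) :
    MDifferentiableAt 𝓘(ℝ, E) 𝓘(ℝ, E) (extChartAt 𝓘(ℝ, E) x₀).symm y :=
  (contMDiffAt_chart_symm hy).mdifferentiableAt (by simp)

theorem mD_chart_comp_symm {x₀ : M} {y : E} (hy : y ∈ (extChartAt 𝓘(ℝ, E) x₀).target) :
    (mD E E (extChartAt 𝓘(ℝ, E) x₀) ((extChartAt 𝓘(ℝ, E) x₀).symm y)).comp
      (mD E E (extChartAt 𝓘(ℝ, E) x₀).symm y) = ContinuousLinearMap.id ℝ E := by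
  rw [← mD_comp (mdiff_chart ((extChartAt 𝓘(ℝ, E) x₀).map_target hy)) (mdiff_chart_symm hy),
    ← mD_id (E := E) (M := E) y]
  refine mD_congr ?_
  filter_upwards [chart_target_mem hy] with z hz using (extChartAt 𝓘(ℝ, E) x₀).right_inv hz

theorem mD_symm_comp_chart {x₀ x : M} (hx : x ∈ (extChartAt 𝓘(ℝ, E) x₀).source) :
    (mD E E (extChartAt 𝓘(ℝ, E) x₀).symm (extChartAt 𝓘(ℝ, E) x₀ x)).comp
      (mD E E (extChartAt 𝓘(ℝ, E) x₀) x) = ContinuousLinearMap.id ℝ E := by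
  rw [← mD_comp (mdiff_chart_symm ((extChartAt 𝓘(ℝ, E) x₀).map_source hx)) (mdiff_chart hx),
    ← mD_id (E := E) x]
  refine mD_congr ?_
  filter_upwards [(isOpen_extChartAt_source (I := 𝓘(ℝ, E)) x₀).mem_nhds hx] with z hz
    using (extChartAt 𝓘(ℝ, E) x₀).left_inv hz

/-- The tangent space at x is identified with the model space by the preferred chart at x. For this
reason the derivatives at the base point can be omitted when `extDer` is compared with a computation
in that chart. -/
theorem mD_chart_self (x : M) : mD E E (extChartAt 𝓘(ℝ, E) x) x = ContinuousLinearMap.id ℝ E :=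
  mfderiv_extChartAt_self

theorem mD_chart_symm_self (x : M) :
    mD E E (extChartAt 𝓘(ℝ, E) x).symm (extChartAt 𝓘(ℝ, E) x x) = ContinuousLinearMap.id ℝ E := by
  have h := mD_symm_comp_chart (mem_extChartAt_source (I := 𝓘(ℝ, E)) x)
  rwa [mD_chart_self, ContinuousLinearMap.comp_id] at h

end Charts
end ManifoldCalculus

/-! ### The adjoint action and its derivative -/

section LieGroupCalculus

open Filter Topology

variable {n : ℕ} {G : Type*} [TopologicalSpace G] [ChartedSpace (Euc n) G] [Group G]

theorem Ad_eq_mD (g : G) : (Ad g : Euc n →L[ℝ] Euc n) = mD (Euc n) (Euc n)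
    (fun h : G => g * h * g⁻¹) 1 := rfl

variable [LieGroup (𝓡 n) ∞ G]

instance : IsManifold 𝓘(ℝ, Euc n) ∞ G := (inferInstance : LieGroup (𝓡 n) ∞ G).toIsManifold

theorem contMDiff_conj (g : G) : ContMDiff 𝓘(ℝ, Euc n) 𝓘(ℝ, Euc n) ∞ (fun h : G => g * h * g⁻¹) :=
  (contMDiff_const.mul contMDiff_id).mul contMDiff_const

theorem mdiff_mul_left (g h : G) :
    MDifferentiableAt 𝓘(ℝ, Euc n) 𝓘(ℝ, Euc n) (fun h : G => g * h) h :=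
  ((contMDiff_const.mul contMDiff_id : ContMDiff 𝓘(ℝ, Euc n) 𝓘(ℝ, Euc n) ∞
    (fun h : G => g * h)) h).mdifferentiableAt (by simp)

theorem mdiff_mul_right (g h : G) :
    MDifferentiableAt 𝓘(ℝ, Euc n) 𝓘(ℝ, Euc n) (fun h : G => h * g) h :=
  ((contMDiff_id.mul contMDiff_const : ContMDiff 𝓘(ℝ, Euc n) 𝓘(ℝ, Euc n) ∞
    (fun h : G => h * g)) h).mdifferentiableAt (by simp)

theorem mdiff_conj (g h : G) :
    MDifferentiableAt 𝓘(ℝ, Euc n) 𝓘(ℝ, Euc n) (fun h : G => g * h * g⁻¹) h :=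
  (contMDiff_conj g h).mdifferentiableAt (by simp)

theorem Ad_mul (g h : G) : (Ad (g * h) : Euc n →L[ℝ] Euc n) = (Ad g).comp (Ad h) := by
  rw [Ad_eq_mD, Ad_eq_mD, Ad_eq_mD, ← mD_comp_of_eq (by simp) (mdiff_conj g 1) (mdiff_conj h 1)]
  congr 1
  funext x
  group

theorem Ad_one : (Ad (1 : G) : Euc n →L[ℝ] Euc n) = ContinuousLinearMap.id ℝ _ := by
  rw [Ad_eq_mD, ← mD_id (E := Euc n) (1 : G)]
  congr 1
  funext x
  simp

theorem Ad_inv_apply (g : G) (a : Euc n) : Ad g⁻¹ (Ad g a) = a := by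
  have h := Ad_mul (n := n) g⁻¹ g
  rw [inv_mul_cancel, Ad_one] at h
  exact (congrArg (fun f : Euc n →L[ℝ] Euc n => f a) h).symm

theorem Ad_apply_inv (g : G) (a : Euc n) : Ad g (Ad g⁻¹ a) = a := by
  have h := Ad_inv_apply (n := n) g⁻¹ a
  rwa [inv_inv] at h

/-- The derivative at 1 of a smooth family of maps is smooth in tangent coordinates. All
conjugations fix 1, so source and target base points are constant and both coordinate changes are
identities. -/
theorem contMDiff_Ad : ContMDiff 𝓘(ℝ, Euc n) 𝓘(ℝ, Euc n →L[ℝ] Euc n) ∞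
    (fun g : G => (Ad g : Euc n →L[ℝ] Euc n)) := by
  intro g₀
  have h1 : ContMDiffAt (𝓘(ℝ, Euc n).prod 𝓘(ℝ, Euc n)) 𝓘(ℝ, Euc n) ∞
      (Function.uncurry fun g h : G => g * h * g⁻¹) (g₀, 1) :=
    ((contMDiff_fst.mul contMDiff_snd).mul contMDiff_fst.inv).contMDiffAt
  have h2 := h1.mfderiv (m := ∞) (fun g h : G => g * h * g⁻¹) (fun _ => (1 : G))
    contMDiffAt_const (by simp)
  change ContMDiffAt _ _ _ (inTangentCoordinates 𝓘(ℝ, Euc n) 𝓘(ℝ, Euc n) (fun _ => (1 : G))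
    (fun x : G => x * 1 * x⁻¹) (fun g : G => (Ad g : Euc n →L[ℝ] Euc n)) g₀) g₀ at h2
  rw [show (fun x : G => x * 1 * x⁻¹) = fun _ => 1 by funext x; simp] at h2
  refine h2.congr_of_eventuallyEq (Eventually.of_forall fun g => ?_)
  have h3 := inTangentCoordinates_eq (I := 𝓘(ℝ, Euc n)) (I' := 𝓘(ℝ, Euc n)) (fun _ : G => (1 : G))
    (fun _ : G => (1 : G)) (fun g : G => (Ad g : Euc n →L[ℝ] Euc n)) (x₀ := g₀) (x := g)
    (mem_chart_source _ _) (mem_chart_source _ _)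
  refine Eq.trans ?_ h3.symm
  have h4 : ∀ v, (tangentBundleCore 𝓘(ℝ, Euc n) G).coordChange (achart (Euc n) 1)
      (achart (Euc n) 1) 1 v = v := fun v =>
    (tangentBundleCore 𝓘(ℝ, Euc n) G).coordChange_self (achart _ 1) 1 (mem_achart_source _ 1) v
  ext1 v
  exact (by rw [h4, h4] : Ad g v = (tangentBundleCore 𝓘(ℝ, Euc n) G).coordChange (achart (Euc n) 1)
      (achart (Euc n) 1) 1 (Ad g ((tangentBundleCore 𝓘(ℝ, Euc n) G).coordChange
        (achart (Euc n) 1) (achart (Euc n) 1) 1 v)))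

/-- The multiplication of a Lie group in the chart around the identity. -/
def chartMul (n : ℕ) (G : Type*) [TopologicalSpace G] [ChartedSpace (Euc n) G] [Group G]
    (q : Euc n × Euc n) : Euc n :=
  extChartAt 𝓘(ℝ, Euc n) (1 : G)
    ((extChartAt 𝓘(ℝ, Euc n) (1 : G)).symm q.1 * (extChartAt 𝓘(ℝ, Euc n) (1 : G)).symm q.2)

/-- The chart around the identity. -/
local notation "φG" => extChartAt 𝓘(ℝ, Euc n) (1 : G)

/-- The identity in the chart around the identity. -/
local notation "oneG" => extChartAt 𝓘(ℝ, Euc n) (1 : G) (1 : G)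

theorem one_mem_target : oneG ∈ (φG).target := mem_extChartAt_target (I := 𝓘(ℝ, Euc n)) (1 : G)

theorem chart_symm_one : (φG).symm oneG = 1 := extChartAt_to_inv (I := 𝓘(ℝ, Euc n)) (1 : G)

theorem contDiffAt_chartMul : ContDiffAt ℝ ∞ (chartMul n G) (oneG, oneG) := by
  rw [← contMDiffAt_iff_contDiffAt]
  have h1 : ContMDiffAt 𝓘(ℝ, Euc n × Euc n) 𝓘(ℝ, Euc n) ∞
      (fun q : Euc n × Euc n => (φG).symm q.1) (oneG, oneG) :=
    ContMDiffAt.comp (I' := 𝓘(ℝ, Euc n)) (g := (φG).symm) (f := fun q : Euc n × Euc n => q.1)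
      (oneG, oneG) (contMDiffAt_chart_symm (one_mem_target (n := n) (G := G)))
      (contDiff_fst.contMDiff.contMDiffAt)
  have h2 : ContMDiffAt 𝓘(ℝ, Euc n × Euc n) 𝓘(ℝ, Euc n) ∞
      (fun q : Euc n × Euc n => (φG).symm q.2) (oneG, oneG) :=
    ContMDiffAt.comp (I' := 𝓘(ℝ, Euc n)) (g := (φG).symm) (f := fun q : Euc n × Euc n => q.2)
      (oneG, oneG) (contMDiffAt_chart_symm (one_mem_target (n := n) (G := G)))
      (contDiff_snd.contMDiff.contMDiffAt)
  refine ContMDiffAt.comp (g := φG) (I' := 𝓘(ℝ, Euc n)) (oneG, oneG) ?_ (h1.mul h2)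
  refine contMDiffAt_extChartAt' ?_
  simp only [chart_symm_one, mul_one]
  exact mem_chart_source _ _

theorem fderiv_chartMul_snd {x : Euc n} (hx : x ∈ (φG).target)
    (hd : DifferentiableAt ℝ (chartMul n G) (x, oneG)) (ξ : Euc n) :
    fderiv ℝ (chartMul n G) (x, oneG) (0, ξ) = mD (Euc n) (Euc n) φG ((φG).symm x)
      (mD (Euc n) (Euc n) (fun h : G => (φG).symm x * h) 1 ξ) := by
  have h1 : HasFDerivAt (fun y : Euc n => chartMul n G (x, y))
      ((fderiv ℝ (chartMul n G) (x, oneG)).comp (ContinuousLinearMap.inr ℝ _ _)) oneG :=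
    hd.hasFDerivAt.comp oneG (hasFDerivAt_prodMk_right x oneG)
  have h2 : fderiv ℝ (fun y : Euc n => chartMul n G (x, y)) oneG =
      (mD (Euc n) (Euc n) φG ((φG).symm x)).comp
        (mD (Euc n) (Euc n) (fun h : G => (φG).symm x * h) 1) := by
    rw [← mD_eq_fderiv]
    have hs : ((φG).symm x) ∈ (φG).source := (φG).map_target hx
    have e1 : mD (Euc n) (Euc n) (fun y : Euc n => (φG).symm x * (φG).symm y) oneG =
        mD (Euc n) (Euc n) (fun h : G => (φG).symm x * h) 1 := by
      rw [mD_comp_of_eq (g := fun h : G => (φG).symm x * h) (chart_symm_one (n := n) (G := G))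
        (mdiff_mul_left _ _) (mdiff_chart_symm one_mem_target), mD_chart_symm_self,
        ContinuousLinearMap.comp_id]
    rw [← e1]
    refine mD_comp_of_eq (g := φG) (f := fun y : Euc n => (φG).symm x * (φG).symm y)
      (by simp only [chart_symm_one, mul_one]) (mdiff_chart hs) ?_
    exact MDifferentiableAt.comp (I' := 𝓘(ℝ, Euc n)) oneG (mdiff_mul_left _ _)
      (mdiff_chart_symm one_mem_target)
  refine Eq.trans ?_ (congrArg (fun f : Euc n →L[ℝ] Euc n => f ξ) h2)
  rw [h1.fderiv]
  rfl

theorem fderiv_chartMul_fst {x : Euc n} (hx : x ∈ (φG).target)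
    (hd : DifferentiableAt ℝ (chartMul n G) (oneG, x)) (ξ : Euc n) :
    fderiv ℝ (chartMul n G) (oneG, x) (ξ, 0) = mD (Euc n) (Euc n) φG ((φG).symm x)
      (mD (Euc n) (Euc n) (fun h : G => h * (φG).symm x) 1 ξ) := by
  have h1 : HasFDerivAt (fun y : Euc n => chartMul n G (y, x))
      ((fderiv ℝ (chartMul n G) (oneG, x)).comp (ContinuousLinearMap.inl ℝ _ _)) oneG :=
    HasFDerivAt.comp (f := fun y => (y, x)) oneG hd.hasFDerivAt (hasFDerivAt_prodMk_left oneG x)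
  have h2 : fderiv ℝ (fun y : Euc n => chartMul n G (y, x)) oneG =
      (mD (Euc n) (Euc n) φG ((φG).symm x)).comp
        (mD (Euc n) (Euc n) (fun h : G => h * (φG).symm x) 1) := by
    rw [← mD_eq_fderiv]
    have hs : ((φG).symm x) ∈ (φG).source := (φG).map_target hx
    have e1 : mD (Euc n) (Euc n) (fun y : Euc n => (φG).symm y * (φG).symm x) oneG =
        mD (Euc n) (Euc n) (fun h : G => h * (φG).symm x) 1 := by
      rw [mD_comp_of_eq (g := fun h : G => h * (φG).symm x) (chart_symm_one (n := n) (G := G))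
        (mdiff_mul_right _ _) (mdiff_chart_symm one_mem_target), mD_chart_symm_self,
        ContinuousLinearMap.comp_id]
    rw [← e1]
    refine mD_comp_of_eq (g := φG) (f := fun y : Euc n => (φG).symm y * (φG).symm x)
      (by simp only [chart_symm_one, one_mul]) (mdiff_chart hs) ?_
    exact MDifferentiableAt.comp (I' := 𝓘(ℝ, Euc n)) oneG (mdiff_mul_right _ _)
      (mdiff_chart_symm one_mem_target)
  refine Eq.trans ?_ (congrArg (fun f : Euc n →L[ℝ] Euc n => f ξ) h2)
  rw [h1.fderiv]
  rfl

/-- Differentiate (g h g⁻¹) g = g h at h = 1. -/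
theorem mD_mul_right_Ad (g : G) (a : Euc n) :
    mD (Euc n) (Euc n) (fun h : G => h * g) 1 (Ad g a) =
      mD (Euc n) (Euc n) (fun h : G => g * h) 1 a := by
  rw [Ad_eq_mD]
  have h := mD_comp_of_eq (E := Euc n) (E' := Euc n) (E'' := Euc n) (x := (1 : G)) (y := 1)
      (f := fun h : G => g * h * g⁻¹) (g := fun h : G => h * g)
    (show g * 1 * g⁻¹ = 1 by simp) (mdiff_mul_right g 1) (mdiff_conj g 1)
  simp only [inv_mul_cancel_right] at h
  rw [h]
  rfl

theorem eventually_chartMul_diff : ∀ᶠ q in 𝓝 (oneG, oneG), DifferentiableAt ℝ (chartMul n G) q :=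
  (((contDiffAt_chartMul (n := n) (G := G)).of_le (m := 1) (by norm_cast)).eventually
    (by simp)).mono fun q hq => hq.differentiableAt (by simp)

theorem fderiv_chartMul_fst_one (ξ : Euc n) :
    fderiv ℝ (chartMul n G) (oneG, oneG) (ξ, 0) = ξ := by
  rw [fderiv_chartMul_fst one_mem_target (eventually_chartMul_diff (n := n) (G := G)).self_of_nhds,
    chart_symm_one]
  simp only [mul_one, mD_id, mD_chart_self]
  rfl

theorem fderiv_chartMul_snd_one (ξ : Euc n) :
    fderiv ℝ (chartMul n G) (oneG, oneG) (0, ξ) = ξ := by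
  rw [fderiv_chartMul_snd one_mem_target (eventually_chartMul_diff (n := n) (G := G)).self_of_nhds,
    chart_symm_one]
  simp only [one_mul, mD_id, mD_chart_self]
  rfl

theorem hasFDerivAt_fderiv_chartMul : HasFDerivAt (fderiv ℝ (chartMul n G))
    (fderiv ℝ (fderiv ℝ (chartMul n G)) (oneG, oneG)) (oneG, oneG) :=
  (((contDiffAt_chartMul (n := n) (G := G)).fderiv_right (m := 1) (by norm_cast)).differentiableAt
    (by simp)).hasFDerivAt

theorem hasFDerivAt_chartMul_snd (a : Euc n) :
    HasFDerivAt (fun x => fderiv ℝ (chartMul n G) (x, oneG) (0, a))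
      (((fderiv ℝ (fderiv ℝ (chartMul n G)) (oneG, oneG)).flip (0, a)).comp
        (ContinuousLinearMap.inl ℝ _ _)) oneG := by
  have h := HasFDerivAt.comp (f := fun x => (x, oneG)) oneG
    (hasFDerivAt_fderiv_chartMul (n := n) (G := G)) (hasFDerivAt_prodMk_left oneG oneG)
  exact ((ContinuousLinearMap.apply ℝ (Euc n) ((0 : Euc n), a)).hasFDerivAt).comp oneG h

/-- The derivative of the adjoint representation is the bracket. -/
theorem lieBr_eq_fderiv (ξ a : Euc n) : lieBr n G ξ a =
    fderiv ℝ (fderiv ℝ (chartMul n G)) (oneG, oneG) (ξ, 0) (0, a) -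
      fderiv ℝ (fderiv ℝ (chartMul n G)) (oneG, oneG) (a, 0) (0, ξ) := by
  -- In the chart, the left-invariant field of ξ is the second partial derivative of the
  -- multiplication at (x, 1), so the Lie bracket is read off from second derivatives of the
  -- multiplication.
  have key : ∀ ξ : Euc n, VectorField.mpullbackWithin 𝓘(ℝ, Euc n) 𝓘(ℝ, Euc n) (φG).symm
      (mulInvariantVectorField (I := 𝓘(ℝ, Euc n)) (G := G) ξ) (Set.range 𝓘(ℝ, Euc n)) =ᶠ[𝓝 oneG]
      fun x => fderiv ℝ (chartMul n G) (x, oneG) (0, ξ) := by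
    intro ξ
    have hc : Tendsto (fun x : Euc n => (x, oneG)) (𝓝 oneG) (𝓝 (oneG, oneG)) :=
      (Continuous.prodMk_left _).tendsto _
    filter_upwards [chart_target_mem (one_mem_target (n := n) (G := G)),
      hc.eventually (eventually_chartMul_diff (n := n) (G := G))] with x hx hd
    rw [fderiv_chartMul_snd hx hd]
    have e1 := mD_chart_comp_symm hx
    have e2 := mD_symm_comp_chart ((φG).map_target hx)
    rw [(φG).right_inv hx] at e2
    have e3 : (mD (Euc n) (Euc n) (φG).symm x).inverse = mD (Euc n) (Euc n) φG ((φG).symm x) :=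
      ContinuousLinearMap.inverse_eq e2 e1
    rw [← e3]
    rw [VectorField.mpullbackWithin_apply, ModelWithCorners.range_eq_univ, mfderivWithin_univ]
    rfl
  have h1 : lieBr n G ξ a = VectorField.lieBracket ℝ
      (fun x => fderiv ℝ (chartMul n G) (x, oneG) (0, ξ))
      (fun x => fderiv ℝ (chartMul n G) (x, oneG) (0, a)) oneG := by
    rw [← ((key ξ).lieBracket_vectorField_eq (key a))]
    have h0 : (mD (Euc n) (Euc n) φG 1).inverse = ContinuousLinearMap.id ℝ _ := by
      rw [mD_chart_self, ContinuousLinearMap.inverse_id]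
    have h2 : lieBr n G ξ a = (mD (Euc n) (Euc n) φG 1).inverse (VectorField.lieBracketWithin ℝ
      (VectorField.mpullbackWithin 𝓘(ℝ, Euc n) 𝓘(ℝ, Euc n) (φG).symm
        (mulInvariantVectorField (I := 𝓘(ℝ, Euc n)) (G := G) ξ) (Set.range 𝓘(ℝ, Euc n)))
      (VectorField.mpullbackWithin 𝓘(ℝ, Euc n) 𝓘(ℝ, Euc n) (φG).symm
        (mulInvariantVectorField (I := 𝓘(ℝ, Euc n)) (G := G) a) (Set.range 𝓘(ℝ, Euc n)))
      ((φG).symm ⁻¹' Set.univ ∩ Set.range 𝓘(ℝ, Euc n)) oneG) := rfl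
    rw [h2, h0, Set.preimage_univ, ModelWithCorners.range_eq_univ, Set.univ_inter]
    exact congrFun VectorField.lieBracketWithin_univ _
  rw [h1, VectorField.lieBracket, (hasFDerivAt_chartMul_snd a).fderiv,
    (hasFDerivAt_chartMul_snd ξ).fderiv, fderiv_chartMul_snd_one, fderiv_chartMul_snd_one]
  rfl

/-- Differentiate the identity D₁m(1, x)(Ad_x a) = D₂m(x, 1)a at x = 1, where m is the
multiplication in the chart and D₁m(1, 1) = 1. The derivative of Ad is then a difference of two
mixed second derivatives of m, which `lieBr_eq_fderiv` identifies with the bracket after using the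
symmetry of the second derivative. -/
theorem hasFDerivAt_Ad (a : Euc n) :
    HasFDerivAt (fun x : Euc n => (Ad ((φG).symm x) : Euc n →L[ℝ] Euc n) a)
    (LinearMap.toContinuousLinearMap ((lieBr n G).flip a)) oneG := by
  have hA : DifferentiableAt ℝ (fun x : Euc n => (Ad ((φG).symm x) : Euc n →L[ℝ] Euc n) a) oneG := by
    have h1 : ContMDiffAt 𝓘(ℝ, Euc n) 𝓘(ℝ, Euc n →L[ℝ] Euc n) ∞
        (fun x : Euc n => (Ad ((φG).symm x) : Euc n →L[ℝ] Euc n)) oneG :=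
      contMDiff_Ad.contMDiffAt.comp oneG (contMDiffAt_chart_symm one_mem_target)
    have h2 := (contMDiffAt_iff_contDiffAt.mp h1).differentiableAt (by simp)
    exact h2.clm_apply (differentiableAt_const a)
  have hev : (fun x => fderiv ℝ (chartMul n G) (oneG, x)
      ((Ad ((φG).symm x) : Euc n →L[ℝ] Euc n) a, 0)) =ᶠ[𝓝 oneG]
      fun x => fderiv ℝ (chartMul n G) (x, oneG) (0, a) := by
    have hc : Tendsto (fun x : Euc n => (x, oneG)) (𝓝 oneG) (𝓝 (oneG, oneG)) :=
      (Continuous.prodMk_left _).tendsto _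
    have hc' : Tendsto (fun x : Euc n => (oneG, x)) (𝓝 oneG) (𝓝 (oneG, oneG)) :=
      (Continuous.prodMk_right _).tendsto _
    filter_upwards [chart_target_mem (one_mem_target (n := n) (G := G)),
      hc.eventually (eventually_chartMul_diff (n := n) (G := G)),
      hc'.eventually (eventually_chartMul_diff (n := n) (G := G))] with x hx hd hd'
    rw [fderiv_chartMul_snd hx hd, fderiv_chartMul_fst hx hd', mD_mul_right_Ad]
  have hL := ((hasFDerivAt_fderiv_chartMul (n := n) (G := G)).comp oneG
    (hasFDerivAt_prodMk_right oneG oneG)).clm_apply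
      (hA.hasFDerivAt.prodMk (hasFDerivAt_const (0 : Euc n) oneG))
  have hR := (hasFDerivAt_chartMul_snd (n := n) (G := G) a).congr_of_eventuallyEq hev
  have hu := hL.unique hR
  have hsymm : IsSymmSndFDerivAt ℝ (chartMul n G) (oneG, oneG) :=
    (contDiffAt_chartMul (n := n) (G := G)).isSymmSndFDerivAt
      (by rw [minSmoothness_of_isRCLikeNormedField]; norm_cast)
  convert hA.hasFDerivAt using 1
  ext1 ξ
  have h1 := congrArg (fun f : Euc n →L[ℝ] Euc n => f ξ) hu
  simp only [Function.comp_def, chart_symm_one, Ad_one, add_apply,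
    ContinuousLinearMap.comp_apply, ContinuousLinearMap.flip_apply, ContinuousLinearMap.prod_apply,
    zero_apply, fderiv_chartMul_fst_one, ContinuousLinearMap.inl_apply,
    ContinuousLinearMap.inr_apply, ContinuousLinearMap.id_apply] at h1
  change lieBr n G ξ a = _
  rw [lieBr_eq_fderiv, ← h1, hsymm.eq (a, 0) (0, ξ)]
  abel

end LieGroupCalculus

/-! ### An invariant inner product on the Lie algebra -/

section InvariantInnerProduct

open Filter Topology MeasureTheory

/-- A bilinear map on finite-dimensional spaces as a continuous bilinear map. -/
def toCLM₂ {E E' W : Type*} [NormedAddCommGroup E] [NormedSpace ℝ E] [FiniteDimensional ℝ E]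
    [NormedAddCommGroup E'] [NormedSpace ℝ E'] [FiniteDimensional ℝ E']
    [NormedAddCommGroup W] [NormedSpace ℝ W] (B : E →ₗ[ℝ] E' →ₗ[ℝ] W) : E →L[ℝ] E' →L[ℝ] W :=
  LinearMap.toContinuousLinearMap
    ((LinearMap.toContinuousLinearMap : (E' →ₗ[ℝ] W) ≃ₗ[ℝ] (E' →L[ℝ] W)).toLinearMap ∘ₗ B)

theorem toCLM₂_apply {E E' W : Type*} [NormedAddCommGroup E] [NormedSpace ℝ E]
    [FiniteDimensional ℝ E] [NormedAddCommGroup E'] [NormedSpace ℝ E'] [FiniteDimensional ℝ E']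
    [NormedAddCommGroup W] [NormedSpace ℝ W] (B : E →ₗ[ℝ] E' →ₗ[ℝ] W)
    (a : E) (b : E') : toCLM₂ B a b = B a b := rfl

variable {n : ℕ} {G : Type*} [TopologicalSpace G] [ChartedSpace (Euc n) G] [Group G]
  [LieGroup (𝓡 n) ∞ G]

theorem lieBr_skew (a b : Euc n) : lieBr n G a b = -lieBr n G b a := by
  rw [lieBr_eq_fderiv, lieBr_eq_fderiv, neg_sub]

theorem continuous_Ad_apply (a : Euc n) : Continuous fun g : G => (Ad g : Euc n →L[ℝ] Euc n) a :=
  (contMDiff_Ad (n := n) (G := G)).continuous.clm_apply continuous_const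

/-- A compact Lie group admits an `Ad`-invariant inner product on its Lie algebra. -/
theorem exists_Ad_invariant_inner (n : ℕ) (G : Type*) [TopologicalSpace G] [T2Space G]
    [CompactSpace G] [ChartedSpace (Euc n) G] [Group G] [LieGroup (𝓡 n) ∞ G] :
    ∃ q : Euc n →ₗ[ℝ] Euc n →ₗ[ℝ] ℝ, (∀ a b, q a b = q b a) ∧ (∀ a, a ≠ 0 → 0 < q a a) ∧
      ∀ (g : G) (a b : Euc n), q (Ad g a) (Ad g b) = q a b := by
  let _ : MeasurableSpace G := borel G
  have : BorelSpace G := ⟨rfl⟩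
  have : IsTopologicalGroup G := topologicalGroup_of_lieGroup (𝓡 n) ∞
  let μ : Measure G := Measure.haar
  have hc : ∀ a b : Euc n, Continuous fun g : G => inner ℝ ((Ad g⁻¹ : Euc n →L[ℝ] Euc n) a)
      ((Ad g⁻¹ : Euc n →L[ℝ] Euc n) b) := fun a b =>
    ((continuous_Ad_apply a).comp continuous_inv).inner
      ((continuous_Ad_apply b).comp continuous_inv)
  have hi : ∀ a b : Euc n, Integrable (fun g : G => inner ℝ ((Ad g⁻¹ : Euc n →L[ℝ] Euc n) a)
      ((Ad g⁻¹ : Euc n →L[ℝ] Euc n) b)) μ := fun a b =>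
    (hc a b).integrable_of_hasCompactSupport (HasCompactSupport.of_compactSpace _)
  -- The average of the Euclidean inner product over Haar measure. The inverse in the integrand
  -- turns Ad-invariance into left invariance of the measure. Definiteness holds because the
  -- integrand is continuous, nonnegative, and positive at 1.
  let q : Euc n →ₗ[ℝ] Euc n →ₗ[ℝ] ℝ := LinearMap.mk₂ ℝ
    (fun a b => ∫ g : G, inner ℝ ((Ad g⁻¹ : Euc n →L[ℝ] Euc n) a)
      ((Ad g⁻¹ : Euc n →L[ℝ] Euc n) b) ∂μ)
    (fun a a' b => by simp only [map_add, inner_add_left]; exact integral_add (hi a b) (hi a' b))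
    (fun c a b => by
      simp only [map_smul, real_inner_smul_left, smul_eq_mul]; exact integral_const_mul c _)
    (fun a b b' => by simp only [map_add, inner_add_right]; exact integral_add (hi a b) (hi a b'))
    (fun c a b => by
      simp only [map_smul, real_inner_smul_right, smul_eq_mul]; exact integral_const_mul c _)
  have hq : ∀ a b, q a b = ∫ g : G, inner ℝ ((Ad g⁻¹ : Euc n →L[ℝ] Euc n) a)
      ((Ad g⁻¹ : Euc n →L[ℝ] Euc n) b) ∂μ := fun _ _ => rfl
  refine ⟨q, fun a b => ?_, fun a ha => ?_, fun h a b => ?_⟩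
  · rw [hq, hq]
    simp only [real_inner_comm]
  · rw [hq]
    refine (hc a a).integral_pos_of_hasCompactSupport_nonneg_nonzero (x := 1)
      (HasCompactSupport.of_compactSpace _) (fun g => real_inner_self_nonneg) ?_
    rw [inv_one, Ad_one]
    exact inner_self_ne_zero.mpr ha
  · rw [hq, hq, ← integral_mul_left_eq_self (μ := μ) (fun g : G =>
      inner ℝ ((Ad g⁻¹ : Euc n →L[ℝ] Euc n) a) ((Ad g⁻¹ : Euc n →L[ℝ] Euc n) b)) h⁻¹]
    refine integral_congr_ae (Eventually.of_forall fun g => ?_)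
    simp only [mul_inv_rev, inv_inv, Ad_mul, ContinuousLinearMap.comp_apply]

/-- The derivative at the identity of the invariance of `q` under Ad. -/
theorem ad_skew {q : Euc n →ₗ[ℝ] Euc n →ₗ[ℝ] ℝ}
    (hq : ∀ (g : G) (a b : Euc n), q (Ad g a) (Ad g b) = q a b) (ξ a b : Euc n) :
    q (lieBr n G ξ a) b = -q a (lieBr n G ξ b) := by
  have h1 := (toCLM₂ q).hasFDerivAt_of_bilinear (hasFDerivAt_Ad (n := n) (G := G) a)
    (hasFDerivAt_Ad (n := n) (G := G) b)
  simp only [toCLM₂_apply, hq] at h1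
  have h2 := congrArg (fun f : Euc n →L[ℝ] ℝ => f ξ) (h1.unique (hasFDerivAt_const _ _))
  simp only [chart_symm_one, Ad_one] at h2
  have h3 : q a (lieBr n G ξ b) + q (lieBr n G ξ a) b = 0 := h2
  linarith

/-- Differentiating Ad_g a = a at the identity shows that a commutes with everything, and the centre
of a simple Lie algebra is zero. -/
theorem eq_zero_of_Ad_invariant (hG : LieAlgebra.IsSimple ℝ (GroupLieAlgebra (𝓡 n) G)) {a : Euc n}
    (ha : ∀ g : G, Ad g a = a) : a = 0 := by
  have h : ∀ ξ : Euc n, lieBr n G ξ a = 0 := by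
    intro ξ
    have h1 := hasFDerivAt_Ad (n := n) (G := G) a
    simp only [ha] at h1
    exact congrArg (fun f : Euc n →L[ℝ] Euc n => f ξ) (h1.unique (hasFDerivAt_const _ _))
  obtain ⟨a', ha'⟩ : ∃ a' : GroupLieAlgebra (𝓡 n) G, a' = a := ⟨a, rfl⟩
  have hc : a' ∈ LieAlgebra.center ℝ (GroupLieAlgebra (𝓡 n) G) := by
    rw [ha']
    exact fun ξ => h ξ
  rw [LieAlgebra.center_eq_bot, LieSubmodule.mem_bot] at hc
  rw [← ha', hc]
  rfl

end InvariantInnerProduct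

/-! ### Derivatives of compositions with alternating forms -/

section AlternatingCalculus

open Filter Topology

variable {E F W : Type*} [NormedAddCommGroup E] [NormedSpace ℝ E] [NormedAddCommGroup F]
  [NormedSpace ℝ F] [NormedAddCommGroup W] [NormedSpace ℝ W] {k : ℕ} {r : WithTop ℕ∞}

/-- Evaluation of alternating maps at a fixed vector. -/
def evalForm (v : Fin k → E) : (E [⋀^Fin k]→L[ℝ] W) →L[ℝ] W :=
  ContinuousAlternatingMap.apply ℝ E W v

theorem form_apply_eq_sum [FiniteDimensional ℝ E] (α : E [⋀^Fin k]→L[ℝ] W) (v : Fin k → E) :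
    α v = ∑ s : Fin k → Fin (Module.finrank ℝ E),
      (∏ i, (Module.finBasis ℝ E).coord (s i) (v i)) •
        α fun i => Module.finBasis ℝ E (s i) := by
  classical
  have hv : v = fun i => ∑ j, (Module.finBasis ℝ E).coord j (v i) • Module.finBasis ℝ E j := by
    funext i
    exact ((Module.finBasis ℝ E).sum_repr (v i)).symm
  conv_lhs => rw [hv]
  exact (α.toAlternatingMap.toMultilinearMap.map_sum _).trans
    (Finset.sum_congr rfl fun r _ => α.toAlternatingMap.toMultilinearMap.map_smul_univ _ _)

theorem contDiffAt_form_apply [FiniteDimensional ℝ E] {α : F → E [⋀^Fin k]→L[ℝ] W}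
    {v : Fin k → F → E} {y : F} (hα : ContDiffAt ℝ r α y) (hv : ∀ i, ContDiffAt ℝ r (v i) y) :
    ContDiffAt ℝ r (fun z => α z fun i => v i z) y := by
  rw [show (fun z => α z fun i => v i z) = _ from funext fun z => form_apply_eq_sum _ _]
  refine ContDiffAt.sum fun s _ => ContDiffAt.smul ?_ ?_
  · refine contDiffAt_prod fun i _ => ?_
    exact (LinearMap.toContinuousLinearMap ((Module.finBasis ℝ E).coord
      (s i))).contDiff.contDiffAt.comp
      y (hv i)
  · exact (evalForm fun i => Module.finBasis ℝ E (s i)).contDiff.contDiffAt.comp y hα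

/-- Evaluation on the tuples of basis vectors is an injective linear map into a finite product of
copies of W and has a linear left inverse. So smoothness of a form may be tested on fixed vectors.
-/
theorem contDiffAt_form [FiniteDimensional ℝ E] [FiniteDimensional ℝ W]
    {α : F → E [⋀^Fin k]→L[ℝ] W} {y : F}
    (h : ∀ v, ContDiffAt ℝ r (fun z => α z v) y) : ContDiffAt ℝ r α y := by
  let ev : (E [⋀^Fin k]→L[ℝ] W) →ₗ[ℝ] ((Fin k → Fin (Module.finrank ℝ E)) → W) :=
    LinearMap.pi fun s => (evalForm fun i => Module.finBasis ℝ E (s i)).toLinearMap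
  have hinj : LinearMap.ker ev = ⊥ := by
    refine LinearMap.ker_eq_bot'.mpr fun α hα => ?_
    ext v
    rw [form_apply_eq_sum]
    refine Finset.sum_eq_zero fun s _ => ?_
    have : α (fun i => Module.finBasis ℝ E (s i)) = 0 := congrFun hα s
    rw [this, smul_zero]
  obtain ⟨inv, hinv⟩ := ev.exists_leftInverse_of_injective hinj
  have h1 : α = fun z => LinearMap.toContinuousLinearMap inv (ev (α z)) := by
    funext z
    exact (congrArg (fun f => f (α z)) hinv).symm
  rw [h1]
  refine (LinearMap.toContinuousLinearMap inv).contDiff.contDiffAt.comp y ?_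
  exact contDiffAt_pi.mpr fun s => h _

theorem contDiffAt_form_comp [FiniteDimensional ℝ E] [FiniteDimensional ℝ F]
    [FiniteDimensional ℝ W] {H : Type*} [NormedAddCommGroup H] [NormedSpace ℝ H]
    {α : H → E [⋀^Fin k]→L[ℝ] W}
    {L : H → F →L[ℝ] E} {y : H} (hα : ContDiffAt ℝ r α y) (hL : ContDiffAt ℝ r L y) :
    ContDiffAt ℝ r (fun z => (α z).compContinuousLinearMap (L z)) y :=
  contDiffAt_form fun v => contDiffAt_form_apply (v := fun i z => L z (v i)) hα
    fun _ => hL.clm_apply contDiffAt_const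

end AlternatingCalculus

/-! ### Pull-back of forms to charts -/

section Pullback

open Filter Topology

variable {E F W : Type*} [NormedAddCommGroup E] [NormedSpace ℝ E] [NormedAddCommGroup F]
  [NormedSpace ℝ F] [NormedAddCommGroup W] [NormedSpace ℝ W] {k : ℕ}
  {M : Type*} [TopologicalSpace M] [ChartedSpace E M]

/-- The value of a form at a point, as a form on the model space. -/
def DiffForm.atModel (α : DiffForm E M W k) (x : M) : E [⋀^Fin k]→L[ℝ] W := α x

/-- The pullback of a form on a manifold to a vector space. -/
def pullForm (f : F → M) (α : DiffForm E M W k) (y : F) : F [⋀^Fin k]→L[ℝ] W :=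
  (DiffForm.atModel α (f y)).compContinuousLinearMap (mD F E f y)

theorem pullForm_apply (f : F → M) (α : DiffForm E M W k) (y : F) (v : Fin k → F) :
    pullForm f α y v = DiffForm.atModel α (f y) fun i => mD F E f y (v i) := rfl

variable [IsManifold 𝓘(ℝ, E) ∞ M]

theorem contDiffAt_chart_comp {f : F → M} {y₀ : F} (hf : ContMDiffAt 𝓘(ℝ, F) 𝓘(ℝ, E) ∞ f y₀) :
    ContDiffAt ℝ ∞ (fun y => extChartAt 𝓘(ℝ, E) (f y₀) (f y)) y₀ :=
  contMDiffAt_iff_contDiffAt.mp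
    (ContMDiffAt.comp (I' := 𝓘(ℝ, E)) (g := extChartAt 𝓘(ℝ, E) (f y₀)) y₀ contMDiffAt_extChartAt hf)

/-- Near y₀ the map factors through the chart at f y₀. A pull-back from the manifold thereby becomes
a pull-back between vector spaces, to which the ordinary calculus of forms applies. -/
theorem pullForm_eventuallyEq {f : F → M} {y₀ : F} (hf : ContMDiffAt 𝓘(ℝ, F) 𝓘(ℝ, E) ∞ f y₀)
    (α : DiffForm E M W k) :
    pullForm f α =ᶠ[𝓝 y₀] fun y =>
      (coordRep α (f y₀) (extChartAt 𝓘(ℝ, E) (f y₀) (f y))).compContinuousLinearMap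
        (fderiv ℝ (fun y => extChartAt 𝓘(ℝ, E) (f y₀) (f y)) y) := by
  have h1 : ∀ᶠ y in 𝓝 y₀, ContMDiffAt 𝓘(ℝ, F) 𝓘(ℝ, E) 1 f y :=
    (contMDiffAt_iff_contMDiffAt_nhds (by simp)).mp (hf.of_le (by norm_cast))
  have h2 : ∀ᶠ y in 𝓝 y₀, f y ∈ (extChartAt 𝓘(ℝ, E) (f y₀)).source :=
    hf.continuousAt.eventually (extChartAt_source_mem_nhds (I := 𝓘(ℝ, E)) (f y₀))
  filter_upwards [h1, h2] with y hy hs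
  have hd : MDifferentiableAt 𝓘(ℝ, F) 𝓘(ℝ, E) f y := hy.mdifferentiableAt (by simp)
  have e1 : fderiv ℝ (fun y => extChartAt 𝓘(ℝ, E) (f y₀) (f y)) y =
      (mD E E (extChartAt 𝓘(ℝ, E) (f y₀)) (f y)).comp (mD F E f y) := by
    rw [← mD_eq_fderiv]
    exact mD_comp (mdiff_chart hs) hd
  rw [e1]
  ext v
  have e2 : ∀ w, mD E E (extChartAt 𝓘(ℝ, E) (f y₀)).symm (extChartAt 𝓘(ℝ, E) (f y₀) (f y))
      (mD E E (extChartAt 𝓘(ℝ, E) (f y₀)) (f y) w) = w := fun w =>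
    congrArg (fun L : E →L[ℝ] E => L w) (mD_symm_comp_chart hs)
  have e3 : (extChartAt 𝓘(ℝ, E) (f y₀)).symm (extChartAt 𝓘(ℝ, E) (f y₀) (f y)) = f y :=
    (extChartAt 𝓘(ℝ, E) (f y₀)).left_inv hs
  change DiffForm.atModel α (f y) (fun i => mD F E f y (v i)) =
    DiffForm.atModel α ((extChartAt 𝓘(ℝ, E) (f y₀)).symm (extChartAt 𝓘(ℝ, E) (f y₀) (f y)))
      (fun i => mD E E (extChartAt 𝓘(ℝ, E) (f y₀)).symm (extChartAt 𝓘(ℝ, E) (f y₀) (f y))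
        (mD E E (extChartAt 𝓘(ℝ, E) (f y₀)) (f y) (mD F E f y (v i))))
  simp only [e2, e3]

theorem IsSmoothForm.contDiffAt {α : DiffForm E M W k} (hα : IsSmoothForm α) {x₀ : M} {y : E}
    (hy : y ∈ (extChartAt 𝓘(ℝ, E) x₀).target) : ContDiffAt ℝ ∞ (coordRep α x₀) y :=
  (hα x₀).contDiffAt (chart_target_mem hy)

/-- The pullback of a smooth form under a smooth map is smooth. -/
theorem contDiffAt_pullForm [FiniteDimensional ℝ E] [FiniteDimensional ℝ F]
    [FiniteDimensional ℝ W] {f : F → M} {y₀ : F} (hf : ContMDiffAt 𝓘(ℝ, F) 𝓘(ℝ, E) ∞ f y₀)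
    {α : DiffForm E M W k} (hα : IsSmoothForm α) : ContDiffAt ℝ ∞ (pullForm f α) y₀ := by
  refine ContDiffAt.congr_of_eventuallyEq ?_ (pullForm_eventuallyEq hf α)
  have hc := contDiffAt_chart_comp hf
  refine contDiffAt_form_comp ?_ (hc.fderiv_right (m := ∞) (by simp))
  exact ContDiffAt.comp (g := coordRep α (f y₀)) y₀
    (hα.contDiffAt (mem_extChartAt_target (I := 𝓘(ℝ, E)) (f y₀))) hc

theorem mD_eq_fderiv_chart {f : F → M} {y₀ : F} (hf : MDifferentiableAt 𝓘(ℝ, F) 𝓘(ℝ, E) f y₀) :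
    mD F E f y₀ = fderiv ℝ (fun y => extChartAt 𝓘(ℝ, E) (f y₀) (f y)) y₀ := by
  rw [← mD_eq_fderiv, mD_comp (mdiff_chart (mem_extChartAt_source (I := 𝓘(ℝ, E)) (f y₀))) hf,
    mD_chart_self, ContinuousLinearMap.id_comp]

/-- The exterior derivative commutes with pullbacks. -/
theorem extDeriv_pullForm {f : F → M} {y₀ : F} (hf : ContMDiffAt 𝓘(ℝ, F) 𝓘(ℝ, E) ∞ f y₀)
    {α : DiffForm E M W k} (hα : IsSmoothForm α) :
    extDeriv (pullForm f α) y₀ = pullForm f (extDer α) y₀ := by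
  have h1 : DifferentiableAt ℝ (coordRep α (f y₀)) (extChartAt 𝓘(ℝ, E) (f y₀) (f y₀)) :=
    (hα.contDiffAt (mem_extChartAt_target (I := 𝓘(ℝ, E)) (f y₀))).differentiableAt (by simp)
  rw [(pullForm_eventuallyEq hf α).extDeriv.self_of_nhds,
    extDeriv_pullback (f := fun y => extChartAt 𝓘(ℝ, E) (f y₀) (f y)) (r := ∞) h1
      (contDiffAt_chart_comp hf) (by rw [minSmoothness_of_isRCLikeNormedField]; norm_cast),
    ← mD_eq_fderiv_chart (hf.mdifferentiableAt (by simp))]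
  ext v
  change _ = extDeriv (coordRep α (f y₀)) (extChartAt 𝓘(ℝ, E) (f y₀) (f y₀)) (fun i =>
    mD E E (extChartAt 𝓘(ℝ, E) (f y₀)) (f y₀) (mD F E f y₀ (v i)))
  rw [mD_chart_self]
  rfl

end Pullback

/-! ### Principal bundles and connections in the model spaces -/

section BundleGeometry

open Filter Topology

variable {n m : ℕ} {X G P : Type*}
  [TopologicalSpace X] [ChartedSpace (Euc 6) X] [IsManifold (𝓡 6) ∞ X]
  [TopologicalSpace G] [ChartedSpace (Euc n) G] [Group G] [LieGroup (𝓡 n) ∞ G]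
  [TopologicalSpace P] [ChartedSpace (Euc m) P] [IsManifold (𝓡 m) ∞ P]

namespace PrincipalBundle

variable (B : PrincipalBundle n m X G P)

/-- Smoothness of the projection is not part of `PrincipalBundle`; it follows because π is the first
component of a smooth local trivialisation. -/
theorem contMDiff_π : ContMDiff (𝓡 m) (𝓡 6) ∞ B.π := by
  intro p
  obtain ⟨U, hU, hx, e, hes, het, he, hes', hπ, -⟩ := B.locally_trivial (B.π p)
  have hp : p ∈ e.source := by rw [hes]; exact hx
  have h1 : ContMDiffAt (𝓡 m) ((𝓡 6).prod (𝓡 n)) ∞ e p := he.contMDiffAt (e.open_source.mem_nhds hp)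
  refine h1.fst.congr_of_eventuallyEq ?_
  filter_upwards [e.open_source.mem_nhds hp] with q hq using (hπ q hq).symm

/-- The projection of a principal bundle on the model spaces. -/
def dπm (p : P) : Euc m →L[ℝ] Euc 6 := mD (Euc m) (Euc 6) B.π p

/-- The fundamental vectors at a point. -/
def vert (p : P) : Euc n →L[ℝ] Euc m := mD (Euc n) (Euc m) (B.act p) 1

theorem mdiff_π (p : P) : MDifferentiableAt 𝓘(ℝ, Euc m) 𝓘(ℝ, Euc 6) B.π p :=
  (B.contMDiff_π p).mdifferentiableAt (by simp)

theorem contMDiffAt_act {E : Type*} [NormedAddCommGroup E] [NormedSpace ℝ E] {M : Type*}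
    [TopologicalSpace M] [ChartedSpace E M] {f : M → P} {c : M → G} {y : M}
    (hf : ContMDiffAt 𝓘(ℝ, E) (𝓡 m) ∞ f y) (hc : ContMDiffAt 𝓘(ℝ, E) (𝓡 n) ∞ c y) :
    ContMDiffAt 𝓘(ℝ, E) (𝓡 m) ∞ (fun z => B.act (f z) (c z)) y :=
  (B.act_smooth (f y, c y)).comp y (hf.prodMk hc)

theorem mdiff_act (p : P) (g : G) : MDifferentiableAt 𝓘(ℝ, Euc n) 𝓘(ℝ, Euc m) (B.act p) g :=
  (B.contMDiffAt_act (f := fun _ : G => p) (c := fun g : G => g) contMDiffAt_const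
    contMDiffAt_id).mdifferentiableAt (by simp)

theorem mdiff_act_right (p : P) (g : G) :
    MDifferentiableAt 𝓘(ℝ, Euc m) 𝓘(ℝ, Euc m) (fun q => B.act q g) p :=
  (B.contMDiffAt_act (f := fun q : P => q) (c := fun _ : P => g) contMDiffAt_id
    contMDiffAt_const).mdifferentiableAt (by simp)

theorem dπm_vert (p : P) (ξ : Euc n) : B.dπm p (B.vert p ξ) = 0 := by
  have h := mD_comp_of_eq (E := Euc n) (E' := Euc m) (E'' := Euc 6) (g := B.π) (f := B.act p)
    (x := (1 : G)) (B.act_one p) (B.mdiff_π p) (B.mdiff_act p 1)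
  simp only [B.π_act, mD_const] at h
  exact (congrArg (fun L : Euc n →L[ℝ] Euc 6 => L ξ) h).symm

/-- A smooth local section of a principal bundle, in a chart of the base. -/
structure IsLocalSection (x₀ : X) (y₀ : Euc 6) (s : Euc 6 → P) : Prop where
  mem : y₀ ∈ (extChartAt 𝓘(ℝ, Euc 6) x₀).target
  smooth : ∀ᶠ y in 𝓝 y₀, ContMDiffAt 𝓘(ℝ, Euc 6) 𝓘(ℝ, Euc m) ∞ s y
  proj : ∀ᶠ y in 𝓝 y₀, B.π (s y) = (extChartAt 𝓘(ℝ, Euc 6) x₀).symm y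

variable {B}

theorem IsLocalSection.eventually {x₀ : X} {y₀ : Euc 6} {s : Euc 6 → P}
    (hs : B.IsLocalSection x₀ y₀ s) : ∀ᶠ y in 𝓝 y₀, B.IsLocalSection x₀ y s := by
  filter_upwards [chart_target_mem hs.mem, hs.smooth.eventually_nhds, hs.proj.eventually_nhds] with
    y h1 h2 h3 using ⟨h1, h2, h3⟩

theorem IsLocalSection.mdiff {x₀ : X} {y₀ : Euc 6} {s : Euc 6 → P}
    (hs : B.IsLocalSection x₀ y₀ s) : MDifferentiableAt 𝓘(ℝ, Euc 6) 𝓘(ℝ, Euc m) s y₀ :=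
  hs.smooth.self_of_nhds.mdifferentiableAt (by simp)

theorem IsLocalSection.dπm_comp {x₀ : X} {y₀ : Euc 6} {s : Euc 6 → P}
    (hs : B.IsLocalSection x₀ y₀ s) (v : Euc 6) : B.dπm (s y₀) (mD (Euc 6) (Euc m) s y₀ v) =
      mD (Euc 6) (Euc 6) (extChartAt 𝓘(ℝ, Euc 6) x₀).symm y₀ v := by
  have h := mD_comp (E := Euc 6) (B.mdiff_π (s y₀)) hs.mdiff
  rw [← mD_congr hs.proj, h]
  rfl

variable (B)

/-- The parametrization of a principal bundle around a section. -/
def param (s : Euc 6 → P) (q : Euc 6 × Euc n) : P :=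
  B.act (s q.1) ((extChartAt 𝓘(ℝ, Euc n) (1 : G)).symm q.2)

variable {B}

theorem IsLocalSection.contMDiffAt_param {x₀ : X} {y₀ : Euc 6} {s : Euc 6 → P}
    (hs : B.IsLocalSection x₀ y₀ s) {z : Euc n}
    (hz : z ∈ (extChartAt 𝓘(ℝ, Euc n) (1 : G)).target) :
    ContMDiffAt 𝓘(ℝ, Euc 6 × Euc n) 𝓘(ℝ, Euc m) ∞ (B.param s) (y₀, z) := by
  refine B.contMDiffAt_act ?_ ?_
  · exact ContMDiffAt.comp (I' := 𝓘(ℝ, Euc 6)) (g := s) (f := fun q : Euc 6 × Euc n => q.1) (y₀, z)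
      hs.smooth.self_of_nhds contDiff_fst.contMDiff.contMDiffAt
  · exact ContMDiffAt.comp (I' := 𝓘(ℝ, Euc n)) (g := (extChartAt 𝓘(ℝ, Euc n) (1 : G)).symm)
      (f := fun q : Euc 6 × Euc n => q.2) (y₀, z) (contMDiffAt_chart_symm hz)
      contDiff_snd.contMDiff.contMDiffAt

theorem param_one (s : Euc 6 → P) (y : Euc 6) :
    B.param s (y, extChartAt 𝓘(ℝ, Euc n) (1 : G) 1) = s y := by
  rw [param, chart_symm_one, B.act_one]

theorem IsLocalSection.mD_param {x₀ : X} {y₀ : Euc 6} {s : Euc 6 → P}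
    (hs : B.IsLocalSection x₀ y₀ s) (v : Euc 6) (ζ : Euc n) :
    mD (Euc 6 × Euc n) (Euc m) (B.param s) (y₀, extChartAt 𝓘(ℝ, Euc n) (1 : G) 1) (v, ζ) =
      mD (Euc 6) (Euc m) s y₀ v + B.vert (s y₀) ζ := by
  set z₀ := extChartAt 𝓘(ℝ, Euc n) (1 : G) 1 with hz₀
  have hΨ : MDifferentiableAt 𝓘(ℝ, Euc 6 × Euc n) 𝓘(ℝ, Euc m) (B.param s) (y₀, z₀) :=
    (hs.contMDiffAt_param one_mem_target).mdifferentiableAt (by simp)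
  have h1 : mD (Euc 6) (Euc m) s y₀ = (mD (Euc 6 × Euc n) (Euc m) (B.param s) (y₀, z₀)).comp
      (ContinuousLinearMap.inl ℝ _ _) := by
    have hf : HasFDerivAt (fun y : Euc 6 => (y, z₀)) (ContinuousLinearMap.inl ℝ _ _) y₀ :=
      hasFDerivAt_prodMk_left y₀ z₀
    have h := mD_comp (E := Euc 6) (E' := Euc 6 × Euc n) (E'' := Euc m) (g := B.param s)
      (f := fun y : Euc 6 => (y, z₀)) hΨ hf.differentiableAt.mdifferentiableAt
    rw [mD_eq_fderiv, hf.fderiv] at h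
    rw [← h]
    simp only [hz₀, param_one]
  have h2 : B.vert (s y₀) = (mD (Euc 6 × Euc n) (Euc m) (B.param s) (y₀, z₀)).comp
      (ContinuousLinearMap.inr ℝ _ _) := by
    have hf : HasFDerivAt (fun z : Euc n => (y₀, z)) (ContinuousLinearMap.inr ℝ _ _) z₀ :=
      hasFDerivAt_prodMk_right y₀ z₀
    have h := mD_comp (E := Euc n) (E' := Euc 6 × Euc n) (E'' := Euc m) (g := B.param s)
      (f := fun z : Euc n => (y₀, z)) hΨ hf.differentiableAt.mdifferentiableAt
    rw [mD_eq_fderiv, hf.fderiv] at h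
    rw [← h]
    have h' := mD_comp_of_eq (E := Euc n) (E' := Euc n) (E'' := Euc m) (g := B.act (s y₀))
      (f := (extChartAt 𝓘(ℝ, Euc n) (1 : G)).symm) (x := z₀) (chart_symm_one (n := n) (G := G))
      (B.mdiff_act (s y₀) 1) (mdiff_chart_symm one_mem_target)
    rw [hz₀, mD_chart_symm_self, ContinuousLinearMap.comp_id] at h'
    exact h'.symm
  rw [h1, h2]
  have : ((v, ζ) : Euc 6 × Euc n) = (v, 0) + (0, ζ) := by simp
  rw [this, map_add]
  rfl

variable (B)

/-- The section freezes the group component of a trivialisation at its value at p. The last clause,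
that section directions and vertical directions span the tangent space at p, holds because the
parametrisation by section and group has a differentiable right inverse near p. No relation between
m and 6 + n is assumed. -/
theorem exists_local_section (p : P) (x₀ : X) (hx : B.π p ∈ (extChartAt 𝓘(ℝ, Euc 6) x₀).source) :
    ∃ s, B.IsLocalSection x₀ (extChartAt 𝓘(ℝ, Euc 6) x₀ (B.π p)) s ∧
      s (extChartAt 𝓘(ℝ, Euc 6) x₀ (B.π p)) = p ∧
      ∀ w, ∃ v ζ, w = mD (Euc 6) (Euc m) s (extChartAt 𝓘(ℝ, Euc 6) x₀ (B.π p)) v + B.vert p ζ := by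
  obtain ⟨U, hU, hxU, e, hes, het, he, hes', hπ, heq⟩ := B.locally_trivial (B.π p)
  have hp : p ∈ e.source := by rw [hes]; exact hxU
  set φ := extChartAt 𝓘(ℝ, Euc 6) x₀ with hφ
  set y₀ := φ (B.π p) with hy₀
  let s : Euc 6 → P := fun y => e.symm (φ.symm y, (e p).2)
  have hy₀t : y₀ ∈ φ.target := φ.map_source hx
  have hφy : φ.symm y₀ = B.π p := φ.left_inv hx
  have hsy : s y₀ = p := by
    change e.symm (φ.symm y₀, (e p).2) = p
    rw [hφy, ← hπ p hp]
    exact e.left_inv hp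
  have hev : ∀ᶠ y in 𝓝 y₀, φ.symm y ∈ U := by
    refine (contMDiffAt_chart_symm hy₀t).continuousAt.eventually ?_
    rw [hφy]
    exact hU.mem_nhds hxU
  have hs : B.IsLocalSection x₀ y₀ s := by
    refine ⟨hy₀t, ?_, ?_⟩
    · filter_upwards [hev, chart_target_mem hy₀t] with y hy hyt
      have h1 : ContMDiffAt ((𝓡 6).prod (𝓡 n)) (𝓡 m) ∞ e.symm (φ.symm y, (e p).2) :=
        hes'.contMDiffAt (e.open_target.mem_nhds (by rw [het]; exact ⟨hy, trivial⟩))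
      exact h1.comp y ((contMDiffAt_chart_symm hyt).prodMk contMDiffAt_const)
    · filter_upwards [hev] with y hy
      have hyt : (φ.symm y, (e p).2) ∈ e.target := by rw [het]; exact ⟨hy, trivial⟩
      rw [← hπ _ (e.map_target hyt), e.right_inv hyt]
  refine ⟨s, hs, hsy, fun w => ?_⟩
  -- the inverse of the parametrization
  have hc1 : ContMDiffAt (𝓡 m) (𝓡 n) ∞ (fun q : P => (e p).2⁻¹ * (e q).2) p :=
    contMDiffAt_const.mul (he.contMDiffAt (e.open_source.mem_nhds hp)).snd
  have hc0 : (e p).2⁻¹ * (e p).2 = 1 := inv_mul_cancel _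
  let Θ : P → Euc 6 × Euc n := fun q =>
    (φ (B.π q), extChartAt 𝓘(ℝ, Euc n) (1 : G) ((e p).2⁻¹ * (e q).2))
  have hΘp : Θ p = (y₀, extChartAt 𝓘(ℝ, Euc n) (1 : G) 1) := by
    change (φ (B.π p), extChartAt 𝓘(ℝ, Euc n) (1 : G) ((e p).2⁻¹ * (e p).2)) = _
    rw [hc0]
  have hΘ : MDifferentiableAt 𝓘(ℝ, Euc m) 𝓘(ℝ, Euc 6 × Euc n) Θ p := by
    have h1 : MDifferentiableAt 𝓘(ℝ, Euc m) 𝓘(ℝ, Euc 6) (fun q => φ (B.π q)) p :=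
      MDifferentiableAt.comp (I' := 𝓘(ℝ, Euc 6)) (g := φ) p (mdiff_chart hx) (B.mdiff_π p)
    have h2 : MDifferentiableAt 𝓘(ℝ, Euc m) 𝓘(ℝ, Euc n)
        (fun q : P => extChartAt 𝓘(ℝ, Euc n) (1 : G) ((e p).2⁻¹ * (e q).2)) p := by
      refine MDifferentiableAt.comp (I' := 𝓘(ℝ, Euc n)) (g := extChartAt 𝓘(ℝ, Euc n) (1 : G))
        (f := fun q : P => (e p).2⁻¹ * (e q).2) p ?_ (hc1.mdifferentiableAt (by simp))
      rw [hc0]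
      exact mdiff_chart (mem_extChartAt_source _)
    exact h1.prodMk_space h2
  have hid : (fun q => B.param s (Θ q)) =ᶠ[𝓝 p] fun q => q := by
    have h1 : ∀ᶠ q in 𝓝 p, B.π q ∈ φ.source :=
      (B.contMDiff_π p).continuousAt.eventually ((isOpen_extChartAt_source x₀).mem_nhds hx)
    have h2 : ∀ᶠ q in 𝓝 p, (e p).2⁻¹ * (e q).2 ∈ (extChartAt 𝓘(ℝ, Euc n) (1 : G)).source := by
      refine hc1.continuousAt.eventually ?_
      change _ ∈ 𝓝 ((e p).2⁻¹ * (e p).2)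
      rw [hc0]
      exact extChartAt_source_mem_nhds _
    filter_upwards [h1, h2, e.open_source.mem_nhds hp] with q hq1 hq2 hq
    have hqU : B.π q ∈ U := by rw [hes] at hq; exact hq
    have hyt : (B.π q, (e p).2) ∈ e.target := by rw [het]; exact ⟨hqU, trivial⟩
    change B.act (e.symm (φ.symm (φ (B.π q)), (e p).2))
      ((extChartAt 𝓘(ℝ, Euc n) (1 : G)).symm
        (extChartAt 𝓘(ℝ, Euc n) (1 : G) ((e p).2⁻¹ * (e q).2))) = q
    rw [φ.left_inv hq1, (extChartAt 𝓘(ℝ, Euc n) (1 : G)).left_inv hq2]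
    have hqs : e.symm (B.π q, (e p).2) ∈ e.source := e.map_target hyt
    have hact : B.act (e.symm (B.π q, (e p).2)) ((e p).2⁻¹ * (e q).2) ∈ e.source := by
      rw [hes] at hqs ⊢
      change B.π _ ∈ U
      rw [B.π_act]
      exact hqs
    refine e.injOn hact hq ?_
    rw [heq _ hqs, e.right_inv hyt, mul_inv_cancel_left]
    exact Prod.ext (hπ q hq).symm rfl
  have h3 := mD_comp_of_eq (E := Euc m) (E' := Euc 6 × Euc n) (E'' := Euc m) hΘp
    ((hs.contMDiffAt_param one_mem_target).mdifferentiableAt (by simp)) hΘ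
  rw [mD_congr hid, mD_id] at h3
  refine ⟨(mD (Euc m) (Euc 6 × Euc n) Θ p w).1, (mD (Euc m) (Euc 6 × Euc n) Θ p w).2, ?_⟩
  have h4 := hs.mD_param (mD (Euc m) (Euc 6 × Euc n) Θ p w).1 (mD (Euc m) (Euc 6 × Euc n) Θ p w).2
  rw [hsy] at h4
  rw [← h4]
  exact congrArg (fun L : Euc m →L[ℝ] Euc m => L w) h3

namespace Connection

variable {B} (A : B.Connection)

/-- The connection form on the model spaces. -/
def θm (p : P) : Euc m →L[ℝ] Euc n := A.θ p

/-- The horizontal lift on the model spaces. -/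
def liftm (p : P) : Euc 6 →L[ℝ] Euc m := A.lift p

theorem θm_vert (p : P) (ξ : Euc n) : A.θm p (B.vert p ξ) = ξ := by
  have h : A.θm (B.act p 1) (B.vert p ξ) = ξ := A.fundamental p ξ
  rwa [B.act_one] at h

/-- On the sum of section directions and vertical directions, (dπ, θ) is triangular with identity
maps on the diagonal. This is what gives `lift` its meaning: `ContinuousLinearMap.inverse` is zero
on maps that are not invertible. -/
theorem prod_bijective (p : P) : Function.Bijective ((B.dπm p).prod (A.θm p)) := by
  obtain ⟨s, hs, hsp, hw⟩ := B.exists_local_section p (B.π p) (mem_extChartAt_source _)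
  have hd := hs.dπm_comp
  rw [hsp] at hd
  have hx := mD_chart_symm_self (E := Euc 6) (B.π p)
  simp only [hx, ContinuousLinearMap.id_apply] at hd
  constructor
  · refine (injective_iff_map_eq_zero _).mpr fun w h0 => ?_
    obtain ⟨v, ζ, rfl⟩ := hw w
    have h1 : B.dπm p _ = 0 := congrArg Prod.fst h0
    have h2 : A.θm p _ = 0 := congrArg Prod.snd h0
    rw [map_add, hd, B.dπm_vert, add_zero] at h1
    rw [h1, map_zero, zero_add, A.θm_vert] at h2
    rw [h1, h2, map_zero, map_zero, add_zero]
  · rintro ⟨v, ξ⟩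
    refine ⟨mD (Euc 6) (Euc m) s (extChartAt 𝓘(ℝ, Euc 6) (B.π p) (B.π p)) v +
      B.vert p (ξ - A.θm p (mD (Euc 6) (Euc m) s
        (extChartAt 𝓘(ℝ, Euc 6) (B.π p) (B.π p)) v)), Prod.ext ?_ ?_⟩
    · change B.dπm p _ = v
      rw [map_add, hd, B.dπm_vert, add_zero]
    · change A.θm p _ = ξ
      rw [map_add, A.θm_vert]
      abel

theorem liftm_unique (p : P) (v : Euc 6) (w : Euc m) (h1 : B.dπm p w = v) (h2 : A.θm p w = 0) :
    A.liftm p v = w := by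
  let K : Euc m ≃L[ℝ] Euc 6 × Euc n :=
    (LinearEquiv.ofBijective ((B.dπm p).prod (A.θm p)).toLinearMap
      (A.prod_bijective p)).toContinuousLinearEquiv
  have hK : (K : Euc m →L[ℝ] Euc 6 × Euc n) = (B.dπm p).prod (A.θm p) := by
    ext1 w; rfl
  have h3 : A.liftm p v = ((B.dπm p).prod (A.θm p)).inverse (v, 0) := rfl
  rw [h3, ← hK, ContinuousLinearMap.inverse_equiv]
  change K.symm (v, 0) = w
  rw [ContinuousLinearEquiv.symm_apply_eq]
  exact (Prod.ext h1 h2 : (B.dπm p w, A.θm p w) = (v, 0)).symm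

end Connection

end PrincipalBundle
end BundleGeometry

/-! ### Exterior derivatives in low degree -/

section ExtDeriv

variable {E W : Type*} [NormedAddCommGroup E] [NormedSpace ℝ E] [NormedAddCommGroup W]
  [NormedSpace ℝ W]

theorem extDeriv_one_apply {α : E → E [⋀^Fin 1]→L[ℝ] W} {y : E} (h : DifferentiableAt ℝ α y)
    (v w : E) : extDeriv α y ![v, w] =
      fderiv ℝ (fun z => α z ![w]) y v - fderiv ℝ (fun z => α z ![v]) y w := by
  have e0 : Fin.removeNth 0 ![v, w] = ![w] := by ext i; fin_cases i; rfl
  have e1 : Fin.removeNth 1 ![v, w] = ![v] := by ext i; fin_cases i; rfl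
  rw [extDeriv_apply h, Fin.sum_univ_two, e0, e1]
  simp [sub_eq_add_neg]

theorem extDeriv_two_apply {α : E → E [⋀^Fin 2]→L[ℝ] W} {y : E} (h : DifferentiableAt ℝ α y)
    (u v w : E) : extDeriv α y ![u, v, w] =
      fderiv ℝ (fun z => α z ![v, w]) y u - fderiv ℝ (fun z => α z ![u, w]) y v
        + fderiv ℝ (fun z => α z ![u, v]) y w := by
  have e0 : Fin.removeNth 0 ![u, v, w] = ![v, w] := by ext i; fin_cases i <;> rfl
  have e1 : Fin.removeNth 1 ![u, v, w] = ![u, w] := by ext i; fin_cases i <;> rfl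
  have e2 : Fin.removeNth 2 ![u, v, w] = ![u, v] := by ext i; fin_cases i <;> rfl
  rw [extDeriv_apply h, Fin.sum_univ_three, e0, e1, e2]
  simp [sub_eq_add_neg]

theorem extDeriv_three_apply {α : E → E [⋀^Fin 3]→L[ℝ] W} {y : E} (h : DifferentiableAt ℝ α y)
    (u v w x : E) : extDeriv α y ![u, v, w, x] =
      fderiv ℝ (fun z => α z ![v, w, x]) y u - fderiv ℝ (fun z => α z ![u, w, x]) y v
        + fderiv ℝ (fun z => α z ![u, v, x]) y w - fderiv ℝ (fun z => α z ![u, v, w]) y x := by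
  have e0 : Fin.removeNth 0 ![u, v, w, x] = ![v, w, x] := by ext i; fin_cases i <;> rfl
  have e1 : Fin.removeNth 1 ![u, v, w, x] = ![u, w, x] := by ext i; fin_cases i <;> rfl
  have e2 : Fin.removeNth 2 ![u, v, w, x] = ![u, v, x] := by ext i; fin_cases i <;> rfl
  have e3 : Fin.removeNth 3 ![u, v, w, x] = ![u, v, w] := by ext i; fin_cases i <;> rfl
  rw [extDeriv_apply h, Fin.sum_univ_four, e0, e1, e2, e3]
  simp [sub_eq_add_neg, pow_succ]

end ExtDeriv

/-! ### Structure equations -/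

section Gauge

open Filter Topology

variable {n m : ℕ} {X G P : Type*}
  [TopologicalSpace X] [ChartedSpace (Euc 6) X] [IsManifold (𝓡 6) ∞ X]
  [TopologicalSpace G] [ChartedSpace (Euc n) G] [Group G] [LieGroup (𝓡 n) ∞ G]
  [TopologicalSpace P] [ChartedSpace (Euc m) P] [IsManifold (𝓡 m) ∞ P]

namespace PrincipalBundle

variable {B : PrincipalBundle n m X G P}

/-- The derivative of an inverse chart of the base. -/
def frameMap (x₀ : X) (y : Euc 6) : Euc 6 →L[ℝ] Euc 6 :=
  mD (Euc 6) (Euc 6) (extChartAt 𝓘(ℝ, Euc 6) x₀).symm y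

/-- A family of forms at a point, on the model space. -/
def FormFamily.atModel {W : Type*} [NormedAddCommGroup W] [NormedSpace ℝ W] {k : ℕ}
    (η : B.FormFamily W k) (p : P) : Euc 6 [⋀^Fin k]→L[ℝ] W := η p

/-- A family of forms, read in a local section. -/
def FormFamily.read {W : Type*} [NormedAddCommGroup W] [NormedSpace ℝ W] {k : ℕ}
    (η : B.FormFamily W k) (x₀ : X) (s : Euc 6 → P) (y : Euc 6) : Euc 6 [⋀^Fin k]→L[ℝ] W :=
  (η.atModel (s y)).compContinuousLinearMap (frameMap x₀ y)

theorem IsLocalSection.pullForm_toTotal {x₀ : X} {y₀ : Euc 6} {s : Euc 6 → P}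
    (hs : B.IsLocalSection x₀ y₀ s) {W : Type*} [NormedAddCommGroup W] [NormedSpace ℝ W] {k : ℕ}
    (η : B.FormFamily W k) : pullForm s η.toTotal =ᶠ[𝓝 y₀] η.read x₀ s := by
  filter_upwards [hs.eventually] with y hy
  ext v
  change η.atModel (s y) (fun i => B.dπm (s y) (mD (Euc 6) (Euc m) s y (v i))) = _
  simp only [hy.dπm_comp]
  rfl

namespace Connection

variable (A : B.Connection)

/-- The connection form, pulled back by a section. -/
def gauge (s : Euc 6 → P) (y : Euc 6) : Euc 6 →L[ℝ] Euc n :=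
  (A.θm (s y)).comp (mD (Euc 6) (Euc m) s y)

variable {A}

theorem pullForm_oneForm {E : Type*} [NormedAddCommGroup E] [NormedSpace ℝ E] (f : E → P) (y : E)
    (v : Fin 1 → E) : pullForm f (oneForm A.θ) y v = A.θm (f y) (mD E (Euc m) f y (v 0)) := rfl

theorem contDiffAt_gauge {x₀ : X} {y₀ : Euc 6} {s : Euc 6 → P} (hs : B.IsLocalSection x₀ y₀ s)
    (v : Euc 6) : ContDiffAt ℝ ∞ (fun y => A.gauge s y v) y₀ := by
  have h := contDiffAt_pullForm hs.smooth.self_of_nhds A.smooth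
  exact contDiffAt_form_apply (v := fun _ _ => v) h fun _ => contDiffAt_const

/-- The derivative of the section projects to the given vector, and subtracting its vertical part
makes it horizontal. -/
theorem liftm_frameMap {x₀ : X} {y₀ : Euc 6} {s : Euc 6 → P} (hs : B.IsLocalSection x₀ y₀ s)
    (v : Euc 6) : A.liftm (s y₀) (frameMap x₀ y₀ v) =
      mD (Euc 6) (Euc m) s y₀ v + B.vert (s y₀) (-A.gauge s y₀ v) := by
  refine A.liftm_unique _ _ _ ?_ ?_
  · rw [map_add, hs.dπm_comp, B.dπm_vert, add_zero]
    rfl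
  · rw [map_add, A.θm_vert]
    exact add_neg_cancel _

/-- Equivariance means that Ad_g Φ(pg) does not depend on g; differentiate this at g = 1 with the
product rule and `hasFDerivAt_Ad`. -/
theorem mD_section_vert (Φ : B.AdSection) (p : P) (ξ : Euc n) :
    mD (Euc m) (Euc n) Φ.val p (B.vert p ξ) = -lieBr n G ξ (Φ.val p) := by
  have h1 : ContMDiffAt 𝓘(ℝ, Euc n) 𝓘(ℝ, Euc n →L[ℝ] Euc n) ∞
      (fun x : Euc n => (Ad ((extChartAt 𝓘(ℝ, Euc n) (1 : G)).symm x) : Euc n →L[ℝ] Euc n))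
      (extChartAt 𝓘(ℝ, Euc n) (1 : G) 1) :=
    contMDiff_Ad.contMDiffAt.comp _ (contMDiffAt_chart_symm one_mem_target)
  have h2 := ((contMDiffAt_iff_contDiffAt.mp h1).differentiableAt (by simp)).hasFDerivAt
  have hb : MDifferentiableAt 𝓘(ℝ, Euc n) 𝓘(ℝ, Euc m)
      (fun z => B.act p ((extChartAt 𝓘(ℝ, Euc n) (1 : G)).symm z))
      (extChartAt 𝓘(ℝ, Euc n) (1 : G) 1) := by
    refine MDifferentiableAt.comp (I' := 𝓘(ℝ, Euc n)) (g := B.act p) _ ?_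
      (mdiff_chart_symm one_mem_target)
    exact B.mdiff_act _ _
  have hΦ : ∀ q, MDifferentiableAt 𝓘(ℝ, Euc m) 𝓘(ℝ, Euc n) Φ.val q := fun q =>
    (Φ.smooth q).mdifferentiableAt (by simp)
  have hvert : mD (Euc n) (Euc m) (fun z => B.act p ((extChartAt 𝓘(ℝ, Euc n) (1 : G)).symm z))
      (extChartAt 𝓘(ℝ, Euc n) (1 : G) 1) = B.vert p := by
    rw [mD_comp_of_eq (g := B.act p) (chart_symm_one (n := n) (G := G)) (B.mdiff_act p 1)
      (mdiff_chart_symm one_mem_target), mD_chart_symm_self, ContinuousLinearMap.comp_id]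
    rfl
  have h3 : DifferentiableAt ℝ
      (fun z => Φ.val (B.act p ((extChartAt 𝓘(ℝ, Euc n) (1 : G)).symm z)))
      (extChartAt 𝓘(ℝ, Euc n) (1 : G) 1) := by
    rw [← mdifferentiableAt_iff_differentiableAt]
    exact MDifferentiableAt.comp (I' := 𝓘(ℝ, Euc m)) (g := Φ.val) _ (hΦ _) hb
  have h4 : fderiv ℝ (fun z => Φ.val (B.act p ((extChartAt 𝓘(ℝ, Euc n) (1 : G)).symm z)))
      (extChartAt 𝓘(ℝ, Euc n) (1 : G) 1) = (mD (Euc m) (Euc n) Φ.val p).comp (B.vert p) := by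
    rw [← hvert, ← mD_eq_fderiv]
    refine mD_comp_of_eq (g := Φ.val) ?_ (hΦ p) hb
    rw [chart_symm_one, B.act_one]
  have h5 := h2.clm_apply h3.hasFDerivAt
  have e1 : (fun z => (Ad ((extChartAt 𝓘(ℝ, Euc n) (1 : G)).symm z) : Euc n →L[ℝ] Euc n)
      (Φ.val (B.act p ((extChartAt 𝓘(ℝ, Euc n) (1 : G)).symm z)))) = fun _ => Φ.val p := by
    funext z
    rw [Φ.equivariant, Ad_apply_inv]
  rw [e1] at h5
  have h6 := congrArg (fun f : Euc n →L[ℝ] Euc n => f ξ) (h5.unique (hasFDerivAt_const _ _))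
  have h7 := (h2.clm_apply (hasFDerivAt_const (Φ.val p) _)).unique (hasFDerivAt_Ad (Φ.val p))
  have h8 := congrArg (fun f : Euc n →L[ℝ] Euc n => f ξ) h7
  simp only [chart_symm_one, B.act_one, Ad_one, h4] at h6 h8
  have h9 : mD (Euc m) (Euc n) Φ.val p (B.vert p ξ) + fderiv ℝ (fun x : Euc n =>
    (Ad ((extChartAt 𝓘(ℝ, Euc n) (1 : G)).symm x) : Euc n →L[ℝ] Euc n))
      (extChartAt 𝓘(ℝ, Euc n) (1 : G) 1) ξ (Φ.val p) = 0 := h6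
  have h10 : (0 : Euc n) + fderiv ℝ (fun x : Euc n =>
    (Ad ((extChartAt 𝓘(ℝ, Euc n) (1 : G)).symm x) : Euc n →L[ℝ] Euc n))
      (extChartAt 𝓘(ℝ, Euc n) (1 : G) 1) ξ (Φ.val p) = lieBr n G ξ (Φ.val p) := h8
  rw [zero_add] at h10
  rw [h10] at h9
  exact eq_neg_of_add_eq_zero_left h9

theorem contDiffAt_section {x₀ : X} {y₀ : Euc 6} {s : Euc 6 → P} (hs : B.IsLocalSection x₀ y₀ s)
    (Φ : B.AdSection) : ContDiffAt ℝ ∞ (fun y => Φ.val (s y)) y₀ :=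
  contMDiffAt_iff_contDiffAt.mp
    (ContMDiffAt.comp (I' := 𝓘(ℝ, Euc m)) (g := Φ.val) y₀ (Φ.smooth _) hs.smooth.self_of_nhds)

/-- The covariant derivative on the model spaces. -/
def d₀m (A : B.Connection) (Φ : P → Euc n) (p : P) : Euc 6 →L[ℝ] Euc n := A.d₀ Φ p

theorem d₀m_frameMap {x₀ : X} {y₀ : Euc 6} {s : Euc 6 → P} (hs : B.IsLocalSection x₀ y₀ s)
    (Φ : B.AdSection) (v : Euc 6) : A.d₀m Φ.val (s y₀) (frameMap x₀ y₀ v) =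
      fderiv ℝ (fun y => Φ.val (s y)) y₀ v + lieBr n G (A.gauge s y₀ v) (Φ.val (s y₀)) := by
  change mD (Euc m) (Euc n) Φ.val (s y₀) (A.liftm (s y₀) (frameMap x₀ y₀ v)) = _
  rw [liftm_frameMap hs, map_add, mD_section_vert, map_neg, LinearMap.neg_apply, neg_neg,
    ← mD_eq_fderiv, mD_comp (g := Φ.val) ((Φ.smooth _).mdifferentiableAt (by simp)) hs.mdiff]
  rfl

/-- The pullback of the connection form to the parametrization around a section. -/
theorem pullForm_param {x₀ : X} {y₀ : Euc 6} {s : Euc 6 → P} (hs : B.IsLocalSection x₀ y₀ s)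
    (v : Euc 6) (ζ : Euc n) :
    pullForm (B.param s) (oneForm A.θ) (y₀, extChartAt 𝓘(ℝ, Euc n) (1 : G) 1) ![(v, ζ)] =
      A.gauge s y₀ v + ζ := by
  rw [pullForm_oneForm, param_one]
  change A.θm (s y₀) (mD (Euc 6 × Euc n) (Euc m) (B.param s)
    (y₀, extChartAt 𝓘(ℝ, Euc n) (1 : G) 1) (v, ζ)) = _
  rw [hs.mD_param, map_add, A.θm_vert]
  rfl

theorem contDiffAt_pullForm_param {x₀ : X} {y₀ : Euc 6} {s : Euc 6 → P}
    (hs : B.IsLocalSection x₀ y₀ s) : ContDiffAt ℝ ∞ (pullForm (B.param s) (oneForm A.θ))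
      (y₀, extChartAt 𝓘(ℝ, Euc n) (1 : G) 1) :=
  contDiffAt_pullForm (hs.contMDiffAt_param one_mem_target) A.smooth

/-- The horizontal lift of v is the image of (v, -a(v)) under the parametrisation, where a is the
pulled back connection form, and exterior derivatives commute with pull-back. The curvature is thus
expressed without the formula da + ½[a, a]. -/
theorem curvature_frameMap {x₀ : X} {y₀ : Euc 6} {s : Euc 6 → P}
    (hs : B.IsLocalSection x₀ y₀ s) : A.curvature.read x₀ s y₀ =
      (extDeriv (pullForm (B.param s) (oneForm A.θ))
        (y₀, extChartAt 𝓘(ℝ, Euc n) (1 : G) 1)).compContinuousLinearMap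
        ((ContinuousLinearMap.id ℝ (Euc 6)).prod (-A.gauge s y₀)) := by
  rw [extDeriv_pullForm (hs.contMDiffAt_param one_mem_target) A.smooth]
  refine ContinuousAlternatingMap.ext fun v => ?_
  change DiffForm.atModel (extDer (oneForm A.θ)) (s y₀)
    (fun i => A.liftm (s y₀) (frameMap x₀ y₀ (v i))) =
    DiffForm.atModel (extDer (oneForm A.θ))
      (B.param s (y₀, extChartAt 𝓘(ℝ, Euc n) (1 : G) 1)) fun i =>
      mD (Euc 6 × Euc n) (Euc m) (B.param s) (y₀, extChartAt 𝓘(ℝ, Euc n) (1 : G) 1)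
        (v i, -A.gauge s y₀ (v i))
  rw [param_one]
  congr 1
  funext i
  rw [liftm_frameMap hs, hs.mD_param]

/-- A local section that is horizontal at a point. -/
structure IsHorizontalAt (A : B.Connection) (x₀ : X) (y₀ : Euc 6) (s : Euc 6 → P) : Prop where
  isLocal : B.IsLocalSection x₀ y₀ s
  gauge_eq : A.gauge s y₀ = 0

/-- Translate a section s by a group-valued function that equals 1 at y₀ and has there the
derivative -s*θ; in the chart of the group this function can be taken affine. At y₀, though not
nearby in general, covariant derivatives then are ordinary ones. -/
theorem exists_horizontal (A : B.Connection) (p : P) (x₀ : X)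
    (hx : B.π p ∈ (extChartAt 𝓘(ℝ, Euc 6) x₀).source) :
    ∃ s, A.IsHorizontalAt x₀ (extChartAt 𝓘(ℝ, Euc 6) x₀ (B.π p)) s ∧
      s (extChartAt 𝓘(ℝ, Euc 6) x₀ (B.π p)) = p := by
  obtain ⟨s, hs, hsp, -⟩ := B.exists_local_section p x₀ hx
  set y₀ := extChartAt 𝓘(ℝ, Euc 6) x₀ (B.π p) with hy₀
  set z₀ := extChartAt 𝓘(ℝ, Euc n) (1 : G) 1 with hz₀
  let f : Euc 6 → Euc 6 × Euc n := fun y => (y, z₀ - A.gauge s y₀ (y - y₀))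
  have hf : ContDiff ℝ ∞ f := by fun_prop
  have hf0 : f y₀ = (y₀, z₀) := by simp [f]
  have hfd : fderiv ℝ f y₀ = (ContinuousLinearMap.id ℝ (Euc 6)).prod (-A.gauge s y₀) := by
    have h1 : HasFDerivAt (fun y => z₀ - A.gauge s y₀ (y - y₀)) (-A.gauge s y₀) y₀ := by
      have h := (A.gauge s y₀).hasFDerivAt.comp y₀ ((hasFDerivAt_id y₀).sub_const y₀)
      simpa using h.const_sub z₀
    exact ((hasFDerivAt_id y₀).prodMk h1).fderiv
  have hsm : ∀ᶠ y in 𝓝 y₀, B.IsLocalSection x₀ y s ∧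
      (f y).2 ∈ (extChartAt 𝓘(ℝ, Euc n) (1 : G)).target := by
    refine hs.eventually.and ?_
    have hc : ContinuousAt (fun y => (f y).2) y₀ := (continuous_snd.comp hf.continuous).continuousAt
    refine hc.eventually ?_
    change _ ∈ 𝓝 (f y₀).2
    rw [hf0]
    exact chart_target_mem one_mem_target
  have hloc : B.IsLocalSection x₀ y₀ fun y => B.param s (f y) := by
    refine ⟨hs.mem, ?_, ?_⟩
    · filter_upwards [hsm] with y hy
      refine ContMDiffAt.comp (I' := 𝓘(ℝ, Euc 6 × Euc n)) (g := B.param s) (f := f) y ?_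
        hf.contMDiff.contMDiffAt
      exact hy.1.contMDiffAt_param hy.2
    · filter_upwards [hs.proj] with y hy
      rw [← hy, param, B.π_act]
  have hfy : B.param s (f y₀) = s y₀ := by rw [hf0, hz₀, param_one]
  refine ⟨fun y => B.param s (f y), ⟨hloc, ?_⟩, hfy.trans hsp⟩
  have hd := mD_comp_of_eq (E := Euc 6) (E' := Euc 6 × Euc n) (E'' := Euc m) (g := B.param s)
    (f := f) hf0 ((hs.contMDiffAt_param one_mem_target).mdifferentiableAt (by simp))
    (hf.contMDiff.contMDiffAt.mdifferentiableAt (by simp))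
  ext1 v
  rw [gauge, hd, mD_eq_fderiv, hfd, hfy]
  change A.θm (s y₀) (mD (Euc 6 × Euc n) (Euc m) (B.param s) (y₀, z₀) (v, -A.gauge s y₀ v)) = 0
  rw [hs.mD_param, map_add, A.θm_vert]
  exact add_neg_cancel _

end Connection
end PrincipalBundle
end Gauge

/-! ### Covariant derivatives of horizontal forms -/

section Horizontal

open Filter Topology

variable {n m : ℕ} {X G P : Type*}
  [TopologicalSpace X] [ChartedSpace (Euc 6) X] [IsManifold (𝓡 6) ∞ X]
  [TopologicalSpace G] [ChartedSpace (Euc n) G] [Group G] [LieGroup (𝓡 n) ∞ G]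
  [TopologicalSpace P] [ChartedSpace (Euc m) P] [IsManifold (𝓡 m) ∞ P]

namespace PrincipalBundle
namespace Connection

variable {B : PrincipalBundle n m X G P} {A : B.Connection} {x₀ : X} {y₀ : Euc 6} {s : Euc 6 → P}

/-- The connection form along a section, as a form. -/
abbrev gaugeForm (A : B.Connection) (s : Euc 6 → P) : Euc 6 → Euc 6 [⋀^Fin 1]→L[ℝ] Euc n :=
  pullForm s (oneForm A.θ)

theorem contDiffAt_gaugeForm (hs : B.IsLocalSection x₀ y₀ s) :
    ContDiffAt ℝ ∞ (A.gaugeForm s) y₀ :=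
  contDiffAt_pullForm hs.smooth.self_of_nhds A.smooth

theorem contDiffAt_clm {E F H : Type*} [NormedAddCommGroup E] [NormedSpace ℝ E]
    [FiniteDimensional ℝ E] [NormedAddCommGroup F] [NormedSpace ℝ F] [NormedAddCommGroup H]
    [NormedSpace ℝ H] {r : WithTop ℕ∞} {L : H → E →L[ℝ] F} {y : H}
    (h : ∀ v, ContDiffAt ℝ r (fun z => L z v) y) : ContDiffAt ℝ r L y := by
  have h1 : L = fun z => ∑ i, ContinuousLinearMap.smulRightL ℝ E F
      (LinearMap.toContinuousLinearMap ((Module.finBasis ℝ E).coord i))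
      (L z (Module.finBasis ℝ E i)) := by
    funext z
    ext1 v
    conv_lhs => rw [← (Module.finBasis ℝ E).sum_repr v]
    rw [map_sum, sum_apply]
    refine Finset.sum_congr rfl fun i _ => ?_
    rw [map_smul]
    rfl
  rw [h1]
  exact ContDiffAt.sum fun i _ => (ContinuousLinearMap.contDiff _).contDiffAt.comp y (h _)

theorem contDiffAt_extDeriv {E W : Type*} [NormedAddCommGroup E] [NormedSpace ℝ E]
    [FiniteDimensional ℝ E] [NormedAddCommGroup W] [NormedSpace ℝ W] [FiniteDimensional ℝ W]
    {k : ℕ} {α : E → E [⋀^Fin k]→L[ℝ] W} {y : E} (h : ContDiffAt ℝ ∞ α y) :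
    ContDiffAt ℝ ∞ (extDeriv α) y := by
  have h1 : ContDiffAt ℝ ∞ (fderiv ℝ α) y := h.fderiv_right (m := ∞) (by simp)
  refine contDiffAt_form fun v => ?_
  change ContDiffAt ℝ ∞ (fun z =>
    ContinuousAlternatingMap.alternatizeUncurryFin (fderiv ℝ α z) v) y
  simp only [ContinuousAlternatingMap.alternatizeUncurryFin_apply]
  refine ContDiffAt.sum fun i _ => ?_
  refine ContDiffAt.const_smul _ ?_
  exact contDiffAt_form_apply (α := fun z => fderiv ℝ α z (v i)) (v := fun j _ => i.removeNth v j)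
    (h1.clm_apply contDiffAt_const) fun _ => contDiffAt_const

theorem contDiffAt_curvature (hs : B.IsLocalSection x₀ y₀ s) :
    ContDiffAt ℝ ∞ (A.curvature.read x₀ s) y₀ := by
  have h1 : A.curvature.read x₀ s =ᶠ[𝓝 y₀] fun y =>
      (extDeriv (pullForm (B.param s) (oneForm A.θ))
        (y, extChartAt 𝓘(ℝ, Euc n) (1 : G) 1)).compContinuousLinearMap
        ((ContinuousLinearMap.id ℝ (Euc 6)).prod (-A.gauge s y)) := by
    filter_upwards [hs.eventually] with y hy using curvature_frameMap hy
  refine ContDiffAt.congr_of_eventuallyEq ?_ h1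
  refine contDiffAt_form_comp ?_ ?_
  · exact ContDiffAt.comp (g := extDeriv (pullForm (B.param s) (oneForm A.θ)))
      (f := fun y => (y, extChartAt 𝓘(ℝ, Euc n) (1 : G) 1)) y₀
      (contDiffAt_extDeriv (contDiffAt_pullForm_param hs)) (contDiffAt_id.prodMk contDiffAt_const)
  · exact contDiffAt_clm fun v => contDiffAt_const.prodMk (contDiffAt_gauge hs v).neg

theorem IsHorizontalAt.gauge_apply (h : A.IsHorizontalAt x₀ y₀ s) (v : Euc 6) :
    A.gauge s y₀ v = 0 := by
  rw [h.gauge_eq]; rfl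

/-- Both terms of dθ(vertical, horizontal) vanish. Along the fibre, translates of horizontal vectors
stay horizontal by equivariance of θ; along the section, θ has the constant value ζ on the
fundamental field of ζ. -/
theorem IsHorizontalAt.extDeriv_mixed (h : A.IsHorizontalAt x₀ y₀ s) (v : Euc 6) (ζ : Euc n) :
    extDeriv (pullForm (B.param s) (oneForm A.θ)) (y₀, extChartAt 𝓘(ℝ, Euc n) (1 : G) 1)
      ![(0, ζ), (v, 0)] = 0 := by
  have hs := h.isLocal
  have hd : DifferentiableAt ℝ (pullForm (B.param s) (oneForm A.θ))
      (y₀, extChartAt 𝓘(ℝ, Euc n) (1 : G) 1) :=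
    (contDiffAt_pullForm_param hs).differentiableAt (by simp)
  have hd' : ∀ w, DifferentiableAt ℝ (fun q => pullForm (B.param s) (oneForm A.θ) q w)
      (y₀, extChartAt 𝓘(ℝ, Euc n) (1 : G) 1) := fun w => hd.continuousAlternatingMap_apply_const w
  rw [extDeriv_one_apply hd]
  have h1 : fderiv ℝ (fun q => pullForm (B.param s) (oneForm A.θ) q ![(v, 0)])
      (y₀, extChartAt 𝓘(ℝ, Euc n) (1 : G) 1) (0, ζ) = 0 := by
    have e1 := HasFDerivAt.comp (f := fun z : Euc n => (y₀, z)) (extChartAt 𝓘(ℝ, Euc n) (1 : G) 1)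
      (hd' ![(v, 0)]).hasFDerivAt (hasFDerivAt_prodMk_right y₀ _)
    have e2 : (fun z => pullForm (B.param s) (oneForm A.θ) (y₀, z) ![(v, 0)]) =ᶠ[𝓝
        (extChartAt 𝓘(ℝ, Euc n) (1 : G) 1)] fun _ => 0 := by
      filter_upwards [chart_target_mem (one_mem_target (n := n) (G := G))] with z hz
      have hΨ : MDifferentiableAt 𝓘(ℝ, Euc 6 × Euc n) 𝓘(ℝ, Euc m) (B.param s) (y₀, z) :=
        (hs.contMDiffAt_param hz).mdifferentiableAt (by simp)
      have hf : HasFDerivAt (fun y : Euc 6 => (y, z)) (ContinuousLinearMap.inl ℝ _ _) y₀ :=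
        hasFDerivAt_prodMk_left y₀ z
      have e3 := mD_comp (E := Euc 6) (E' := Euc 6 × Euc n) (E'' := Euc m) (g := B.param s)
        (f := fun y : Euc 6 => (y, z)) hΨ hf.differentiableAt.mdifferentiableAt
      rw [mD_eq_fderiv, hf.fderiv] at e3
      have e4 := mD_comp (E := Euc 6) (E' := Euc m) (E'' := Euc m)
        (g := fun q => B.act q ((extChartAt 𝓘(ℝ, Euc n) (1 : G)).symm z)) (f := s)
        (B.mdiff_act_right _ _) hs.mdiff
      have e5 := congrArg (fun L : Euc 6 →L[ℝ] Euc m => L v) (e3.symm.trans e4)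
      rw [pullForm_oneForm]
      change A.θm (B.param s (y₀, z))
        (mD (Euc 6 × Euc n) (Euc m) (B.param s) (y₀, z) (v, 0)) = 0
      rw [show mD (Euc 6 × Euc n) (Euc m) (B.param s) (y₀, z) (v, 0) = _ from e5]
      refine (A.equivariant ((extChartAt 𝓘(ℝ, Euc n) (1 : G)).symm z) (s y₀)
        (mD (Euc 6) (Euc m) s y₀ v)).trans ?_
      change (Ad _ : Euc n →L[ℝ] Euc n) (A.gauge s y₀ v) = 0
      rw [h.gauge_apply, map_zero]
    have e6 := e1.unique ((hasFDerivAt_const (0 : Euc n) _).congr_of_eventuallyEq e2)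
    exact congrArg (fun L : Euc n →L[ℝ] Euc n => L ζ) e6
  have h2 : fderiv ℝ (fun q => pullForm (B.param s) (oneForm A.θ) q ![((0 : Euc 6), ζ)])
      (y₀, extChartAt 𝓘(ℝ, Euc n) (1 : G) 1) (v, 0) = 0 := by
    have e1 := HasFDerivAt.comp (f := fun y : Euc 6 => (y, extChartAt 𝓘(ℝ, Euc n) (1 : G) 1)) y₀
      (hd' ![(0, ζ)]).hasFDerivAt (hasFDerivAt_prodMk_left y₀ _)
    have e2 : (fun y => pullForm (B.param s) (oneForm A.θ)
        (y, extChartAt 𝓘(ℝ, Euc n) (1 : G) 1) ![(0, ζ)]) =ᶠ[𝓝 y₀] fun _ => ζ := by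
      filter_upwards [hs.eventually] with y hy
      rw [pullForm_param hy, map_zero, zero_add]
    have e6 := e1.unique ((hasFDerivAt_const ζ _).congr_of_eventuallyEq e2)
    exact congrArg (fun L : Euc 6 →L[ℝ] Euc n => L v) e6
  rw [h1, h2, sub_zero]

/-- The restriction of the connection form to a section. -/
theorem gaugeForm_eventuallyEq (hs : B.IsLocalSection x₀ y₀ s) : A.gaugeForm s =ᶠ[𝓝 y₀] fun y =>
    (pullForm (B.param s) (oneForm A.θ)
      (y, extChartAt 𝓘(ℝ, Euc n) (1 : G) 1)).compContinuousLinearMap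
      (ContinuousLinearMap.inl ℝ (Euc 6) (Euc n)) := by
  filter_upwards [hs.eventually] with y hy
  refine ContinuousAlternatingMap.ext fun v => ?_
  have hv : v = ![v 0] := by ext i; fin_cases i; rfl
  rw [hv, ContinuousAlternatingMap.compContinuousLinearMap_apply]
  have h1 : (⇑(ContinuousLinearMap.inl ℝ (Euc 6) (Euc n)) ∘ ![v 0]) = ![(v 0, 0)] := by
    ext1 i; fin_cases i; rfl
  rw [h1, pullForm_param hy, add_zero]
  rfl

theorem extDeriv_gaugeForm (hs : B.IsLocalSection x₀ y₀ s) : extDeriv (A.gaugeForm s) y₀ =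
    (extDeriv (pullForm (B.param s) (oneForm A.θ))
      (y₀, extChartAt 𝓘(ℝ, Euc n) (1 : G) 1)).compContinuousLinearMap
      (ContinuousLinearMap.inl ℝ (Euc 6) (Euc n)) := by
  have h1 : HasFDerivAt (fun y : Euc 6 => (y, extChartAt 𝓘(ℝ, Euc n) (1 : G) 1))
    (ContinuousLinearMap.inl ℝ _ _) y₀ := hasFDerivAt_prodMk_left y₀ _
  have h2 := extDeriv_pullback
    (f := fun y : Euc 6 => (y, extChartAt 𝓘(ℝ, Euc n) (1 : G) 1)) (x := y₀) (r := ∞)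
    ((contDiffAt_pullForm_param (A := A) hs).differentiableAt (by simp))
    (contDiffAt_id.prodMk contDiffAt_const)
    (by rw [minSmoothness_of_isRCLikeNormedField]; norm_cast)
  rw [h1.fderiv] at h2
  rw [← h2]
  refine ((gaugeForm_eventuallyEq hs).trans ?_).extDeriv_eq
  refine Eventually.of_forall fun y => ?_
  change _ = ContinuousAlternatingMap.compContinuousLinearMap _
    (fderiv ℝ (fun y : Euc 6 => (y, extChartAt 𝓘(ℝ, Euc n) (1 : G) 1)) y)
  rw [(hasFDerivAt_prodMk_left y (extChartAt 𝓘(ℝ, Euc n) (1 : G) 1)).fderiv]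

theorem IsHorizontalAt.curvature_eq (h : A.IsHorizontalAt x₀ y₀ s) :
    A.curvature.read x₀ s y₀ = extDeriv (A.gaugeForm s) y₀ := by
  rw [curvature_frameMap h.isLocal, extDeriv_gaugeForm h.isLocal, h.gauge_eq]
  congr 1
  ext1 v
  exact Prod.ext rfl neg_zero

/-- Where a = s*θ vanishes, F and da agree to first order: their difference is quadratic in a. In
the parametrisation this is the vanishing of dθ on a vertical and a horizontal vector, since the
derivative of (v, -a(v)) is vertical. -/
theorem IsHorizontalAt.fderiv_curvature (h : A.IsHorizontalAt x₀ y₀ s) (v w : Euc 6) :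
    fderiv ℝ (fun y => A.curvature.read x₀ s y ![v, w]) y₀ =
      fderiv ℝ (fun y => extDeriv (A.gaugeForm s) y ![v, w]) y₀ := by
  have hs := h.isLocal
  set D : Euc 6 → (Euc 6 × Euc n) [⋀^Fin 2]→L[ℝ] Euc n := fun y =>
    extDeriv (pullForm (B.param s) (oneForm A.θ)) (y, extChartAt 𝓘(ℝ, Euc n) (1 : G) 1) with hD
  have hDd : ContDiffAt ℝ ∞ D y₀ :=
    ContDiffAt.comp (g := extDeriv (pullForm (B.param s) (oneForm A.θ)))
      (f := fun y => (y, extChartAt 𝓘(ℝ, Euc n) (1 : G) 1)) y₀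
      (contDiffAt_extDeriv (contDiffAt_pullForm_param hs)) (contDiffAt_id.prodMk contDiffAt_const)
  have hev : (fun y => A.curvature.read x₀ s y ![v, w]) =ᶠ[𝓝 y₀] fun y =>
      D y ![(v, -A.gauge s y v), (w, -A.gauge s y w)] := by
    filter_upwards [hs.eventually] with y hy
    rw [curvature_frameMap hy, ContinuousAlternatingMap.compContinuousLinearMap_apply]
    congr 1
    ext1 i
    fin_cases i <;> rfl
  have hev' : (fun y => extDeriv (A.gaugeForm s) y ![v, w]) =ᶠ[𝓝 y₀] fun y =>
      D y ![(v, 0), (w, 0)] := by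
    filter_upwards [hs.eventually] with y hy
    rw [extDeriv_gaugeForm hy, ContinuousAlternatingMap.compContinuousLinearMap_apply]
    congr 1
    ext1 i
    fin_cases i <;> rfl
  rw [hev.fderiv_eq, hev'.fderiv_eq]
  set V : Fin 2 → Euc 6 → Euc 6 × Euc n :=
    ![fun y => (v, -A.gauge s y v), fun y => (w, -A.gauge s y w)] with hV
  have hV0 : (fun i => V i y₀) = ![(v, 0), (w, 0)] := by
    ext1 i
    fin_cases i
    · change (v, -A.gauge s y₀ v) = (v, 0)
      rw [h.gauge_apply, neg_zero]
    · change (w, -A.gauge s y₀ w) = (w, 0)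
      rw [h.gauge_apply, neg_zero]
  have hVd : ∀ u, HasFDerivAt (fun y => (u, -A.gauge s y u))
      ((0 : Euc 6 →L[ℝ] Euc 6).prod (-fderiv ℝ (fun y => A.gauge s y u) y₀)) y₀ := fun u =>
    (hasFDerivAt_const u y₀).prodMk
      (((contDiffAt_gauge (A := A) hs u).differentiableAt (by simp)).hasFDerivAt.neg)
  have hVd' : ∀ i, DifferentiableAt ℝ (V i) y₀ := by
    intro i
    fin_cases i
    · exact (hVd v).differentiableAt
    · exact (hVd w).differentiableAt
  ext1 e
  have hDdiff : DifferentiableAt ℝ D y₀ := hDd.differentiableAt (by simp)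
  have hfe : (fun y => D y ![(v, -A.gauge s y v), (w, -A.gauge s y w)]) =
      fun y => D y fun i => V i y := by
    funext y
    congr 1
    ext1 i
    fin_cases i <;> rfl
  rw [hfe, fderiv_continuousAlternatingMap_apply_apply hDdiff hVd', hV0,
    fderiv_continuousAlternatingMap_apply_const_apply hDdiff, Fin.sum_univ_two]
  have hmix : ∀ ζ u, D y₀ ![(0, ζ), (u, 0)] = 0 := fun ζ u => h.extDeriv_mixed u ζ
  have t1 : D y₀ (Function.update ![(v, 0), (w, 0)] 0 (fderiv ℝ (V 0) y₀ e)) = 0 := by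
    have : Function.update ![(v, (0 : Euc n)), (w, 0)] 0 (fderiv ℝ (V 0) y₀ e) =
        ![(0, -fderiv ℝ (fun y => A.gauge s y v) y₀ e), (w, 0)] := by
      ext1 i
      fin_cases i
      · exact congrArg (fun L : Euc 6 →L[ℝ] Euc 6 × Euc n => L e) (hVd v).fderiv
      · rfl
    rw [this, hmix]
  have t2 : D y₀ (Function.update ![(v, 0), (w, 0)] 1 (fderiv ℝ (V 1) y₀ e)) = 0 := by
    have : Function.update ![(v, (0 : Euc n)), (w, 0)] 1 (fderiv ℝ (V 1) y₀ e) =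
        ![(0, -fderiv ℝ (fun y => A.gauge s y w) y₀ e), (v, 0)] ∘ Equiv.swap 0 1 := by
      ext1 i
      fin_cases i
      · rfl
      · exact congrArg (fun L : Euc 6 →L[ℝ] Euc 6 × Euc n => L e) (hVd w).fderiv
    rw [this, show D y₀ (_ ∘ Equiv.swap 0 1) = -D y₀ _ from
      (D y₀).toAlternatingMap.map_swap _ (by decide), hmix, neg_zero]
  rw [t1, t2, add_zero, add_zero]

/-- The Bianchi identity. -/
theorem IsHorizontalAt.bianchi (h : A.IsHorizontalAt x₀ y₀ s) :
    extDeriv (A.curvature.read x₀ s) y₀ = 0 := by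
  have hd : DifferentiableAt ℝ (A.curvature.read x₀ s) y₀ :=
    (contDiffAt_curvature h.isLocal).differentiableAt (by simp)
  have hd' : DifferentiableAt ℝ (extDeriv (A.gaugeForm s)) y₀ :=
    (contDiffAt_extDeriv (contDiffAt_gaugeForm h.isLocal)).differentiableAt (by simp)
  refine ContinuousAlternatingMap.ext fun v => ?_
  have hv : v = ![v 0, v 1, v 2] := by ext i; fin_cases i <;> rfl
  -- Only first derivatives of F enter dF, so F may be replaced by da, and dda = 0.
  rw [hv, extDeriv_two_apply hd, h.fderiv_curvature, h.fderiv_curvature, h.fderiv_curvature,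
    ← extDeriv_two_apply hd', extDeriv_extDeriv_apply (contDiffAt_gaugeForm h.isLocal)
      (by rw [minSmoothness_of_isRCLikeNormedField]; norm_cast)]

theorem contDiffAt_fderiv_apply {E F : Type*} [NormedAddCommGroup E] [NormedSpace ℝ E]
    [NormedAddCommGroup F] [NormedSpace ℝ F] {f : E → F} {y : E} (h : ContDiffAt ℝ ∞ f y) (v : E) :
    ContDiffAt ℝ ∞ (fun z => fderiv ℝ f z v) y :=
  (h.fderiv_right (m := ∞) (by simp)).clm_apply contDiffAt_const

/-- The covariant derivative of a section, in a local section. -/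
def d₀Form (A : B.Connection) (Φ : P → Euc n) (x₀ : X) (s : Euc 6 → P) (y : Euc 6) :
    Euc 6 →L[ℝ] Euc n := (A.d₀m Φ (s y)).comp (frameMap x₀ y)

theorem d₀Form_apply_eventuallyEq (hs : B.IsLocalSection x₀ y₀ s) (Φ : B.AdSection) (v : Euc 6) :
    (fun y => A.d₀Form Φ.val x₀ s y v) =ᶠ[𝓝 y₀] fun y => fderiv ℝ (fun z => Φ.val (s z)) y v +
      toCLM₂ (lieBr n G) (A.gauge s y v) (Φ.val (s y)) := by
  filter_upwards [hs.eventually] with y hy using d₀m_frameMap hy Φ v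

theorem contDiffAt_d₀Form (hs : B.IsLocalSection x₀ y₀ s) (Φ : B.AdSection) (v : Euc 6) :
    ContDiffAt ℝ ∞ (fun y => A.d₀Form Φ.val x₀ s y v) y₀ := by
  refine ContDiffAt.congr_of_eventuallyEq ?_ (d₀Form_apply_eventuallyEq hs Φ v)
  have h2 := contDiffAt_gauge (A := A) hs v
  have h3 := contDiffAt_section hs Φ
  exact (contDiffAt_fderiv_apply h3 v).add
    ((contDiffAt_const.clm_apply h2).clm_apply h3)

theorem IsHorizontalAt.d₀Form_eq (h : A.IsHorizontalAt x₀ y₀ s) (Φ : B.AdSection) :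
    A.d₀Form Φ.val x₀ s y₀ = fderiv ℝ (fun y => Φ.val (s y)) y₀ := by
  ext1 v
  refine (d₀Form_apply_eventuallyEq h.isLocal Φ v).self_of_nhds.trans ?_
  simp only [h.gauge_apply, map_zero, zero_apply, add_zero]

/-- The square of the covariant derivative of a section is the action of the curvature. -/
theorem IsHorizontalAt.d₀Form_comm (h : A.IsHorizontalAt x₀ y₀ s) (Φ : B.AdSection) (v w : Euc 6) :
    fderiv ℝ (fun y => A.d₀Form Φ.val x₀ s y w) y₀ v -
      fderiv ℝ (fun y => A.d₀Form Φ.val x₀ s y v) y₀ w =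
      lieBr n G (A.curvature.read x₀ s y₀ ![v, w]) (Φ.val (s y₀)) := by
  have hs := h.isLocal
  have hg : ∀ u, DifferentiableAt ℝ (fun y => A.gauge s y u) y₀ := fun u =>
    (contDiffAt_gauge hs u).differentiableAt (by simp)
  have hΦ := contDiffAt_section hs Φ
  have hΦd : DifferentiableAt ℝ (fun y => Φ.val (s y)) y₀ := hΦ.differentiableAt (by simp)
  have h2 : HasFDerivAt (fderiv ℝ (fun y => Φ.val (s y)))
      (fderiv ℝ (fderiv ℝ (fun y => Φ.val (s y))) y₀) y₀ :=
    ((hΦ.fderiv_right (m := 1) (by norm_cast)).differentiableAt (by simp)).hasFDerivAt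
  -- The term [a, dΦ] of the product rule vanishes because a = 0 at y₀. Antisymmetrisation then
  -- removes the second derivative of Φ and leaves [da, Φ].
  have h1 : ∀ u e, fderiv ℝ (fun y => A.d₀Form Φ.val x₀ s y u) y₀ e =
      fderiv ℝ (fderiv ℝ (fun y => Φ.val (s y))) y₀ e u +
        lieBr n G (fderiv ℝ (fun y => A.gauge s y u) y₀ e) (Φ.val (s y₀)) := by
    intro u e
    rw [(d₀Form_apply_eventuallyEq hs Φ u).fderiv_eq]
    have h3 := (h2.clm_apply (hasFDerivAt_const u y₀)).add
      ((toCLM₂ (lieBr n G)).hasFDerivAt_of_bilinear (hg u).hasFDerivAt hΦd.hasFDerivAt)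
    refine (congrArg (fun L : Euc 6 →L[ℝ] Euc n => L e) h3.fderiv).trans ?_
    simp [h.gauge_apply, toCLM₂_apply]
  have hsymm : IsSymmSndFDerivAt ℝ (fun y => Φ.val (s y)) y₀ :=
    hΦ.isSymmSndFDerivAt (by rw [minSmoothness_of_isRCLikeNormedField]; norm_cast)
  rw [h1, h1, h.curvature_eq, extDeriv_one_apply
    ((contDiffAt_gaugeForm hs).differentiableAt (by simp)), hsymm.eq v w, map_sub,
    LinearMap.sub_apply]
  have e1 : ∀ u, (fun z => A.gaugeForm s z ![u]) = fun z => A.gauge s z u := fun u => rfl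
  rw [e1, e1]
  abel

end Connection
end PrincipalBundle
end Horizontal

/-! ### Smooth forms on the base -/

section BaseGeometry

open Filter Topology

variable {X : Type*} [TopologicalSpace X] [ChartedSpace (Euc 6) X] [IsManifold (𝓡 6) ∞ X]

/-- Smoothness of vector fields along an inverse chart. -/
theorem contMDiffAt_vector_iff {x₀ : X} {y : Euc 6}
    (hy : y ∈ (extChartAt 𝓘(ℝ, Euc 6) x₀).target)
    (V : (z : Euc 6) → TangentSpace (𝓡 6) ((extChartAt 𝓘(ℝ, Euc 6) x₀).symm z)) :
    ContMDiffAt 𝓘(ℝ, Euc 6) ((𝓡 6).prod 𝓘(ℝ, Euc 6)) ∞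
      (fun z => Bundle.TotalSpace.mk' (Euc 6) (E := fun x : X => TangentSpace (𝓡 6) x)
        ((extChartAt 𝓘(ℝ, Euc 6) x₀).symm z) (V z)) y ↔
    ContDiffAt ℝ ∞ (fun z => mD (Euc 6) (Euc 6) (extChartAt 𝓘(ℝ, Euc 6) x₀)
      ((extChartAt 𝓘(ℝ, Euc 6) x₀).symm z) (V z)) y := by
  have hs : ∀ z ∈ (extChartAt 𝓘(ℝ, Euc 6) x₀).target,
      (extChartAt 𝓘(ℝ, Euc 6) x₀).symm z ∈ (chartAt (Euc 6) x₀).source := fun z hz => by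
    have := (extChartAt 𝓘(ℝ, Euc 6) x₀).map_target hz
    rwa [extChartAt_source] at this
  have he : Bundle.TotalSpace.mk' (Euc 6) (E := fun x : X => TangentSpace (𝓡 6) x)
      ((extChartAt 𝓘(ℝ, Euc 6) x₀).symm y) (V y) ∈
      (trivializationAt (Euc 6) (TangentSpace (𝓡 6)) x₀).source := by
    rw [Bundle.Trivialization.mem_source, TangentBundle.trivializationAt_baseSet]
    exact hs y hy
  refine (Bundle.Trivialization.contMDiffAt_iff (IB := 𝓡 6) (n := ∞)
    (f := fun z => Bundle.TotalSpace.mk' (Euc 6) (E := fun x : X => TangentSpace (𝓡 6) x)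
      ((extChartAt 𝓘(ℝ, Euc 6) x₀).symm z) (V z)) he).trans
    ((and_iff_right (contMDiffAt_chart_symm hy)).trans
      (Iff.trans ?_ contMDiffAt_iff_contDiffAt))
  refine EventuallyEq.contMDiffAt_iff ?_
  filter_upwards [chart_target_mem hy] with z hz
  have h1 := TangentBundle.continuousLinearMapAt_trivializationAt (I := 𝓡 6) (hs z hz)
  have h2 := congrArg (fun L : Euc 6 →L[ℝ] Euc 6 => L (V z)) h1
  refine Eq.trans ?_ h2
  have hb : (extChartAt 𝓘(ℝ, Euc 6) x₀).symm z ∈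
      (trivializationAt (Euc 6) (TangentSpace (𝓡 6)) x₀).baseSet := by
    rw [TangentBundle.trivializationAt_baseSet]
    exact hs z hz
  exact (congrFun ((trivializationAt (Euc 6) (TangentSpace (𝓡 6)) x₀).coe_linearMapAt_of_mem
    (R := ℝ) hb) (V z)).symm

theorem contMDiffAt_frameMap {x₀ : X} {y : Euc 6} (hy : y ∈ (extChartAt 𝓘(ℝ, Euc 6) x₀).target)
    (v : Euc 6) : ContMDiffAt 𝓘(ℝ, Euc 6) ((𝓡 6).prod 𝓘(ℝ, Euc 6)) ∞
      (fun z => Bundle.TotalSpace.mk' (Euc 6) (E := fun x : X => TangentSpace (𝓡 6) x)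
        ((extChartAt 𝓘(ℝ, Euc 6) x₀).symm z) (PrincipalBundle.frameMap x₀ z v)) y := by
  refine (contMDiffAt_vector_iff hy fun z => PrincipalBundle.frameMap x₀ z v).mpr ?_
  refine (contDiffAt_const (c := v)).congr_of_eventuallyEq ?_
  filter_upwards [chart_target_mem hy] with z hz
  exact congrArg (fun L : Euc 6 →L[ℝ] Euc 6 => L v) (mD_chart_comp_symm hz)

namespace AlmostHermitian

variable (S : AlmostHermitian X)

/-- The metric on the model space. -/
def gM (x : X) : Euc 6 →L[ℝ] Euc 6 →L[ℝ] ℝ := S.g.inner x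

/-- The almost complex structure on the model space. -/
def JM (x : X) : Euc 6 →L[ℝ] Euc 6 := S.J x

theorem contDiffAt_metric {x₀ : X} {y : Euc 6} {V W : Euc 6 → Euc 6}
    (hV : ContMDiffAt 𝓘(ℝ, Euc 6) ((𝓡 6).prod 𝓘(ℝ, Euc 6)) ∞
      (fun z => Bundle.TotalSpace.mk' (Euc 6) (E := fun x : X => TangentSpace (𝓡 6) x)
        ((extChartAt 𝓘(ℝ, Euc 6) x₀).symm z) (V z)) y)
    (hW : ContMDiffAt 𝓘(ℝ, Euc 6) ((𝓡 6).prod 𝓘(ℝ, Euc 6)) ∞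
      (fun z => Bundle.TotalSpace.mk' (Euc 6) (E := fun x : X => TangentSpace (𝓡 6) x)
        ((extChartAt 𝓘(ℝ, Euc 6) x₀).symm z) (W z)) y) :
    ContDiffAt ℝ ∞ (fun z => S.gM ((extChartAt 𝓘(ℝ, Euc 6) x₀).symm z) (V z) (W z)) y := by
  have hb : ContMDiffAt 𝓘(ℝ, Euc 6) (𝓡 6) ∞ (extChartAt 𝓘(ℝ, Euc 6) x₀).symm y :=
    (Bundle.contMDiffAt_totalSpace.mp hV).1
  have : ContMDiffAt 𝓘(ℝ, Euc 6) ((𝓡 6).prod 𝓘(ℝ)) ∞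
      (fun z => Bundle.TotalSpace.mk' ℝ (E := Bundle.Trivial X ℝ)
        ((extChartAt 𝓘(ℝ, Euc 6) x₀).symm z)
        (S.g.inner ((extChartAt 𝓘(ℝ, Euc 6) x₀).symm z) (V z) (W z))) y := by
    apply ContMDiffAt.clm_bundle_apply₂ (F₁ := Euc 6) (F₂ := Euc 6)
    · exact ContMDiffAt.comp y S.g.contMDiff.contMDiffAt hb
    · exact hV
    · exact hW
  exact contMDiffAt_iff_contDiffAt.mp (Bundle.contMDiffAt_totalSpace.mp this).2

theorem contMDiffAt_J {x₀ : X} {y : Euc 6} {V : Euc 6 → Euc 6}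
    (hV : ContMDiffAt 𝓘(ℝ, Euc 6) ((𝓡 6).prod 𝓘(ℝ, Euc 6)) ∞
      (fun z => Bundle.TotalSpace.mk' (Euc 6) (E := fun x : X => TangentSpace (𝓡 6) x)
        ((extChartAt 𝓘(ℝ, Euc 6) x₀).symm z) (V z)) y) :
    ContMDiffAt 𝓘(ℝ, Euc 6) ((𝓡 6).prod 𝓘(ℝ, Euc 6)) ∞
      (fun z => Bundle.TotalSpace.mk' (Euc 6) (E := fun x : X => TangentSpace (𝓡 6) x)
        ((extChartAt 𝓘(ℝ, Euc 6) x₀).symm z)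
        (S.JM ((extChartAt 𝓘(ℝ, Euc 6) x₀).symm z) (V z))) y := by
  have hb : ContMDiffAt 𝓘(ℝ, Euc 6) (𝓡 6) ∞ (extChartAt 𝓘(ℝ, Euc 6) x₀).symm y :=
    (Bundle.contMDiffAt_totalSpace.mp hV).1
  exact ContMDiffAt.clm_bundle_apply (F₁ := Euc 6) (F₂ := Euc 6)
    (E₁ := fun x : X => TangentSpace (𝓡 6) x) (E₂ := fun x : X => TangentSpace (𝓡 6) x)
    (ContMDiffAt.comp y S.J_smooth.contMDiffAt hb) hV

/-- The almost complex structure in a chart. -/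
def coordJ (x₀ : X) (y : Euc 6) : Euc 6 →L[ℝ] Euc 6 :=
  (mD (Euc 6) (Euc 6) (extChartAt 𝓘(ℝ, Euc 6) x₀) ((extChartAt 𝓘(ℝ, Euc 6) x₀).symm y)).comp
    ((S.JM ((extChartAt 𝓘(ℝ, Euc 6) x₀).symm y)).comp (PrincipalBundle.frameMap x₀ y))

theorem contDiffAt_coordJ {x₀ : X} {y : Euc 6} (hy : y ∈ (extChartAt 𝓘(ℝ, Euc 6) x₀).target)
    (v : Euc 6) : ContDiffAt ℝ ∞ (fun z => S.coordJ x₀ z v) y :=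
  (contMDiffAt_vector_iff hy _).mp (S.contMDiffAt_J (contMDiffAt_frameMap hy v))

theorem frameMap_coordJ {x₀ : X} {y : Euc 6} (hy : y ∈ (extChartAt 𝓘(ℝ, Euc 6) x₀).target)
    (v : Euc 6) : PrincipalBundle.frameMap x₀ y (S.coordJ x₀ y v) =
      S.JM ((extChartAt 𝓘(ℝ, Euc 6) x₀).symm y) (PrincipalBundle.frameMap x₀ y v) := by
  have h := mD_symm_comp_chart ((extChartAt 𝓘(ℝ, Euc 6) x₀).map_target hy)
  rw [(extChartAt 𝓘(ℝ, Euc 6) x₀).right_inv hy] at h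
  exact congrArg (fun L : Euc 6 →L[ℝ] Euc 6 => L
    (S.JM ((extChartAt 𝓘(ℝ, Euc 6) x₀).symm y) (PrincipalBundle.frameMap x₀ y v))) h

/-- The metric in a chart. -/
def coordG (x₀ : X) (y v w : Euc 6) : ℝ :=
  S.gM ((extChartAt 𝓘(ℝ, Euc 6) x₀).symm y) (PrincipalBundle.frameMap x₀ y v)
    (PrincipalBundle.frameMap x₀ y w)

theorem contDiffAt_coordG {x₀ : X} {y : Euc 6} (hy : y ∈ (extChartAt 𝓘(ℝ, Euc 6) x₀).target)
    (v w : Euc 6) : ContDiffAt ℝ ∞ (fun z => S.coordG x₀ z v w) y :=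
  S.contDiffAt_metric (contMDiffAt_frameMap hy v) (contMDiffAt_frameMap hy w)

theorem isSmoothForm_of_contDiffAt {W : Type*} [NormedAddCommGroup W] [NormedSpace ℝ W]
    [FiniteDimensional ℝ W] {k : ℕ} {α : DiffForm (Euc 6) X W k}
    (h : ∀ x₀ : X, ∀ y ∈ (extChartAt 𝓘(ℝ, Euc 6) x₀).target, ∀ v,
      ContDiffAt ℝ ∞ (fun z => coordRep α x₀ z v) y) : IsSmoothForm α :=
  fun x₀ y hy => (contDiffAt_form (h x₀ y hy)).contDiffWithinAt

theorem isSmoothForm_omega : IsSmoothForm S.omega := by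
  refine isSmoothForm_of_contDiffAt fun x₀ y hy v => ?_
  exact S.contDiffAt_metric (S.contMDiffAt_J (contMDiffAt_frameMap hy (v 0)))
    (contMDiffAt_frameMap hy (v 1))

end AlmostHermitian

/-- Only Ω₁ is smooth by definition. In a chart Ω₂ is Ω₁ composed with the coordinate expression of
J, which is smooth. -/
theorem SU3Structure.isSmoothForm_im (S : SU3Structure X) : IsSmoothForm S.Ω₂ := by
  refine AlmostHermitian.isSmoothForm_of_contDiffAt fun x₀ y hy v => ?_
  have h1 : ContDiffAt ℝ ∞ (fun z => coordRep S.Ω₁ x₀ z fun i => S.coordJ x₀ z (v i)) y :=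
    contDiffAt_form_apply (S.smooth.contDiffAt hy) fun i => S.contDiffAt_coordJ hy (v i)
  refine h1.congr_of_eventuallyEq ?_
  filter_upwards [chart_target_mem hy] with z hz
  change DiffForm.atModel S.Ω₁ ((extChartAt 𝓘(ℝ, Euc 6) x₀).symm z) (fun i =>
    S.JM ((extChartAt 𝓘(ℝ, Euc 6) x₀).symm z) (PrincipalBundle.frameMap x₀ z (v i))) =
    DiffForm.atModel S.Ω₁ ((extChartAt 𝓘(ℝ, Euc 6) x₀).symm z) fun i =>
      PrincipalBundle.frameMap x₀ z (S.coordJ x₀ z (v i))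
  congr 1
  funext i
  exact (S.frameMap_coordJ hz (v i)).symm

end BaseGeometry

/-! ### Wedge products in low degree -/

section WedgeCalculus

variable {E F W W₁ W₂ W₃ : Type*} [NormedAddCommGroup E] [NormedSpace ℝ E]
  [FiniteDimensional ℝ E] [NormedAddCommGroup F] [NormedSpace ℝ F]
  [NormedAddCommGroup W] [NormedSpace ℝ W] [FiniteDimensional ℝ W]
  [NormedAddCommGroup W₁] [NormedSpace ℝ W₁] [FiniteDimensional ℝ W₁]
  [NormedAddCommGroup W₂] [NormedSpace ℝ W₂] [FiniteDimensional ℝ W₂]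
  [NormedAddCommGroup W₃] [NormedSpace ℝ W₃] {k l N : ℕ}

/-- The wedge product commutes with pullbacks. -/
theorem wedge_comp (B : W₁ →ₗ[ℝ] W₂ →ₗ[ℝ] W₃) (α : E [⋀^Fin k]→L[ℝ] W₁)
    (β : E [⋀^Fin l]→L[ℝ] W₂) (L : E →L[ℝ] E) (R : Fin N → Equiv.Perm (Fin (k + l)))
    (hN : N * (k.factorial * l.factorial) = (k + l).factorial)
    (hR : ∀ i j, (∀ a : Fin k, ∃ b : Fin k, R i (Fin.castAdd l a) = R j (Fin.castAdd l b)) → i = j)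
    (v : Fin (k + l) → E) :
    wedge B (α.compContinuousLinearMap L) (β.compContinuousLinearMap L) v =
      wedge B α β fun i => L (v i) := by
  rw [wedge_eq_sum_reps B _ _ R hN hR, wedge_eq_sum_reps B _ _ R hN hR]
  rfl

theorem contDiffAt_wedge {r : WithTop ℕ∞} (B : W₁ →ₗ[ℝ] W₂ →ₗ[ℝ] W) {α : F → E [⋀^Fin k]→L[ℝ] W₁}
    {β : F → E [⋀^Fin l]→L[ℝ] W₂} {y : F} (hα : ContDiffAt ℝ r α y) (hβ : ContDiffAt ℝ r β y)
    (R : Fin N → Equiv.Perm (Fin (k + l)))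
    (hN : N * (k.factorial * l.factorial) = (k + l).factorial)
    (hR : ∀ i j, (∀ a : Fin k, ∃ b : Fin k,
      R i (Fin.castAdd l a) = R j (Fin.castAdd l b)) → i = j) :
    ContDiffAt ℝ r (fun z => wedge B (α z) (β z)) y := by
  refine contDiffAt_form fun v => ?_
  simp only [wedge_eq_sum_reps B _ _ R hN hR]
  refine ContDiffAt.sum fun i _ => ?_
  simp only [← Int.cast_smul_eq_zsmul ℝ]
  refine contDiffAt_const.smul ?_
  have h1 : ContDiffAt ℝ r (fun z => α z fun a => v (R i (Fin.castAdd l a))) y :=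
    contDiffAt_form_apply hα fun _ => contDiffAt_const
  have h2 : ContDiffAt ℝ r (fun z => β z fun b => v (R i (Fin.natAdd k b))) y :=
    contDiffAt_form_apply hβ fun _ => contDiffAt_const
  have h3 : ContDiffAt ℝ r (fun z => toCLM₂ B (α z fun a => v (R i (Fin.castAdd l a)))) y :=
    (toCLM₂ B).contDiff.contDiffAt.comp y h1
  exact h3.clm_apply h2

/-- The product rule for the wedge product. -/
theorem fderiv_wedge (B : W₁ →ₗ[ℝ] W₂ →ₗ[ℝ] W) {α : F → E [⋀^Fin k]→L[ℝ] W₁}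
    {β : F → E [⋀^Fin l]→L[ℝ] W₂} {y : F} (hα : DifferentiableAt ℝ α y)
    (hβ : DifferentiableAt ℝ β y) (R : Fin N → Equiv.Perm (Fin (k + l)))
    (hN : N * (k.factorial * l.factorial) = (k + l).factorial)
    (hR : ∀ i j, (∀ a : Fin k, ∃ b : Fin k, R i (Fin.castAdd l a) = R j (Fin.castAdd l b)) → i = j)
    (v : Fin (k + l) → E) (e : F) :
    fderiv ℝ (fun z => wedge B (α z) (β z) v) y e =
      wedge B (fderiv ℝ α y e) (β y) v + wedge B (α y) (fderiv ℝ β y e) v := by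
  have h := HasFDerivAt.fun_sum (u := (Finset.univ : Finset (Fin N))) fun i _ =>
    ((toCLM₂ B).hasFDerivAt_of_bilinear
      (hα.hasFDerivAt.continuousAlternatingMap_apply_const fun a => v (R i (Fin.castAdd l a)))
      (hβ.hasFDerivAt.continuousAlternatingMap_apply_const fun b =>
        v (R i (Fin.natAdd k b)))).const_smul ((Equiv.Perm.sign (R i) : ℤ) : ℝ)
  have e1 : (fun z => wedge B (α z) (β z) v) = fun z => ∑ i,
      ((Equiv.Perm.sign (R i) : ℤ) : ℝ) • toCLM₂ B (α z fun a => v (R i (Fin.castAdd l a)))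
        (β z fun b => v (R i (Fin.natAdd k b))) := by
    funext z
    rw [wedge_eq_sum_reps B _ _ R hN hR]
    simp only [Int.cast_smul_eq_zsmul, toCLM₂_apply]
  rw [e1]
  refine (congrArg (fun L : F →L[ℝ] W => L e) h.fderiv).trans ?_
  rw [wedge_eq_sum_reps B _ _ R hN hR, wedge_eq_sum_reps B _ _ R hN hR, sum_apply,
    ← Finset.sum_add_distrib]
  refine Finset.sum_congr rfl fun i _ => ?_
  simp only [← Int.cast_smul_eq_zsmul ℝ]
  rw [← smul_add, add_comm (B _ _)]
  rfl

end WedgeCalculus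

/-! ### Three-forms and complex structures -/

section ThreeForms

variable {E : Type*} [NormedAddCommGroup E] [NormedSpace ℝ E] [FiniteDimensional ℝ E]

theorem extDeriv_three_apply' {α : E → E [⋀^Fin 3]→L[ℝ] ℝ} {y : E} (h : DifferentiableAt ℝ α y)
    (u v w x : E) : extDeriv α y ![u, v, w, x] =
      fderiv ℝ α y u ![v, w, x] - fderiv ℝ α y v ![u, w, x]
        + fderiv ℝ α y w ![u, v, x] - fderiv ℝ α y x ![u, v, w] := by
  rw [extDeriv_three_apply h]
  simp only [fderiv_continuousAlternatingMap_apply_const_apply h]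

theorem fderiv_three_first {α : E → E [⋀^Fin 3]→L[ℝ] ℝ} {K : E → E} {y : E}
    (hα : DifferentiableAt ℝ α y) (hK : DifferentiableAt ℝ K y) (b c e : E) :
    fderiv ℝ (fun z => α z ![K z, b, c]) y e =
      fderiv ℝ α y e ![K y, b, c] + α y ![fderiv ℝ K y e, b, c] := by
  have hV : ∀ i, DifferentiableAt ℝ ((![K, fun _ => b, fun _ => c] : Fin 3 → E → E) i) y := by
    intro i
    fin_cases i
    exacts [hK, differentiableAt_const b, differentiableAt_const c]
  have h := fderiv_continuousAlternatingMap_apply_apply hα hV e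
  have e1 : ∀ z, (fun i => (![K, fun _ => b, fun _ => c] : Fin 3 → E → E) i z) = ![K z, b, c] := by
    intro z; ext1 i; fin_cases i <;> rfl
  simp only [e1] at h
  rw [h, Fin.sum_univ_three]
  have t0 : Function.update ![K y, b, c] 0 (fderiv ℝ K y e) = ![fderiv ℝ K y e, b, c] := by
    ext1 i; fin_cases i <;> rfl
  have t1 : α y (Function.update ![K y, b, c] 1 (fderiv ℝ (fun _ => b) y e)) = 0 := by
    rw [fderiv_fun_const]; exact (α y).map_update_zero _ _
  have t2 : α y (Function.update ![K y, b, c] 2 (fderiv ℝ (fun _ => c) y e)) = 0 := by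
    rw [fderiv_fun_const]; exact (α y).map_update_zero _ _
  simp only [Matrix.cons_val_zero, Matrix.cons_val_one, Matrix.cons_val] at *
  rw [t0, t1, t2, add_zero, add_zero]

/-- If `Ω₁ + i Ω₂` is of type `(3, 0)` and `Ω₁` is closed, then the component of type `(2, 2)` of
`dΩ₂` satisfies the following symmetries. -/
theorem extDeriv_im_symm {Ω₁ Ω₂ : E → E [⋀^Fin 3]→L[ℝ] ℝ} {J : E → E → E} {y : E}
    (h₁ : DifferentiableAt ℝ Ω₁ y) (h₂ : DifferentiableAt ℝ Ω₂ y)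
    (hJ : ∀ v, DifferentiableAt ℝ (fun z => J z v) y)
    (hre : ∀ᶠ z in nhds y, ∀ a b c, Ω₁ z ![J z a, b, c] = -Ω₂ z ![a, b, c])
    (him : ∀ᶠ z in nhds y, ∀ a b c, Ω₂ z ![J z a, b, c] = Ω₁ z ![a, b, c])
    (hd : extDeriv Ω₁ y = 0) (a b c : E) :
    extDeriv Ω₂ y ![a, b, c, J y c] = extDeriv Ω₂ y ![J y a, J y b, c, J y c] ∧
      extDeriv Ω₂ y ![J y a, b, c, J y c] = -extDeriv Ω₂ y ![a, J y b, c, J y c] := by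
  -- In terms of types, dΩ has components of type (3,1) and (2,2) only, as Ω is of type (3,0). If
  -- dΩ₁ = 0, then dΩ = i dΩ₂ with dΩ₂ real, so conjugation leaves only type (2,2). Such a form is
  -- J-invariant, and both claims are instances of this. The steps below verify them directly.
  have r0 := hre.self_of_nhds
  have i0 := him.self_of_nhds
  have r1 : ∀ a b c, Ω₁ y ![a, J y b, c] = -Ω₂ y ![a, b, c] := fun a b c => by
    rw [(map_vec3_swap (Ω₁ y) (J y b) a c).1, r0, (map_vec3_swap (Ω₂ y) a b c).1, neg_neg]
  have r2 : ∀ a b c, Ω₁ y ![a, b, J y c] = -Ω₂ y ![a, b, c] := fun a b c => by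
    rw [(map_vec3_swap (Ω₁ y) (J y c) b a).2.2, r0, (map_vec3_swap (Ω₂ y) a b c).2.2, neg_neg]
  have i2 : ∀ a b c, Ω₂ y ![a, b, J y c] = Ω₁ y ![a, b, c] := fun a b c => by
    rw [(map_vec3_swap (Ω₂ y) (J y c) b a).2.2, i0, (map_vec3_swap (Ω₁ y) a b c).2.2, neg_neg]
  have dre : ∀ e a b c, fderiv ℝ Ω₁ y e ![J y a, b, c] +
      Ω₁ y ![fderiv ℝ (fun z => J z a) y e, b, c] = -fderiv ℝ Ω₂ y e ![a, b, c] := by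
    intro e a b c
    rw [← fderiv_three_first h₁ (hJ a), ← fderiv_continuousAlternatingMap_apply_const_apply h₂,
      ← neg_apply, ← fderiv_fun_neg]
    have : (fun z => Ω₁ z ![J z a, b, c]) =ᶠ[nhds y] fun z => -Ω₂ z ![a, b, c] := by
      filter_upwards [hre] with z hz using hz a b c
    rw [this.fderiv_eq]
  have dim : ∀ e a b c, fderiv ℝ Ω₂ y e ![J y a, b, c] +
      Ω₂ y ![fderiv ℝ (fun z => J z a) y e, b, c] = fderiv ℝ Ω₁ y e ![a, b, c] := by
    intro e a b c
    rw [← fderiv_three_first h₂ (hJ a), ← fderiv_continuousAlternatingMap_apply_const_apply h₁]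
    have : (fun z => Ω₂ z ![J z a, b, c]) =ᶠ[nhds y] fun z => Ω₁ z ![a, b, c] := by
      filter_upwards [him] with z hz using hz a b c
    rw [this.fderiv_eq]
  -- Differentiating the type condition produces derivatives of J; with (c, Jc) in the last two
  -- slots they drop out, because Ω₁ and Ω₂ vanish on such arguments.
  have e1 : ∀ e b c, fderiv ℝ Ω₁ y e ![b, c, J y c] = fderiv ℝ Ω₂ y e ![J y b, c, J y c] := by
    intro e b c
    have h := dim e b c (J y c)
    rw [i2, (map_vec3_eq_zero (Ω₁ y) c _).2.2, add_zero] at h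
    exact h.symm
  have e2 : ∀ e b c, fderiv ℝ Ω₂ y e ![b, c, J y c] = -fderiv ℝ Ω₁ y e ![J y b, c, J y c] := by
    intro e b c
    have h := dre e b c (J y c)
    rw [r2, (map_vec3_eq_zero (Ω₂ y) c _).2.2, neg_zero, add_zero] at h
    linarith
  -- For general arguments the derivative of J is eliminated between the differentiated conditions
  -- on Ω₁ and on Ω₂.
  have e3 : ∀ e a b d, fderiv ℝ Ω₁ y e ![a, b, d] - fderiv ℝ Ω₁ y e ![J y a, J y b, d]
      - fderiv ℝ Ω₂ y e ![a, J y b, d] - fderiv ℝ Ω₂ y e ![J y a, b, d] = 0 := by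
    intro e a b d
    have h1 := dre e a (J y b) d
    have h2 := dim e a b d
    rw [r1] at h1
    linarith
  have e4 : ∀ e a b d, fderiv ℝ Ω₂ y e ![a, b, d] - fderiv ℝ Ω₂ y e ![J y a, J y b, d]
      + fderiv ℝ Ω₁ y e ![a, J y b, d] + fderiv ℝ Ω₁ y e ![J y a, b, d] = 0 := by
    intro e a b d
    have i1 : ∀ a b c, Ω₂ y ![a, J y b, c] = Ω₁ y ![a, b, c] := fun a b c => by
      rw [(map_vec3_swap (Ω₂ y) (J y b) a c).1, i0, (map_vec3_swap (Ω₁ y) a b c).1, neg_neg]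
    have h1 := dim e a (J y b) d
    have h2 := dre e a b d
    rw [i1] at h1
    linarith
  have hz : ∀ a b c d, extDeriv Ω₁ y ![a, b, c, d] = 0 := fun a b c d => by rw [hd]; rfl
  have z1 := hz a (J y b) c (J y c)
  have z2 := hz (J y a) b c (J y c)
  have z3 := hz a b c (J y c)
  have z4 := hz (J y a) (J y b) c (J y c)
  rw [extDeriv_three_apply' h₁] at z1 z2 z3 z4
  simp only [extDeriv_three_apply' h₂]
  constructor
  · linarith [e1 a (J y b) c, e2 a b c, e1 (J y a) b c, e2 (J y a) (J y b) c, e1 b (J y a) c,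
      e2 b a c, e1 (J y b) a c, e2 (J y b) (J y a) c, e4 c a b (J y c), e4 (J y c) a b c,
      e1 a b c, e2 a (J y b) c, e1 b a c, e2 b (J y a) c, e1 (J y a) (J y b) c, e2 (J y a) b c,
      e1 (J y b) (J y a) c, e2 (J y b) a c]
  · linarith [e1 a (J y b) c, e2 a b c, e1 (J y a) b c, e2 (J y a) (J y b) c, e1 b (J y a) c,
      e2 b a c, e1 (J y b) a c, e2 (J y b) (J y a) c, e3 c a b (J y c), e3 (J y c) a b c,
      e1 a b c, e2 a (J y b) c, e1 b a c, e2 b (J y a) c, e1 (J y a) (J y b) c, e2 (J y a) b c,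
      e1 (J y b) (J y a) c, e2 (J y b) a c]

end ThreeForms

/-! ### The structure at a point in the model space -/

section PointwiseStructure

variable {X : Type*} [TopologicalSpace X] [ChartedSpace (Euc 6) X] [IsManifold (𝓡 6) ∞ X]

namespace AlmostHermitian

variable (S : AlmostHermitian X)

/-- The fundamental form on the model space. -/
def omegaM (x : X) : Euc 6 [⋀^Fin 2]→L[ℝ] ℝ := S.omega x

/-- The volume form on the model space. -/
def volM (x : X) : Euc 6 [⋀^Fin 6]→L[ℝ] ℝ := S.vol x

theorem volM_eq (x : X) :
    S.volM x = (1 / 6 : ℝ) • wedgeR (wedgeR (S.omegaM x) (S.omegaM x)) (S.omegaM x) := rfl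

variable {S} {W : Type*} [NormedAddCommGroup W] [NormedSpace ℝ W] {x : X}
  {o : Module.Basis (Fin 6) ℝ (Euc 6)}

theorem star_three_three (ho : OrthonormalFor (S.gM x) o) (α : Euc 6 [⋀^Fin 3]→L[ℝ] W) :
    S.star x 3 3 rfl α = hodge (k := 3) (m := 3) (S.gM x) o (S.volM x) α :=
  hodge_eq_of_orthonormal (k := 3) (m := 3) ho (EuclideanSpace.basisFun (Fin 6) ℝ).toBasis
    (S.volM x) α

theorem star_four_two (ho : OrthonormalFor (S.gM x) o) (α : Euc 6 [⋀^Fin 4]→L[ℝ] W) :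
    S.star x 4 2 rfl α = hodge (k := 4) (m := 2) (S.gM x) o (S.volM x) α :=
  hodge_eq_of_orthonormal (k := 4) (m := 2) ho (EuclideanSpace.basisFun (Fin 6) ℝ).toBasis
    (S.volM x) α

theorem star_five_one (ho : OrthonormalFor (S.gM x) o) (α : Euc 6 [⋀^Fin 5]→L[ℝ] W) :
    S.star x 5 1 rfl α = hodge (k := 5) (m := 1) (S.gM x) o (S.volM x) α :=
  hodge_eq_of_orthonormal (k := 5) (m := 1) ho (EuclideanSpace.basisFun (Fin 6) ℝ).toBasis
    (S.volM x) α

theorem star_six_zero (ho : OrthonormalFor (S.gM x) o) (α : Euc 6 [⋀^Fin 6]→L[ℝ] W) :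
    S.star x 6 0 rfl α = hodge (k := 6) (m := 0) (S.gM x) o (S.volM x) α :=
  hodge_eq_of_orthonormal (k := 6) (m := 0) ho (EuclideanSpace.basisFun (Fin 6) ℝ).toBasis
    (S.volM x) α

end AlmostHermitian

namespace SU3Structure

variable (S : SU3Structure X)

/-- The real part of the complex volume form on the model space. -/
def reM (x : X) : Euc 6 [⋀^Fin 3]→L[ℝ] ℝ := S.Ω₁ x

/-- The imaginary part of the complex volume form on the model space. -/
def imM (x : X) : Euc 6 [⋀^Fin 3]→L[ℝ] ℝ := S.Ω₂ x

theorem su3Point (x : X) :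
    SU3Point (S.gM x) (S.JM x) (S.omegaM x) (S.reM x) (S.imM x) := by
  have hre : ∀ a b c : Euc 6, S.reM x ![S.JM x a, b, c] = -S.imM x ![a, b, c] := by
    intro a b c
    have h := S.type_three_zero x ![a, b, c] 0
    have e : Function.update ![a, b, c] 0 (S.J x (![a, b, c] 0)) = ![S.JM x a, b, c] := by
      ext1 i; fin_cases i <;> rfl
    exact (congrArg (S.Ω₁ x) e.symm).trans h
  have hJ : ∀ v, S.JM x (S.JM x v) = -v := S.J_sq x
  refine ⟨finrank_euclideanSpace_fin, S.g.symm x, S.g.pos x, hJ, S.compat x,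
    fun _ _ => rfl, hre, fun a b c => ?_, S.normalized x⟩
  have h := hre (S.JM x a) b c
  rw [hJ, (map_vec3_neg _ _ _ _).1] at h
  exact (neg_injective h).symm

theorem exists_frame (x : X) : ∃ o : Module.Basis (Fin 6) ℝ (Euc 6),
    IsSU3Frame (S.gM x) (S.JM x) (S.reM x) (S.imM x) o ∧ S.volM x o = 1 := by
  obtain ⟨o, ho⟩ := (S.su3Point x).exists_frame
  exact ⟨o, ho, ho.vol_apply (S.su3Point x)⟩

end SU3Structure

theorem cmul_conj_apply {Y : Type*} [NormedAddCommGroup Y] [NormedSpace ℝ Y] (a b : ℝ)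
    (φ₁ φ₂ : Y) : cmul (Complex.I / 4 * (starRingEnd ℂ) ⟨a, b⟩) (φ₁, φ₂) =
      (1 / 4 : ℝ) • (a • (-φ₂, φ₁) + b • (φ₁, φ₂)) := by
  have h : Complex.I / 4 * (starRingEnd ℂ) ⟨a, b⟩ = ⟨b / 4, a / 4⟩ := by
    apply Complex.ext <;> simp <;> ring
  rw [h, cmul_apply]
  ext1
  · simp only [Prod.smul_mk, Prod.mk_add_mk]
    module
  · simp only [Prod.smul_mk, Prod.mk_add_mk]
    module

end PointwiseStructure

/-! ### The components of a Higgs field -/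

section Components

open Filter Topology

variable {n m : ℕ} {X G P : Type*}
  [TopologicalSpace X] [ChartedSpace (Euc 6) X] [IsManifold (𝓡 6) ∞ X]
  [TopologicalSpace G] [ChartedSpace (Euc n) G] [Group G] [LieGroup (𝓡 n) ∞ G]
  [TopologicalSpace P] [ChartedSpace (Euc m) P] [IsManifold (𝓡 m) ∞ P]

namespace PrincipalBundle

variable {B : PrincipalBundle n m X G P} {S : SU3Structure X}

/-- `u = (i / 4) (φ₁ + i φ₂) Ω̄` at a point. -/
def HasComponentsAt (S : SU3Structure X) (u : B.HiggsField S.toAlmostHermitian) (p : P)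
    (φ : Euc n × Euc n) : Prop :=
  ∀ v, u.val.atModel p v = (1 / 4 : ℝ) • (S.reM (B.π p) v • (-φ.2, φ.1) +
    S.imM (B.π p) v • (φ.1, φ.2))

theorem hasComponents_iff (u : B.HiggsField S.toAlmostHermitian) (Φ₁ Φ₂ : B.AdSection) :
    HasComponents S u Φ₁ Φ₂ ↔ ∀ p, HasComponentsAt S u p (Φ₁.val p, Φ₂.val p) :=
  forall_congr' fun p => forall_congr' fun v => by
    rw [SU3Structure.Ω, cmul_conj_apply]
    rfl

theorem exists_hasComponentsAt (u : B.HiggsField S.toAlmostHermitian) (p : P) :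
    ∃ φ, HasComponentsAt S u p φ := by
  obtain ⟨o, ho, -⟩ := S.exists_frame (B.π p)
  have h := ho.eq_of_zero_three (S.su3Point (B.π p)) (u.val.atModel p) (u.type_zero_three p)
  set w := u.val.atModel p ![o 0, o 2, o 4]
  -- On the adapted frame Ω = 1, so w = (i/4)φ and φ = -4iw.
  refine ⟨((4 : ℝ) • w.2, -(4 : ℝ) • w.1), fun v => ?_⟩
  rw [h v, cmul_apply]
  ext1
  · simp only [Prod.smul_mk, Prod.mk_add_mk]
    module
  · simp only [Prod.smul_mk, Prod.mk_add_mk]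
    module

theorem HasComponentsAt.unique {u : B.HiggsField S.toAlmostHermitian} {p : P}
    {φ φ' : Euc n × Euc n} (h : HasComponentsAt S u p φ) (h' : HasComponentsAt S u p φ') :
    φ = φ' := by
  obtain ⟨o, ho, -⟩ := S.exists_frame (B.π p)
  have e := (h ![o 0, o 2, o 4]).symm.trans (h' ![o 0, o 2, o 4])
  rw [ho.re, ho.im] at e
  have e1 := congrArg Prod.fst e
  have e2 := congrArg Prod.snd e
  simp only [Prod.smul_mk, Prod.mk_add_mk] at e1 e2
  ext1
  · linear_combination (norm := module) (4 : ℝ) • e2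
  · linear_combination (norm := module) (-4 : ℝ) • e1

/-- Ω depends only on the base point, so the transformation law of u passes to its components by
uniqueness. -/
theorem HasComponentsAt.equivariant {u : B.HiggsField S.toAlmostHermitian} {p : P} {g : G}
    {φ φ' : Euc n × Euc n} (h : HasComponentsAt S u p φ)
    (h' : HasComponentsAt S u (B.act p g) φ') : φ' = (Ad g⁻¹ φ.1, Ad g⁻¹ φ.2) := by
  refine h'.unique fun v => ?_
  rw [B.π_act]
  obtain ⟨A, hA⟩ : ∃ w : Fin 3 → Euc m, ∀ i, B.dπm p (w i) = v i := by
    obtain ⟨s, hs, hsp, -⟩ := B.exists_local_section p (B.π p) (mem_extChartAt_source _)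
    refine ⟨fun i => mD (Euc 6) (Euc m) s (extChartAt 𝓘(ℝ, Euc 6) (B.π p) (B.π p)) (v i),
      fun i => ?_⟩
    have hd := hs.dπm_comp (v i)
    rwa [hsp, mD_chart_symm_self] at hd
  have hR : ∀ w, B.dπm (B.act p g) (mD (Euc m) (Euc m) (fun q => B.act q g) p w) = B.dπm p w := by
    intro w
    have h1 := mD_comp (E := Euc m) (E' := Euc m) (E'' := Euc 6) (g := B.π)
      (f := fun q => B.act q g) (x := p) (B.mdiff_π _) (B.mdiff_act_right p g)
    simp only [B.π_act] at h1
    exact (congrArg (fun L : Euc m →L[ℝ] Euc 6 => L w) h1).symm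
  have e := u.equivariant g p A
  have e1 : u.val.atModel (B.act p g) (fun i => B.dπm (B.act p g)
      (mD (Euc m) (Euc m) (fun q => B.act q g) p (A i))) =
      ((Ad g⁻¹).prodMap (Ad g⁻¹) : Euc n × Euc n →L[ℝ] Euc n × Euc n)
        (u.val.atModel p fun i => B.dπm p (A i)) := e
  simp only [hR, hA] at e1
  rw [e1, h v]
  simp only [map_smul, map_add]
  ext1 <;> simp

/-- The pullback of a smooth form under the projection, in a chart. -/
theorem contDiffAt_pullForm_π {α : DiffForm (Euc 6) X ℝ 3} (hα : IsSmoothForm α) {p₀ : P}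
    {z : Euc m} (hz : z ∈ (extChartAt 𝓘(ℝ, Euc m) p₀).target) :
    ContDiffAt ℝ ∞ (pullForm (fun z => B.π ((extChartAt 𝓘(ℝ, Euc m) p₀).symm z)) α) z :=
  contDiffAt_pullForm (ContMDiffAt.comp (I' := 𝓘(ℝ, Euc m)) (g := B.π) z
    (B.contMDiff_π _) (contMDiffAt_chart_symm hz)) hα

theorem mD_π_chart {p₀ : P} {z : Euc m} (hz : z ∈ (extChartAt 𝓘(ℝ, Euc m) p₀).target)
    (v : Euc m) : mD (Euc m) (Euc 6) (fun z => B.π ((extChartAt 𝓘(ℝ, Euc m) p₀).symm z)) z v =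
      B.dπm ((extChartAt 𝓘(ℝ, Euc m) p₀).symm z)
        (mD (Euc m) (Euc m) (extChartAt 𝓘(ℝ, Euc m) p₀).symm z v) := by
  rw [mD_comp (g := B.π) (B.mdiff_π _) (mdiff_chart_symm hz)]
  rfl

/-- Evaluate u and Ω on fixed vectors of a chart of P that lie over the adapted frame at the base
point. There Ω = 1, so it stays invertible nearby and the components are smooth quotients. -/
theorem contMDiff_components {u : B.HiggsField S.toAlmostHermitian} {φ : P → Euc n × Euc n}
    (h : ∀ p, HasComponentsAt S u p (φ p)) : ContMDiff (𝓡 m) 𝓘(ℝ, Euc n × Euc n) ∞ φ := by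
  intro p₀
  set ψ := extChartAt 𝓘(ℝ, Euc m) p₀ with hψ
  have hz₀ : ψ p₀ ∈ ψ.target := mem_extChartAt_target (I := 𝓘(ℝ, Euc m)) p₀
  obtain ⟨o, ho, -⟩ := S.exists_frame (B.π p₀)
  obtain ⟨w, hw⟩ : ∃ w : Fin 3 → Euc m, ∀ i, B.dπm p₀ (w i) = ![o 0, o 2, o 4] i := by
    obtain ⟨s, hs, hsp, -⟩ := B.exists_local_section p₀ (B.π p₀) (mem_extChartAt_source _)
    refine ⟨fun i => mD (Euc 6) (Euc m) s (extChartAt 𝓘(ℝ, Euc 6) (B.π p₀) (B.π p₀))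
      (![o 0, o 2, o 4] i), fun i => ?_⟩
    have hd := hs.dπm_comp (![o 0, o 2, o 4] i)
    rwa [hsp, mD_chart_symm_self] at hd
  let a : Euc m → ℝ := fun z => pullForm (fun z => B.π (ψ.symm z)) S.Ω₁ z w
  let b : Euc m → ℝ := fun z => pullForm (fun z => B.π (ψ.symm z)) S.Ω₂ z w
  let U : Euc m → Euc n × Euc n := fun z => coordRep u.val.toTotal p₀ z w
  have ha : ContDiffAt ℝ ∞ a (ψ p₀) :=
    contDiffAt_form_apply (contDiffAt_pullForm_π S.smooth hz₀) fun _ => contDiffAt_const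
  have hb : ContDiffAt ℝ ∞ b (ψ p₀) :=
    contDiffAt_form_apply (contDiffAt_pullForm_π S.isSmoothForm_im hz₀) fun _ => contDiffAt_const
  have hU : ContDiffAt ℝ ∞ U (ψ p₀) :=
    contDiffAt_form_apply (u.smooth.contDiffAt hz₀) fun _ => contDiffAt_const
  have hsymm : ψ.symm (ψ p₀) = p₀ := extChartAt_to_inv (I := 𝓘(ℝ, Euc m)) p₀
  have hv₀ : ∀ i, mD (Euc m) (Euc 6) (fun z => B.π (ψ.symm z)) (ψ p₀) (w i) =
      ![o 0, o 2, o 4] i := by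
    intro i
    rw [mD_π_chart hz₀, mD_chart_symm_self]
    change B.dπm (ψ.symm (ψ p₀)) (w i) = _
    rw [hsymm, hw]
  have ha0 : a (ψ p₀) = 1 := by
    change S.reM (B.π (ψ.symm (ψ p₀)))
      (fun i => mD (Euc m) (Euc 6) (fun z => B.π (ψ.symm z)) (ψ p₀) (w i)) = 1
    simp only [hv₀]
    rw [hsymm]
    exact ho.re
  have hd0 : a (ψ p₀) ^ 2 + b (ψ p₀) ^ 2 ≠ 0 := by rw [ha0]; positivity
  have hd : ContDiffAt ℝ ∞ (fun z => a z ^ 2 + b z ^ 2) (ψ p₀) := (ha.pow 2).add (hb.pow 2)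
  -- The solution of U = (i/4)φ(a - ib), namely φ = -4i(a + ib)U/(a² + b²), in real and imaginary
  -- parts.
  let f : Euc m → Euc n × Euc n := fun z =>
    ((a z ^ 2 + b z ^ 2)⁻¹ • ((4 * b z) • (U z).1 + (4 * a z) • (U z).2),
      (a z ^ 2 + b z ^ 2)⁻¹ • ((4 * b z) • (U z).2 - (4 * a z) • (U z).1))
  have hf : ContDiffAt ℝ ∞ f (ψ p₀) := by
    have h4a := contDiffAt_const (c := (4 : ℝ)).mul ha
    have h4b := contDiffAt_const (c := (4 : ℝ)).mul hb
    exact ((hd.inv hd0).smul ((h4b.smul hU.fst).add (h4a.smul hU.snd))).prodMk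
      ((hd.inv hd0).smul ((h4b.smul hU.snd).sub (h4a.smul hU.fst)))
  have hev : φ =ᶠ[𝓝 p₀] fun q => f (ψ q) := by
    have h1 : ∀ᶠ q in 𝓝 p₀, a (ψ q) ^ 2 + b (ψ q) ^ 2 ≠ 0 :=
      (continuousAt_extChartAt (I := 𝓘(ℝ, Euc m)) p₀).eventually
        (hd.continuousAt.eventually_ne hd0)
    filter_upwards [h1, extChartAt_source_mem_nhds (I := 𝓘(ℝ, Euc m)) p₀] with q hq hqs
    have hz : ψ q ∈ ψ.target := ψ.map_source hqs
    have e := h (ψ.symm (ψ q)) fun i => mD (Euc m) (Euc 6) (fun z => B.π (ψ.symm z)) (ψ q) (w i)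
    have eU : u.val.atModel (ψ.symm (ψ q))
        (fun i => mD (Euc m) (Euc 6) (fun z => B.π (ψ.symm z)) (ψ q) (w i)) = U (ψ q) := by
      exact congrArg (u.val.atModel _) (funext fun i => mD_π_chart hz (w i))
    rw [eU] at e
    change U (ψ q) = (1 / 4 : ℝ) • (a (ψ q) • _ + b (ψ q) • _) at e
    rw [ψ.left_inv hqs] at e
    have e1 := congrArg Prod.fst e
    have e2 := congrArg Prod.snd e
    simp only [Prod.smul_mk, Prod.mk_add_mk] at e1 e2
    have e3 : (4 * b (ψ q)) • (U (ψ q)).1 + (4 * a (ψ q)) • (U (ψ q)).2 =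
        (a (ψ q) ^ 2 + b (ψ q) ^ 2) • (φ q).1 := by
      rw [e1, e2]; module
    have e4 : (4 * b (ψ q)) • (U (ψ q)).2 - (4 * a (ψ q)) • (U (ψ q)).1 =
        (a (ψ q) ^ 2 + b (ψ q) ^ 2) • (φ q).2 := by
      rw [e1, e2]; module
    change φ q = (_ • _, _ • _)
    rw [e3, e4, inv_smul_smul₀ hq, inv_smul_smul₀ hq]
  refine ContMDiffAt.congr_of_eventuallyEq ?_ hev
  exact ContMDiffAt.comp (I' := 𝓘(ℝ, Euc m)) (g := f) p₀ hf.contMDiffAt contMDiffAt_extChartAt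

theorem existsUnique_components (u : B.HiggsField S.toAlmostHermitian) :
    ∃! Φ : B.AdSection × B.AdSection, HasComponents S u Φ.1 Φ.2 := by
  choose φ hφ using exists_hasComponentsAt (S := S) u
  have hs := contMDiff_components hφ
  refine ⟨(⟨fun p => (φ p).1, ?_, fun g p => ?_⟩, ⟨fun p => (φ p).2, ?_, fun g p => ?_⟩), ?_, ?_⟩
  · exact contDiff_fst.contMDiff.comp hs
  · rw [(hφ p).equivariant (hφ (B.act p g))]
  · exact contDiff_snd.contMDiff.comp hs
  · rw [(hφ p).equivariant (hφ (B.act p g))]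
  · exact (hasComponents_iff u _ _).mpr hφ
  · rintro ⟨⟨Φ₁, h₁, h₁'⟩, ⟨Φ₂, h₂, h₂'⟩⟩ hΦ
    have e := fun p => ((hasComponents_iff u _ _).mp hΦ p).unique (hφ p)
    obtain rfl : Φ₁ = fun p => (φ p).1 := funext fun p => congrArg Prod.fst (e p)
    obtain rfl : Φ₂ = fun p => (φ p).2 := funext fun p => congrArg Prod.snd (e p)
    rfl

end PrincipalBundle
end Components

/-! ### Complex conjugation of forms -/

section ConjugateForms

variable {E W : Type*} [NormedAddCommGroup E] [NormedSpace ℝ E] [NormedAddCommGroup W]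
  [NormedSpace ℝ W]

theorem fderiv_conj_form {σ₁ σ₂ : E → E [⋀^Fin 3]→L[ℝ] ℝ} {f₁ f₂ : E → W}
    {η : E → E [⋀^Fin 3]→L[ℝ] (W × W)} {y : E} (hσ₁ : DifferentiableAt ℝ σ₁ y)
    (hσ₂ : DifferentiableAt ℝ σ₂ y) (hf₁ : DifferentiableAt ℝ f₁ y) (hf₂ : DifferentiableAt ℝ f₂ y)
    (hη : ∀ᶠ z in nhds y, ∀ v, η z v = (1 / 4 : ℝ) •
      (σ₂ z v • (-f₂ z, f₁ z) - σ₁ z v • (f₁ z, f₂ z))) (v : Fin 3 → E) (e : E) :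
    fderiv ℝ (fun z => η z v) y e = (1 / 4 : ℝ) •
      (σ₂ y v • (-fderiv ℝ f₂ y e, fderiv ℝ f₁ y e) + fderiv ℝ (fun z => σ₂ z v) y e • (-f₂ y, f₁ y)
        - (σ₁ y v • (fderiv ℝ f₁ y e, fderiv ℝ f₂ y e) +
          fderiv ℝ (fun z => σ₁ z v) y e • (f₁ y, f₂ y))) := by
  have h1 := (hσ₁.continuousAlternatingMap_apply_const v).hasFDerivAt
  have h2 := (hσ₂.continuousAlternatingMap_apply_const v).hasFDerivAt
  have h := ((h2.fun_smul (hf₂.hasFDerivAt.fun_neg.prodMk hf₁.hasFDerivAt)).fun_sub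
    (h1.fun_smul (hf₁.hasFDerivAt.prodMk hf₂.hasFDerivAt))).fun_const_smul (1 / 4 : ℝ)
  have hev : (fun z => η z v) =ᶠ[nhds y] fun z => (1 / 4 : ℝ) •
      (σ₂ z v • (-f₂ z, f₁ z) - σ₁ z v • (f₁ z, f₂ z)) := by
    filter_upwards [hη] with z hz using hz v
  rw [hev.fderiv_eq]
  exact congrArg (fun L : E →L[ℝ] W × W => L e) h.fderiv

/-- The exterior derivative of `-(i / 4) (f₁ + i f₂) (σ₁ - i σ₂)`, up to a factor `-i`. -/
theorem extDeriv_conj_form {σ₁ σ₂ : E → E [⋀^Fin 3]→L[ℝ] ℝ} {f₁ f₂ : E → W}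
    {η : E → E [⋀^Fin 3]→L[ℝ] (W × W)} {y : E} (hσ₁ : DifferentiableAt ℝ σ₁ y)
    (hσ₂ : DifferentiableAt ℝ σ₂ y) (hf₁ : DifferentiableAt ℝ f₁ y) (hf₂ : DifferentiableAt ℝ f₂ y)
    (hηd : DifferentiableAt ℝ η y)
    (hη : ∀ᶠ z in nhds y, ∀ v, η z v = (1 / 4 : ℝ) •
      (σ₂ z v • (-f₂ z, f₁ z) - σ₁ z v • (f₁ z, f₂ z)))
    (hd : extDeriv σ₁ y = 0) (a b c d : E) :
    extDeriv η y ![a, b, c, d] = -(1 / 4 : ℝ) •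
      (conjTerm (σ₁ y) (σ₂ y) (fderiv ℝ f₁ y) (fderiv ℝ f₂ y) a b c d
        - conjTerm (σ₁ y) (σ₂ y) (fderiv ℝ f₁ y) (fderiv ℝ f₂ y) b a c d
        + conjTerm (σ₁ y) (σ₂ y) (fderiv ℝ f₁ y) (fderiv ℝ f₂ y) c a b d
        - conjTerm (σ₁ y) (σ₂ y) (fderiv ℝ f₁ y) (fderiv ℝ f₂ y) d a b c
        + (extDeriv σ₂ y ![a, b, c, d] • f₂ y, -extDeriv σ₂ y ![a, b, c, d] • f₁ y)) := by
  -- Closedness of σ₁ removes its derivatives; of the derivatives of the 3-forms only dσ₂ is left.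
  have h0 : extDeriv σ₁ y ![a, b, c, d] = 0 := by rw [hd]; rfl
  rw [extDeriv_three_apply hσ₁] at h0
  rw [extDeriv_three_apply hηd, extDeriv_three_apply hσ₂]
  simp only [fderiv_conj_form hσ₁ hσ₂ hf₁ hf₂ hη, conjTerm]
  ext1
  · simp only [Prod.fst_add, Prod.fst_sub, Prod.smul_fst]
    linear_combination (norm := module) -(1 / 4 : ℝ) • congrArg (fun t : ℝ => t • f₁ y) h0
  · simp only [Prod.snd_add, Prod.snd_sub, Prod.smul_snd]
    linear_combination (norm := module) -(1 / 4 : ℝ) • congrArg (fun t : ℝ => t • f₂ y) h0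

end ConjugateForms

/-! ### The instanton equations in a unitary frame -/

section PointwiseEquations

open Filter Topology

variable {n m : ℕ} {X G P : Type*}
  [TopologicalSpace X] [ChartedSpace (Euc 6) X] [IsManifold (𝓡 6) ∞ X]
  [TopologicalSpace G] [ChartedSpace (Euc n) G] [Group G] [LieGroup (𝓡 n) ∞ G]
  [TopologicalSpace P] [ChartedSpace (Euc m) P] [IsManifold (𝓡 m) ∞ P]

theorem extDeriv_coordRep {W : Type*} [NormedAddCommGroup W] [NormedSpace ℝ W] {k : ℕ}
    {α : DiffForm (Euc 6) X W k} (hα : IsSmoothForm α) (hd : ∀ x, extDer α x = 0) {x₀ : X}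
    {y : Euc 6} (hy : y ∈ (extChartAt 𝓘(ℝ, Euc 6) x₀).target) :
    extDeriv (coordRep α x₀) y = 0 := by
  refine (extDeriv_pullForm (contMDiffAt_chart_symm hy) hα).trans ?_
  refine ContinuousAlternatingMap.ext fun v => ?_
  rw [pullForm_apply, DiffForm.atModel, hd]
  rfl

namespace PrincipalBundle

variable {B : PrincipalBundle n m X G P}

/-- The covariant exterior derivative is the exterior derivative at a point where the local
section is horizontal. -/
theorem Connection.IsHorizontalAt.d_read {A : B.Connection} {x₀ : X} {y₀ : Euc 6} {s : Euc 6 → P}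
    (h : A.IsHorizontalAt x₀ y₀ s) {W : Type*} [NormedAddCommGroup W] [NormedSpace ℝ W] {k : ℕ}
    {η : B.FormFamily W k} (hη : IsSmoothForm η.toTotal) :
    (A.d η).read x₀ s y₀ = extDeriv (η.read x₀ s) y₀ := by
  rw [← (h.isLocal.pullForm_toTotal η).extDeriv_eq,
    extDeriv_pullForm h.isLocal.smooth.self_of_nhds hη]
  refine ContinuousAlternatingMap.ext fun v => ?_
  change DiffForm.atModel (extDer η.toTotal) (s y₀) (fun i => A.liftm (s y₀) (frameMap x₀ y₀ (v i)))
    = DiffForm.atModel (extDer η.toTotal) (s y₀) fun i => mD (Euc 6) (Euc m) s y₀ (v i)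
  congr 1
  funext i
  rw [Connection.liftm_frameMap h.isLocal, h.gauge_apply, neg_zero, map_zero, add_zero]

variable {S : SU3Structure X}

/-- The form `*u`. -/
def starHiggs (S : SU3Structure X) (u : B.HiggsField S.toAlmostHermitian) :
    B.FormFamily (Euc n × Euc n) 3 := fun q => S.star (B.π q) 3 3 rfl (u.val q)

variable {u : B.HiggsField S.toAlmostHermitian}

/-- From *Ω₁ = Ω₂ and *Ω₂ = -Ω₁ one gets *Ω̄ = iΩ̄, hence *u = -(1/4)ΦΩ̄. -/
theorem HasComponentsAt.starHiggs_apply {p : P} {φ : Euc n × Euc n}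
    (h : HasComponentsAt S u p φ) (v : Fin 3 → Euc 6) :
    (starHiggs S u).atModel p v = (1 / 4 : ℝ) • (S.imM (B.π p) v • (-φ.2, φ.1) -
      S.reM (B.π p) v • (φ.1, φ.2)) := by
  obtain ⟨o, ho, hvol⟩ := S.exists_frame (B.π p)
  have e := (AlmostHermitian.star_three_three ho.orthonormal (u.val.atModel p)).trans
    (ho.hodge_three (S.su3Point (B.π p)) hvol (u.val.atModel p) ((1 / 4 : ℝ) • (-φ.2, φ.1))
      ((1 / 4 : ℝ) • (φ.1, φ.2)) fun v => by rw [h v]; module)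
  refine (congrArg (fun f : Euc 6 [⋀^Fin 3]→L[ℝ] (Euc n × Euc n) => f v) e).trans ?_
  rw [ContinuousAlternatingMap.sub_apply, smulForm_apply, smulForm_apply]
  module

theorem isSmoothForm_starHiggs {Φ₁ Φ₂ : B.AdSection}
    (h : ∀ p, HasComponentsAt S u p (Φ₁.val p, Φ₂.val p)) :
    IsSmoothForm (starHiggs S u).toTotal := by
  intro p₀ z hz
  refine (contDiffAt_form fun v => ?_).contDiffWithinAt
  have hΦ : ∀ Φ : B.AdSection, ContDiffAt ℝ ∞
      (fun z => Φ.val ((extChartAt 𝓘(ℝ, Euc m) p₀).symm z)) z := fun Φ =>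
    contMDiffAt_iff_contDiffAt.mp (ContMDiffAt.comp (I' := 𝓘(ℝ, Euc m)) (g := Φ.val) z
      (Φ.smooth _) (contMDiffAt_chart_symm hz))
  have h1 : ContDiffAt ℝ ∞ (fun z => pullForm
      (fun z => B.π ((extChartAt 𝓘(ℝ, Euc m) p₀).symm z)) S.Ω₁ z v) z :=
    contDiffAt_form_apply (contDiffAt_pullForm_π S.smooth hz) fun _ => contDiffAt_const
  have h2 : ContDiffAt ℝ ∞ (fun z => pullForm
      (fun z => B.π ((extChartAt 𝓘(ℝ, Euc m) p₀).symm z)) S.Ω₂ z v) z :=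
    contDiffAt_form_apply (contDiffAt_pullForm_π S.isSmoothForm_im hz) fun _ => contDiffAt_const
  have h3 := ((h2.smul ((hΦ Φ₂).neg.prodMk (hΦ Φ₁))).sub
    (h1.smul ((hΦ Φ₁).prodMk (hΦ Φ₂)))).const_smul (1 / 4 : ℝ)
  refine h3.congr_of_eventuallyEq ?_
  filter_upwards [chart_target_mem hz] with z hz
  refine (congrArg ((starHiggs S u).atModel _) (funext fun i => (mD_π_chart hz
      (v i)).symm)).trans ?_
  exact (h _).starHiggs_apply _

variable {A : B.Connection}

/-- The covariant exterior derivative of `*u`. -/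
theorem d_starHiggs (hS : S.IsHalfFlat) {Φ₁ Φ₂ : B.AdSection}
    (h : ∀ p, HasComponentsAt S u p (Φ₁.val p, Φ₂.val p)) (p : P) :
    ∃ δ : Euc 6 [⋀^Fin 4]→L[ℝ] ℝ,
      (∀ a b c, δ ![a, b, c, S.JM (B.π p) c] =
        δ ![S.JM (B.π p) a, S.JM (B.π p) b, c, S.JM (B.π p) c]) ∧
      (∀ a b c, δ ![S.JM (B.π p) a, b, c, S.JM (B.π p) c] =
        -δ ![a, S.JM (B.π p) b, c, S.JM (B.π p) c]) ∧
      ∀ a b c d, (A.d (starHiggs S u)).atModel p ![a, b, c, d] = -(1 / 4 : ℝ) •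
        (conjTerm (S.reM (B.π p)) (S.imM (B.π p)) (A.d₀m Φ₁.val p) (A.d₀m Φ₂.val p) a b c d
          - conjTerm (S.reM (B.π p)) (S.imM (B.π p)) (A.d₀m Φ₁.val p) (A.d₀m Φ₂.val p) b a c d
          + conjTerm (S.reM (B.π p)) (S.imM (B.π p)) (A.d₀m Φ₁.val p) (A.d₀m Φ₂.val p) c a b d
          - conjTerm (S.reM (B.π p)) (S.imM (B.π p)) (A.d₀m Φ₁.val p) (A.d₀m Φ₂.val p) d a b c
          + (δ ![a, b, c, d] • Φ₂.val p, -δ ![a, b, c, d] • Φ₁.val p)) := by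
  -- With a section horizontal at p and the chart centred at π(p), d_A is the ordinary d at that
  -- point and the coordinate frame is the identity there.
  obtain ⟨s, hs, hsp⟩ := A.exists_horizontal p (B.π p) (mem_extChartAt_source _)
  set x₀ := B.π p with hx₀
  set y₀ := extChartAt 𝓘(ℝ, Euc 6) x₀ x₀ with hy₀
  have ht : y₀ ∈ (extChartAt 𝓘(ℝ, Euc 6) x₀).target := hs.isLocal.mem
  have hid : frameMap x₀ y₀ = ContinuousLinearMap.id ℝ (Euc 6) := mD_chart_symm_self x₀
  have hsymm : (extChartAt 𝓘(ℝ, Euc 6) x₀).symm y₀ = x₀ :=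
    extChartAt_to_inv (I := 𝓘(ℝ, Euc 6)) x₀
  have hrep : ∀ α : DiffForm (Euc 6) X ℝ 3, coordRep α x₀ y₀ = DiffForm.atModel α x₀ := by
    intro α
    refine ContinuousAlternatingMap.ext fun v => ?_
    change DiffForm.atModel α ((extChartAt 𝓘(ℝ, Euc 6) x₀).symm y₀)
      (fun i => frameMap x₀ y₀ (v i)) = _
    rw [hid, hsymm]
    rfl
  have hJ : S.coordJ x₀ y₀ = S.JM x₀ := by
    ext1 v
    have e := S.frameMap_coordJ ht v
    rw [hid, hsymm] at e
    exact e
  have hfd : ∀ Φ : B.AdSection, fderiv ℝ (fun y => Φ.val (s y)) y₀ = A.d₀m Φ.val p := by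
    intro Φ
    rw [← hs.d₀Form_eq Φ, Connection.d₀Form, hid, hsp]
    rfl
  have h1 : DifferentiableAt ℝ (coordRep S.Ω₁ x₀) y₀ :=
    (S.smooth.contDiffAt ht).differentiableAt (by simp)
  have h2 : DifferentiableAt ℝ (coordRep S.Ω₂ x₀) y₀ :=
    (S.isSmoothForm_im.contDiffAt ht).differentiableAt (by simp)
  have hd : extDeriv (coordRep S.Ω₁ x₀) y₀ = 0 := extDeriv_coordRep S.smooth hS.2 ht
  have hvec : ∀ (z a b c : Euc 6), (fun i => frameMap x₀ z (![a, b, c] i)) =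
      ![frameMap x₀ z a, frameMap x₀ z b, frameMap x₀ z c] := by
    intro z a b c; ext1 i; fin_cases i <;> rfl
  have hJz : ∀ᶠ z in 𝓝 y₀, (∀ a b c, coordRep S.Ω₁ x₀ z ![S.coordJ x₀ z a, b, c] =
      -coordRep S.Ω₂ x₀ z ![a, b, c]) ∧ ∀ a b c, coordRep S.Ω₂ x₀ z ![S.coordJ x₀ z a, b, c] =
      coordRep S.Ω₁ x₀ z ![a, b, c] := by
    filter_upwards [chart_target_mem ht] with z hz
    have hP := S.su3Point ((extChartAt 𝓘(ℝ, Euc 6) x₀).symm z)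
    refine ⟨fun a b c => ?_, fun a b c => ?_⟩
    · change S.reM _ (fun i => frameMap x₀ z (![S.coordJ x₀ z a, b, c] i)) =
        -S.imM _ (fun i => frameMap x₀ z (![a, b, c] i))
      rw [hvec, hvec, S.frameMap_coordJ hz, hP.re_J]
    · change S.imM _ (fun i => frameMap x₀ z (![S.coordJ x₀ z a, b, c] i)) =
        S.reM _ (fun i => frameMap x₀ z (![a, b, c] i))
      rw [hvec, hvec, S.frameMap_coordJ hz, hP.im_J]
  have hsym := extDeriv_im_symm (J := fun z v => S.coordJ x₀ z v) h1 h2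
    (fun v => (S.contDiffAt_coordJ ht v).differentiableAt (by simp)) (hJz.mono fun _ h => h.1)
    (hJz.mono fun _ h => h.2) hd
  rw [hJ] at hsym
  -- The form δ is dΩ₂, whose symmetries come from `extDeriv_im_symm`.
  refine ⟨extDeriv (coordRep S.Ω₂ x₀) y₀, fun a b c => (hsym a b c).1, fun a b c => (hsym a b c).2,
    fun a b c d => ?_⟩
  have hsm := isSmoothForm_starHiggs h
  have hη : ∀ᶠ z in 𝓝 y₀, ∀ v, (starHiggs S u).read x₀ s z v = (1 / 4 : ℝ) •
      (coordRep S.Ω₂ x₀ z v • (-Φ₂.val (s z), Φ₁.val (s z)) -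
        coordRep S.Ω₁ x₀ z v • (Φ₁.val (s z), Φ₂.val (s z))) := by
    filter_upwards [hs.isLocal.proj] with z hz v
    refine ((h (s z)).starHiggs_apply _).trans ?_
    rw [hz]
    rfl
  have hηd : DifferentiableAt ℝ ((starHiggs S u).read x₀ s) y₀ := by
    refine DifferentiableAt.congr_of_eventuallyEq ?_
      (hs.isLocal.pullForm_toTotal (starHiggs S u)).symm
    exact (contDiffAt_pullForm hs.isLocal.smooth.self_of_nhds hsm).differentiableAt (by simp)
  have hf : ∀ Φ : B.AdSection, DifferentiableAt ℝ (fun y => Φ.val (s y)) y₀ := fun Φ =>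
    (Connection.contDiffAt_section hs.isLocal Φ).differentiableAt (by simp)
  have key := extDeriv_conj_form h1 h2 (hf Φ₁) (hf Φ₂) hηd hη hd a b c d
  rw [← hs.d_read hsm, hrep, hrep, hfd, hfd, hsp] at key
  refine Eq.trans ?_ key
  rw [FormFamily.read, hid, hsp]
  rfl

theorem frameRelations (hS : S.IsHalfFlat) {Φ₁ Φ₂ : B.AdSection}
    (h : ∀ p, HasComponentsAt S u p (Φ₁.val p, Φ₂.val p))
    (hDT : IsDTInstanton S.toAlmostHermitian A u) (p : P) {o : Module.Basis (Fin 6) ℝ (Euc 6)}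
    (ho : IsSU3Frame (S.gM (B.π p)) (S.JM (B.π p)) (S.reM (B.π p)) (S.imM (B.π p)) o) :
    FrameRelations o (A.curvature.atModel p) (A.d₀m Φ₁.val p) (A.d₀m Φ₂.val p) := by
  obtain ⟨δ, hδ₁, hδ₂, hβ⟩ := d_starHiggs (A := A) hS h p
  refine ho.relations (S.su3Point _) (S.volM_eq _) _ _ _ (Φ₁.val p) (Φ₂.val p) δ hδ₁ hδ₂
    ((A.d (starHiggs S u)).atModel p) hβ ?_
  have e := hDT.1 p
  have e' := AlmostHermitian.star_four_two ho.orthonormal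
    (pqPart (S.JM (B.π p)) 1 3 ((A.d (starHiggs S u)).atModel p))
  exact e.trans (congrArg Neg.neg e')

/-- The second instanton equation. -/
theorem wedge_omegaSq (hDT : IsDTInstanton S.toAlmostHermitian A u) {p : P} {φ : Euc n × Euc n}
    (h : HasComponentsAt S u p φ) :
    wedgeS (A.curvature.atModel p)
      ((1 / 2 : ℝ) • wedgeR (S.omegaM (B.π p)) (S.omegaM (B.π p))) =
      smulForm (S.volM (B.π p)) (lieBr n G φ.1 φ.2) := by
  obtain ⟨o, ho, hvol⟩ := S.exists_frame (B.π p)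
  have e := hDT.2 p
  let κ : Euc 6 [⋀^Fin 6]→L[ℝ] Euc n := wedgeS (A.curvature.atModel p)
      ((1 / 2 : ℝ) • wedgeR (S.omegaM (B.π p)) (S.omegaM (B.π p)))
  let κ' : Euc 6 [⋀^Fin 6]→L[ℝ] (Euc n × Euc n) := wedge (complexify (lieBr n G)) (u.val.atModel p)
    (conjC.compContinuousAlternatingMap (u.val.atModel p))
  have e1 := AlmostHermitian.star_six_zero ho.orthonormal κ
  have e2 := AlmostHermitian.star_six_zero ho.orthonormal κ'
  have e3 : (ContinuousLinearMap.inl ℝ (Euc n) (Euc n)).compContinuousAlternatingMap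
      (hodge (k := 6) (m := 0) (S.gM (B.π p)) o (S.volM (B.π p)) κ) =
      hodge (k := 6) (m := 0) (S.gM (B.π p)) o (S.volM (B.π p)) κ' := by
    rw [← e1, ← e2]
    exact e
  -- ΛF is real, so only the real part of the equation is needed to determine it.
  have e4 := congrArg (fun f : Euc 6 [⋀^Fin 0]→L[ℝ] (Euc n × Euc n) => (f Fin.elim0).1) e3
  rw [hodge_top ho.orthonormal hvol] at e4
  have e5 : κ o = (κ' o).1 := by
    refine Eq.trans ?_ e4
    exact (hodge_top ho.orthonormal hvol κ Fin.elim0).symm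
  have e6 := ho.wedge_conj (S.su3Point _) hvol (lieBr n G) lieBr_skew φ.1 φ.2 (u.val.atModel p) h o
  refine alternating_top_ext o ?_
  rw [smulForm_apply]
  exact e5.trans e6

end PrincipalBundle
end PointwiseEquations

/-! ### Exterior derivatives of wedge products -/

section WedgeDerivative

variable {E W : Type*} [NormedAddCommGroup E] [NormedSpace ℝ E] [FiniteDimensional ℝ E]
  [NormedAddCommGroup W] [NormedSpace ℝ W]

/-- If `dκ = 0`, then `dκ ∧ Ω = 0`, on frames. -/
theorem sum_wedge_of_closed_left {D : E → E [⋀^Fin 2]→L[ℝ] W}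
    (h : ∀ a b c, D a ![b, c] - D b ![a, c] + D c ![a, b] = 0) (Ω : E [⋀^Fin 3]→L[ℝ] ℝ)
    (e : Fin 6 → E) : ∑ k : Fin 6, ((-1) ^ k.val : ℤ) •
      wedgeS (D (e k)) Ω (fun a => e (k.succAbove a)) = 0 := by
  simp only [vec_succAbove, Fin.sum_univ_six]
  dsimp
  simp only [wedgeTwoThree_apply, LinearMap.flip_apply, LinearMap.lsmul_apply]
  -- The identity for each triple is weighted by Ω on the complementary triple, with the sign of the
  -- corresponding shuffle.
  linear_combination (norm := skip)
      Ω ![e 3, e 4, e 5] • h (e 0) (e 1) (e 2) - Ω ![e 2, e 4, e 5] • h (e 0) (e 1) (e 3)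
        + Ω ![e 2, e 3, e 5] • h (e 0) (e 1) (e 4) - Ω ![e 2, e 3, e 4] • h (e 0) (e 1) (e 5)
        + Ω ![e 1, e 4, e 5] • h (e 0) (e 2) (e 3) - Ω ![e 1, e 3, e 5] • h (e 0) (e 2) (e 4)
        + Ω ![e 1, e 3, e 4] • h (e 0) (e 2) (e 5) + Ω ![e 1, e 2, e 5] • h (e 0) (e 3) (e 4)
        - Ω ![e 1, e 2, e 4] • h (e 0) (e 3) (e 5) + Ω ![e 1, e 2, e 3] • h (e 0) (e 4) (e 5)
        - Ω ![e 0, e 4, e 5] • h (e 1) (e 2) (e 3) + Ω ![e 0, e 3, e 5] • h (e 1) (e 2) (e 4)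
        - Ω ![e 0, e 3, e 4] • h (e 1) (e 2) (e 5) - Ω ![e 0, e 2, e 5] • h (e 1) (e 3) (e 4)
        + Ω ![e 0, e 2, e 4] • h (e 1) (e 3) (e 5) - Ω ![e 0, e 2, e 3] • h (e 1) (e 4) (e 5)
        + Ω ![e 0, e 1, e 5] • h (e 2) (e 3) (e 4) - Ω ![e 0, e 1, e 4] • h (e 2) (e 3) (e 5)
        + Ω ![e 0, e 1, e 3] • h (e 2) (e 4) (e 5) - Ω ![e 0, e 1, e 2] • h (e 3) (e 4) (e 5)
  simp
  module

/-- If `dΩ = 0`, then `κ ∧ dΩ = 0`, on frames. -/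
theorem sum_wedge_of_closed_right (κ : E [⋀^Fin 2]→L[ℝ] W) {D : E → E [⋀^Fin 3]→L[ℝ] ℝ}
    (h : ∀ a b c d, D a ![b, c, d] - D b ![a, c, d] + D c ![a, b, d] - D d ![a, b, c] = 0)
    (e : Fin 6 → E) : ∑ k : Fin 6, ((-1) ^ k.val : ℤ) •
      wedgeS κ (D (e k)) (fun a => e (k.succAbove a)) = 0 := by
  simp only [vec_succAbove, Fin.sum_univ_six]
  dsimp
  simp only [wedgeTwoThree_apply, LinearMap.flip_apply, LinearMap.lsmul_apply]
  linear_combination (norm := skip)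
      h (e 2) (e 3) (e 4) (e 5) • κ ![e 0, e 1] - h (e 1) (e 3) (e 4) (e 5) • κ ![e 0, e 2]
        + h (e 1) (e 2) (e 4) (e 5) • κ ![e 0, e 3] - h (e 1) (e 2) (e 3) (e 5) • κ ![e 0, e 4]
        + h (e 1) (e 2) (e 3) (e 4) • κ ![e 0, e 5] + h (e 0) (e 3) (e 4) (e 5) • κ ![e 1, e 2]
        - h (e 0) (e 2) (e 4) (e 5) • κ ![e 1, e 3] + h (e 0) (e 2) (e 3) (e 5) • κ ![e 1, e 4]
        - h (e 0) (e 2) (e 3) (e 4) • κ ![e 1, e 5] + h (e 0) (e 1) (e 4) (e 5) • κ ![e 2, e 3]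
        - h (e 0) (e 1) (e 3) (e 5) • κ ![e 2, e 4] + h (e 0) (e 1) (e 3) (e 4) • κ ![e 2, e 5]
        + h (e 0) (e 1) (e 2) (e 5) • κ ![e 3, e 4] - h (e 0) (e 1) (e 2) (e 4) • κ ![e 3, e 5]
        + h (e 0) (e 1) (e 2) (e 3) • κ ![e 4, e 5]
  simp
  module

/-- The form `dα ∧ τ`, on frames. -/
theorem sum_wedge_one_four {D : E → E [⋀^Fin 1]→L[ℝ] W} {κ : E [⋀^Fin 2]→L[ℝ] W}
    (h : ∀ a b, D a ![b] - D b ![a] = κ ![a, b]) (τ : E [⋀^Fin 4]→L[ℝ] ℝ)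
    (e : Fin 6 → E) : ∑ k : Fin 6, ((-1) ^ k.val : ℤ) •
      wedgeS (D (e k)) τ (fun a => e (k.succAbove a)) = wedgeS κ τ e := by
  rw [show e = ![e 0, e 1, e 2, e 3, e 4, e 5] by ext1 i; fin_cases i <;> rfl, wedgeTwoFour_apply]
  simp only [vec_succAbove, Fin.sum_univ_six]
  dsimp
  simp only [wedgeOneFour_apply, LinearMap.flip_apply, LinearMap.lsmul_apply]
  linear_combination (norm := skip)
      τ ![e 2, e 3, e 4, e 5] • h (e 0) (e 1) - τ ![e 1, e 3, e 4, e 5] • h (e 0) (e 2)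
        + τ ![e 1, e 2, e 4, e 5] • h (e 0) (e 3) - τ ![e 1, e 2, e 3, e 5] • h (e 0) (e 4)
        + τ ![e 1, e 2, e 3, e 4] • h (e 0) (e 5) + τ ![e 0, e 3, e 4, e 5] • h (e 1) (e 2)
        - τ ![e 0, e 2, e 4, e 5] • h (e 1) (e 3) + τ ![e 0, e 2, e 3, e 5] • h (e 1) (e 4)
        - τ ![e 0, e 2, e 3, e 4] • h (e 1) (e 5) + τ ![e 0, e 1, e 4, e 5] • h (e 2) (e 3)
        - τ ![e 0, e 1, e 3, e 5] • h (e 2) (e 4) + τ ![e 0, e 1, e 3, e 4] • h (e 2) (e 5)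
        + τ ![e 0, e 1, e 2, e 5] • h (e 3) (e 4) - τ ![e 0, e 1, e 2, e 4] • h (e 3) (e 5)
        + τ ![e 0, e 1, e 2, e 3] • h (e 4) (e 5)
  simp
  module

/-- If `dτ = 0`, then `α ∧ dτ = 0`, on frames. -/
theorem sum_wedge_one_of_closed (α : E [⋀^Fin 1]→L[ℝ] W) {D : E → E [⋀^Fin 4]→L[ℝ] ℝ}
    (h : ∀ a b c d f, D a ![b, c, d, f] - D b ![a, c, d, f] + D c ![a, b, d, f] - D d ![a, b, c, f]
      + D f ![a, b, c, d] = 0)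
    (e : Fin 6 → E) : ∑ k : Fin 6, ((-1) ^ k.val : ℤ) •
      wedgeS α (D (e k)) (fun a => e (k.succAbove a)) = 0 := by
  simp only [vec_succAbove, Fin.sum_univ_six]
  dsimp
  simp only [wedgeOneFour_apply, LinearMap.flip_apply, LinearMap.lsmul_apply]
  linear_combination (norm := skip)
      - h (e 1) (e 2) (e 3) (e 4) (e 5) • α ![e 0] + h (e 0) (e 2) (e 3) (e 4) (e 5) • α ![e 1]
        - h (e 0) (e 1) (e 3) (e 4) (e 5) • α ![e 2]
        + h (e 0) (e 1) (e 2) (e 4) (e 5) • α ![e 3]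
        - h (e 0) (e 1) (e 2) (e 3) (e 5) • α ![e 4]
        + h (e 0) (e 1) (e 2) (e 3) (e 4) • α ![e 5]
  simp
  module

end WedgeDerivative

/-! ### The Hodge star on five-forms -/

section HodgeBasis

variable {V W : Type*} [AddCommGroup V] [Module ℝ V] [TopologicalSpace V] [IsTopologicalAddGroup V]
  [ContinuousSMul ℝ V] [T2Space V] [FiniteDimensional ℝ V]
  [NormedAddCommGroup W] [NormedSpace ℝ W]

/-- The Hodge star of a `1`-form on the faces of a basis. -/
theorem hodge_one_five_basis (g : V →L[ℝ] V →L[ℝ] ℝ) (b : Module.Basis (Fin 6) ℝ V)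
    (vol : V [⋀^Fin 6]→L[ℝ] ℝ) (α : V →L[ℝ] W) (k : Fin 6) :
    hodge (k := 1) (m := 5) g b vol (ofFunctional α) (fun a => b (k.succAbove a)) =
      ((-1) ^ k.val : ℤ) •
        ∑ i, (vol b * (Matrix.of fun i j => g (b i) (b j))⁻¹ i k) • α (b i) := by
  obtain ⟨τ, hs, h0, hτ⟩ := exists_perm_one_five k
  -- The functional that inserts a vector in front of the k-th face of the volume form. It kills
  -- every basis vector except b k, so of the dual vectors only their b k-coefficients, the entries
  -- of the inverse Gram matrix, survive.
  let L : V →ₗ[ℝ] ℝ := vol.toAlternatingMap.toMultilinearMap.toLinearMap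
    (Fin.append (fun _ : Fin 1 => b k) fun a => b (k.succAbove a)) (Fin.castAdd 5 0)
  have hup : ∀ x, Function.update (fun _ : Fin 1 => b k) 0 x = fun _ => x := fun x => by
    ext1 i; rw [Subsingleton.elim i 0]; simp
  have hL : ∀ x, L x = vol (Fin.append (fun _ : Fin 1 => x) fun a => b (k.succAbove a)) := by
    intro x
    refine congrArg vol ?_
    rw [← append_update_left, hup]
  have hLk : L (b k) = ((-1) ^ k.val : ℤ) • vol b := by
    rw [hL, ← hs]
    refine Eq.trans ?_ (vol.toAlternatingMap.map_perm b τ)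
    refine congrArg vol ?_
    ext1 j
    refine Fin.cases ?_ (fun a => ?_) j
    · exact congrArg b h0.symm
    · have e : (Fin.succ a : Fin 6) = Fin.natAdd 1 a := Fin.ext (Nat.add_comm _ _)
      rw [e, Fin.append_right, ← e]
      exact congrArg b (hτ a).symm
  have hLj : ∀ j, j ≠ k → L (b j) = 0 := by
    intro j hj
    obtain ⟨a, rfl⟩ := Fin.exists_succAbove_eq hj
    rw [hL]
    refine vol.map_eq_zero_of_eq _ (i := Fin.castAdd 5 0) (j := Fin.natAdd 1 a) ?_ ?_
    · rw [Fin.append_left, Fin.append_right]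
    · simp [Fin.ext_iff]; omega
  rw [hodge_apply, Nat.factorial_one, Nat.cast_one, inv_one, one_smul,
    ← (Equiv.funUnique (Fin 1) (Fin 6)).symm.sum_comp, Finset.smul_sum]
  refine Finset.sum_congr rfl fun i _ => ?_
  change vol (Fin.append (m := 1) (n := 5) (fun _ => dualFrame g b i) fun a => b (k.succAbove a)) •
    α (b i) = _
  rw [← hL, dualFrame, map_sum, Finset.sum_eq_single k, map_smul, hLk,
    zsmul_eq_mul, ← Int.cast_smul_eq_zsmul ℝ, smul_smul]
  · congr 1
    simp only [smul_eq_mul]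
    ring
  · intro j _ hj
    rw [map_smul, hLj j hj, smul_zero]
  · intro h
    exact absurd (Finset.mem_univ k) h

/-- A linear map commutes with the wedge product with a real form. -/
theorem wedgeS_comp_left {W' : Type*} [NormedAddCommGroup W'] [NormedSpace ℝ W'] (f : W →L[ℝ] W')
    (F : V [⋀^Fin 2]→L[ℝ] W) (τ : V [⋀^Fin 4]→L[ℝ] ℝ) (v : Fin 6 → V) :
    wedgeS (f.compContinuousAlternatingMap F) τ v = f (wedgeS F τ v) := by
  rw [show v = ![v 0, v 1, v 2, v 3, v 4, v 5] by ext1 i; fin_cases i <;> rfl,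
    wedgeTwoFour_apply, wedgeTwoFour_apply]
  simp

end HodgeBasis

/-! ### Derivatives of inverse matrices -/

section MatrixCalculus

variable {E : Type*} [NormedAddCommGroup E] [NormedSpace ℝ E] {ι : Type*} [Fintype ι]
  [DecidableEq ι] {r : WithTop ℕ∞}

theorem contDiffAt_det {M : E → Matrix ι ι ℝ} {y : E}
    (h : ∀ i j, ContDiffAt ℝ r (fun z => M z i j) y) : ContDiffAt ℝ r (fun z => (M z).det) y := by
  simp only [Matrix.det_apply, ← Int.cast_smul_eq_zsmul ℝ, Units.smul_def]
  refine ContDiffAt.sum fun τ _ => ?_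
  exact (contDiffAt_prod fun i _ => h (τ i) i).const_smul _

/-- By Cramer's rule the entries of the inverse are quotients of determinants. -/
theorem contDiffAt_matrix_inv {M : E → Matrix ι ι ℝ} {y : E}
    (h : ∀ i j, ContDiffAt ℝ r (fun z => M z i j) y) (hdet : (M y).det ≠ 0) (i j : ι) :
    ContDiffAt ℝ r (fun z => (M z)⁻¹ i j) y := by
  have h1 : ∀ z, (M z)⁻¹ i j = (M z).det⁻¹ * ((M z).updateRow j (Pi.single i 1)).det := by
    intro z
    rw [Matrix.inv_def, Matrix.smul_apply, Matrix.adjugate_apply, Ring.inverse_eq_inv', smul_eq_mul]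
  simp only [h1]
  refine ((contDiffAt_det h).inv hdet).mul (contDiffAt_det fun k l => ?_)
  by_cases hk : k = j
  · subst hk
    simp only [Matrix.updateRow_self]
    exact contDiffAt_const
  · simp only [Matrix.updateRow_ne hk]
    exact h k l

end MatrixCalculus

/-! ### Half-flat structures in coordinates -/

section Coordinates

open Filter Topology

variable {X : Type*} [TopologicalSpace X] [ChartedSpace (Euc 6) X] [IsManifold (𝓡 6) ∞ X]

/-- The coordinate frame as a basis. -/
theorem exists_frameMap_basis (e : Module.Basis (Fin 6) ℝ (Euc 6)) {x₀ : X} {y : Euc 6}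
    (hy : y ∈ (extChartAt 𝓘(ℝ, Euc 6) x₀).target) : ∃ b : Module.Basis (Fin 6) ℝ (Euc 6),
      ∀ i, b i = PrincipalBundle.frameMap x₀ y (e i) := by
  have h1 := mD_symm_comp_chart ((extChartAt 𝓘(ℝ, Euc 6) x₀).map_target hy)
  rw [(extChartAt 𝓘(ℝ, Euc 6) x₀).right_inv hy] at h1
  have h2 := mD_chart_comp_symm hy
  let T : Euc 6 ≃ₗ[ℝ] Euc 6 := LinearEquiv.ofLinearMap (PrincipalBundle.frameMap x₀ y).toLinearMap
    (mD (Euc 6) (Euc 6) (extChartAt 𝓘(ℝ, Euc 6) x₀)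
      ((extChartAt 𝓘(ℝ, Euc 6) x₀).symm y)).toLinearMap
    (LinearMap.ext fun v => congrArg (fun L : Euc 6 →L[ℝ] Euc 6 => L v) h1)
    (LinearMap.ext fun v => congrArg (fun L : Euc 6 →L[ℝ] Euc 6 => L v) h2)
  exact ⟨e.map T, fun i => e.map_apply T i⟩

namespace AlmostHermitian

variable (S : AlmostHermitian X)

/-- The Gram matrix of a frame in a chart. -/
def coordGram (e : Fin 6 → Euc 6) (x₀ : X) (y : Euc 6) : Matrix (Fin 6) (Fin 6) ℝ :=
  Matrix.of fun i j => S.coordG x₀ y (e i) (e j)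

/-- The volume density of a frame in a chart. -/
def coordVol (e : Fin 6 → Euc 6) (x₀ : X) (y : Euc 6) : ℝ :=
  S.volM ((extChartAt 𝓘(ℝ, Euc 6) x₀).symm y) fun i => PrincipalBundle.frameMap x₀ y (e i)

theorem contDiffAt_coordOmegaSq {x₀ : X} {y : Euc 6}
    (hy : y ∈ (extChartAt 𝓘(ℝ, Euc 6) x₀).target) :
    ContDiffAt ℝ ∞ (coordRep S.omegaSq x₀) y := by
  have h := S.isSmoothForm_omega.contDiffAt hy
  refine contDiffAt_form fun v => ?_
  have h1 := contDiffAt_form_apply (v := fun i _ => v i) (contDiffAt_wedge (LinearMap.mul ℝ ℝ) h h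
    shuffleTwoTwo (by decide) (by decide)) fun _ => contDiffAt_const
  refine h1.congr_of_eventuallyEq (Eventually.of_forall fun z => ?_)
  exact (wedge_comp (LinearMap.mul ℝ ℝ) (S.omegaM _) (S.omegaM _)
    (PrincipalBundle.frameMap x₀ z) shuffleTwoTwo (by decide) (by decide) v).symm

theorem isSmoothForm_omegaSq : IsSmoothForm S.omegaSq := fun _ _ hy =>
  (S.contDiffAt_coordOmegaSq hy).contDiffWithinAt

theorem contDiffAt_coordVol (e : Fin 6 → Euc 6) {x₀ : X} {y : Euc 6}
    (hy : y ∈ (extChartAt 𝓘(ℝ, Euc 6) x₀).target) : ContDiffAt ℝ ∞ (S.coordVol e x₀) y := by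
  have h := S.isSmoothForm_omega.contDiffAt hy
  have h1 := contDiffAt_form_apply (v := fun i _ => e i) (contDiffAt_wedge (LinearMap.mul ℝ ℝ)
    (S.contDiffAt_coordOmegaSq hy) h shuffleFourTwo (by decide) (by decide))
    fun _ => contDiffAt_const
  refine (h1.const_smul (1 / 6 : ℝ)).congr_of_eventuallyEq (Eventually.of_forall fun z => ?_)
  have h2 := wedge_comp (LinearMap.mul ℝ ℝ) (wedgeR (S.omegaM ((extChartAt 𝓘(ℝ, Euc 6) x₀).symm z))
    (S.omegaM ((extChartAt 𝓘(ℝ, Euc 6) x₀).symm z))) (S.omegaM ((extChartAt 𝓘(ℝ, Euc 6) x₀).symm z))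
    (PrincipalBundle.frameMap x₀ z) shuffleFourTwo (by decide) (by decide) e
  exact congrArg (fun t : ℝ => (1 / 6 : ℝ) * t) h2.symm

theorem contDiffAt_coordGram (e : Fin 6 → Euc 6) {x₀ : X} {y : Euc 6}
    (hy : y ∈ (extChartAt 𝓘(ℝ, Euc 6) x₀).target) (i j : Fin 6) :
    ContDiffAt ℝ ∞ (fun z => S.coordGram e x₀ z i j) y :=
  S.contDiffAt_coordG hy (e i) (e j)

theorem coordGram_eq {e : Fin 6 → Euc 6} {x₀ : X} {y : Euc 6} {b : Fin 6 → Euc 6}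
    (hb : ∀ i, b i = PrincipalBundle.frameMap x₀ y (e i)) : S.coordGram e x₀ y =
      Matrix.of fun i j => S.gM ((extChartAt 𝓘(ℝ, Euc 6) x₀).symm y) (b i) (b j) := by
  ext i j
  simp only [hb]
  rfl

theorem coordVol_eq {e : Fin 6 → Euc 6} {x₀ : X} {y : Euc 6} {b : Fin 6 → Euc 6}
    (hb : ∀ i, b i = PrincipalBundle.frameMap x₀ y (e i)) : S.coordVol e x₀ y =
      S.volM ((extChartAt 𝓘(ℝ, Euc 6) x₀).symm y) b :=
  congrArg (S.volM _) (funext fun i => (hb i).symm)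

end AlmostHermitian

namespace SU3Structure

variable (S : SU3Structure X)

/-- If P expresses the coordinate frame in an orthonormal one, the Gram matrix is PᵀP, and its
inverse is CᵀC with C = (Pᵀ)⁻¹. -/
theorem isPosFactored_inv_coordGram (e : Module.Basis (Fin 6) ℝ (Euc 6)) {x₀ : X} {y : Euc 6}
    (hy : y ∈ (extChartAt 𝓘(ℝ, Euc 6) x₀).target) :
    (S.coordGram e x₀ y).det ≠ 0 ∧ IsPosFactored (S.coordGram e x₀ y)⁻¹ := by
  obtain ⟨b, hb⟩ := exists_frameMap_basis e hy
  obtain ⟨o, ho, -⟩ := S.exists_frame ((extChartAt 𝓘(ℝ, Euc 6) x₀).symm y)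
  have h := S.coordGram_eq hb
  rw [ho.orthonormal.gram_eq b] at h
  have hP : IsUnit (o.toMatrix b).det := by
    have := o.invertibleToMatrix b
    exact (Matrix.isUnit_iff_isUnit_det _).mp (isUnit_of_invertible _)
  rw [h]
  refine ⟨?_, ((o.toMatrix b).transpose)⁻¹, ?_, ?_⟩
  · rw [Matrix.det_mul, Matrix.det_transpose]
    exact mul_ne_zero hP.ne_zero hP.ne_zero
  · rw [Matrix.isUnit_nonsing_inv_det_iff, Matrix.det_transpose]
    exact hP
  · rw [Matrix.mul_inv_rev, Matrix.transpose_nonsing_inv, Matrix.transpose_transpose]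

theorem coordVol_ne_zero (e : Module.Basis (Fin 6) ℝ (Euc 6)) {x₀ : X} {y : Euc 6}
    (hy : y ∈ (extChartAt 𝓘(ℝ, Euc 6) x₀).target) : S.coordVol e x₀ y ≠ 0 := by
  obtain ⟨b, hb⟩ := exists_frameMap_basis e hy
  obtain ⟨o, -, ho⟩ := S.exists_frame ((extChartAt 𝓘(ℝ, Euc 6) x₀).symm y)
  rw [S.coordVol_eq hb]
  intro h
  have h1 : S.volM ((extChartAt 𝓘(ℝ, Euc 6) x₀).symm y) = 0 := alternating_top_ext b h
  rw [h1] at ho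
  exact zero_ne_one ho

end SU3Structure
end Coordinates

/-! ### The covariant gradient of Φ₁ in coordinates -/

section Divergence

open Filter Topology

variable {n m : ℕ} {X G P : Type*}
  [TopologicalSpace X] [ChartedSpace (Euc 6) X] [IsManifold (𝓡 6) ∞ X]
  [TopologicalSpace G] [ChartedSpace (Euc n) G] [Group G] [LieGroup (𝓡 n) ∞ G]
  [TopologicalSpace P] [ChartedSpace (Euc m) P] [IsManifold (𝓡 m) ∞ P]

namespace PrincipalBundle

variable {B : PrincipalBundle n m X G P} {S : SU3Structure X}
  {u : B.HiggsField S.toAlmostHermitian} {A : B.Connection}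

/-- The vector density dual to the covariant derivative of a section. -/
def gradDensity (S : SU3Structure X) (A : B.Connection) (Φ : P → Euc n) (e : Fin 6 → Euc 6)
    (x₀ : X) (s : Euc 6 → P) (k : Fin 6) (y : Euc 6) : Euc n :=
  ∑ i, (S.coordVol e x₀ y * (S.coordGram e x₀ y)⁻¹ i k) • A.d₀Form Φ x₀ s y (e i)

/-- The k-th component of the gradient density is, up to sign, the value of *d_AΦ₁ on the k-th
coordinate face. By `wedge_re_eq` this is a value of F ∧ Ω₁ - d_AΦ₂ ∧ ω²/2, whose exterior
derivative needs no second derivative of Φ₁. -/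
theorem gradDensity_eq (hS : S.IsHalfFlat) {Φ₁ Φ₂ : B.AdSection}
    (h : ∀ p, HasComponentsAt S u p (Φ₁.val p, Φ₂.val p))
    (hDT : IsDTInstanton S.toAlmostHermitian A u) (e : Module.Basis (Fin 6) ℝ (Euc 6)) {x₀ : X}
    {y : Euc 6} {s : Euc 6 → P} (hs : B.IsLocalSection x₀ y s) (k : Fin 6) :
    gradDensity S A Φ₁.val e x₀ s k y = ((-1) ^ k.val : ℤ) •
      (wedgeS (A.curvature.read x₀ s y) (coordRep S.Ω₁ x₀ y) (fun a => e (k.succAbove a)) -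
        wedgeS (ofFunctional (A.d₀Form Φ₂.val x₀ s y)) ((1 / 2 : ℝ) • coordRep S.omegaSq x₀ y)
          (fun a => e (k.succAbove a))) := by
  have hp : (extChartAt 𝓘(ℝ, Euc 6) x₀).symm y = B.π (s y) := hs.proj.self_of_nhds.symm
  obtain ⟨b, hb⟩ := exists_frameMap_basis e hs.mem
  obtain ⟨o, ho, hvol⟩ := S.exists_frame (B.π (s y))
  have h0 := ho.wedge_re_eq (S.su3Point _) hvol (frameRelations hS h hDT (s y) ho)
  have h1 := hodge_one_five_basis (S.gM (B.π (s y))) b (S.volM (B.π (s y))) (A.d₀m Φ₁.val (s y)) k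
  rw [hodge_eq_of_orthonormal (k := 1) (m := 5) ho.orthonormal b] at h1
  have hG := S.coordGram_eq hb
  have hν := S.coordVol_eq hb
  rw [hp] at hG hν
  rw [← hG, ← hν] at h1
  have hb' : (fun a => b (k.succAbove a)) =
      fun a : Fin 5 => frameMap x₀ y (e (k.succAbove a)) := funext fun a => hb _
  have w1 := wedge_comp ((LinearMap.lsmul ℝ (Euc n)).flip) (A.curvature.atModel (s y))
    (S.reM (B.π (s y))) (frameMap x₀ y) shuffleTwoThree (by decide) (by decide)
    (fun a => e (k.succAbove a))
  have w2 := wedge_comp ((LinearMap.lsmul ℝ (Euc n)).flip) (ofFunctional (A.d₀m Φ₂.val (s y)))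
    ((1 / 2 : ℝ) • wedgeR (S.omegaM (B.π (s y))) (S.omegaM (B.π (s y)))) (frameMap x₀ y)
    shuffleOneFour (by decide) (by decide) (fun a => e (k.succAbove a))
  have r1 : coordRep S.Ω₁ x₀ y = (S.reM (B.π (s y))).compContinuousLinearMap (frameMap x₀ y) := by
    rw [← hp]; rfl
  have r2 : (1 / 2 : ℝ) • coordRep S.omegaSq x₀ y =
      ((1 / 2 : ℝ) • wedgeR (S.omegaM (B.π (s y)))
        (S.omegaM (B.π (s y)))).compContinuousLinearMap (frameMap x₀ y) := by
    rw [← hp]; rfl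
  have r3 : ofFunctional (A.d₀Form Φ₂.val x₀ s y) =
      (ofFunctional (A.d₀m Φ₂.val (s y))).compContinuousLinearMap (frameMap x₀ y) := rfl
  have h2 := congrArg (fun f : Euc 6 [⋀^Fin 5]→L[ℝ] Euc n => f fun a => b (k.succAbove a)) h0
  have h3 : wedgeS (A.curvature.read x₀ s y) (coordRep S.Ω₁ x₀ y) (fun a => e (k.succAbove a)) =
      ((-1) ^ k.val : ℤ) • gradDensity S A Φ₁.val e x₀ s k y +
        wedgeS (ofFunctional (A.d₀Form Φ₂.val x₀ s y)) ((1 / 2 : ℝ) • coordRep S.omegaSq x₀ y)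
          (fun a => e (k.succAbove a)) := by
    rw [r1, r2, r3]
    refine w1.trans (Eq.trans ?_ (congrArg₂ (· + ·) (h1.trans ?_) w2.symm))
    · rw [← hb']
      exact h2
    · simp only [hb]
      rfl
  rw [h3, add_sub_cancel_right, smul_smul, ← pow_add, ← two_mul, pow_mul]
  simp

end PrincipalBundle
end Divergence

/-! ### Four-forms of type `(1, 3)` -/

section FourForms

variable {E W : Type*} [NormedAddCommGroup E] [NormedSpace ℝ E] [NormedAddCommGroup W]
  [NormedSpace ℝ W]

theorem extDeriv_four_apply {α : E → E [⋀^Fin 4]→L[ℝ] W} {y : E} (h : DifferentiableAt ℝ α y)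
    (a b c d f : E) : extDeriv α y ![a, b, c, d, f] =
      fderiv ℝ α y a ![b, c, d, f] - fderiv ℝ α y b ![a, c, d, f] + fderiv ℝ α y c ![a, b, d, f]
        - fderiv ℝ α y d ![a, b, c, f] + fderiv ℝ α y f ![a, b, c, d] := by
  have e0 : Fin.removeNth 0 ![a, b, c, d, f] = ![b, c, d, f] := by ext i; fin_cases i <;> rfl
  have e1 : Fin.removeNth 1 ![a, b, c, d, f] = ![a, c, d, f] := by ext i; fin_cases i <;> rfl
  have e2 : Fin.removeNth 2 ![a, b, c, d, f] = ![a, b, d, f] := by ext i; fin_cases i <;> rfl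
  have e3 : Fin.removeNth 3 ![a, b, c, d, f] = ![a, b, c, f] := by ext i; fin_cases i <;> rfl
  have e4 : Fin.removeNth 4 ![a, b, c, d, f] = ![a, b, c, d] := by ext i; fin_cases i <;> rfl
  rw [extDeriv_apply h, Fin.sum_univ_five, e0, e1, e2, e3, e4]
  simp [sub_eq_add_neg, pow_succ, fderiv_continuousAlternatingMap_apply_const_apply h]

end FourForms

/-! ### The divergence of the covariant gradient of Φ₁ -/

section Divergence

open Filter Topology

variable {n m : ℕ} {X G P : Type*}
  [TopologicalSpace X] [ChartedSpace (Euc 6) X] [IsManifold (𝓡 6) ∞ X]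
  [TopologicalSpace G] [ChartedSpace (Euc n) G] [Group G] [LieGroup (𝓡 n) ∞ G]
  [TopologicalSpace P] [ChartedSpace (Euc m) P] [IsManifold (𝓡 m) ∞ P]

namespace PrincipalBundle

variable {B : PrincipalBundle n m X G P} {S : SU3Structure X}
  {u : B.HiggsField S.toAlmostHermitian} {A : B.Connection}

theorem wedge_curvature_omegaSq (hDT : IsDTInstanton S.toAlmostHermitian A u) {Φ₁ Φ₂ : B.AdSection}
    (h : ∀ p, HasComponentsAt S u p (Φ₁.val p, Φ₂.val p)) (e : Fin 6 → Euc 6) {x₀ : X}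
    {y : Euc 6} {s : Euc 6 → P} (hs : B.IsLocalSection x₀ y s) :
    wedgeS (A.curvature.read x₀ s y) ((1 / 2 : ℝ) • coordRep S.omegaSq x₀ y) e =
      S.coordVol e x₀ y • lieBr n G (Φ₁.val (s y)) (Φ₂.val (s y)) := by
  have hp : (extChartAt 𝓘(ℝ, Euc 6) x₀).symm y = B.π (s y) := hs.proj.self_of_nhds.symm
  have w := wedge_comp ((LinearMap.lsmul ℝ (Euc n)).flip) (A.curvature.atModel (s y))
    ((1 / 2 : ℝ) • wedgeR (S.omegaM (B.π (s y))) (S.omegaM (B.π (s y)))) (frameMap x₀ y)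
    shuffleTwoFour (by decide) (by decide) e
  have r2 : (1 / 2 : ℝ) • coordRep S.omegaSq x₀ y =
      ((1 / 2 : ℝ) • wedgeR (S.omegaM (B.π (s y)))
        (S.omegaM (B.π (s y)))).compContinuousLinearMap (frameMap x₀ y) := by
    rw [← hp]; rfl
  rw [r2]
  refine w.trans ((congrArg (fun f : Euc 6 [⋀^Fin 6]→L[ℝ] Euc n => f fun i => frameMap x₀ y (e i))
    (wedge_omegaSq hDT (h (s y)))).trans ?_)
  rw [smulForm_apply, AlmostHermitian.coordVol, hp]

theorem contDiffAt_wedge_apply {E W W₁ W₂ : Type*} [NormedAddCommGroup E] [NormedSpace ℝ E]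
    [FiniteDimensional ℝ E] [NormedAddCommGroup W] [NormedSpace ℝ W] [FiniteDimensional ℝ W]
    [NormedAddCommGroup W₁] [NormedSpace ℝ W₁] [FiniteDimensional ℝ W₁]
    [NormedAddCommGroup W₂] [NormedSpace ℝ W₂] [FiniteDimensional ℝ W₂] {k l N : ℕ}
    {r : WithTop ℕ∞} (C : W₁ →ₗ[ℝ] W₂ →ₗ[ℝ] W) {α : E → E [⋀^Fin k]→L[ℝ] W₁}
    {β : E → E [⋀^Fin l]→L[ℝ] W₂} {y : E} (hα : ContDiffAt ℝ r α y) (hβ : ContDiffAt ℝ r β y)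
    (R : Fin N → Equiv.Perm (Fin (k + l)))
    (hN : N * (k.factorial * l.factorial) = (k + l).factorial)
    (hR : ∀ i j, (∀ a : Fin k, ∃ b : Fin k, R i (Fin.castAdd l a) = R j (Fin.castAdd l b)) → i = j)
    (v : Fin (k + l) → E) : ContDiffAt ℝ r (fun z => wedge C (α z) (β z) v) y :=
  contDiffAt_form_apply (v := fun i _ => v i) (contDiffAt_wedge C hα hβ R hN hR)
    fun _ => contDiffAt_const

theorem contDiffAt_ofFunctional_d₀Form {x₀ : X} {y₀ : Euc 6} {s : Euc 6 → P}
    (hs : B.IsLocalSection x₀ y₀ s) (Φ : B.AdSection) :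
    ContDiffAt ℝ ∞ (fun y => ofFunctional (A.d₀Form Φ.val x₀ s y)) y₀ :=
  contDiffAt_form fun v => Connection.contDiffAt_d₀Form hs Φ (v 0)

theorem fderiv_gradDensity (hS : S.IsHalfFlat) {Φ₁ Φ₂ : B.AdSection}
    (h : ∀ p, HasComponentsAt S u p (Φ₁.val p, Φ₂.val p))
    (hDT : IsDTInstanton S.toAlmostHermitian A u) (e : Module.Basis (Fin 6) ℝ (Euc 6)) {x₀ : X}
    {y₀ : Euc 6} {s : Euc 6 → P} (hs : B.IsLocalSection x₀ y₀ s) (k : Fin 6) :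
    fderiv ℝ (gradDensity S A Φ₁.val e x₀ s k) y₀ (e k) = ((-1) ^ k.val : ℤ) •
      (wedgeS (fderiv ℝ (A.curvature.read x₀ s) y₀ (e k)) (coordRep S.Ω₁ x₀ y₀)
          (fun a => e (k.succAbove a)) +
        wedgeS (A.curvature.read x₀ s y₀) (fderiv ℝ (coordRep S.Ω₁ x₀) y₀ (e k))
          (fun a => e (k.succAbove a)) -
        (wedgeS (fderiv ℝ (fun y => ofFunctional (A.d₀Form Φ₂.val x₀ s y)) y₀ (e k))
          ((1 / 2 : ℝ) • coordRep S.omegaSq x₀ y₀) (fun a => e (k.succAbove a)) +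
        wedgeS (ofFunctional (A.d₀Form Φ₂.val x₀ s y₀))
          (fderiv ℝ (fun y => (1 / 2 : ℝ) • coordRep S.omegaSq x₀ y) y₀ (e k))
          (fun a => e (k.succAbove a)))) := by
  have hev : gradDensity S A Φ₁.val e x₀ s k =ᶠ[𝓝 y₀] fun y => ((-1 : ℝ) ^ k.val) •
      (wedgeS (A.curvature.read x₀ s y) (coordRep S.Ω₁ x₀ y) (fun a => e (k.succAbove a)) -
        wedgeS (ofFunctional (A.d₀Form Φ₂.val x₀ s y)) ((1 / 2 : ℝ) • coordRep S.omegaSq x₀ y)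
          (fun a => e (k.succAbove a))) := by
    filter_upwards [hs.eventually] with y hy
    rw [gradDensity_eq hS h hDT e hy k, ← Int.cast_smul_eq_zsmul ℝ]
    push_cast
    rfl
  have c1 := Connection.contDiffAt_curvature (A := A) hs
  have c2 := S.smooth.contDiffAt hs.mem
  have c3 := contDiffAt_ofFunctional_d₀Form (A := A) hs Φ₂
  have c4 := (S.contDiffAt_coordOmegaSq hs.mem).const_smul (1 / 2 : ℝ)
  have d1 := (contDiffAt_wedge_apply ((LinearMap.lsmul ℝ (Euc n)).flip) c1 c2 shuffleTwoThree
    (by decide) (by decide) fun a => e (k.succAbove a)).differentiableAt (by simp)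
  have d2 := (contDiffAt_wedge_apply ((LinearMap.lsmul ℝ (Euc n)).flip) c3 c4 shuffleOneFour
    (by decide) (by decide) fun a => e (k.succAbove a)).differentiableAt (by simp)
  have w1 := fderiv_wedge ((LinearMap.lsmul ℝ (Euc n)).flip) (c1.differentiableAt (by simp))
    (c2.differentiableAt (by simp)) shuffleTwoThree (by decide) (by decide)
    (fun a => e (k.succAbove a)) (e k)
  have w2 := fderiv_wedge ((LinearMap.lsmul ℝ (Euc n)).flip) (c3.differentiableAt (by simp))
    (c4.differentiableAt (by simp)) shuffleOneFour (by decide) (by decide)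
    (fun a => e (k.succAbove a)) (e k)
  rw [hev.fderiv_eq]
  have hd := ((d1.hasFDerivAt.fun_sub d2.hasFDerivAt).fun_const_smul ((-1 : ℝ) ^ k.val)).fderiv
  refine (congrArg (fun L : Euc 6 →L[ℝ] Euc n => L (e k)) hd).trans ?_
  rw [← Int.cast_smul_eq_zsmul ℝ]
  push_cast
  exact congrArg (fun t => ((-1 : ℝ) ^ k.val) • t) (congrArg₂ (· - ·) w1 w2)

/-- The divergence of the covariant gradient of `Φ₁`. -/
theorem sum_fderiv_gradDensity (hS : S.IsHalfFlat) {Φ₁ Φ₂ : B.AdSection}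
    (h : ∀ p, HasComponentsAt S u p (Φ₁.val p, Φ₂.val p))
    (hDT : IsDTInstanton S.toAlmostHermitian A u) (e : Module.Basis (Fin 6) ℝ (Euc 6)) {x₀ : X}
    {y₀ : Euc 6} {s : Euc 6 → P} (hs : A.IsHorizontalAt x₀ y₀ s) :
    ∑ k, fderiv ℝ (gradDensity S A Φ₁.val e x₀ s k) y₀ (e k) = -(S.coordVol e x₀ y₀ •
      lieBr n G (lieBr n G (Φ₁.val (s y₀)) (Φ₂.val (s y₀))) (Φ₂.val (s y₀))) := by
  have hl := hs.isLocal
  have c1 : DifferentiableAt ℝ (A.curvature.read x₀ s) y₀ :=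
    (Connection.contDiffAt_curvature hl).differentiableAt (by simp)
  have c2 : DifferentiableAt ℝ (coordRep S.Ω₁ x₀) y₀ :=
    (S.smooth.contDiffAt hl.mem).differentiableAt (by simp)
  have c3 : DifferentiableAt ℝ (fun y => ofFunctional (A.d₀Form Φ₂.val x₀ s y)) y₀ :=
    (contDiffAt_ofFunctional_d₀Form hl Φ₂).differentiableAt (by simp)
  have c4 : DifferentiableAt ℝ (coordRep S.omegaSq x₀) y₀ :=
    (S.contDiffAt_coordOmegaSq hl.mem).differentiableAt (by simp)
  have z1 : ∀ a b c, fderiv ℝ (A.curvature.read x₀ s) y₀ a ![b, c] -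
      fderiv ℝ (A.curvature.read x₀ s) y₀ b ![a, c] +
      fderiv ℝ (A.curvature.read x₀ s) y₀ c ![a, b] = 0 := by
    intro a b c
    have := extDeriv_two_apply c1 a b c
    rw [hs.bianchi] at this
    simp only [fderiv_continuousAlternatingMap_apply_const_apply c1] at this
    exact this.symm
  have z2 : ∀ a b c d, fderiv ℝ (coordRep S.Ω₁ x₀) y₀ a ![b, c, d] -
      fderiv ℝ (coordRep S.Ω₁ x₀) y₀ b ![a, c, d] + fderiv ℝ (coordRep S.Ω₁ x₀) y₀ c ![a, b, d] -
      fderiv ℝ (coordRep S.Ω₁ x₀) y₀ d ![a, b, c] = 0 := by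
    intro a b c d
    rw [← extDeriv_three_apply' c2, extDeriv_coordRep S.smooth hS.2 hl.mem]
    rfl
  have z3 : ∀ a b, fderiv ℝ (fun y => ofFunctional (A.d₀Form Φ₂.val x₀ s y)) y₀ a ![b] -
      fderiv ℝ (fun y => ofFunctional (A.d₀Form Φ₂.val x₀ s y)) y₀ b ![a] =
      ((toCLM₂ (lieBr n G)).flip (Φ₂.val (s y₀))).compContinuousAlternatingMap
        (A.curvature.read x₀ s y₀) ![a, b] := by
    intro a b
    simp only [← fderiv_continuousAlternatingMap_apply_const_apply c3]
    exact hs.d₀Form_comm Φ₂ a b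
  have z4 : ∀ a b c d f, fderiv ℝ (fun y => (1 / 2 : ℝ) • coordRep S.omegaSq x₀ y) y₀ a
      ![b, c, d, f]
      - fderiv ℝ (fun y => (1 / 2 : ℝ) • coordRep S.omegaSq x₀ y) y₀ b ![a, c, d, f]
      + fderiv ℝ (fun y => (1 / 2 : ℝ) • coordRep S.omegaSq x₀ y) y₀ c ![a, b, d, f]
      - fderiv ℝ (fun y => (1 / 2 : ℝ) • coordRep S.omegaSq x₀ y) y₀ d ![a, b, c, f]
      + fderiv ℝ (fun y => (1 / 2 : ℝ) • coordRep S.omegaSq x₀ y) y₀ f ![a, b, c, d] = 0 := by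
    intro a b c d f
    have h0 : extDeriv (coordRep S.omegaSq x₀) y₀ ![a, b, c, d, f] = 0 := by
      rw [extDeriv_coordRep S.isSmoothForm_omegaSq hS.1 hl.mem]; rfl
    rw [extDeriv_four_apply c4] at h0
    rw [fderiv_fun_const_smul c4]
    simp only [smul_apply, ContinuousAlternatingMap.smul_apply, smul_eq_mul]
    linear_combination (1 / 2 : ℝ) * h0
  simp only [fderiv_gradDensity hS h hDT e hl, smul_sub, smul_add, Finset.sum_sub_distrib,
    Finset.sum_add_distrib]
  -- The four sums are d_AF ∧ Ω₁, F ∧ dΩ₁, d_A²Φ₂ ∧ ω²/2 and the term with d(ω²/2). The first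
  -- vanishes by Bianchi, the second and the last by half-flatness. The third is [F, Φ₂] ∧ ω²/2 =
  -- [[Φ₁, Φ₂], Φ₂] vol by the second instanton equation.
  rw [sum_wedge_of_closed_left z1, sum_wedge_of_closed_right _ z2, sum_wedge_one_four z3,
    sum_wedge_one_of_closed _ z4, wedgeS_comp_left, wedge_curvature_omegaSq hDT h e hl]
  simp [toCLM₂_apply]

end PrincipalBundle
end Divergence

/-! ### The Bochner formula -/

section NormSquared

open Filter Topology

variable {n m : ℕ} {X G P : Type*}
  [TopologicalSpace X] [ChartedSpace (Euc 6) X] [IsManifold (𝓡 6) ∞ X]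
  [TopologicalSpace G] [ChartedSpace (Euc n) G] [Group G] [LieGroup (𝓡 n) ∞ G]
  [TopologicalSpace P] [ChartedSpace (Euc m) P] [IsManifold (𝓡 m) ∞ P]

theorem IsPosFactored.apply_comm {ι : Type*} [Fintype ι] [DecidableEq ι] {A : Matrix ι ι ℝ}
    (hA : IsPosFactored A) (i k : ι) : A i k = A k i := by
  obtain ⟨C, -, rfl⟩ := hA
  simp only [Matrix.mul_apply, Matrix.transpose_apply, mul_comm]

/-- A second order operator in divergence form. -/
theorem ellipticOp_divergence {E ι : Type*} [NormedAddCommGroup E] [InnerProductSpace ℝ E]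
    [Fintype ι]
    (e : ι → E) {ν : E → ℝ} {A : E → Matrix ι ι ℝ} {f : E → ℝ} {y : E} (hν : ν y ≠ 0)
    (hA : ∀ i k, A y i k = A y k i)
    (hc : ∀ i k, DifferentiableAt ℝ (fun z => ν z * A z i k) y)
    (hf : DifferentiableAt ℝ (fderiv ℝ f) y) :
    ν y * ellipticOp e A (fun z i => (ν z)⁻¹ * ∑ k, fderiv ℝ (fun w => ν w * A w i k) z (e k)) f y =
      ∑ k, fderiv ℝ (fun z => ∑ i, ν z * A z i k * fderiv ℝ f z (e i)) y (e k) := by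
  have h1 : ∀ k, fderiv ℝ (fun z => ∑ i, ν z * A z i k * fderiv ℝ f z (e i)) y (e k) =
      ∑ i, (ν y * A y i k * fderiv ℝ (fderiv ℝ f) y (e k) (e i) +
        fderiv ℝ f y (e i) * fderiv ℝ (fun w => ν w * A w i k) y (e k)) := by
    intro k
    have h := HasFDerivAt.fun_sum (u := Finset.univ) fun i _ =>
      (hc i k).hasFDerivAt.fun_mul (hf.hasFDerivAt.clm_apply (hasFDerivAt_const (e i) y))
    refine (congrArg (fun L : E →L[ℝ] ℝ => L (e k)) h.fderiv).trans ?_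
    rw [sum_apply]
    refine Finset.sum_congr rfl fun i _ => ?_
    simp
  simp only [h1, Finset.sum_add_distrib]
  rw [ellipticOp, mul_add]
  congr 1
  · rw [Finset.mul_sum]
    refine Finset.sum_congr rfl fun i _ => ?_
    rw [Finset.mul_sum]
    refine Finset.sum_congr rfl fun k _ => ?_
    rw [hA]
    ring
  · rw [Finset.sum_comm, Finset.mul_sum]
    refine Finset.sum_congr rfl fun i _ => ?_
    rw [← Finset.mul_sum, ← mul_assoc, mul_inv_cancel_left₀ hν, mul_comm]

namespace PrincipalBundle

theorem surjective_π (B : PrincipalBundle n m X G P) : Function.Surjective B.π := by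
  intro x
  obtain ⟨U, -, hx, e, hes, het, -, -, hπ, -⟩ := B.locally_trivial x
  have ht : (x, (1 : G)) ∈ e.target := by rw [het]; exact ⟨hx, trivial⟩
  exact ⟨e.symm (x, 1), by rw [← hπ _ (e.map_target ht), e.right_inv ht]⟩

theorem exists_act_eq (B : PrincipalBundle n m X G P) {p q : P} (h : B.π p = B.π q) :
    ∃ g, B.act p g = q := by
  obtain ⟨U, -, hx, e, hes, -, -, -, hπ, heq⟩ := B.locally_trivial (B.π p)
  have hp : p ∈ e.source := by rw [hes]; exact hx
  have hq : q ∈ e.source := by rw [hes]; change B.π q ∈ U; rw [← h]; exact hx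
  have ha : B.act p ((e p).2⁻¹ * (e q).2) ∈ e.source := by
    rw [hes]; change B.π _ ∈ U; rw [B.π_act]; exact hx
  refine ⟨(e p).2⁻¹ * (e q).2, e.injOn ha hq ?_⟩
  rw [heq p hp, mul_inv_cancel_left]
  exact Prod.ext (by rw [hπ p hp, hπ q hq, h]) rfl

variable {B : PrincipalBundle n m X G P} {S : SU3Structure X}
  {u : B.HiggsField S.toAlmostHermitian} {A : B.Connection}
  {q : Euc n →ₗ[ℝ] Euc n →ₗ[ℝ] ℝ}

/-- The pointwise norm of a section descends to the base. -/
theorem exists_normSq (hq : ∀ (g : G) (a b : Euc n), q (Ad g a) (Ad g b) = q a b)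
    (Φ : B.AdSection) : ∃ F : X → ℝ, ∀ p, F (B.π p) = q (Φ.val p) (Φ.val p) := by
  choose r hr using B.surjective_π
  refine ⟨fun x => q (Φ.val (r x)) (Φ.val (r x)), fun p => ?_⟩
  obtain ⟨g, hg⟩ := B.exists_act_eq (hr (B.π p)).symm
  change q (Φ.val (r (B.π p))) (Φ.val (r (B.π p))) = _
  rw [← hg, Φ.equivariant, hq]

variable {Φ₁ Φ₂ : B.AdSection} {F : X → ℝ} {x₀ : X} {y₀ : Euc 6} {s : Euc 6 → P}

theorem normSq_eventuallyEq (hF : ∀ p, F (B.π p) = q (Φ₁.val p) (Φ₁.val p))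
    (hs : B.IsLocalSection x₀ y₀ s) :
    (fun y => F ((extChartAt 𝓘(ℝ, Euc 6) x₀).symm y)) =ᶠ[𝓝 y₀] fun y =>
      toCLM₂ q (Φ₁.val (s y)) (Φ₁.val (s y)) := by
  filter_upwards [hs.proj] with y hy
  rw [← hy, hF, toCLM₂_apply]

theorem contDiffAt_normSq (hF : ∀ p, F (B.π p) = q (Φ₁.val p) (Φ₁.val p))
    (hs : B.IsLocalSection x₀ y₀ s) :
    ContDiffAt ℝ ∞ (fun y => F ((extChartAt 𝓘(ℝ, Euc 6) x₀).symm y)) y₀ := by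
  refine ContDiffAt.congr_of_eventuallyEq ?_ (normSq_eventuallyEq hF hs)
  have h := Connection.contDiffAt_section hs Φ₁
  exact (contDiffAt_const.clm_apply h).clm_apply h

/-- Since ad is skew for `q`, the connection term in d_AΦ₁ is orthogonal to Φ₁, so the ordinary
derivative may be replaced by the covariant one. -/
theorem fderiv_normSq (hsymm : ∀ a b, q a b = q b a)
    (hq : ∀ (g : G) (a b : Euc n), q (Ad g a) (Ad g b) = q a b)
    (hF : ∀ p, F (B.π p) = q (Φ₁.val p) (Φ₁.val p))
    (hs : B.IsLocalSection x₀ y₀ s) (v : Euc 6) :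
    fderiv ℝ (fun y => F ((extChartAt 𝓘(ℝ, Euc 6) x₀).symm y)) y₀ v =
      2 * q (Φ₁.val (s y₀)) (A.d₀Form Φ₁.val x₀ s y₀ v) := by
  have h := ((Connection.contDiffAt_section hs Φ₁).differentiableAt (by simp)).hasFDerivAt
  have h1 := ((toCLM₂ q).hasFDerivAt_of_bilinear h h).fderiv
  have h2 : A.d₀Form Φ₁.val x₀ s y₀ v = fderiv ℝ (fun z => Φ₁.val (s z)) y₀ v +
      lieBr n G (A.gauge s y₀ v) (Φ₁.val (s y₀)) :=
    (Connection.d₀Form_apply_eventuallyEq (A := A) hs Φ₁ v).self_of_nhds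
  have h3 := ad_skew hq (A.gauge s y₀ v) (Φ₁.val (s y₀)) (Φ₁.val (s y₀))
  rw [hsymm] at h3
  have h4 : q (Φ₁.val (s y₀)) (lieBr n G (A.gauge s y₀ v) (Φ₁.val (s y₀))) = 0 := by linarith
  rw [(normSq_eventuallyEq hF hs).fderiv_eq]
  refine (congrArg (fun L : Euc 6 →L[ℝ] ℝ => L v) h1).trans ?_
  rw [h2, map_add, h4]
  change q (Φ₁.val (s y₀)) (fderiv ℝ (fun y => Φ₁.val (s y)) y₀ v) +
    q (fderiv ℝ (fun y => Φ₁.val (s y)) y₀ v) (Φ₁.val (s y₀)) = _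
  rw [hsymm (fderiv ℝ (fun y => Φ₁.val (s y)) y₀ v)]
  ring

/-- The coefficients of the Laplace operator in a chart. -/
def laplaceDrift (S : SU3Structure X) (e : Fin 6 → Euc 6) (x₀ : X) (y : Euc 6) (i : Fin 6) : ℝ :=
  (S.coordVol e x₀ y)⁻¹ * ∑ k, fderiv ℝ (fun w => S.coordVol e x₀ w *
    (S.coordGram e x₀ w)⁻¹ i k) y (e k)

theorem contDiffAt_inv_coordGram (e : Module.Basis (Fin 6) ℝ (Euc 6))
    (hy : y₀ ∈ (extChartAt 𝓘(ℝ, Euc 6) x₀).target) (i k : Fin 6) :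
    ContDiffAt ℝ ∞ (fun y => (S.coordGram e x₀ y)⁻¹ i k) y₀ :=
  contDiffAt_matrix_inv (S.contDiffAt_coordGram e hy) (S.isPosFactored_inv_coordGram e hy).1 i k

theorem contDiffAt_laplaceDrift (e : Module.Basis (Fin 6) ℝ (Euc 6))
    (hy : y₀ ∈ (extChartAt 𝓘(ℝ, Euc 6) x₀).target) (i : Fin 6) :
    ContDiffAt ℝ ∞ (fun y => laplaceDrift S e x₀ y i) y₀ :=
  ((S.contDiffAt_coordVol e hy).inv (S.coordVol_ne_zero e hy)).mul
    (ContDiffAt.sum fun k _ => Connection.contDiffAt_fderiv_apply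
      ((S.contDiffAt_coordVol e hy).mul (contDiffAt_inv_coordGram e hy i k)) (e k))

/-- A Bochner formula for the norm of `Φ₁`. -/
theorem ellipticOp_normSq (hsymm : ∀ a b, q a b = q b a)
    (hq : ∀ (g : G) (a b : Euc n), q (Ad g a) (Ad g b) = q a b)
    (hF : ∀ p, F (B.π p) = q (Φ₁.val p) (Φ₁.val p)) (hS : S.IsHalfFlat)
    (h : ∀ p, HasComponentsAt S u p (Φ₁.val p, Φ₂.val p))
    (hDT : IsDTInstanton S.toAlmostHermitian A u) (e : Module.Basis (Fin 6) ℝ (Euc 6)) {p : P}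
    (hp : B.π p ∈ (extChartAt 𝓘(ℝ, Euc 6) x₀).source) :
    ellipticOp e (fun y => (S.coordGram e x₀ y)⁻¹) (laplaceDrift S e x₀)
      (fun y => F ((extChartAt 𝓘(ℝ, Euc 6) x₀).symm y)) (extChartAt 𝓘(ℝ, Euc 6) x₀ (B.π p)) =
      2 * (∑ i, ∑ k, (S.coordGram e x₀ (extChartAt 𝓘(ℝ, Euc 6) x₀ (B.π p)))⁻¹ i k *
        q (A.d₀m Φ₁.val p (frameMap x₀ (extChartAt 𝓘(ℝ, Euc 6) x₀ (B.π p)) (e i)))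
          (A.d₀m Φ₁.val p (frameMap x₀ (extChartAt 𝓘(ℝ, Euc 6) x₀ (B.π p)) (e k))) +
        q (lieBr n G (Φ₁.val p) (Φ₂.val p)) (lieBr n G (Φ₁.val p) (Φ₂.val p))) := by
  obtain ⟨s, hs, hsp⟩ := A.exists_horizontal p x₀ hp
  set y := extChartAt 𝓘(ℝ, Euc 6) x₀ (B.π p) with hy
  have hl := hs.isLocal
  have hν := S.coordVol_ne_zero e hl.mem
  have hpos := (S.isPosFactored_inv_coordGram e hl.mem).2
  set f : Euc 6 → ℝ := fun y => F ((extChartAt 𝓘(ℝ, Euc 6) x₀).symm y) with hfdef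
  have hf : ContDiffAt ℝ ∞ f y := contDiffAt_normSq hF hl
  -- Multiplied by the volume density, the operator is a divergence; its flux is twice the pairing
  -- of Φ₁ with the gradient density.
  have hdiv := ellipticOp_divergence (ι := Fin 6) e (ν := S.coordVol e x₀)
    (A := fun y => (S.coordGram e x₀ y)⁻¹) (f := f) hν hpos.apply_comm
    (fun i k => ((S.contDiffAt_coordVol e hl.mem).mul
      (contDiffAt_inv_coordGram e hl.mem i k)).differentiableAt (by simp))
    ((hf.fderiv_right (m := ∞) (by simp)).differentiableAt (by simp))
  have hΦ := ((Connection.contDiffAt_section hl Φ₁).differentiableAt (by simp)).hasFDerivAt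
  have hV : ∀ k, DifferentiableAt ℝ (gradDensity S A Φ₁.val e x₀ s k) y := fun k => by
    refine ContDiffAt.differentiableAt (n := ∞) (ContDiffAt.sum fun i _ => ?_) (by simp)
    exact ((S.contDiffAt_coordVol e hl.mem).mul (contDiffAt_inv_coordGram e hl.mem i k)).smul
      (Connection.contDiffAt_d₀Form hl Φ₁ (e i))
  have hk : ∀ k, fderiv ℝ (fun z => ∑ i, S.coordVol e x₀ z * (S.coordGram e x₀ z)⁻¹ i k *
      fderiv ℝ f z (e i)) y (e k) = 2 * (q (Φ₁.val p)
        (fderiv ℝ (gradDensity S A Φ₁.val e x₀ s k) y (e k)) +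
        q (A.d₀m Φ₁.val p (frameMap x₀ y (e k))) (gradDensity S A Φ₁.val e x₀ s k y)) := by
    intro k
    have hev : (fun z => ∑ i, S.coordVol e x₀ z * (S.coordGram e x₀ z)⁻¹ i k *
        fderiv ℝ f z (e i)) =ᶠ[𝓝 y] fun z => 2 * toCLM₂ q (Φ₁.val (s z))
          (gradDensity S A Φ₁.val e x₀ s k z) := by
      filter_upwards [hl.eventually] with z hz
      rw [toCLM₂_apply, gradDensity, map_sum, Finset.mul_sum]
      refine Finset.sum_congr rfl fun i _ => ?_
      rw [fderiv_normSq (A := A) hsymm hq hF hz, map_smul, smul_eq_mul]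
      ring
    have h1 := (((toCLM₂ q).hasFDerivAt_of_bilinear hΦ (hV k).hasFDerivAt).const_mul
      (2 : ℝ)).fderiv
    rw [hev.fderiv_eq]
    refine (congrArg (fun L : Euc 6 →L[ℝ] ℝ => L (e k)) h1).trans ?_
    have h2 : A.d₀m Φ₁.val p (frameMap x₀ y (e k)) =
        fderiv ℝ (fun y => Φ₁.val (s y)) y (e k) := by
      rw [← hs.d₀Form_eq, Connection.d₀Form, hsp]
      rfl
    rw [h2, ← hsp]
    rfl
  have hsum := sum_fderiv_gradDensity hS h hDT e hs
  rw [hsp] at hsum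
  simp only [hk] at hdiv
  rw [← Finset.mul_sum, Finset.sum_add_distrib, ← map_sum, hsum, map_neg, map_smul] at hdiv
  -- By skewness of ad the zero order term is minus a square. Together with the minus sign in the
  -- divergence formula it becomes nonnegative.
  have hbr : q (Φ₁.val p) (lieBr n G (lieBr n G (Φ₁.val p) (Φ₂.val p)) (Φ₂.val p)) =
      -q (lieBr n G (Φ₁.val p) (Φ₂.val p)) (lieBr n G (Φ₁.val p) (Φ₂.val p)) := by
    have h1 := ad_skew hq (Φ₂.val p) (Φ₁.val p) (lieBr n G (Φ₁.val p) (Φ₂.val p))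
    rw [lieBr_skew (Φ₂.val p) (Φ₁.val p), lieBr_skew (Φ₂.val p) (lieBr n G _ _), map_neg, map_neg,
      LinearMap.neg_apply, neg_neg] at h1
    exact h1.symm
  have hgrad : ∑ k, q (A.d₀m Φ₁.val p (frameMap x₀ y (e k))) (gradDensity S A Φ₁.val e x₀ s k y) =
      S.coordVol e x₀ y * ∑ i, ∑ k, (S.coordGram e x₀ y)⁻¹ i k *
        q (A.d₀m Φ₁.val p (frameMap x₀ y (e i))) (A.d₀m Φ₁.val p (frameMap x₀ y (e k))) := by
    rw [Finset.mul_sum]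
    refine Finset.sum_congr rfl fun k _ => ?_
    rw [gradDensity, map_sum, Finset.mul_sum]
    refine Finset.sum_congr rfl fun i _ => ?_
    rw [map_smul, smul_eq_mul, Connection.d₀Form, hsp, hpos.apply_comm i k, mul_assoc]
    rfl
  rw [hgrad, hbr, smul_eq_mul] at hdiv
  refine mul_left_cancel₀ hν (hdiv.trans ?_)
  ring

end PrincipalBundle
end NormSquared

/-! ### Vanishing of the first component -/

section Vanishing

open Filter Topology

variable {n m : ℕ} {X G P : Type*}
  [TopologicalSpace X] [ChartedSpace (Euc 6) X] [IsManifold (𝓡 6) ∞ X]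
  [TopologicalSpace G] [ChartedSpace (Euc n) G] [Group G] [LieGroup (𝓡 n) ∞ G]
  [TopologicalSpace P] [ChartedSpace (Euc m) P] [IsManifold (𝓡 m) ∞ P]

/-- A continuous function on a compact locally connected space whose maxima on open sets propagate
is locally constant. -/
theorem eventually_eq_of_maximum_principle {Y : Type*} [TopologicalSpace Y] [CompactSpace Y]
    [LocallyConnectedSpace Y] {F : Y → ℝ} (hF : Continuous F)
    (h : ∀ (C : Set Y) (x : Y), IsOpen C → x ∈ C → (∀ z ∈ C, F z ≤ F x) → ∀ᶠ z in 𝓝 x, F z = F x)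
    (x : Y) : ∀ᶠ z in 𝓝 x, F z = F x := by
  obtain ⟨a, haC, ha⟩ := (isClosed_connectedComponent (x := x)).isCompact.exists_isMaxOn
    ⟨x, mem_connectedComponent⟩ hF.continuousOn
  have ho : IsOpen (connectedComponent x) := isOpen_connectedComponent
  -- The maximum is taken on one connected component, which is open by local connectedness, since
  -- the space need not be connected. The set where it is attained is clopen and so contains the
  -- whole component.
  have hcl : IsClopen (connectedComponent x ∩ F ⁻¹' {F a}) := by
    refine ⟨isClosed_connectedComponent.inter (isClosed_singleton.preimage hF), ?_⟩
    rw [isOpen_iff_mem_nhds]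
    rintro z ⟨hzC, hz⟩
    have hz' : F z = F a := hz
    filter_upwards [ho.mem_nhds hzC, h _ z ho hzC fun w hw => hz'.symm ▸ ha hw] with w hw hw'
    exact ⟨hw, hw'.trans hz'⟩
  have hsub := isPreconnected_connectedComponent.subset_isClopen (s := connectedComponent x) hcl
    ⟨a, haC, haC, rfl⟩
  filter_upwards [ho.mem_nhds mem_connectedComponent] with z hz
  have h1 : F z = F a := (hsub hz).2
  have h2 : F x = F a := (hsub mem_connectedComponent).2
  rw [h1, h2]

namespace PrincipalBundle

variable {B : PrincipalBundle n m X G P} {S : SU3Structure X}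
  {u : B.HiggsField S.toAlmostHermitian} {A : B.Connection}
  {q : Euc n →ₗ[ℝ] Euc n →ₗ[ℝ] ℝ} {Φ₁ Φ₂ : B.AdSection}

theorem continuous_normSq {F : X → ℝ} (hF : ∀ p, F (B.π p) = q (Φ₁.val p) (Φ₁.val p)) :
    Continuous F := by
  rw [continuous_iff_continuousAt]
  intro x
  obtain ⟨p, rfl⟩ := B.surjective_π x
  obtain ⟨s, hs, -, -⟩ := B.exists_local_section p (B.π p) (mem_extChartAt_source _)
  have h1 := (contDiffAt_normSq hF hs).continuousAt
  have h2 : ContinuousAt (fun z => F ((extChartAt 𝓘(ℝ, Euc 6) (B.π p)).symm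
      (extChartAt 𝓘(ℝ, Euc 6) (B.π p) z))) (B.π p) :=
    ContinuousAt.comp (g := fun y => F ((extChartAt 𝓘(ℝ, Euc 6) (B.π p)).symm y)) h1
      (continuousAt_extChartAt (I := 𝓘(ℝ, Euc 6)) (B.π p))
  refine h2.congr ?_
  filter_upwards [extChartAt_source_mem_nhds (I := 𝓘(ℝ, Euc 6)) (B.π p)] with z hz
  rw [(extChartAt 𝓘(ℝ, Euc 6) (B.π p)).left_inv hz]

/-- In every chart the norm is a subsolution by `ellipticOp_normSq`, so
`eventually_eq_of_ellipticOp_nonneg` propagates its maxima on open sets, and compactness provides a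
maximum on each component. -/
theorem normSq_eventually_const [CompactSpace X] (hsymm : ∀ a b, q a b = q b a)
    (hpos : ∀ a, a ≠ 0 → 0 < q a a)
    (hq : ∀ (g : G) (a b : Euc n), q (Ad g a) (Ad g b) = q a b)
    {F : X → ℝ} (hF : ∀ p, F (B.π p) = q (Φ₁.val p) (Φ₁.val p)) (hS : S.IsHalfFlat)
    (h : ∀ p, HasComponentsAt S u p (Φ₁.val p, Φ₂.val p))
    (hDT : IsDTInstanton S.toAlmostHermitian A u) (x : X) : ∀ᶠ z in 𝓝 x, F z = F x := by
  have hq0 : ∀ a, 0 ≤ q a a := fun a => by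
    by_cases ha : a = 0
    · simp [ha]
    · exact (hpos a ha).le
  have hc := continuous_normSq hF
  have : LocallyConnectedSpace X := ChartedSpace.locallyConnectedSpace (Euc 6) X
  refine eventually_eq_of_maximum_principle hc (fun C x hC hx hmax => ?_) x
  set e := (EuclideanSpace.basisFun (Fin 6) ℝ).toBasis
  set φ := extChartAt 𝓘(ℝ, Euc 6) x with hφ
  have hx0 : φ.symm (φ x) = x := extChartAt_to_inv (I := 𝓘(ℝ, Euc 6)) x
  have hU : IsOpen (φ.target ∩ φ.symm ⁻¹' C) :=
    (continuousOn_extChartAt_symm (I := 𝓘(ℝ, Euc 6)) x).isOpen_inter_preimage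
      (isOpen_extChartAt_target x) hC
  have key := eventually_eq_of_ellipticOp_nonneg e (A := fun y => (S.coordGram e x y)⁻¹)
    (b := laplaceDrift S e x) (f := fun y => F (φ.symm y)) hU
    (fun y hy => ?_) (fun i k y hy => ?_) (fun i y hy => ?_) (fun y hy => ?_) (fun y hy => ?_)
    (y₀ := φ x) ⟨mem_extChartAt_target (I := 𝓘(ℝ, Euc 6)) x, by
      change φ.symm (φ x) ∈ C; rwa [hx0]⟩ (fun y hy => ?_)
  · have h1 := (continuousAt_extChartAt (I := 𝓘(ℝ, Euc 6)) x).eventually key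
    filter_upwards [h1, extChartAt_source_mem_nhds (I := 𝓘(ℝ, Euc 6)) x] with z hz hzs
    have h2 : F (φ.symm (φ z)) = F (φ.symm (φ x)) := hz
    rwa [φ.left_inv hzs, hx0] at h2
  · obtain ⟨p, hp⟩ := B.surjective_π (φ.symm y)
    obtain ⟨s, hs, -, -⟩ := B.exists_local_section p x (by rw [hp]; exact φ.map_target hy.1)
    rw [hp, φ.right_inv hy.1] at hs
    exact ((contDiffAt_normSq hF hs).of_le (by norm_cast)).contDiffWithinAt
  · exact (contDiffAt_inv_coordGram e hy.1 i k).continuousAt.continuousWithinAt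
  · exact (contDiffAt_laplaceDrift e hy.1 i).continuousAt.continuousWithinAt
  · exact (S.isPosFactored_inv_coordGram e hy.1).2
  · obtain ⟨p, hp⟩ := B.surjective_π (φ.symm y)
    have h1 := ellipticOp_normSq hsymm hq hF hS h hDT e (x₀ := x) (p := p)
      (by rw [hp]; exact φ.map_target hy.1)
    rw [hp, φ.right_inv hy.1] at h1
    rw [h1]
    have h2 := (S.isPosFactored_inv_coordGram e hy.1).2.sum_nonneg q hq0
      fun i => A.d₀m Φ₁.val p (frameMap x y (e i))
    have h3 := hq0 (lieBr n G (Φ₁.val p) (Φ₂.val p))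
    linarith
  · rw [hx0]
    exact hmax _ hy.2

/-- Since |Φ₁|² is locally constant, the left side of the Bochner formula is zero. Its right side is
a sum of two nonnegative terms, so the gradient term vanishes, and this term is definite because the
inverse metric and the invariant inner product are. -/
theorem d₀_eq_zero [CompactSpace X] [T2Space G] [CompactSpace G] (hS : S.IsHalfFlat)
    (h : ∀ p, HasComponentsAt S u p (Φ₁.val p, Φ₂.val p))
    (hDT : IsDTInstanton S.toAlmostHermitian A u) (p : P) : A.d₀m Φ₁.val p = 0 := by
  obtain ⟨q, hsymm, hpos, hq⟩ := exists_Ad_invariant_inner n G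
  obtain ⟨F, hF⟩ := exists_normSq hq Φ₁
  have hq0 : ∀ a, 0 ≤ q a a := fun a => by
    by_cases ha : a = 0
    · simp [ha]
    · exact (hpos a ha).le
  set x := B.π p with hx
  set e := (EuclideanSpace.basisFun (Fin 6) ℝ).toBasis
  set φ := extChartAt 𝓘(ℝ, Euc 6) x with hφ
  have ht : φ x ∈ φ.target := mem_extChartAt_target (I := 𝓘(ℝ, Euc 6)) x
  have h1 := ellipticOp_normSq hsymm hq hF hS h hDT e (x₀ := x) (p := p)
    (mem_extChartAt_source (I := 𝓘(ℝ, Euc 6)) x)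
  have hc : (fun y => F (φ.symm y)) =ᶠ[𝓝 (φ x)] fun _ => F x := by
    have h2 : ContinuousAt φ.symm (φ x) := (contMDiffAt_chart_symm ht).continuousAt
    refine h2.eventually (p := fun z => F z = F x) ?_
    rw [show φ.symm (φ x) = x from extChartAt_to_inv (I := 𝓘(ℝ, Euc 6)) x]
    exact normSq_eventually_const hsymm hpos hq hF hS h hDT x
  have h0 : ellipticOp e (fun y => (S.coordGram e x y)⁻¹) (laplaceDrift S e x)
      (fun y => F (φ.symm y)) (φ x) = 0 := by
    have hf1 : fderiv ℝ (fun y => F (φ.symm y)) (φ x) = 0 := by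
      rw [hc.fderiv_eq, fderiv_fun_const]; rfl
    have hf2 : fderiv ℝ (fderiv ℝ fun y => F (φ.symm y)) (φ x) = 0 := by
      have h3 : fderiv ℝ (fun y => F (φ.symm y)) =ᶠ[𝓝 (φ x)] fun _ => 0 := by
        refine hc.fderiv.trans (Eventually.of_forall fun y => ?_)
        rw [fderiv_fun_const]; rfl
      rw [h3.fderiv_eq, fderiv_fun_const]; rfl
    rw [ellipticOp, hf1, hf2]
    simp
  have hA := (S.isPosFactored_inv_coordGram e ht).2
  have h2 := hA.sum_nonneg q hq0 fun i => A.d₀m Φ₁.val p (frameMap x (φ x) (e i))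
  have h3 := hq0 (lieBr n G (Φ₁.val p) (Φ₂.val p))
  have h4 := hA.eq_zero_of_sum_eq_zero q hpos
    (fun i => A.d₀m Φ₁.val p (frameMap x (φ x) (e i))) (by linarith)
  have hid : frameMap x (φ x) = ContinuousLinearMap.id ℝ (Euc 6) := mD_chart_symm_self x
  rw [hid] at h4
  refine ContinuousLinearMap.coe_injective (e.ext fun i => ?_)
  exact h4 i

/-- The velocity of a horizontal path is the horizontal lift of its projection, so the derivative of
Φ₁ along the path is a value of d_AΦ₁. -/
theorem eq_of_horizontallyJoined (hd : ∀ p, A.d₀m Φ₁.val p = 0) {p p' : P}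
    (h : A.HorizontallyJoined p p') : Φ₁.val p' = Φ₁.val p := by
  obtain ⟨γ, hγ, rfl, rfl, hh⟩ := h
  have hγd : ∀ t, MDifferentiableAt 𝓘(ℝ, ℝ) 𝓘(ℝ, Euc m) γ t := fun t =>
    (hγ t).mdifferentiableAt (by simp)
  have hΦ : ∀ p, MDifferentiableAt 𝓘(ℝ, Euc m) 𝓘(ℝ, Euc n) Φ₁.val p := fun p =>
    (Φ₁.smooth p).mdifferentiableAt (by simp)
  have hdiff : Differentiable ℝ fun t => Φ₁.val (γ t) := fun t =>
    mdifferentiableAt_iff_differentiableAt.mp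
      (MDifferentiableAt.comp (I' := 𝓘(ℝ, Euc m)) (g := Φ₁.val) t (hΦ _) (hγd t))
  refine constant_of_has_deriv_right_zero (f := fun t => Φ₁.val (γ t)) (a := 0) (b := 1)
    hdiff.continuous.continuousOn (fun t ht => ?_) 1 (by simp)
  have h1 : A.liftm (γ t) (B.dπm (γ t) (mD ℝ (Euc m) γ t 1)) = mD ℝ (Euc m) γ t 1 :=
    A.liftm_unique _ _ _ rfl (hh t ⟨ht.1, ht.2.le⟩)
  have h2 : fderiv ℝ (fun t => Φ₁.val (γ t)) t 1 = 0 := by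
    rw [← mD_eq_fderiv, mD_comp (g := Φ₁.val) (hΦ _) (hγd t)]
    change mD (Euc m) (Euc n) Φ₁.val (γ t) (mD ℝ (Euc m) γ t 1) = 0
    rw [← h1]
    exact congrArg (fun L : Euc 6 →L[ℝ] Euc n => L (B.dπm (γ t) (mD ℝ (Euc m) γ t 1))) (hd (γ t))
  have h3 := (hdiff t).hasFDerivAt.hasDerivAt
  rw [h2] at h3
  exact h3.hasDerivWithinAt

/-- A parallel section of the adjoint bundle of an irreducible connection vanishes. -/
theorem eq_zero_of_parallel (hG : LieAlgebra.IsSimple ℝ (GroupLieAlgebra (𝓡 n) G))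
    (hA : A.IsIrreducible) (hd : ∀ p, A.d₀m Φ₁.val p = 0) (p : P) : Φ₁.val p = 0 := by
  refine eq_zero_of_Ad_invariant hG fun g => ?_
  -- The inverse is used because Φ₁(p g⁻¹) = Ad_g Φ₁(p).
  have h1 : g⁻¹ ∈ A.holonomy p := by rw [hA p]; trivial
  have h2 : ∀ p', Relation.ReflTransGen A.HorizontallyJoined p p' → Φ₁.val p' = Φ₁.val p := by
    intro p' h
    induction h with
    | refl => rfl
    | tail _ h ih => rw [eq_of_horizontallyJoined hd h, ih]
  have h3 := h2 _ h1
  rwa [Φ₁.equivariant, inv_inv] at h3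

/-- For a section `Φ₂` which, with a parallel `Φ₁`, makes up a DT-instanton,
`I d_A Φ₂ = -* (F_A ∧ Ω₁)`. -/
theorem d₀_J_eq_neg_star_wedge_Ω₁ (hS : S.IsHalfFlat)
    (h : ∀ p, HasComponentsAt S u p (Φ₁.val p, Φ₂.val p))
    (hDT : IsDTInstanton S.toAlmostHermitian A u) (hd : ∀ p, A.d₀m Φ₁.val p = 0)
    (p : P) (v : TangentSpace (𝓡 6) (B.π p)) :
    A.d₀ Φ₂.val p (S.J (B.π p) v) =
      -S.star (B.π p) 5 1 rfl (wedgeS (A.curvature p) (S.Ω₁ (B.π p))) (fun _ => v) := by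
  obtain ⟨o, ho, hvol⟩ := S.exists_frame (B.π p)
  have e₀ := ho.hodge_wedge_re (S.su3Point _) hvol (frameRelations hS h hDT p ho)
  obtain ⟨κ, h₁, h₂⟩ : ∃ κ : TangentSpace (𝓡 6) (B.π p) [⋀^Fin 5]→L[ℝ] Euc n,
      wedgeS (A.curvature p) (S.Ω₁ (B.π p)) = κ ∧
        (wedgeS (A.curvature.atModel p) (S.reM (B.π p)) : Euc 6 [⋀^Fin 5]→L[ℝ] Euc n) = κ :=
    ⟨_, rfl, rfl⟩
  rw [h₁]
  rw [h₂] at e₀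
  have e := (AlmostHermitian.star_five_one ho.orthonormal κ).trans e₀
  rw [hd p, zero_add] at e
  refine Eq.trans ?_ (congrArg Neg.neg (DFunLike.congr_fun e fun _ => v)).symm
  exact (neg_neg (A.d₀m Φ₂.val p (S.JM (B.π p) v))).symm

/-- For a section `Φ₂` which, with a parallel `Φ₁`, makes up a DT-instanton,
`d_A Φ₂ = -* (F_A ∧ Ω₂)`. -/
theorem d₀_eq_neg_star_wedge_Ω₂ (hS : S.IsHalfFlat)
    (h : ∀ p, HasComponentsAt S u p (Φ₁.val p, Φ₂.val p))
    (hDT : IsDTInstanton S.toAlmostHermitian A u) (hd : ∀ p, A.d₀m Φ₁.val p = 0)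
    (p : P) (v : TangentSpace (𝓡 6) (B.π p)) :
    A.d₀ Φ₂.val p v =
      -S.star (B.π p) 5 1 rfl (wedgeS (A.curvature p) (S.Ω₂ (B.π p))) (fun _ => v) := by
  obtain ⟨o, ho, hvol⟩ := S.exists_frame (B.π p)
  have e₀ := ho.hodge_wedge_im (S.su3Point _) hvol (frameRelations hS h hDT p ho)
  obtain ⟨κ, h₁, h₂⟩ : ∃ κ : TangentSpace (𝓡 6) (B.π p) [⋀^Fin 5]→L[ℝ] Euc n,
      wedgeS (A.curvature p) (S.Ω₂ (B.π p)) = κ ∧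
        (wedgeS (A.curvature.atModel p) (S.imM (B.π p)) : Euc 6 [⋀^Fin 5]→L[ℝ] Euc n) = κ :=
    ⟨_, rfl, rfl⟩
  rw [h₁]
  rw [h₂] at e₀
  have e := (AlmostHermitian.star_five_one ho.orthonormal κ).trans e₀
  rw [hd p, ContinuousLinearMap.zero_comp, sub_zero] at e
  refine Eq.trans ?_ (congrArg Neg.neg (DFunLike.congr_fun e fun _ => v)).symm
  exact (neg_neg (A.d₀m Φ₂.val p v)).symm

theorem wedge_omegaSq_eq_zero (hDT : IsDTInstanton S.toAlmostHermitian A u) (p : P)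
    (h : HasComponentsAt S u p (Φ₁.val p, Φ₂.val p))
    (hz : Φ₁.val p = 0) :
    wedgeS (A.curvature p) ((1 / 2 : ℝ) • S.omegaSq (B.π p)) = 0 := by
  have e0 : lieBr n G (Φ₁.val p) (Φ₂.val p) = 0 := by rw [hz, map_zero, LinearMap.zero_apply]
  refine (wedge_omegaSq hDT h).trans (ContinuousAlternatingMap.ext fun v => ?_)
  rw [smulForm_apply, e0, smul_zero]
  rfl

end PrincipalBundle
end Vanishing

end

end DTInstanton

theorem proposition4
    {X : Type*} [TopologicalSpace X] [T2Space X] [CompactSpace X]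
    [ChartedSpace (DTInstanton.Euc 6) X] [IsManifold (𝓡 6) ∞ X]
    {n : ℕ} {G : Type*} [TopologicalSpace G] [T2Space G] [CompactSpace G]
    [ChartedSpace (DTInstanton.Euc n) G] [Group G] [LieGroup (𝓡 n) ∞ G]
    (hG : LieAlgebra.IsSimple ℝ (GroupLieAlgebra (𝓡 n) G))
    {m : ℕ} {P : Type*} [TopologicalSpace P] [ChartedSpace (DTInstanton.Euc m) P]
    [IsManifold (𝓡 m) ∞ P]
    (B : DTInstanton.PrincipalBundle n m X G P)
    (S : DTInstanton.SU3Structure X) (hS : S.IsHalfFlat)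
    (A : B.Connection) (u : B.HiggsField S.toAlmostHermitian)
    (hDT : DTInstanton.PrincipalBundle.IsDTInstanton S.toAlmostHermitian A u)
    (hA : A.IsIrreducible) :
    (∃! Φ : B.AdSection × B.AdSection,
      DTInstanton.PrincipalBundle.HasComponents S u Φ.1 Φ.2) ∧
    ∀ Φ₁ Φ₂ : B.AdSection, DTInstanton.PrincipalBundle.HasComponents S u Φ₁ Φ₂ →
      (∀ p, Φ₁.val p = 0) ∧
      (∀ p v, A.d₀ Φ₂.val p (S.J (B.π p) v) =
        -S.star (B.π p) 5 1 rfl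
          (DTInstanton.wedgeS (A.curvature p) (S.Ω₁ (B.π p))) (fun _ => v)) ∧
      (∀ p v, A.d₀ Φ₂.val p v =
        -S.star (B.π p) 5 1 rfl
          (DTInstanton.wedgeS (A.curvature p) (S.Ω₂ (B.π p))) (fun _ => v)) ∧
      (∀ p, DTInstanton.wedgeS (A.curvature p) ((1 / 2 : ℝ) • S.omegaSq (B.π p)) = 0) := by
  refine ⟨DTInstanton.PrincipalBundle.existsUnique_components u, fun Φ₁ Φ₂ hΦ => ?_⟩
  have h := (DTInstanton.PrincipalBundle.hasComponents_iff u Φ₁ Φ₂).mp hΦ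
  have hd := DTInstanton.PrincipalBundle.d₀_eq_zero hS h hDT
  have hz := DTInstanton.PrincipalBundle.eq_zero_of_parallel hG hA hd
  exact ⟨hz, DTInstanton.PrincipalBundle.d₀_J_eq_neg_star_wedge_Ω₁ hS h hDT hd,
    DTInstanton.PrincipalBundle.d₀_eq_neg_star_wedge_Ω₂ hS h hDT hd,
    fun p => DTInstanton.PrincipalBundle.wedge_omegaSq_eq_zero hDT p (h p) (hz p)⟩
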